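/- **Conventions.** All spaces are complex, and $\hat\otimes$ is the completed bornological tensor product of complete (convex, separated) bornological vector spaces. A *complete bornological DG algebra* $(R,\delta)$ is a (non-unital) associative $\mathbb Z/2$-graded complete bornological algebra with a bounded product of degree $0$ and a bounded odd derivation $\delta$, $\delta(xy)=(\delta x)y+(-1)^{|x|}x\,\delta y$, $\delta^2=0$. Let $\widetilde R=\mathbb C\oplus R$ be its unitalization, with $|1|=0$ and $\delta 1=0$. Let $\Omega^1R=\widetilde R\,\hat\otimes\,R$, where $x\otimes y$ is written $x\,\mathbf dy$ and has degree $|x|+|y|+1$, with $\mathbf d1=0$, $\mathbf d(xy)=\mathbf dx\,y+(-1)^{|x|}x\,\mathbf dy$, and $\delta(x\,\mathbf dy)=\delta x\,\mathbf dy-(-1)^{|x|}x\,\mathbf d(\delta y)$. Let $\natural:\Omega^1R\to\Omega^1R_\natural$ be the quotient by the closed subspace generated by the graded commutators $[x,\omega]$, $x\in R$, $\omega\in\Omega^1R$, and let $\bar b(\natural x\,\mathbf dy)=(-1)^{|x|}[x,y]$. The augmented $X$-complex is $\widetilde X(R)=\widetilde R\oplus\Omega^1R_\natural$ with total differential $(\natural\mathbf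 d\oplus\bar b)+\delta$. All tensor products carry Koszul signs: $(x_1\otimes x_2)(y_1\otimes y_2)=(-1)^{|x_2||y_1|}x_1y_1\otimes x_2y_2$, and an odd operator on the second factor acts on $x_1\otimes x_2$ with the sign $(-1)^{|x_1|}$. Operators on the first and second factor are marked by the indices $1$ and $2$; $\natural_1=\natural\otimes\mathrm{id}$, $\natural_2=\mathrm{id}\otimes\natural$, $\natural_{12}=\natural\otimes\natural$. **The map $\Psi$.** Let $R_1,R_2$ be complete bornological DG algebras and let $R=R_1*R_2$ be their free product: the direct sum, with the direct sum bornology, of all completed alternating tensor products of $R_1$ and $R_2$, with product $*$ and differential $\delta$ extending those of $R_1,R_2$. Let $\mu:\widetilde R\to\widetilde R_1\hat\otimes\widetilde R_2$ be the unital homomorphism with $\mu(x_1)=x_1\otimes1$ and $\mu(x_2)=1\otimes x_2$, and let $\phi:\widetilde R\to\Omega^1R_1\hat\otimes\Omega^1R_2$ be the linear map with $\phi(1)=\phi(x_1)=\phi(x_2)=0$ and $$\phi(X*Y)=\phi(X)\mu(Y)+\mu(X)\phi(Y)+(-1)^{|X|}\mathbf d_2\mu(X)\,\mathbf d_1\mu(Y).$$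 Then there is exactly one bounded linear map $\Psi:\widetilde X(R)\to\widetilde X(R_1)\hat\otimes\widetilde X(R_2)$ such that, for all $X\in\widetilde R$, $$\Psi(X)=\mu(X)+\natural_{12}\phi(X),$$ and, for all homogeneous $X\in\widetilde R$, $Y\in R$, $$\Psi(\natural X\,\mathbf dY)=(-1)^{|X|(|Y|+1)}\natural_1\,\mathbf d_1\mu(Y)\,\mu(X)+\natural_2\,\mu(X)\,\mathbf d_2\mu(Y)+(-1)^{|X|}(\bar b_1+\bar b_2)\natural_{12}\,\mu(X)\phi(Y).$$ **The Chern character.** Let $A\in\widetilde R_1\hat\otimes\widetilde R_2$ be odd, put $\delta=\delta_1+\delta_2$ and $F=\delta A+A^2$, and assume that the exponential series $e^{-F}=\sum_n\frac{(-1)^n}{n!}F^n$ converges in the bornological sense in $\widetilde R_1\hat\otimes\widetilde R_2$. Let $\mathsf A\in R$ be the image of $A$ under the linear inclusion $x_1\otimes x_2\mapsto x_1*x_2$ of $\widetilde R_1\hat\otimes\widetilde R_2$ in $\widetilde R$, and $\mathsf F=\delta\mathsf A+\mathsf A*\mathsf A$. The image under $\Psi$ of Quillen's Chern character $(e^{-\mathsf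 F},\,-\natural e^{-\mathsf F}\,\mathbf d\mathsf A)$ is taken term by term: $$\mathrm{ch}(A)=\sum_{n\ge0}\frac{(-1)^n}{n!}\,\Psi\big(\mathsf F^n-\natural\,\mathsf F^n\,\mathbf d\mathsf A\big).$$ This series converges (and its sum is $\Psi(\mathrm{ch}(\mathsf A))$ whenever the series defining $\mathrm{ch}(\mathsf A)$ converges in $\widetilde X(R)$). The components of $\mathrm{ch}(A)$ are $$\mathrm{ch}^{0,0}(A)=e^{-F}\in\widetilde R_1\hat\otimes\widetilde R_2,\qquad \mathrm{ch}^{1,0}(A)=-\natural_1\,\mathbf d_1A\,e^{-F}\in\Omega^1R_{1\natural}\hat\otimes\widetilde R_2,$$ $$\mathrm{ch}^{0,1}(A)=-\natural_2\,e^{-F}\,\mathbf d_2A\in\widetilde R_1\hat\otimes\Omega^1R_{2\natural},$$ $$\mathrm{ch}^{1,1}(A)=\natural_{12}\,\mathbf d_1A\,e^{-F}\,\mathbf d_2A+\int_{\Delta_2}ds_1ds_2\;\natural_{12}\,e^{-s_0F}\,\mathbf d_2F\,e^{-s_1F}\,\mathbf d_1F\,e^{-s_2F}\in\Omega^1R_{1\natural}\hat\otimes\Omega^1R_{2\natural},$$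 where $\Delta_2=\{(s_0,s_1,s_2)\in[0,1]^3:\ s_0+s_1+s_2=1\}$ and the integral exists as a Bochner integral in the Banach space spanned by some bounded disk. Moreover $\mathrm{ch}(A)$ is a cocycle in the total complex $\widetilde X(R_1)\hat\otimes\widetilde X(R_2)$, that is, $$\delta\,\mathrm{ch}^{0,0}+\bar b_1\mathrm{ch}^{1,0}+\bar b_2\mathrm{ch}^{0,1}=0,\qquad \delta\,\mathrm{ch}^{1,0}+\natural_1\mathbf d_1\mathrm{ch}^{0,0}+\bar b_2\mathrm{ch}^{1,1}=0,$$ $$\delta\,\mathrm{ch}^{0,1}+\bar b_1\mathrm{ch}^{1,1}+\natural_2\mathbf d_2\mathrm{ch}^{0,0}=0,\qquad \delta\,\mathrm{ch}^{1,1}+\natural_1\mathbf d_1\mathrm{ch}^{0,1}+\natural_2\mathbf d_2\mathrm{ch}^{1,0}=0.$$ **Homotopy invariance.** Let $(A_t)_{t\in[0,1]}$ be a smooth family of odd elements, i.e. an odd element of $(\widetilde R_1\hat\otimes\widetilde R_2)\hat\otimes C^\infty[0,1]$, such that the exponential series of $-F_t$, $F_t=\delta A_t+A_t^2$, converges in $(\widetilde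 R_1\hat\otimes\widetilde R_2)\hat\otimes C^\infty[0,1]$. Then for all $s,t\in[0,1]$ the cocycles $\mathrm{ch}(A_s)$ and $\mathrm{ch}(A_t)$ differ by a coboundary of $\widetilde X(R_1)\hat\otimes\widetilde X(R_2)$. -/

import Mathlib

open Bornology Set Filter Topology
open scoped Pointwise

universe u

noncomputable section

namespace BornChern


/-- A bounded disk of `E` whose span is a Banach space for the gauge norm, presented as the injective
linear map `j` of that Banach space `V` into `E`; the disk itself is the image of the unit ball. -/
structure BanachDisk (E : Type u) [AddCommGroup E] [Module ℂ E] [Bornology E] where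
  V : Type u
  [grp : NormedAddCommGroup V]
  [nrm : NormedSpace ℂ V]
  [cpl : CompleteSpace V]
  j : V →ₗ[ℂ] E
  inj : Function.Injective j
  bdd : ∀ r : ℝ, IsBounded (j '' Metric.closedBall 0 r)

attribute [instance] BanachDisk.grp BanachDisk.nrm BanachDisk.cpl

/-- Complete (convex, separated) bornological vector spaces over `ℂ`: every bounded set lies in a
bounded Banach disk. -/
class CB (E : Type u) extends AddCommGroup E, Module ℂ E, Bornology E where
  complete : ∀ S : Set E, IsBounded S →
    ∃ d : BanachDisk E, S ⊆ d.j '' Metric.closedBall 0 1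

section basic
variable {E F G H : Type u} [CB E] [CB F] [CB G] [CB H]

theorem exists_disk {S : Set E} (hS : IsBounded S) :
    ∃ d : BanachDisk E, S ⊆ d.j '' Metric.closedBall 0 1 := CB.complete S hS

theorem complete_of_radius (E : Type u) [AddCommGroup E] [Module ℂ E] [Bornology E]
    (S : Set E) (d : BanachDisk E) (C : ℝ) (h : S ⊆ d.j '' Metric.closedBall 0 C) :
    ∃ d : BanachDisk E, S ⊆ d.j '' Metric.closedBall 0 1 := by
  obtain ⟨m, hm, hCm⟩ : ∃ m : ℝ, 0 < m ∧ C ≤ m := ⟨max C 1, by positivity, le_max_left _ _⟩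
  have hc : (m : ℂ) ≠ 0 := by exact_mod_cast hm.ne'
  have hn : ‖(m : ℂ)‖ = m := by rw [Complex.norm_real, Real.norm_of_nonneg hm.le]
  refine ⟨⟨d.V, (m : ℂ) • d.j, fun x y hxy =>
    d.inj (smul_right_injective E hc hxy), fun r => ?_⟩, ?_⟩
  · refine (d.bdd (m * r)).subset ?_
    rintro _ ⟨v, hv, rfl⟩
    refine ⟨(m : ℂ) • v, ?_, by simp⟩
    rw [mem_closedBall_zero_iff] at hv ⊢
    rw [norm_smul, hn]
    gcongr
  · intro x hx
    obtain ⟨v, hv, rfl⟩ := h hx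
    refine ⟨(m : ℂ)⁻¹ • v, ?_, ?_⟩
    · rw [mem_closedBall_zero_iff] at hv ⊢
      have : ‖(m : ℂ)⁻¹ • v‖ = m⁻¹ * ‖v‖ := by rw [norm_smul, norm_inv, hn]
      rw [this, inv_mul_le_iff₀ hm, mul_one]
      exact hv.trans hCm
    · simp only [LinearMap.smul_apply, map_smul]
      rw [smul_smul, inv_mul_cancel₀ hc, one_smul]

theorem bdd_comb {S T : Set E} (hS : IsBounded S) (hT : IsBounded T) (C : ℝ) :
    IsBounded {x : E | ∃ a b : ℂ, ∃ s ∈ S, ∃ t ∈ T, ‖a‖ ≤ C ∧ ‖b‖ ≤ C ∧ x = a • s + b • t} := by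
  obtain ⟨d, hd⟩ := exists_disk (hS.union hT)
  refine (d.bdd (C * 1 + C * 1)).subset ?_
  rintro _ ⟨a, b, s, hs, t, ht, ha, hb, rfl⟩
  obtain ⟨v, hv, rfl⟩ := hd (Or.inl hs)
  obtain ⟨w, hw, rfl⟩ := hd (Or.inr ht)
  refine ⟨a • v + b • w, ?_, by simp⟩
  rw [mem_closedBall_zero_iff] at *
  have hC : 0 ≤ C := (norm_nonneg a).trans ha
  refine (norm_add_le _ _).trans ?_
  rw [norm_smul, norm_smul]
  gcongr

theorem bdd_add {S T : Set E} (hS : IsBounded S) (hT : IsBounded T) :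
    IsBounded {x : E | ∃ s ∈ S, ∃ t ∈ T, x = s + t} := by
  refine (bdd_comb hS hT 1).subset ?_
  rintro _ ⟨s, hs, t, ht, rfl⟩
  exact ⟨1, 1, s, hs, t, ht, by simp, by simp, by simp⟩

theorem bdd_smul {S : Set E} (hS : IsBounded S) (C : ℝ) :
    IsBounded {x : E | ∃ a : ℂ, ∃ s ∈ S, ‖a‖ ≤ C ∧ x = a • s} := by
  refine (bdd_comb hS hS C).subset ?_
  rintro _ ⟨a, s, hs, ha, rfl⟩
  exact ⟨a, 0, s, hs, s, hs, ha, by simpa using (norm_nonneg a).trans ha, by simp⟩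

/-- Bornological (Mackey) convergence: for one bounded set `B` and each `ε > 0`, the differences
`x i - a` eventually lie in `ε B`. -/
def MTendsto {ι : Type*} (l : Filter ι) (x : ι → E) (a : E) : Prop :=
  ∃ B : Set E, IsBounded B ∧ ∀ ε : ℝ, 0 < ε → ∀ᶠ i in l, ∃ b ∈ B, x i - a = (ε : ℂ) • b

theorem MTendsto.unique {ι : Type*} {l : Filter ι} [l.NeBot] {x : ι → E} {a b : E}
    (ha : MTendsto l x a) (hb : MTendsto l x b) : a = b := by
  obtain ⟨B, hB, h1⟩ := ha
  obtain ⟨B', hB', h2⟩ := hb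
  obtain ⟨d, hd⟩ := exists_disk (hB.union hB')
  have key : ∀ ε : ℝ, 0 < ε → ∃ v : d.V, ‖v‖ ≤ 2 * ε ∧ d.j v = a - b := by
    intro ε hε
    obtain ⟨i, ⟨s, hs, hs'⟩, t, ht, ht'⟩ := ((h1 ε hε).and (h2 ε hε)).exists
    obtain ⟨v, hv, rfl⟩ := hd (Or.inl hs)
    obtain ⟨w, hw, rfl⟩ := hd (Or.inr ht)
    rw [mem_closedBall_zero_iff] at hv hw
    refine ⟨(ε : ℂ) • (w - v), ?_, ?_⟩
    · rw [norm_smul, Complex.norm_real, Real.norm_of_nonneg hε.le]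
      have := norm_sub_le w v
      nlinarith
    · rw [map_smul, map_sub, smul_sub, ← ht', ← hs']; abel
  obtain ⟨v, -, hv⟩ := key 1 one_pos
  have : ‖v‖ ≤ 0 := by
    refine le_of_forall_pos_le_add fun ε hε => ?_
    obtain ⟨w, hw, hw'⟩ := key (ε / 2) (by positivity)
    rw [d.inj (hv.trans hw'.symm)]
    linarith
  have hv0 : v = 0 := by simpa using this
  rw [hv0, map_zero] at hv
  exact (sub_eq_zero.mp hv.symm)

theorem MTendsto.comb {ι : Type*} {l : Filter ι} {x y : ι → E} {a b : E}
    (ha : MTendsto l x a) (hb : MTendsto l y b) (c e : ℂ) :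
    MTendsto l (fun i => c • x i + e • y i) (c • a + e • b) := by
  obtain ⟨B, hB, h1⟩ := ha
  obtain ⟨B', hB', h2⟩ := hb
  refine ⟨_, bdd_comb hB hB' (max ‖c‖ ‖e‖), fun ε hε => ?_⟩
  filter_upwards [h1 ε hε, h2 ε hε] with i ⟨s, hs, hs'⟩ ⟨t, ht, ht'⟩
  refine ⟨c • s + e • t, ⟨c, e, s, hs, t, ht, le_max_left _ _, le_max_right _ _, rfl⟩, ?_⟩
  rw [smul_add, smul_comm _ c, smul_comm _ e, ← hs', ← ht', smul_sub, smul_sub]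
  abel

theorem MTendsto.add {ι : Type*} {l : Filter ι} {x y : ι → E} {a b : E}
    (ha : MTendsto l x a) (hb : MTendsto l y b) :
    MTendsto l (fun i => x i + y i) (a + b) := by
  simpa using ha.comb hb 1 1

theorem MTendsto.smul {ι : Type*} {l : Filter ι} {x : ι → E} {a : E}
    (ha : MTendsto l x a) (c : ℂ) : MTendsto l (fun i => c • x i) (c • a) := by
  simpa using ha.comb ha c 0

theorem MTendsto.of_disk {ι : Type*} {l : Filter ι} (d : BanachDisk E) {x : ι → d.V} {a : d.V}
    (h : Tendsto x l (𝓝 a)) : MTendsto l (fun i => d.j (x i)) (d.j a) := by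
  refine ⟨_, d.bdd 1, fun ε hε => ?_⟩
  filter_upwards [Metric.tendsto_nhds.1 h ε hε] with i hi
  have hc : (ε : ℂ) ≠ 0 := by exact_mod_cast hε.ne'
  refine ⟨d.j ((ε : ℂ)⁻¹ • (x i - a)), ⟨_, ?_, rfl⟩, ?_⟩
  · rw [mem_closedBall_zero_iff, norm_smul, norm_inv, Complex.norm_real, Real.norm_of_nonneg hε.le,
      inv_mul_le_iff₀ hε, mul_one, ← dist_eq_norm]
    exact hi.le
  · rw [map_smul, smul_smul, mul_inv_cancel₀ hc, one_smul, map_sub]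

theorem MTendsto.const {ι : Type*} (l : Filter ι) (a : E) : MTendsto l (fun _ => a) a :=
  ⟨{0}, isBounded_singleton, fun ε _ => Eventually.of_forall fun _ => ⟨0, rfl, by simp⟩⟩

/-- Unconditional bornological convergence of a series. -/
def MHasSum {ι : Type*} (f : ι → E) (a : E) : Prop :=
  MTendsto atTop (fun s : Finset ι => ∑ i ∈ s, f i) a

/-- Bornological convergence of the series `f 0 + f 1 + ⋯` to `a`. -/
def SHasSum (f : ℕ → E) (a : E) : Prop :=
  MTendsto atTop (fun N : ℕ => ∑ n ∈ Finset.range N, f n) a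

/-- The sum of a bornologically convergent series (and `0` for other series). -/
noncomputable def ssum (f : ℕ → E) : E :=
  open Classical in if h : ∃ a, SHasSum f a then h.choose else 0

/-! ### Bounded linear maps -/

/-- The subspace of bounded linear maps. -/
def bmaps (E F : Type u) [CB E] [CB F] : Submodule ℂ (E →ₗ[ℂ] F) where
  carrier := {f | ∀ S : Set E, IsBounded S → IsBounded (f '' S)}
  add_mem' := by
    intro _ _ hf hg S hS
    refine (bdd_add (hf S hS) (hg S hS)).subset ?_
    rintro _ ⟨x, hx, rfl⟩
    exact ⟨_, ⟨x, hx, rfl⟩, _, ⟨x, hx, rfl⟩, rfl⟩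
  zero_mem' := by
    intro S hS
    refine (isBounded_singleton (x := (0 : F))).subset ?_
    rintro _ ⟨x, hx, rfl⟩
    rfl
  smul_mem' := by
    intro c f hf S hS
    refine (bdd_smul (hf S hS) ‖c‖).subset ?_
    rintro _ ⟨x, hx, rfl⟩
    exact ⟨c, f x, ⟨x, hx, rfl⟩, le_rfl, rfl⟩

/-- Bounded linear maps between complete bornological spaces. -/
def BMap (E F : Type u) [CB E] [CB F] : Type u := ↥(bmaps E F)

infixr:25 " ⟹ " => BMap

noncomputable instance : AddCommGroup (E ⟹ F) := inferInstanceAs (AddCommGroup ↥(bmaps E F))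
noncomputable instance : Module ℂ (E ⟹ F) := inferInstanceAs (Module ℂ ↥(bmaps E F))

instance : FunLike (E ⟹ F) E F where
  coe f := f.1
  coe_injective f g h := Subtype.ext (DFunLike.coe_injective h)

instance : LinearMapClass (E ⟹ F) ℂ E F where
  map_add f := map_add f.1
  map_smulₛₗ f := map_smul f.1

theorem BMap.ext {f g : E ⟹ F} (h : ∀ x, f x = g x) : f = g := DFunLike.ext _ _ h

theorem BMap.bdd (f : E ⟹ F) {S : Set E} (hS : IsBounded S) : IsBounded (f '' S) := f.2 S hS

@[simp] theorem BMap.add_apply (f g : E ⟹ F) (x : E) : (f + g) x = f x + g x := rfl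
@[simp] theorem BMap.sub_apply (f g : E ⟹ F) (x : E) : (f - g) x = f x - g x := rfl
@[simp] theorem BMap.neg_apply (f : E ⟹ F) (x : E) : (-f) x = -f x := rfl
@[simp] theorem BMap.zero_apply (x : E) : (0 : E ⟹ F) x = 0 := rfl
@[simp] theorem BMap.smul_apply (c : ℂ) (f : E ⟹ F) (x : E) : (c • f) x = c • f x := rfl

/-- A linear map that preserves bounded sets, as a bounded linear map. -/
def BMap.mk (f : E →ₗ[ℂ] F) (h : ∀ S : Set E, IsBounded S → IsBounded (f '' S)) : E ⟹ F := ⟨f, h⟩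

@[simp] theorem BMap.mk_apply (f : E →ₗ[ℂ] F) (h) (x : E) : BMap.mk f h x = f x := rfl

theorem MTendsto.map {ι : Type*} {l : Filter ι} {x : ι → E} {a : E}
    (ha : MTendsto l x a) (f : E ⟹ F) : MTendsto l (fun i => f (x i)) (f a) := by
  obtain ⟨B, hB, h⟩ := ha
  refine ⟨_, f.bdd hB, fun ε hε => ?_⟩
  filter_upwards [h ε hε] with i ⟨b, hb, hb'⟩
  exact ⟨f b, ⟨b, hb, rfl⟩, by rw [← map_sub, hb', map_smul]⟩

theorem MHasSum.map {ι : Type*} {x : ι → E} {a : E} (ha : MHasSum x a) (f : E ⟹ F) :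
    MHasSum (fun i => f (x i)) (f a) := by
  have := MTendsto.map ha f
  simpa only [MHasSum, map_sum] using this

/-- The bornology of equibounded sets of bounded linear maps. -/
instance BMap.born : Bornology (E ⟹ F) :=
  Bornology.ofBounded {H : Set (E ⟹ F) | ∀ S : Set E, IsBounded S →
      IsBounded {y : F | ∃ f ∈ H, ∃ x ∈ S, y = f x}}
    (by intro S _; simp)
    (by
      intro H hH H' hs S hS
      refine (hH S hS).subset ?_
      rintro _ ⟨f, hf, x, hx, rfl⟩
      exact ⟨f, hs hf, x, hx, rfl⟩)
    (by
      intro H hH H' hH' S hS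
      refine ((hH S hS).union (hH' S hS)).subset ?_
      rintro _ ⟨f, hf | hf, x, hx, rfl⟩
      · exact Or.inl ⟨f, hf, x, hx, rfl⟩
      · exact Or.inr ⟨f, hf, x, hx, rfl⟩)
    (by
      intro f S hS
      refine (f.bdd hS).subset ?_
      rintro _ ⟨_, rfl, x, hx, rfl⟩
      exact ⟨x, hx, rfl⟩)

theorem BMap.isBounded_iff {H : Set (E ⟹ F)} : IsBounded H ↔ ∀ S : Set E, IsBounded S →
    IsBounded {y : F | ∃ f ∈ H, ∃ x ∈ S, y = f x} :=
  isBounded_ofBounded_iff _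

open scoped ENNReal in
/-- Bounded linear maps form a complete bornological space. -/
noncomputable instance BMap.instCB : CB (E ⟹ F) where
  complete := by
    classical
    intro H hH
    rw [BMap.isBounded_iff] at hH
    let B := {S : Set E // IsBounded S}
    choose d hd using fun S : B => exists_disk (hH S.1 S.2)
    let ι := Σ S : B, S.1
    -- families of preimages of the values of one bounded map
    let W : Submodule ℂ (lp (fun p : ι => (d p.1).V) ∞) :=
      { carrier := {v | ∃ f : E ⟹ F, ∀ p : ι, (d p.1).j (v p) = f p.2.1}
        add_mem' := by
          rintro v w ⟨f, hf⟩ ⟨g, hg⟩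
          exact ⟨f + g, fun p => by simp [hf, hg]⟩
        zero_mem' := ⟨0, fun p => by simp⟩
        smul_mem' := by
          rintro c v ⟨f, hf⟩
          exact ⟨c • f, fun p => by simp [hf]⟩ }
    have pt : ∀ x : E, ∃ p : ι, p.2.1 = x := fun x =>
      ⟨⟨⟨{x}, isBounded_singleton⟩, ⟨x, rfl⟩⟩, rfl⟩
    have hex : ∀ w : W, ∃ f : E ⟹ F, ∀ p : ι, (d p.1).j (w.1 p) = f p.2.1 := fun w => w.2
    choose φ hφ using hex
    have hφ' : ∀ (w : W) (f : E ⟹ F), (∀ p : ι, (d p.1).j (w.1 p) = f p.2.1) → φ w = f := by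
      intro w f hf
      refine BMap.ext fun x => ?_
      obtain ⟨p, rfl⟩ := pt x
      rw [← hφ, hf]
    let J : W →ₗ[ℂ] (E ⟹ F) :=
      { toFun := φ
        map_add' := fun v w => hφ' _ _ fun p => by simp [hφ]
        map_smul' := fun c v => hφ' _ _ fun p => by simp [hφ] }
    have hcl : IsClosed (W : Set (lp (fun p : ι => (d p.1).V) ∞)) := by
      refine isClosed_of_closure_subset fun v hv => ?_
      obtain ⟨w, hw, hlim⟩ := mem_closure_iff_seq_limit.1 hv
      have hw' : ∀ n, w n ∈ W := hw
      have hp : ∀ p : ι, MTendsto atTop (fun n => φ ⟨w n, hw' n⟩ p.2.1) ((d p.1).j (v p)) := by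
        intro p
        have h1 : Tendsto (fun n => (w n) p) atTop (𝓝 (v p)) :=
          ((lp.lipschitzWith_one_eval ∞ p).continuous.tendsto v).comp hlim
        have := MTendsto.of_disk (d p.1) h1
        simpa only [← hφ] using this
      choose q hq using pt
      have hx : ∀ x : E, MTendsto atTop (fun n => φ ⟨w n, hw' n⟩ x)
          ((d (q x).1).j (v (q x))) := by
        intro x
        have := hp (q x)
        rwa [hq x] at this
      let f : E →ₗ[ℂ] F :=
        { toFun := fun x => (d (q x).1).j (v (q x))
          map_add' := fun x y => (hx (x + y)).unique (by
            simpa only [map_add] using (hx x).add (hx y))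
          map_smul' := fun c x => (hx (c • x)).unique (by
            simpa only [map_smul, RingHom.id_apply] using (hx x).smul c) }
      have hfp : ∀ p : ι, (d p.1).j (v p) = f p.2.1 := fun p =>
        (hp p).unique (hx p.2.1)
      refine ⟨BMap.mk f fun S hS => ?_, hfp⟩
      refine ((d ⟨S, hS⟩).bdd ‖v‖).subset ?_
      rintro _ ⟨x, hxS, rfl⟩
      refine ⟨v ⟨⟨S, hS⟩, ⟨x, hxS⟩⟩, ?_, hfp ⟨⟨S, hS⟩, ⟨x, hxS⟩⟩⟩
      rw [mem_closedBall_zero_iff]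
      exact lp.norm_apply_le_norm (by simp) v _
    have : CompleteSpace W := hcl.completeSpace_coe
    refine ⟨⟨W, J, ?_, fun r => ?_⟩, ?_⟩
    · refine (injective_iff_map_eq_zero J).2 fun w hw => ?_
      have h0 : φ w = 0 := hw
      ext p
      refine (d p.1).inj ?_
      rw [hφ, h0]; simp
    · rw [BMap.isBounded_iff]
      intro S hS
      refine ((d ⟨S, hS⟩).bdd r).subset ?_
      rintro _ ⟨_, ⟨w, hw, rfl⟩, x, hxS, rfl⟩
      refine ⟨w.1 ⟨⟨S, hS⟩, ⟨x, hxS⟩⟩, ?_, hφ w ⟨⟨S, hS⟩, ⟨x, hxS⟩⟩⟩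
      rw [mem_closedBall_zero_iff] at hw ⊢
      exact (lp.norm_apply_le_norm (by simp) w.1 _).trans hw
    · intro f hf
      have : ∀ p : ι, ∃ v ∈ Metric.closedBall (0 : (d p.1).V) 1, (d p.1).j v = f p.2.1 :=
        fun p => hd p.1 ⟨f, hf, p.2.1, p.2.2, rfl⟩
      choose v hv hv' using this
      have hmem : Memℓp v ∞ := memℓp_infty ⟨1, by
        rintro _ ⟨p, rfl⟩
        simpa using hv p⟩
      refine ⟨⟨⟨v, hmem⟩, f, hv'⟩, ?_, hφ' _ _ hv'⟩
      rw [mem_closedBall_zero_iff]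
      refine lp.norm_le_of_forall_le zero_le_one fun p => ?_
      simpa using hv p

end basic

section maps
variable {E F G H P Q : Type u} [CB E] [CB F] [CB G] [CB H] [CB P] [CB Q]

/-- The identity. -/
def BMap.id (E : Type u) [CB E] : E ⟹ E := BMap.mk LinearMap.id fun S hS => by simpa using hS

/-- Composition. -/
def BMap.comp (g : F ⟹ G) (f : E ⟹ F) : E ⟹ G :=
  BMap.mk (g.1.comp f.1) fun S hS => by
    have := g.bdd (f.bdd hS)
    rwa [image_image] at this

@[simp] theorem BMap.id_apply (x : E) : BMap.id E x = x := rfl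
@[simp] theorem BMap.comp_apply (g : F ⟹ G) (f : E ⟹ F) (x : E) : g.comp f x = g (f x) := rfl

theorem BMap.bdd₂ (β : E ⟹ F ⟹ G) {S : Set E} {T : Set F} (hS : IsBounded S) (hT : IsBounded T) :
    IsBounded {z : G | ∃ x ∈ S, ∃ y ∈ T, z = β x y} := by
  refine (BMap.isBounded_iff.1 (β.bdd hS) T hT).subset ?_
  rintro _ ⟨x, hx, y, hy, rfl⟩
  exact ⟨β x, ⟨x, hx, rfl⟩, y, hy, rfl⟩

/-- A jointly bounded bilinear map, in curried form. -/
def BMap.mk₂ (f : E →ₗ[ℂ] F →ₗ[ℂ] G) (h : ∀ (S : Set E) (T : Set F), IsBounded S → IsBounded T →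
    IsBounded {z : G | ∃ x ∈ S, ∃ y ∈ T, z = f x y}) : E ⟹ F ⟹ G :=
  BMap.mk
    { toFun := fun x => BMap.mk (f x) fun T hT => (h {x} T isBounded_singleton hT).subset (by
        rintro _ ⟨y, hy, rfl⟩; exact ⟨x, rfl, y, hy, rfl⟩)
      map_add' := fun x y => BMap.ext fun z => by simp
      map_smul' := fun c y => BMap.ext fun z => by simp }
    fun S hS => BMap.isBounded_iff.2 fun T hT => (h S T hS hT).subset (by
      rintro _ ⟨_, ⟨x, hx, rfl⟩, y, hy, rfl⟩
      exact ⟨x, hx, y, hy, rfl⟩)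

@[simp] theorem BMap.mk₂_apply (f : E →ₗ[ℂ] F →ₗ[ℂ] G) (h) (x : E) (y : F) :
    BMap.mk₂ f h x y = f x y := rfl

/-- Precomposition of a bilinear map in both variables. -/
def BMap.bi (β : P ⟹ Q ⟹ G) (p : E ⟹ P) (q : F ⟹ Q) : E ⟹ F ⟹ G :=
  BMap.mk₂ (LinearMap.mk₂ ℂ (fun x y => β (p x) (q y)) (by simp) (by simp) (by simp) (by simp))
    fun S T hS hT => (β.bdd₂ (p.bdd hS) (q.bdd hT)).subset (by
      rintro _ ⟨x, hx, y, hy, rfl⟩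
      exact ⟨_, ⟨x, hx, rfl⟩, _, ⟨y, hy, rfl⟩, rfl⟩)

@[simp] theorem BMap.bi_apply (β : P ⟹ Q ⟹ G) (p : E ⟹ P) (q : F ⟹ Q) (x : E) (y : F) :
    β.bi p q x y = β (p x) (q y) := rfl

/-- Exchange of the two variables of a bilinear map. -/
def BMap.flip (β : E ⟹ F ⟹ G) : F ⟹ E ⟹ G :=
  BMap.mk₂ (LinearMap.mk₂ ℂ (fun y x => β x y) (by simp) (by simp) (by simp) (by simp))
    fun S T hS hT => (β.bdd₂ hT hS).subset (by
      rintro _ ⟨x, hx, y, hy, rfl⟩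
      exact ⟨y, hy, x, hx, rfl⟩)

@[simp] theorem BMap.flip_apply (β : E ⟹ F ⟹ G) (x : E) (y : F) : β.flip y x = β x y := rfl

/-- Composition as a bilinear map. -/
def BMap.compB (E F G : Type u) [CB E] [CB F] [CB G] : (F ⟹ G) ⟹ (E ⟹ F) ⟹ (E ⟹ G) :=
  BMap.mk₂ (LinearMap.mk₂ ℂ (fun g f => g.comp f) (fun _ _ _ => rfl) (fun _ _ _ => rfl)
      (fun g f f' => BMap.ext fun x => map_add g _ _)
      (fun c g f => BMap.ext fun x => map_smul g _ _))
    fun S T hS hT => BMap.isBounded_iff.2 fun U hU => by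
      refine (BMap.isBounded_iff.1 hS _ (BMap.isBounded_iff.1 hT U hU)).subset ?_
      rintro _ ⟨_, ⟨g, hg, f, hf, rfl⟩, x, hx, rfl⟩
      exact ⟨g, hg, f x, ⟨f, hf, x, hx, rfl⟩, rfl⟩

@[simp] theorem BMap.compB_apply (g : F ⟹ G) (f : E ⟹ F) (x : E) :
    BMap.compB E F G g f x = g (f x) := rfl

/-- Postcomposition of a bilinear map. -/
def BMap.post (g : G ⟹ H) (β : E ⟹ F ⟹ G) : E ⟹ F ⟹ H := (BMap.compB F G H g).comp β

@[simp] theorem BMap.post_apply (g : G ⟹ H) (β : E ⟹ F ⟹ G) (x : E) (y : F) :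
    BMap.post g β x y = g (β x y) := rfl

end maps

/-! ### Quotients by bornologically closed subspaces -/

section quot
variable {E F G : Type u} [CB E] [CB F] [CB G]

/-- Subspaces closed under bornological limits of sequences. -/
def BClosed (N : Submodule ℂ E) : Prop :=
  ∀ (x : ℕ → E) (a : E), (∀ n, x n ∈ N) → MTendsto atTop x a → a ∈ N

/-- The smallest bornologically closed subspace containing `S`. -/
def bclosure (S : Set E) : Submodule ℂ E := sInf {N | S ⊆ N ∧ BClosed N}

theorem subset_bclosure (S : Set E) : S ⊆ bclosure S := fun x hx => by
  simp only [bclosure, SetLike.mem_coe, Submodule.mem_sInf]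
  exact fun N hN => hN.1 hx

theorem bclosure_le {S : Set E} {N : Submodule ℂ E} (h : S ⊆ N) (hN : BClosed N) :
    bclosure S ≤ N := sInf_le ⟨h, hN⟩

theorem bclosed_bclosure (S : Set E) : BClosed (bclosure S) := by
  intro x a hx ha
  simp only [bclosure, Submodule.mem_sInf] at hx ⊢
  exact fun N hN => hN.2 x a (fun n => hx n N hN) ha

/-- The complete bornological quotient of `E` by the closed subspace generated by `S`. -/
def BQuot (S : Set E) : Type u := E ⧸ bclosure S

noncomputable instance (S : Set E) : AddCommGroup (BQuot S) :=
  inferInstanceAs (AddCommGroup (E ⧸ bclosure S))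
noncomputable instance (S : Set E) : Module ℂ (BQuot S) :=
  inferInstanceAs (Module ℂ (E ⧸ bclosure S))

/-- The projection, as a linear map. -/
def BQuot.mkL (S : Set E) : E →ₗ[ℂ] BQuot S := (bclosure S).mkQ

theorem BQuot.mkL_surj (S : Set E) : Function.Surjective (BQuot.mkL S) :=
  (bclosure S).mkQ_surjective

theorem BQuot.mkL_eq_zero (S : Set E) (x : E) : BQuot.mkL S x = 0 ↔ x ∈ bclosure S :=
  Submodule.Quotient.mk_eq_zero _

instance (S : Set E) : Bornology (BQuot S) :=
  Bornology.ofBounded {B | ∃ T : Set E, IsBounded T ∧ B ⊆ BQuot.mkL S '' T}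
    ⟨∅, isBounded_empty, by simp⟩
    (fun B ⟨T, hT, h⟩ B' h' => ⟨T, hT, h'.trans h⟩)
    (fun B ⟨T, hT, h⟩ B' ⟨T', hT', h'⟩ => ⟨T ∪ T', hT.union hT', by
      rw [image_union]; exact union_subset_union h h'⟩)
    (fun x => by
      obtain ⟨y, rfl⟩ := BQuot.mkL_surj S x
      exact ⟨{y}, isBounded_singleton, by simp⟩)

theorem BQuot.isBounded_iff {S : Set E} {B : Set (BQuot S)} :
    IsBounded B ↔ ∃ T : Set E, IsBounded T ∧ B ⊆ BQuot.mkL S '' T := isBounded_ofBounded_iff _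

noncomputable instance (S : Set E) : CB (BQuot S) where
  complete := by
    intro B hB
    obtain ⟨T, hT, hBT⟩ := BQuot.isBounded_iff.1 hB
    obtain ⟨d, hd⟩ := exists_disk hT
    let f : d.V →ₗ[ℂ] BQuot S := (BQuot.mkL S).comp d.j
    have hcl : IsClosed (LinearMap.ker f : Set d.V) := by
      refine isClosed_of_closure_subset fun v hv => ?_
      obtain ⟨w, hw, hlim⟩ := mem_closure_iff_seq_limit.1 hv
      have : d.j v ∈ bclosure S := bclosed_bclosure S _ _
        (fun n => (BQuot.mkL_eq_zero S _).1 (hw n)) (MTendsto.of_disk d hlim)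
      exact (BQuot.mkL_eq_zero S _).2 this
    let g : (d.V ⧸ LinearMap.ker f) →ₗ[ℂ] BQuot S := (LinearMap.ker f).liftQ f le_rfl
    have hg : Function.Injective g := by
      rw [← LinearMap.ker_eq_bot]
      exact Submodule.ker_liftQ_eq_bot _ _ _ le_rfl
    refine complete_of_radius _ B ⟨d.V ⧸ LinearMap.ker f, g, hg, fun r => ?_⟩ 1 ?_
    · rw [BQuot.isBounded_iff]
      refine ⟨_, d.bdd (r + 1), ?_⟩
      rintro _ ⟨q, hq, rfl⟩
      rw [mem_closedBall_zero_iff] at hq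
      obtain ⟨v, rfl, hv⟩ := Submodule.Quotient.norm_mk_lt q (ε := 1) one_pos
      refine ⟨d.j v, ⟨v, ?_, rfl⟩, rfl⟩
      rw [mem_closedBall_zero_iff]
      linarith
    · rintro b hb
      obtain ⟨t, ht, rfl⟩ := hBT hb
      obtain ⟨v, hv, rfl⟩ := hd ht
      refine ⟨(LinearMap.ker f).mkQ v, ?_, rfl⟩
      rw [mem_closedBall_zero_iff] at hv ⊢
      exact (Submodule.Quotient.norm_mk_le _ v).trans hv

/-- The projection onto the quotient. -/
def BQuot.mk (S : Set E) : E ⟹ BQuot S :=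
  BMap.mk (BQuot.mkL S) fun T hT => BQuot.isBounded_iff.2 ⟨T, hT, le_rfl⟩

theorem BQuot.mk_surj (S : Set E) : Function.Surjective (BQuot.mk S) := BQuot.mkL_surj S

theorem bclosed_ker (f : E ⟹ F) : BClosed (LinearMap.ker f.1) := by
  intro x a hx ha
  have h0 : (fun n => f (x n)) = fun _ => 0 := funext fun n => hx n
  have := ha.map f
  rw [h0] at this
  exact this.unique (MTendsto.const _ _)

theorem bclosure_le_ker {S : Set E} {f : E ⟹ F} (h : ∀ x ∈ S, f x = 0) :
    bclosure S ≤ LinearMap.ker f.1 := bclosure_le h (bclosed_ker f)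

/-- Factorization through the quotient of a bounded map vanishing on the generators. -/
noncomputable def BQuot.lift {S : Set E} (f : E ⟹ F) (h : ∀ x ∈ S, f x = 0) : BQuot S ⟹ F :=
  BMap.mk ((bclosure S).liftQ f.1 (bclosure_le_ker h)) fun B hB => by
    obtain ⟨T, hT, hBT⟩ := BQuot.isBounded_iff.1 hB
    refine (f.bdd hT).subset ?_
    rintro _ ⟨b, hb, rfl⟩
    obtain ⟨t, ht, rfl⟩ := hBT hb
    exact ⟨t, ht, rfl⟩

@[simp] theorem BQuot.lift_mk {S : Set E} (f : E ⟹ F) (h) (x : E) :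
    BQuot.lift (S := S) f h (BQuot.mk S x) = f x := rfl

theorem BQuot.hom_ext {S : Set E} {f g : BQuot S ⟹ F}
    (h : ∀ x, f (BQuot.mk S x) = g (BQuot.mk S x)) : f = g :=
  BMap.ext fun q => by obtain ⟨x, rfl⟩ := BQuot.mk_surj S q; exact h x

end quot

/-! ### The free complete bornological space on a bornological set -/

section free
variable (X : Type u) [Bornology X]

/-- Absolutely summable chains with bounded support. -/
def chains : Submodule ℂ (lp (fun _ : X => ℂ) 1) where
  carrier := {f | IsBounded {x | f x ≠ 0}}
  add_mem' := by
    intro f g hf hg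
    refine (hf.union hg).subset fun x hx => ?_
    by_contra h
    simp only [mem_union, mem_ofPred_eq, not_or, not_not] at h
    exact hx (by simp [h.1, h.2])
  zero_mem' := by simp
  smul_mem' := by
    intro c f hf
    refine hf.subset fun x hx h => hx ?_
    simp only [lp.coeFn_smul, Pi.smul_apply, h, smul_zero]

/-- The free complete bornological space on `X`. -/
def FreeCB : Type u := ↥(chains X)

noncomputable instance : AddCommGroup (FreeCB X) := inferInstanceAs (AddCommGroup ↥(chains X))
noncomputable instance : Module ℂ (FreeCB X) := inferInstanceAs (Module ℂ ↥(chains X))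

variable {X}

/-- The set of chains of norm at most `C` supported in `S`. -/
def chainSet (S : Set X) (C : ℝ) : Set (FreeCB X) :=
  {f | (∀ x, x ∉ S → f.1 x = 0) ∧ ‖f.1‖ ≤ C}

/-- Bounded sets of chains: common bounded support and bounded total mass. -/
instance : Bornology (FreeCB X) :=
  Bornology.ofBounded {B | ∃ S : Set X, IsBounded S ∧ ∃ C : ℝ, B ⊆ chainSet S C}
    ⟨∅, isBounded_empty, 0, by simp⟩
    (fun B ⟨S, hS, C, h⟩ B' h' => ⟨S, hS, C, h'.trans h⟩)
    (by
      rintro B ⟨S, hS, C, h⟩ B' ⟨S', hS', C', h'⟩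
      refine ⟨S ∪ S', hS.union hS', max C C', ?_⟩
      rintro f (hf | hf)
      · exact ⟨fun x hx => (h hf).1 x fun h => hx (Or.inl h), (h hf).2.trans (le_max_left _ _)⟩
      · exact ⟨fun x hx => (h' hf).1 x fun h => hx (Or.inr h), (h' hf).2.trans (le_max_right _ _)⟩)
    (fun f => ⟨_, f.2, ‖f.1‖, by
      rintro _ rfl
      exact ⟨fun x hx => not_not.1 hx, le_rfl⟩⟩)

theorem FreeCB.isBounded_iff {B : Set (FreeCB X)} :
    IsBounded B ↔ ∃ S : Set X, IsBounded S ∧ ∃ C : ℝ, B ⊆ chainSet S C := isBounded_ofBounded_iff _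

theorem isBounded_chainSet {S : Set X} (hS : IsBounded S) (C : ℝ) : IsBounded (chainSet S C) :=
  FreeCB.isBounded_iff.2 ⟨S, hS, C, le_rfl⟩

/-- The Banach space of summable chains supported in `S`. -/
def chainsOn (S : Set X) : Submodule ℂ (lp (fun _ : X => ℂ) 1) where
  carrier := {f | ∀ x, x ∉ S → f x = 0}
  add_mem' := by
    intro f g hf hg x hx
    simp [hf x hx, hg x hx]
  zero_mem' := by simp
  smul_mem' := by
    intro c f hf x hx
    simp only [lp.coeFn_smul, Pi.smul_apply, hf x hx, smul_zero]

theorem isClosed_chainsOn (S : Set X) : IsClosed (chainsOn S : Set (lp (fun _ : X => ℂ) 1)) := by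
  have : (chainsOn S : Set (lp (fun _ : X => ℂ) 1)) = ⋂ x, ⋂ _ : x ∉ S, {f | f x = 0} := by
    ext f
    simp only [mem_iInter, SetLike.mem_coe]
    exact Iff.rfl
  rw [this]
  refine isClosed_iInter fun x => isClosed_iInter fun _ => ?_
  exact isClosed_eq (lp.lipschitzWith_one_eval 1 x).continuous continuous_const

/-- The disk of chains supported in a bounded set. -/
noncomputable def chainDisk {S : Set X} (hS : IsBounded S) : BanachDisk (FreeCB X) :=
  have : CompleteSpace (chainsOn S) := (isClosed_chainsOn S).completeSpace_coe
  { V := chainsOn S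
    j :=
      { toFun := fun f => ⟨f.1, hS.subset fun x hx => by
          by_contra h
          exact hx (f.2 x h)⟩
        map_add' := fun _ _ => rfl
        map_smul' := fun _ _ => rfl }
    inj := fun f g h => Subtype.ext (congrArg (fun c : chains X => c.1) h)
    bdd := fun r => by
      refine (isBounded_chainSet hS r).subset ?_
      rintro _ ⟨f, hf, rfl⟩
      rw [mem_closedBall_zero_iff] at hf
      exact ⟨f.2, hf⟩ }

noncomputable instance : CB (FreeCB X) where
  complete := by
    intro B hB
    obtain ⟨S, hS, C, h⟩ := FreeCB.isBounded_iff.1 hB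
    refine complete_of_radius _ B (chainDisk hS) C fun f hf => ?_
    exact ⟨⟨f.1, (h hf).1⟩, (mem_closedBall_zero_iff (E := chainsOn S)).2 (h hf).2, rfl⟩

open Classical in
/-- The generators. -/
noncomputable def FreeCB.single (x : X) : FreeCB X :=
  ⟨lp.single 1 x 1, (isBounded_singleton (x := x)).subset fun y hy => by
    by_contra h
    exact hy (lp.single_apply_ne 1 x 1 h)⟩

theorem single_mem_chainSet {S : Set X} {x : X} (hx : x ∈ S) :
    FreeCB.single x ∈ chainSet S 1 := by
  classical
  refine ⟨fun y hy => ?_, ?_⟩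
  · refine lp.single_apply_ne 1 x 1 ?_
    rintro rfl
    exact hy hx
  · simp only [FreeCB.single]
    rw [lp.norm_single (by simp)]
    simp

theorem FreeCB.hasSum_single (f : FreeCB X) : MHasSum (fun x => f.1 x • FreeCB.single x) f := by
  classical
  have hS := f.2
  let g : chainsOn {x | f.1 x ≠ 0} := ⟨f.1, fun x hx => not_not.1 hx⟩
  have key : ∀ x, f.1 x • lp.single 1 x (1 : ℂ) ∈ chainsOn {x | f.1 x ≠ 0} := by
    intro x y hy
    by_cases h : y = x
    · subst h
      have : f.1 y = 0 := not_not.1 hy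
      simp [this]
    · simp only [lp.coeFn_smul, Pi.smul_apply]
      rw [lp.single_apply_ne 1 x 1 h, smul_zero]
  have h1 : Tendsto (fun s : Finset X => ∑ x ∈ s, (⟨_, key x⟩ : chainsOn {x | f.1 x ≠ 0})) atTop
      (𝓝 g) := by
    refine tendsto_subtype_rng.2 ?_
    have h2 := lp.hasSum_single (p := 1) (by simp) f.1
    simp only [HasSum, SummationFilter.unconditional_filter] at h2
    refine h2.congr fun s => ?_
    rw [AddSubmonoidClass.coe_finsetSum]
    refine Finset.sum_congr rfl fun x _ => ?_
    simp only
    rw [← lp.single_smul]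
    simp
  have h3 := MTendsto.of_disk (chainDisk hS) h1
  have h4 : ∀ s : Finset X, (chainDisk hS).j (∑ x ∈ s, (⟨_, key x⟩ : chainsOn {x | f.1 x ≠ 0})) =
      ∑ x ∈ s, f.1 x • FreeCB.single x := fun s =>
    map_sum (chainDisk hS).j (fun x => (⟨_, key x⟩ : chainsOn {x | f.1 x ≠ 0})) s
  obtain ⟨B, hB, h5⟩ := h3
  exact ⟨B, hB, fun ε hε => (h5 ε hε).mono fun s ⟨b, hb, e⟩ =>
    ⟨b, hb, (congrArg (fun z => z - f) (h4 s)).symm.trans e⟩⟩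

variable {G : Type u} [CB G]

theorem chain_sum {h : X → G} {S : Set X} (d : BanachDisk G)
    (hd : h '' S ⊆ d.j '' Metric.closedBall 0 1) (f : FreeCB X) (hf : ∀ x, x ∉ S → f.1 x = 0) :
    ∃ v : d.V, ‖v‖ ≤ ‖f.1‖ ∧ MHasSum (fun x => f.1 x • h x) (d.j v) := by
  have : ∀ x, ∃ v : d.V, ‖v‖ ≤ 1 ∧ (x ∈ S → d.j v = h x) := by
    intro x
    by_cases hx : x ∈ S
    · obtain ⟨v, hv, hv'⟩ := hd ⟨x, hx, rfl⟩
      exact ⟨v, by simpa using hv, fun _ => hv'⟩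
    · exact ⟨0, by simp, fun h => absurd h hx⟩
  choose v hv hv' using this
  have hn : HasSum (fun x => ‖f.1 x‖) ‖f.1‖ := by
    have := lp.hasSum_norm (p := 1) (by simp) f.1
    simpa using this
  have hb : ∀ x, ‖f.1 x • v x‖ ≤ ‖f.1 x‖ := fun x => by
    rw [norm_smul]
    exact mul_le_of_le_one_right (norm_nonneg _) (hv x)
  have hs : Summable (fun x => f.1 x • v x) := Summable.of_norm_bounded hn.summable hb
  refine ⟨∑' x, f.1 x • v x, tsum_of_norm_bounded hn hb, ?_⟩
  have h0 := hs.hasSum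
  simp only [HasSum, SummationFilter.unconditional_filter] at h0
  have h1 := MTendsto.of_disk d h0
  have h2 : ∀ x, d.j (f.1 x • v x) = f.1 x • h x := fun x => by
    by_cases hx : x ∈ S
    · rw [map_smul, hv' x hx]
    · rw [hf x hx]; simp
  simp only [map_sum, h2] at h1
  exact h1

/-- The bounded linear extension of a bounded map defined on the generators. -/
noncomputable def FreeCB.ext (h : X → G) (hb : ∀ S : Set X, IsBounded S → IsBounded (h '' S)) :
    FreeCB X ⟹ G :=
  have ex : ∀ f : FreeCB X, ∃ a, MHasSum (fun x => f.1 x • h x) a := fun f => by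
    obtain ⟨d, hd⟩ := exists_disk (hb _ f.2)
    obtain ⟨v, -, hv⟩ := chain_sum d hd f fun x hx => not_not.1 hx
    exact ⟨_, hv⟩
  BMap.mk
    { toFun := fun f => (ex f).choose
      map_add' := fun f g => (ex (f + g)).choose_spec.unique (by
        have := (ex f).choose_spec.add (ex g).choose_spec
        simp only [← Finset.sum_add_distrib, ← add_smul] at this
        exact this)
      map_smul' := fun c f => (ex (c • f)).choose_spec.unique (by
        have := (ex f).choose_spec.smul c
        simp only [Finset.smul_sum, smul_smul] at this
        exact this) }
    fun B hB => by
      obtain ⟨S, hS, C, h'⟩ := FreeCB.isBounded_iff.1 hB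
      obtain ⟨d, hd⟩ := exists_disk (hb _ hS)
      refine (d.bdd C).subset ?_
      rintro _ ⟨f, hf, rfl⟩
      obtain ⟨v, hv, hv'⟩ := chain_sum d hd f (h' hf).1
      refine ⟨v, ?_, hv'.unique (ex f).choose_spec⟩
      rw [mem_closedBall_zero_iff]
      exact hv.trans (h' hf).2

theorem FreeCB.ext_hasSum (h : X → G) (hb) (f : FreeCB X) :
    MHasSum (fun x => f.1 x • h x) (FreeCB.ext h hb f) := by
  have ex : ∃ a, MHasSum (fun x => f.1 x • h x) a := by
    obtain ⟨d, hd⟩ := exists_disk (hb _ f.2)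
    obtain ⟨v, -, hv⟩ := chain_sum d hd f fun x hx => not_not.1 hx
    exact ⟨_, hv⟩
  exact ex.choose_spec

theorem FreeCB.ext_mem (h : X → G) (hb) {S : Set X} {C : ℝ} (d : BanachDisk G)
    (hd : h '' S ⊆ d.j '' Metric.closedBall 0 1) {f : FreeCB X} (hf : f ∈ chainSet S C) :
    FreeCB.ext h hb f ∈ d.j '' Metric.closedBall 0 C := by
  obtain ⟨v, hv, hv'⟩ := chain_sum d hd f hf.1
  refine ⟨v, ?_, hv'.unique (FreeCB.ext_hasSum h hb f)⟩
  rw [mem_closedBall_zero_iff]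
  exact hv.trans hf.2

theorem FreeCB.ext_single (h : X → G) (hb) (x : X) :
    FreeCB.ext h hb (FreeCB.single x) = h x := by
  classical
  refine (FreeCB.ext_hasSum h hb _).unique ?_
  refine ⟨{0}, isBounded_singleton, fun ε _ => ?_⟩
  filter_upwards [eventually_ge_atTop {x}] with s hs
  refine ⟨0, rfl, ?_⟩
  rw [Finset.sum_eq_single x]
  · have : (FreeCB.single x).1 x = (1 : ℂ) := lp.single_apply_self 1 x 1
    simp [this]
  · intro y _ hy
    have : (FreeCB.single x).1 y = (0 : ℂ) := lp.single_apply_ne 1 x 1 hy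
    rw [this, zero_smul]
  · intro h
    exact absurd (hs (Finset.mem_singleton_self x)) h

theorem FreeCB.hom_ext {f g : FreeCB X ⟹ G}
    (h : ∀ x, f (FreeCB.single x) = g (FreeCB.single x)) : f = g :=
  BMap.ext fun c => by
    have h1 := (FreeCB.hasSum_single c).map f
    have h2 := (FreeCB.hasSum_single c).map g
    simp only [map_smul, h] at h1 h2
    exact h1.unique h2

end free


/-! ### Completed tensor products -/

section tensor
variable {E F G E' F' : Type u} [CB E] [CB F] [CB G] [CB E'] [CB F']

/-- The bilinearity relations. -/
def tensorRel (E F : Type u) [CB E] [CB F] : Set (FreeCB (E × F)) :=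
  {z | (∃ (a b : ℂ) (x x' : E) (y : F), z = FreeCB.single (a • x + b • x', y) -
      (a • FreeCB.single (x, y) + b • FreeCB.single (x', y))) ∨
    ∃ (a b : ℂ) (x : E) (y y' : F), z = FreeCB.single (x, a • y + b • y') -
      (a • FreeCB.single (x, y) + b • FreeCB.single (x, y'))}

/-- The completed bornological tensor product: summable chains of pairs modulo the closed
subspace generated by bilinearity. -/
def CTensor (E F : Type u) [CB E] [CB F] : Type u := BQuot (tensorRel E F)

infixr:70 " ⊗̂ " => CTensor

instance : CB (E ⊗̂ F) := inferInstanceAs (CB (BQuot (tensorRel E F)))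

/-- The projection from chains. -/
def CTensor.proj (E F : Type u) [CB E] [CB F] : FreeCB (E × F) ⟹ E ⊗̂ F := BQuot.mk (tensorRel E F)

theorem tmul_comb_left (a b : ℂ) (x x' : E) (y : F) :
    CTensor.proj E F (FreeCB.single (a • x + b • x', y)) =
      a • CTensor.proj E F (FreeCB.single (x, y)) + b • CTensor.proj E F (FreeCB.single (x', y)) := by
  rw [← sub_eq_zero, ← map_smul, ← map_smul, ← map_add, ← map_sub]
  exact (BQuot.mkL_eq_zero _ _).2 (subset_bclosure _ (Or.inl ⟨a, b, x, x', y, rfl⟩))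

theorem tmul_comb_right (a b : ℂ) (x : E) (y y' : F) :
    CTensor.proj E F (FreeCB.single (x, a • y + b • y')) =
      a • CTensor.proj E F (FreeCB.single (x, y)) + b • CTensor.proj E F (FreeCB.single (x, y')) := by
  rw [← sub_eq_zero, ← map_smul, ← map_smul, ← map_add, ← map_sub]
  exact (BQuot.mkL_eq_zero _ _).2 (subset_bclosure _ (Or.inr ⟨a, b, x, y, y', rfl⟩))

theorem bdd_prod {S : Set E} {T : Set F} (hS : IsBounded S) (hT : IsBounded T) :
    IsBounded (S ×ˢ T) := hS.prod hT

/-- The universal bounded bilinear map `x, y ↦ x ⊗ y`. -/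
def tmul (E F : Type u) [CB E] [CB F] : E ⟹ F ⟹ E ⊗̂ F :=
  BMap.mk₂
    (LinearMap.mk₂ ℂ (fun x y => CTensor.proj E F (FreeCB.single (x, y)))
      (fun x x' y => by simpa using tmul_comb_left 1 1 x x' y)
      (fun c x y => by simpa using tmul_comb_left c 0 x 0 y)
      (fun x y y' => by simpa using tmul_comb_right 1 1 x y y')
      (fun c x y => by simpa using tmul_comb_right c 0 x y 0))
    fun S T hS hT => by
      refine ((CTensor.proj E F).bdd (isBounded_chainSet (hS.prod hT) 1)).subset ?_
      rintro _ ⟨x, hx, y, hy, rfl⟩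
      exact ⟨_, single_mem_chainSet (⟨hx, hy⟩ : (x, y) ∈ S ×ˢ T), rfl⟩

theorem tmul_eq (x : E) (y : F) : tmul E F x y = CTensor.proj E F (FreeCB.single (x, y)) := rfl

theorem BMap.bdd_uncurry (β : E ⟹ F ⟹ G) (S : Set (E × F)) (hS : IsBounded S) :
    IsBounded ((fun p : E × F => β p.1 p.2) '' S) := by
  have h := isBounded_image_fst_and_snd.2 hS
  refine (β.bdd₂ h.1 h.2).subset ?_
  rintro _ ⟨p, hp, rfl⟩
  exact ⟨p.1, ⟨p, hp, rfl⟩, p.2, ⟨p, hp, rfl⟩, rfl⟩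

theorem lift_aux (β : E ⟹ F ⟹ G) (z : FreeCB (E × F)) (hz : z ∈ tensorRel E F) :
    FreeCB.ext (fun p : E × F => β p.1 p.2) β.bdd_uncurry z = 0 := by
  rcases hz with ⟨a, b, x, x', y, rfl⟩ | ⟨a, b, x, y, y', rfl⟩ <;>
  simp only [map_sub, map_add, map_smul, FreeCB.ext_single, BMap.add_apply, BMap.smul_apply,
    sub_self]

/-- The bounded linear map on the completed tensor product defined by a bounded bilinear map. -/
def lift (β : E ⟹ F ⟹ G) : E ⊗̂ F ⟹ G :=
  BQuot.lift (S := tensorRel E F) (FreeCB.ext (fun p : E × F => β p.1 p.2) β.bdd_uncurry)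
    (lift_aux β)

theorem lift_proj (β : E ⟹ F ⟹ G) (c : FreeCB (E × F)) : lift β (CTensor.proj E F c) =
    FreeCB.ext (fun p : E × F => β p.1 p.2) β.bdd_uncurry c := rfl

@[simp] theorem lift_tmul (β : E ⟹ F ⟹ G) (x : E) (y : F) :
    lift β (tmul E F x y) = β x y := by
  rw [tmul_eq, lift_proj, FreeCB.ext_single]

theorem tensor_ext {f g : E ⊗̂ F ⟹ G} (h : ∀ x y, f (tmul E F x y) = g (tmul E F x y)) : f = g := by
  refine BQuot.hom_ext fun c => ?_
  have : f.comp (CTensor.proj E F) = g.comp (CTensor.proj E F) :=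
    FreeCB.hom_ext fun p => h p.1 p.2
  exact DFunLike.congr_fun this c

theorem tensor_ext₂ {f g : E ⊗̂ F ⟹ E' ⟹ G}
    (h : ∀ x y z, f (tmul E F x y) z = g (tmul E F x y) z) : f = g :=
  tensor_ext fun x y => BMap.ext fun z => h x y z

/-- An equibounded set of bilinear maps induces an equibounded set of maps on the tensor product. -/
theorem bdd_lift {B : Set (E ⟹ F ⟹ G)} (hB : IsBounded B) : IsBounded (lift '' B) := by
  rw [BMap.isBounded_iff]
  intro T hT
  obtain ⟨U, hU, hTU⟩ := BQuot.isBounded_iff.1 hT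
  obtain ⟨S, hS, C, hC⟩ := FreeCB.isBounded_iff.1 hU
  have h := isBounded_image_fst_and_snd.2 hS
  obtain ⟨d, hd⟩ := exists_disk (BMap.isBounded_iff.1 (BMap.isBounded_iff.1 hB _ h.1) _ h.2)
  refine (d.bdd C).subset ?_
  rintro _ ⟨_, ⟨β, hβ, rfl⟩, t, ht, rfl⟩
  obtain ⟨c, hc, rfl⟩ := hTU ht
  refine FreeCB.ext_mem (fun p : E × F => β p.1 p.2) β.bdd_uncurry d ?_ (hC hc)
  rintro _ ⟨p, hp, rfl⟩
  exact hd ⟨_, ⟨β, hβ, p.1, ⟨p, hp, rfl⟩, rfl⟩, p.2, ⟨p, hp, rfl⟩, rfl⟩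

/-- The tensor product of two bounded maps (without sign). -/
def tmap (f : E ⟹ E') (g : F ⟹ F') : E ⊗̂ F ⟹ E' ⊗̂ F' := lift ((tmul E' F').bi f g)

@[simp] theorem tmap_tmul (f : E ⟹ E') (g : F ⟹ F') (x : E) (y : F) :
    tmap f g (tmul E F x y) = tmul E' F' (f x) (g y) := by simp [tmap]

/-- The tensor product of bounded maps, as a bounded bilinear map. -/
def tmapB (E F E' F' : Type u) [CB E] [CB F] [CB E'] [CB F'] :
    (E ⟹ E') ⟹ (F ⟹ F') ⟹ (E ⊗̂ F ⟹ E' ⊗̂ F') :=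
  BMap.mk₂ (LinearMap.mk₂ ℂ tmap
      (fun f f' g => tensor_ext fun x y => by simp)
      (fun c f g => tensor_ext fun x y => by simp)
      (fun f g g' => tensor_ext fun x y => by simp)
      (fun c f g => tensor_ext fun x y => by simp))
    fun S T hS hT => by
      refine (bdd_lift (B := {β | ∃ f ∈ S, ∃ g ∈ T, β = (tmul E' F').bi f g}) ?_).subset ?_
      · rw [BMap.isBounded_iff]
        intro U hU
        rw [BMap.isBounded_iff]
        intro W hW
        refine ((tmul E' F').bdd₂ (BMap.isBounded_iff.1 hS U hU)
          (BMap.isBounded_iff.1 hT W hW)).subset ?_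
        rintro _ ⟨_, ⟨_, ⟨f, hf, g, hg, rfl⟩, x, hx, rfl⟩, y, hy, rfl⟩
        exact ⟨f x, ⟨f, hf, x, hx, rfl⟩, g y, ⟨g, hg, y, hy, rfl⟩, rfl⟩
      · rintro _ ⟨f, hf, g, hg, rfl⟩
        exact ⟨_, ⟨f, hf, g, hg, rfl⟩, rfl⟩

@[simp] theorem tmapB_apply (f : E ⟹ E') (g : F ⟹ F') : tmapB E F E' F' f g = tmap f g := rfl

end tensor

/-! ### Products, unitalizations and direct sums -/

section prod
variable {E F G : Type u} [CB E] [CB F] [CB G]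

instance : CB (E × F) where
  complete := by
    intro S hS
    have h := isBounded_image_fst_and_snd.2 hS
    obtain ⟨d, hd⟩ := exists_disk h.1
    obtain ⟨e, he⟩ := exists_disk h.2
    refine ⟨⟨d.V × e.V, d.j.prodMap e.j, ?_, fun r => ?_⟩, ?_⟩
    · exact Function.Injective.prodMap d.inj e.inj
    · refine ((d.bdd r).prod (e.bdd r)).subset ?_
      rintro _ ⟨v, hv, rfl⟩
      rw [mem_closedBall_zero_iff] at hv
      exact ⟨⟨v.1, mem_closedBall_zero_iff.2 ((norm_fst_le v).trans hv), rfl⟩,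
        ⟨v.2, mem_closedBall_zero_iff.2 ((norm_snd_le v).trans hv), rfl⟩⟩
    · rintro ⟨x, y⟩ hxy
      obtain ⟨v, hv, rfl⟩ := hd ⟨_, hxy, rfl⟩
      obtain ⟨w, hw, rfl⟩ := he ⟨_, hxy, rfl⟩
      rw [mem_closedBall_zero_iff] at hv hw
      exact ⟨(v, w), mem_closedBall_zero_iff.2 (norm_prod_le_iff.2 ⟨hv, hw⟩), rfl⟩

/-- The projections of a product. -/
def fstB (E F : Type u) [CB E] [CB F] : E × F ⟹ E :=
  BMap.mk (LinearMap.fst ℂ E F) fun _ hS => (isBounded_image_fst_and_snd.2 hS).1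
def sndB (E F : Type u) [CB E] [CB F] : E × F ⟹ F :=
  BMap.mk (LinearMap.snd ℂ E F) fun _ hS => (isBounded_image_fst_and_snd.2 hS).2
@[simp] theorem fstB_apply (x : E × F) : fstB E F x = x.1 := rfl
@[simp] theorem sndB_apply (x : E × F) : sndB E F x = x.2 := rfl

/-- The pairing of two bounded maps. -/
def pairB (f : G ⟹ E) (g : G ⟹ F) : G ⟹ E × F :=
  BMap.mk (f.1.prod g.1) fun S hS => by
    refine ((f.bdd hS).prod (g.bdd hS)).subset ?_
    rintro _ ⟨x, hx, rfl⟩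
    exact ⟨⟨x, hx, rfl⟩, ⟨x, hx, rfl⟩⟩
@[simp] theorem pairB_apply (f : G ⟹ E) (g : G ⟹ F) (x : G) : pairB f g x = (f x, g x) := rfl

instance unitBorn (E : Type u) [CB E] : Bornology (Unitization ℂ E) :=
  Bornology.induced (fun x : Unitization ℂ E => (x.fst, x.snd))

theorem unit_isBounded_iff {S : Set (Unitization ℂ E)} :
    IsBounded S ↔ IsBounded ((fun x : Unitization ℂ E => x.fst) '' S) ∧ IsBounded ((fun x : Unitization ℂ E => x.snd) '' S) := by
  rw [isBounded_induced, ← isBounded_image_fst_and_snd, image_image, image_image]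

/-- The unitalization `ℂ ⊕ E`. -/
instance (E : Type u) [CB E] : CB (Unitization ℂ E) where
  complete := by
    intro S hS
    obtain ⟨h1, h2⟩ := unit_isBounded_iff.1 hS
    obtain ⟨d, hd⟩ := exists_disk h2
    obtain ⟨C, hC⟩ := h1.exists_norm_le
    let j : (ℂ × d.V) →ₗ[ℂ] Unitization ℂ E :=
      { toFun := fun p => Unitization.inl p.1 + Unitization.inr (d.j p.2)
        map_add' := fun p q => by ext <;> simp
        map_smul' := fun c p => by ext <;> simp }
    have hj1 : ∀ p, (j p).fst = p.1 := fun p => by simp [j]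
    have hj2 : ∀ p, (j p).snd = d.j p.2 := fun p => by simp [j]
    refine complete_of_radius _ S ⟨ℂ × d.V, j, fun p q h => ?_, fun r => ?_⟩ (max C 1) ?_
    · refine Prod.ext ?_ (d.inj ?_)
      · rw [← hj1, h, hj1]
      · rw [← hj2, h, hj2]
    · refine unit_isBounded_iff.2 ⟨(Metric.isBounded_closedBall (x := (0 : ℂ)) (r := r)).subset ?_,
        (d.bdd r).subset ?_⟩
      · rintro _ ⟨_, ⟨p, hp, rfl⟩, rfl⟩
        rw [mem_closedBall_zero_iff] at hp
        beta_reduce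
        rw [hj1, mem_closedBall_zero_iff]
        exact (norm_fst_le p).trans hp
      · rintro _ ⟨_, ⟨p, hp, rfl⟩, rfl⟩
        rw [mem_closedBall_zero_iff] at hp
        beta_reduce
        rw [hj2]
        exact ⟨p.2, mem_closedBall_zero_iff.2 ((norm_snd_le p).trans hp), rfl⟩
    · intro x hx
      obtain ⟨v, hv, hv'⟩ := hd ⟨x, hx, rfl⟩
      rw [mem_closedBall_zero_iff] at hv
      refine ⟨(x.fst, v), mem_closedBall_zero_iff.2 (norm_prod_le_iff.2
        ⟨(hC _ ⟨x, hx, rfl⟩).trans (le_max_left _ _), hv.trans (le_max_right _ _)⟩), ?_⟩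
      refine Unitization.ext ?_ ?_
      · rw [hj1]
      · rw [hj2]; exact hv'

/-- The projection of the unitalization onto `E`. -/
def usnd (E : Type u) [CB E] : Unitization ℂ E ⟹ E :=
  BMap.mk (Unitization.sndHom ℂ ℂ E) fun _ hS => (unit_isBounded_iff.1 hS).2
/-- The inclusion of `E` in its unitalization. -/
def uinr (E : Type u) [CB E] : E ⟹ Unitization ℂ E :=
  BMap.mk (Unitization.inrHom ℂ ℂ E) fun S hS => unit_isBounded_iff.2
    ⟨(isBounded_singleton (x := (0 : ℂ))).subset (by rintro _ ⟨_, ⟨x, hx, rfl⟩, rfl⟩; simp),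
      hS.subset (by rintro _ ⟨_, ⟨x, hx, rfl⟩, rfl⟩; simpa using hx)⟩
@[simp] theorem usnd_apply (x : Unitization ℂ E) : usnd E x = x.snd := rfl
@[simp] theorem uinr_apply (x : E) : uinr E x = (x : Unitization ℂ E) := rfl

/-- The bounded map on the unitalization with value `a` at the unit and given by `f` on `E`. -/
def uext (a : G) (f : E ⟹ G) : Unitization ℂ E ⟹ G :=
  BMap.mk
    { toFun := fun x => x.fst • a + f x.snd
      map_add' := fun x y => by
        rw [Unitization.fst_add, Unitization.snd_add, map_add, add_smul]
        abel
      map_smul' := fun c x => by simp [smul_smul] }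
    fun S hS => by
      obtain ⟨h1, h2⟩ := unit_isBounded_iff.1 hS
      obtain ⟨C, hC⟩ := h1.exists_norm_le
      refine (bdd_add (bdd_smul (isBounded_singleton (x := a)) C) (f.bdd h2)).subset ?_
      rintro _ ⟨x, hx, rfl⟩
      exact ⟨_, ⟨x.fst, a, rfl, hC _ ⟨x, hx, rfl⟩, rfl⟩, _, ⟨_, ⟨x, hx, rfl⟩, rfl⟩, rfl⟩

@[simp] theorem uext_apply (a : G) (f : E ⟹ G) (x : Unitization ℂ E) :
    uext a f x = x.fst • a + f x.snd := rfl

end prod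

section dsum
variable {ι : Type} [DecidableEq ι] {E : ι → Type u} [∀ i, CB (E i)] {G : Type u} [CB G]

/-- The direct sum bornology. -/
instance : Bornology (Π₀ i, E i) :=
  Bornology.ofBounded {B | ∃ s : Finset ι, (∀ f ∈ B, ∀ i ∉ s, f i = 0) ∧
      ∀ i, IsBounded ((fun f : Π₀ i, E i => f i) '' B)}
    ⟨∅, by simp⟩
    (fun B ⟨s, h, h'⟩ B' hB => ⟨s, fun f hf => h f (hB hf), fun i =>
      (h' i).subset (image_mono hB)⟩)
    (by
      rintro B ⟨s, h, h'⟩ B' ⟨t, k, k'⟩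
      refine ⟨s ∪ t, ?_, fun i => by rw [image_union]; exact (h' i).union (k' i)⟩
      rintro f (hf | hf) i hi
      · exact h f hf i fun hs => hi (Finset.mem_union_left _ hs)
      · exact k f hf i fun hs => hi (Finset.mem_union_right _ hs))
    (by
      classical
      intro f
      refine ⟨f.support, ?_, fun i => by simp⟩
      rintro _ rfl i hi
      simpa using hi)

theorem dsum_isBounded_iff {B : Set (Π₀ i, E i)} : IsBounded B ↔ ∃ s : Finset ι,
    (∀ f ∈ B, ∀ i ∉ s, f i = 0) ∧ ∀ i, IsBounded ((fun f : Π₀ i, E i => f i) '' B) :=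
  isBounded_ofBounded_iff _

instance : CB (Π₀ i, E i) where
  complete := by
    intro B hB
    obtain ⟨s, h, h'⟩ := dsum_isBounded_iff.1 hB
    choose d hd using fun i => exists_disk (h' i)
    let j : (∀ i : s, (d i).V) →ₗ[ℂ] Π₀ i, E i :=
      { toFun := fun v => DFinsupp.mk s fun i => (d i).j (v i)
        map_add' := fun v w => by
          ext i
          by_cases hi : i ∈ s <;> simp [hi]
        map_smul' := fun c v => by
          ext i
          by_cases hi : i ∈ s <;> simp [hi] }
    have hj : ∀ v (i : s), j v i = (d i).j (v i) := fun v i => by simp [j]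
    have hj' : ∀ v, ∀ i ∉ s, j v i = 0 := fun v i hi => by simp [j, hi]
    refine ⟨⟨∀ i : s, (d i).V, j, fun v w e => ?_, fun r => ?_⟩, ?_⟩
    · funext i
      refine (d i).inj ?_
      rw [← hj, e, hj]
    · refine dsum_isBounded_iff.2 ⟨s, ?_, fun i => ?_⟩
      · rintro _ ⟨v, hv, rfl⟩ i hi
        exact hj' v i hi
      · by_cases hi : i ∈ s
        · refine ((d i).bdd r).subset ?_
          rintro _ ⟨_, ⟨v, hv, rfl⟩, rfl⟩
          rw [mem_closedBall_zero_iff] at hv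
          exact ⟨v ⟨i, hi⟩, mem_closedBall_zero_iff.2 ((norm_le_pi_norm v ⟨i, hi⟩).trans hv),
            (hj v ⟨i, hi⟩).symm⟩
        · refine (isBounded_singleton (x := (0 : E i))).subset ?_
          rintro _ ⟨_, ⟨v, hv, rfl⟩, rfl⟩
          exact hj' v i hi
    · intro f hf
      choose v hv hv' using fun i => hd i ⟨f, hf, rfl⟩
      refine ⟨fun i => v i, ?_, ?_⟩
      · rw [mem_closedBall_zero_iff, pi_norm_le_iff_of_nonneg zero_le_one]
        exact fun i => mem_closedBall_zero_iff.1 (hv i)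
      · ext i
        by_cases hi : i ∈ s
        · rw [hj _ ⟨i, hi⟩]; exact hv' i
        · rw [hj' _ i hi, h f hf i hi]

/-- The inclusion of a summand. -/
def dof (E : ι → Type u) [∀ i, CB (E i)] (i : ι) : E i ⟹ Π₀ i, E i :=
  BMap.mk (DFinsupp.lsingle i) fun S hS => dsum_isBounded_iff.2 ⟨{i}, by
      rintro _ ⟨x, hx, rfl⟩ k hk
      simp only [DFinsupp.lsingle_apply]
      exact DFinsupp.single_eq_of_ne (by simpa using hk), fun k => by
      by_cases hk : k = i
      · subst hk
        refine hS.subset ?_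
        rintro _ ⟨_, ⟨x, hx, rfl⟩, rfl⟩
        simpa using hx
      · refine (isBounded_singleton (x := (0 : E k))).subset ?_
        rintro _ ⟨_, ⟨x, hx, rfl⟩, rfl⟩
        simp only [DFinsupp.lsingle_apply]
        exact DFinsupp.single_eq_of_ne hk⟩

theorem bdd_finset_sum {κ : Type*} (s : Finset κ) (S : κ → Set G) (h : ∀ i, IsBounded (S i)) :
    IsBounded {x : G | ∃ v : κ → G, (∀ i, v i ∈ S i) ∧ x = ∑ i ∈ s, v i} := by
  classical
  induction s using Finset.induction_on with
  | empty =>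
    refine (isBounded_singleton (x := (0 : G))).subset ?_
    rintro _ ⟨v, hv, rfl⟩
    simp
  | insert a s ha ih =>
    refine (bdd_add (h a) ih).subset ?_
    rintro _ ⟨v, hv, rfl⟩
    exact ⟨v a, hv a, _, ⟨v, hv, rfl⟩, Finset.sum_insert ha⟩

/-- The bounded map on a direct sum given by bounded maps on the summands. -/
def dlift (f : ∀ i, E i ⟹ G) : (Π₀ i, E i) ⟹ G :=
  BMap.mk (DFinsupp.lsum ℂ fun i => (f i).1) fun B hB => by
    classical
    obtain ⟨s, h, h'⟩ := dsum_isBounded_iff.1 hB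
    refine (bdd_finset_sum s _ fun i => (f i).bdd (h' i)).subset ?_
    rintro _ ⟨x, hx, rfl⟩
    refine ⟨fun i => f i (x i), fun i => ⟨_, ⟨x, hx, rfl⟩, rfl⟩, ?_⟩
    have : x.support ⊆ s := fun i hi => by
      by_contra hs
      exact (DFinsupp.mem_support_toFun x i).1 hi (h x hx i hs)
    rw [DFinsupp.lsum_apply_apply, DFinsupp.sumAddHom_apply, DFinsupp.sum]
    refine Finset.sum_subset this fun i _ hi => ?_
    rw [DFinsupp.notMem_support_iff.1 hi]
    exact map_zero (f i)

@[simp] theorem dlift_dof (f : ∀ i, E i ⟹ G) (i : ι) (x : E i) : dlift f (dof E i x) = f i x := by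
  change DFinsupp.lsum ℂ (fun i => (f i).1) (DFinsupp.single i x) = _
  rw [DFinsupp.lsum_single]; rfl

theorem dsum_ext {f g : (Π₀ i, E i) ⟹ G} (h : ∀ i x, f (dof E i x) = g (dof E i x)) : f = g := by
  have : f.1 = g.1 := DFinsupp.lhom_ext h
  exact BMap.ext fun x => DFunLike.congr_fun this x

end dsum


/-! ### Graded spaces and differential graded algebras -/

/-- `ℤ/2`-graded complete bornological spaces. The grading is recorded by the bounded involution
`eps` equal to `+1` on the even part and to `-1` on the odd part. -/
class GCB (E : Type u) extends CB E where
  eps : E →ₗ[ℂ] E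
  eps_eps : ∀ x, eps (eps x) = x
  eps_bdd : ∀ S : Set E, IsBounded S → IsBounded (eps '' S)

/-- The grading involution as a bounded map. -/
def par (E : Type u) [GCB E] : E ⟹ E := BMap.mk GCB.eps GCB.eps_bdd

@[simp] theorem par_par {E : Type u} [GCB E] (x : E) : par E (par E x) = x := GCB.eps_eps x

/-- `x` is homogeneous of degree `p` modulo `2`. -/
def HasDeg {E : Type u} [GCB E] (x : E) (p : ℕ) : Prop := par E x = (-1 : ℂ) ^ p • x

/-- The projection onto the even part. -/
def evenB (E : Type u) [GCB E] : E ⟹ E := (1 / 2 : ℂ) • (BMap.id E + par E)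
/-- The projection onto the odd part. -/
def oddB (E : Type u) [GCB E] : E ⟹ E := (1 / 2 : ℂ) • (BMap.id E - par E)

theorem evenB_apply {E : Type u} [GCB E] (x : E) : evenB E x = (1 / 2 : ℂ) • (x + par E x) := rfl
theorem oddB_apply {E : Type u} [GCB E] (x : E) : oddB E x = (1 / 2 : ℂ) • (x - par E x) := rfl

/-- Complete bornological DG algebras: `ℤ/2`-graded complete bornological spaces with a bounded
associative product of degree zero and a bounded odd derivation `diff` of square zero. -/
class DGBAlg (R : Type u) extends GCB R, NonUnitalRing R where
  smul_mul_assoc' : ∀ (c : ℂ) (x y : R), (c • x) * y = c • (x * y)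
  mul_smul_comm' : ∀ (c : ℂ) (x y : R), x * (c • y) = c • (x * y)
  mul_bdd : ∀ S T : Set R, IsBounded S → IsBounded T → IsBounded {z | ∃ x ∈ S, ∃ y ∈ T, z = x * y}
  eps_mul : ∀ x y : R, eps (x * y) = eps x * eps y
  diff : R →ₗ[ℂ] R
  diff_bdd : ∀ S : Set R, IsBounded S → IsBounded (diff '' S)
  diff_eps : ∀ x : R, diff (eps x) = -eps (diff x)
  diff_mul : ∀ x y : R, diff (x * y) = diff x * y + eps x * diff y
  diff_diff : ∀ x : R, diff (diff x) = 0

instance (R : Type u) [DGBAlg R] : IsScalarTower ℂ R R := ⟨DGBAlg.smul_mul_assoc'⟩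
instance (R : Type u) [DGBAlg R] : SMulCommClass ℂ R R :=
  ⟨fun c x y => (DGBAlg.mul_smul_comm' c x y).symm⟩

section graded
variable {E F : Type u} [GCB E] [GCB F]

/-- The graded tensor product: degrees add up. -/
instance : GCB (E ⊗̂ F) where
  eps := (tmap (par E) (par F)).1
  eps_eps := by
    have : (tmap (par E) (par F)).comp (tmap (par E) (par F)) = BMap.id (E ⊗̂ F) :=
      tensor_ext fun x y => by simp
    exact DFunLike.congr_fun this
  eps_bdd := fun _ hS => (tmap (par E) (par F)).bdd hS

theorem par_tensor : par (E ⊗̂ F) = tmap (par E) (par F) := rfl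

@[simp] theorem par_tmul (x : E) (y : F) :
    par (E ⊗̂ F) (tmul E F x y) = tmul E F (par E x) (par F y) := by simp [par_tensor]

instance : GCB (E × F) where
  eps := (pairB ((par E).comp (fstB E F)) ((par F).comp (sndB E F))).1
  eps_eps := fun x => Prod.ext (par_par _) (par_par _)
  eps_bdd := fun _ hS => (pairB ((par E).comp (fstB E F)) ((par F).comp (sndB E F))).bdd hS

/-- The involution of the unitalization; the unit has degree zero. -/
def upar (E : Type u) [GCB E] : Unitization ℂ E ⟹ Unitization ℂ E :=
  uext (Unitization.inl 1) ((uinr E).comp (par E))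

theorem upar_apply (x : Unitization ℂ E) :
    upar E x = Unitization.inl x.fst + Unitization.inr (par E x.snd) := by
  refine Unitization.ext ?_ ?_ <;> simp [upar]

instance : GCB (Unitization ℂ E) where
  eps := (upar E).1
  eps_eps := fun x => by
    change upar E (upar E x) = x
    rw [upar_apply, upar_apply]
    refine Unitization.ext ?_ ?_ <;> simp
  eps_bdd := fun _ hS => (upar E).bdd hS

@[simp] theorem par_unit (x : Unitization ℂ E) :
    par (Unitization ℂ E) x = Unitization.inl x.fst + Unitization.inr (par E x.snd) := upar_apply x

end graded

section shift

/-- The space `E` with the opposite grading. -/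
def Shift (E : Type u) : Type u := E

instance (E : Type u) [CB E] : CB (Shift E) := inferInstanceAs (CB E)

/-- The identity of `E`, as an odd map to the shift. -/
def toShift (E : Type u) [CB E] : E ⟹ (Shift E : Type u) := BMap.id E
/-- The identity of `E`, as an odd map from the shift. -/
def ofShift (E : Type u) [CB E] : (Shift E : Type u) ⟹ E := BMap.id E


instance (E : Type u) [GCB E] : GCB (Shift E) where
  eps := (-par E).1
  eps_eps := fun x => by
    have h : ∀ y : E, -par E (-par E y) = y := fun y => by rw [map_neg, par_par, neg_neg]
    exact h x
  eps_bdd := fun _ hS => (-par E).bdd hS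

@[simp] theorem par_toShift {E : Type u} [GCB E] (x : E) :
    par (Shift E) (toShift E x) = -toShift E (par E x) := rfl

end shift


section dgalg
variable (R : Type u) [DGBAlg R]

/-- The product of `R`. -/
def mulB : R ⟹ R ⟹ R :=
  BMap.mk₂ (LinearMap.mk₂ ℂ (fun x y => x * y) add_mul (fun c x y => smul_mul_assoc c x y) mul_add
    (fun c x y => mul_smul_comm c x y)) fun S T hS hT => DGBAlg.mul_bdd S T hS hT

@[simp] theorem mulB_apply (x y : R) : mulB R x y = x * y := rfl

/-- The differential of `R`. -/
def dif : R ⟹ R := BMap.mk DGBAlg.diff DGBAlg.diff_bdd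

variable {R}
theorem par_mul (x y : R) : par R (x * y) = par R x * par R y := DGBAlg.eps_mul x y
theorem dif_par (x : R) : dif R (par R x) = -par R (dif R x) := DGBAlg.diff_eps x
theorem dif_mul (x y : R) : dif R (x * y) = dif R x * y + par R x * dif R y := DGBAlg.diff_mul x y
theorem dif_dif (x : R) : dif R (dif R x) = 0 := DGBAlg.diff_diff x
variable (R)

/-- The product of the unitalization of `R`. -/
def umul : Unitization ℂ R ⟹ Unitization ℂ R ⟹ Unitization ℂ R :=
  BMap.mk₂ (LinearMap.mk₂ ℂ (fun x y => x * y) add_mul (fun c x y => smul_mul_assoc c x y) mul_add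
    (fun c x y => mul_smul_comm c x y)) fun S T hS hT => by
      obtain ⟨h1, h2⟩ := unit_isBounded_iff.1 hS
      obtain ⟨k1, k2⟩ := unit_isBounded_iff.1 hT
      obtain ⟨C, hC⟩ := h1.exists_norm_le
      obtain ⟨D, hD⟩ := k1.exists_norm_le
      refine unit_isBounded_iff.2 ⟨isBounded_iff_forall_norm_le.2 ⟨C * D, ?_⟩, ?_⟩
      · rintro _ ⟨_, ⟨x, hx, y, hy, rfl⟩, rfl⟩
        have hx' := hC _ ⟨x, hx, rfl⟩
        simp only [LinearMap.mk₂_apply, Unitization.fst_mul, norm_mul]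
        exact mul_le_mul hx' (hD _ ⟨y, hy, rfl⟩) (norm_nonneg _) ((norm_nonneg _).trans hx')
      · refine (bdd_add (bdd_add (bdd_smul k2 C) (bdd_smul h2 D))
          ((mulB R).bdd₂ h2 k2)).subset ?_
        rintro _ ⟨_, ⟨x, hx, y, hy, rfl⟩, rfl⟩
        exact ⟨_, ⟨_, ⟨x.fst, y.snd, ⟨y, hy, rfl⟩, hC _ ⟨x, hx, rfl⟩, rfl⟩,
          _, ⟨y.fst, x.snd, ⟨x, hx, rfl⟩, hD _ ⟨y, hy, rfl⟩, rfl⟩, rfl⟩,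
          _, ⟨x.snd, ⟨x, hx, rfl⟩, y.snd, ⟨y, hy, rfl⟩, rfl⟩, rfl⟩

variable {R} in
@[simp] theorem umul_apply (x y : Unitization ℂ R) : umul R x y = x * y := rfl

/-- The differential of the unitalization; it kills the unit. -/
def udif : Unitization ℂ R ⟹ Unitization ℂ R := (uinr R).comp ((dif R).comp (usnd R))

variable {R} in
@[simp] theorem udif_apply (x : Unitization ℂ R) :
    udif R x = ((dif R x.snd : R) : Unitization ℂ R) := rfl

variable {R}

theorem upar_mul (x y : Unitization ℂ R) : par (Unitization ℂ R) (x * y) =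
    par (Unitization ℂ R) x * par (Unitization ℂ R) y := by
  refine Unitization.ext ?_ ?_ <;> simp [par_mul]

theorem udif_par (x : Unitization ℂ R) :
    udif R (par (Unitization ℂ R) x) = -par (Unitization ℂ R) (udif R x) := by
  refine Unitization.ext ?_ ?_ <;> simp [dif_par]

theorem udif_mul (x y : Unitization ℂ R) : udif R (x * y) =
    udif R x * y + par (Unitization ℂ R) x * udif R y := by
  refine Unitization.ext ?_ ?_
  · simp
  · simp [dif_mul]
    abel

end dgalg

/-! ### One-forms and the commutator quotient -/

section forms
variable (R : Type u) [DGBAlg R]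

/-- The bimodule of one-forms `R̃ ⊗̂ R`, where `x ⊗ y` stands for `x dy` and has degree
`|x| + |y| + 1`. -/
def Omega1 (R : Type u) [DGBAlg R] : Type u := Unitization ℂ R ⊗̂ (Shift R : Type u)

instance : GCB (Omega1 R) := inferInstanceAs (GCB (Unitization ℂ R ⊗̂ (Shift R : Type u)))

/-- The one-form `x dy`. -/
def form : Unitization ℂ R ⟹ R ⟹ Omega1 R :=
  (tmul (Unitization ℂ R) (Shift R)).bi (BMap.id _) (toShift R)

variable {R} {G : Type u} [CB G]

theorem omega_ext {f g : Omega1 R ⟹ G} (h : ∀ x y, f (form R x y) = g (form R x y)) : f = g :=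
  tensor_ext h

/-- The bounded map on one-forms with prescribed values on the forms `x dy`. -/
def omegaLift (β : Unitization ℂ R ⟹ R ⟹ G) : Omega1 R ⟹ G :=
  lift (β.bi (BMap.id _) (ofShift R))

@[simp] theorem omegaLift_form (β : Unitization ℂ R ⟹ R ⟹ G) (x : Unitization ℂ R) (y : R) :
    omegaLift β (form R x y) = β x y := lift_tmul _ _ _

theorem par_form (x : Unitization ℂ R) (y : R) :
    par (Omega1 R) (form R x y) = -form R (par _ x) (par R y) := by
  have h := par_tmul x (toShift R y)
  rw [par_toShift, map_neg] at h
  exact h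

variable (R)

/-- The universal derivation `x ↦ dx`, with `d1 = 0`. -/
def dform : Unitization ℂ R ⟹ Omega1 R := (form R 1).comp (usnd R)

/-- The left module structure, `z (x dy) = (z x) dy`. -/
def oleft : Unitization ℂ R ⟹ Omega1 R ⟹ Omega1 R :=
  ((tmapB (Unitization ℂ R) (Shift R) (Unitization ℂ R) (Shift R)).flip (BMap.id _)).comp (umul R)

/-- The right multiplication of `R` by its unitalization. -/
def rmul : Unitization ℂ R ⟹ R ⟹ R :=
  BMap.post (usnd R) ((umul R).flip.bi (BMap.id _) (uinr R))

/-- The operation `x dy, z ↦ x d(y z)`. -/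
def oright₀ : Omega1 R ⟹ Unitization ℂ R ⟹ Omega1 R :=
  ((tmapB (Unitization ℂ R) (Shift R) (Unitization ℂ R) (Shift R) (BMap.id _)).comp
    (show Unitization ℂ R ⟹ (Shift R : Type u) ⟹ (Shift R : Type u) from rmul R)).flip

/-- The right module structure, `(x dy) z = x d(y z) - (-1)^|y| (x y) dz`. -/
def oright : Omega1 R ⟹ Unitization ℂ R ⟹ Omega1 R :=
  oright₀ R - (form R).bi (omegaLift ((umul R).bi (BMap.id _) ((uinr R).comp (par R)))) (usnd R)

/-- The differential `x dy ↦ (δ x) dy - (-1)^|x| x d(δ y)`, which anticommutes with `d`. -/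
def odif : Omega1 R ⟹ Omega1 R :=
  omegaLift ((form R).bi (udif R) (BMap.id R) - (form R).bi (par _) (dif R))

/-- The Hochschild map `x dy ↦ (-1)^|x| [x, y]` (graded commutator). The formula spells it out by
splitting `y` in its even and odd parts. -/
def hoch : Omega1 R ⟹ Unitization ℂ R :=
  omegaLift ((umul R).bi (par _) (uinr R)
    - ((umul R).bi ((uinr R).comp (evenB R)) (par _)).flip
    - ((umul R).bi ((uinr R).comp (oddB R)) (BMap.id _)).flip)

variable {R}

@[simp] theorem oleft_form (z x : Unitization ℂ R) (y : R) :
    oleft R z (form R x y) = form R (z * x) y := tmap_tmul _ _ _ _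

theorem rmul_apply (z : Unitization ℂ R) (y : R) : rmul R z y = z.fst • y + y * z.snd := by
  simp [rmul]

theorem oright₀_form (x z : Unitization ℂ R) (y : R) :
    oright₀ R (form R x y) z = form R x (rmul R z y) :=
  tmap_tmul (BMap.id (Unitization ℂ R))
    (show (Shift R : Type u) ⟹ (Shift R : Type u) from rmul R z) x (toShift R y)

@[simp] theorem oright_form (x z : Unitization ℂ R) (y : R) : oright R (form R x y) z =
    form R x (rmul R z y) - form R (x * (par R y : R)) z.snd := by
  have h : oright R (form R x y) z = oright₀ R (form R x y) z -
      form R (omegaLift ((umul R).bi (BMap.id _) ((uinr R).comp (par R))) (form R x y)) z.snd := rfl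
  rw [h, oright₀_form, omegaLift_form]
  rfl

@[simp] theorem odif_form (x : Unitization ℂ R) (y : R) : odif R (form R x y) =
    form R (udif R x) y - form R (par _ x) (dif R y) := by
  rw [odif, omegaLift_form]; rfl

@[simp] theorem hoch_form (x : Unitization ℂ R) (y : R) : hoch R (form R x y) =
    par _ x * (y : Unitization ℂ R) - (evenB R y : R) * par _ x - (oddB R y : R) * x := by
  rw [hoch, omegaLift_form]; rfl

end forms


section nat
variable {R : Type u} [DGBAlg R]

theorem par_oleft (z : Unitization ℂ R) (ω : Omega1 R) :
    par _ (oleft R z ω) = oleft R (par _ z) (par _ ω) := by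
  have h : (par _).comp (oleft R z) = (oleft R (par _ z)).comp (par _) :=
    omega_ext fun x y => by
      simp only [BMap.comp_apply, oleft_form, par_form, map_neg, upar_mul]
  exact DFunLike.congr_fun h ω

theorem par_rmul (z : Unitization ℂ R) (y : R) :
    par R (rmul R z y) = rmul R (par _ z) (par R y) := by
  simp [rmul_apply, par_mul]

theorem dif_rmul (z : Unitization ℂ R) (y : R) :
    dif R (rmul R z y) = rmul R z (dif R y) + par R y * dif R z.snd := by
  simp [rmul_apply, dif_mul]
  abel

theorem par_snd (z : Unitization ℂ R) : (par (Unitization ℂ R) z).snd = par R z.snd := by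
  simp

theorem par_inr (y : R) : par (Unitization ℂ R) (y : Unitization ℂ R) = (par R y : R) := by
  simp

theorem udif_inr (y : R) : udif R (y : Unitization ℂ R) = (dif R y : R) := by
  simp

theorem par_oright (ω : Omega1 R) (z : Unitization ℂ R) :
    par _ (oright R ω z) = oright R (par _ ω) (par _ z) := by
  have h : (par _).comp ((oright R).flip z) = ((oright R).flip (par _ z)).comp (par _) :=
    omega_ext fun x y => by
      simp only [BMap.comp_apply, BMap.flip_apply, oright_form, par_form, map_neg, map_sub,
        upar_mul, par_rmul, par_inr, par_snd]
      abel
  exact DFunLike.congr_fun h ω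

theorem odif_par (ω : Omega1 R) : odif R (par _ ω) = -par _ (odif R ω) := by
  have h : (odif R).comp (par _) = -(par _).comp (odif R) :=
    omega_ext fun x y => by
      simp only [BMap.comp_apply, BMap.neg_apply, odif_form, par_form, map_neg, map_sub,
        udif_par, dif_par]
  exact DFunLike.congr_fun h ω

theorem odif_oleft (z : Unitization ℂ R) (ω : Omega1 R) :
    odif R (oleft R z ω) = oleft R (udif R z) ω + oleft R (par _ z) (odif R ω) := by
  have h : (odif R).comp (oleft R z) = oleft R (udif R z) + (oleft R (par _ z)).comp (odif R) :=
    omega_ext fun x y => by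
      simp only [BMap.comp_apply, BMap.add_apply, odif_form, oleft_form, map_sub, udif_mul, map_add,
        upar_mul]
      abel
  exact DFunLike.congr_fun h ω

theorem odif_oright (z : Unitization ℂ R) (ω : Omega1 R) :
    odif R (oright R ω z) = oright R (odif R ω) z + oright R (par _ ω) (udif R z) := by
  have h : (odif R).comp ((oright R).flip z) =
      ((oright R).flip z).comp (odif R) + ((oright R).flip (udif R z)).comp (par _) :=
    omega_ext fun x y => by
      simp only [BMap.comp_apply, BMap.add_apply, BMap.flip_apply, odif_form, oright_form, map_sub,
        BMap.sub_apply, map_neg, BMap.neg_apply, par_form, udif_mul, map_add,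
        upar_mul, dif_rmul, par_inr, udif_inr, dif_par]
      simp only [udif_apply, Unitization.snd_inr, Unitization.inr_neg, mul_neg, map_neg,
        BMap.neg_apply, rmul_apply, par_par, Unitization.fst_inr, zero_smul, zero_add]
      abel
  exact DFunLike.congr_fun h ω

theorem hoch_even (x : Unitization ℂ R) {y : R} (hy : par R y = y) :
    hoch R (form R x y) = par _ x * (y : Unitization ℂ R) - y * par _ x := by
  rw [hoch_form]
  simp [evenB_apply, oddB_apply, hy, ← two_smul ℂ y, smul_smul]

theorem hoch_odd (x : Unitization ℂ R) {y : R} (hy : par R y = -y) :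
    hoch R (form R x y) = par _ x * (y : Unitization ℂ R) - y * x := by
  rw [hoch_form]
  simp [evenB_apply, oddB_apply, hy, ← two_smul ℂ y, smul_smul]

theorem homog_ext {G : Type u} [CB G] {f g : Omega1 R ⟹ G}
    (h : ∀ x y, par R y = y ∨ par R y = -y → f (form R x y) = g (form R x y)) : f = g :=
  omega_ext fun x y => by
    have hy : y = evenB R y + oddB R y := by
      rw [evenB_apply, oddB_apply, ← smul_add, add_add_sub_cancel, ← two_smul ℂ y, smul_smul]
      norm_num
    have h1 := h x (evenB R y) (Or.inl (by simp [evenB_apply, add_comm]))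
    have h2 := h x (oddB R y) (Or.inr (by simp [oddB_apply, ← smul_neg]))
    rw [hy, map_add, map_add, map_add, h1, h2]

/-- The trace property of the Hochschild map for an even element. -/
theorem hoch_comm_even {z : R} (hz : par R z = z) (ω : Omega1 R) :
    hoch R (oleft R z ω) = hoch R (oright R ω z) := by
  have h : (hoch R).comp (oleft R (z : Unitization ℂ R)) =
      (hoch R).comp ((oright R).flip (z : Unitization ℂ R)) :=
    homog_ext fun x y hy => by
      have hu : par _ (z : Unitization ℂ R) = z := by rw [par_inr, hz]
      have hr : rmul R (z : Unitization ℂ R) y = y * z := by simp [rmul_apply]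
      simp only [BMap.comp_apply, BMap.flip_apply, oleft_form, oright_form, map_sub, hr,
        Unitization.snd_inr]
      rcases hy with hy | hy
      · rw [hoch_even _ hy, hoch_even _ hz, hoch_even _ (by rw [par_mul, hy, hz])]
        simp only [upar_mul, par_inr, hy, hz, hu, Unitization.inr_mul]
        noncomm_ring
      · rw [hoch_odd _ hy, hoch_even _ hz, hoch_odd _ (by rw [par_mul, hy, hz, neg_mul])]
        simp only [upar_mul, par_inr, hy, hz, hu, Unitization.inr_mul, Unitization.inr_neg, map_neg]
        noncomm_ring
  exact DFunLike.congr_fun h ω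

/-- The trace property of the Hochschild map for an odd element. -/
theorem hoch_comm_odd {z : R} (hz : par R z = -z) (ω : Omega1 R) :
    hoch R (oleft R z ω) = hoch R (oright R (par _ ω) z) := by
  have h : (hoch R).comp (oleft R (z : Unitization ℂ R)) =
      ((hoch R).comp ((oright R).flip (z : Unitization ℂ R))).comp (par _) :=
    homog_ext fun x y hy => by
      have hu : par _ (z : Unitization ℂ R) = -z := by rw [par_inr, hz, Unitization.inr_neg]
      have hr : ∀ w, rmul R (z : Unitization ℂ R) w = w * z := fun w => by simp [rmul_apply]
      simp only [BMap.comp_apply, BMap.flip_apply, oleft_form, par_form, map_neg, BMap.neg_apply,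
        oright_form, map_sub, hr, Unitization.snd_inr, par_par]
      rcases hy with hy | hy
      · rw [hy, hoch_even _ hy, hoch_odd _ hz, hoch_odd _ (by rw [par_mul, hy, hz, mul_neg])]
        simp only [upar_mul, par_inr, hy, hz, hu, Unitization.inr_mul, par_par]
        noncomm_ring
      · have h1 : hoch R (form R (par _ x) (par R y * z)) = -hoch R (form R (par _ x) (y * z)) := by
          rw [hy, neg_mul, map_neg, map_neg]
        rw [h1, hoch_odd _ hy, hoch_odd _ hz,
          hoch_even _ (by rw [par_mul, hy, hz, neg_mul_neg])]
        simp only [upar_mul, par_inr, hy, hz, hu, Unitization.inr_mul, par_par, Unitization.inr_neg]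
        noncomm_ring
  exact DFunLike.congr_fun h ω

theorem hasDeg_odd {E : Type u} [GCB E] {x : E} {p : ℕ} (hp : Odd p) (h : HasDeg x p) :
    par E x = -x := by rw [h, hp.neg_one_pow, neg_one_smul]

theorem hasDeg_even {E : Type u} [GCB E] {x : E} {p : ℕ} (hp : Even p) (h : HasDeg x p) :
    par E x = x := by rw [h, hp.neg_one_pow, one_smul]

variable (R)

/-- The graded commutators `[x, ω] = x ω - (-1)^(|x| |ω|) ω x`. -/
def gcomms : Set (Omega1 R) :=
  {ν | ∃ (p q : ℕ) (x : R) (ω : Omega1 R), HasDeg x p ∧ HasDeg ω q ∧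
    ν = oleft R x ω - (-1 : ℂ) ^ (p * q) • oright R ω x}

/-- The quotient of the one-forms by the closed subspace of graded commutators. -/
def Omega1Nat : Type u := BQuot (gcomms R)

instance : CB (Omega1Nat R) := inferInstanceAs (CB (BQuot (gcomms R)))

/-- The projection onto the commutator quotient. -/
def nat : Omega1 R ⟹ Omega1Nat R := BQuot.mk (gcomms R)

variable {R}

/-- Factorization of a map through the commutator quotient. -/
def natLift {G : Type u} [CB G] (f : Omega1 R ⟹ G) (h : ∀ ν ∈ gcomms R, f ν = 0) :
    Omega1Nat R ⟹ G := BQuot.lift f h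

@[simp] theorem natLift_nat {G : Type u} [CB G] (f : Omega1 R ⟹ G) (h) (ω : Omega1 R) :
    natLift f h (nat R ω) = f ω := rfl

theorem nat_ext {G : Type u} [CB G] {f g : Omega1Nat R ⟹ G}
    (h : ∀ ω, f (nat R ω) = g (nat R ω)) : f = g := BQuot.hom_ext h

theorem nat_eq_zero {ν : Omega1 R} (h : ν ∈ gcomms R) : nat R ν = 0 :=
  (BQuot.mkL_eq_zero _ _).2 (subset_bclosure _ h)

theorem nat_par_gcomms (ν : Omega1 R) (h : ν ∈ gcomms R) : (nat R).comp (par _) ν = 0 := by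
  obtain ⟨p, q, x, ω, hx, hω, rfl⟩ := id h
  have hx' : par (Unitization ℂ R) (x : Unitization ℂ R) = (-1 : ℂ) ^ p • (x : Unitization ℂ R) := by
    rw [par_inr, hx, Unitization.inr_smul]
  have : par _ (oleft R x ω - (-1 : ℂ) ^ (p * q) • oright R ω x) =
      ((-1 : ℂ) ^ (p + q)) • (oleft R x ω - (-1 : ℂ) ^ (p * q) • oright R ω x) := by
    rw [map_sub, map_smul, par_oleft, par_oright, hx', hω]
    simp only [map_smul, BMap.smul_apply, smul_smul, smul_sub]
    congr 2 <;> ring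
  rw [BMap.comp_apply, this, map_smul, nat_eq_zero h, smul_zero]

theorem hoch_gcomms (ν : Omega1 R) (h : ν ∈ gcomms R) : hoch R ν = 0 := by
  obtain ⟨p, q, x, ω, hx, hω, rfl⟩ := id h
  rw [map_sub, map_smul, sub_eq_zero]
  rcases Nat.even_or_odd p with hp | hp
  · rw [hoch_comm_even (hasDeg_even hp hx), (hp.mul_right q).neg_one_pow, one_smul]
  · rw [hoch_comm_odd (hasDeg_odd hp hx), hω, map_smul, BMap.smul_apply, map_smul, pow_mul,
      hp.neg_one_pow]

theorem hasDeg_dif {x : R} {p : ℕ} (h : HasDeg x p) : HasDeg (dif R x) (p + 1) := by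
  have := dif_par x
  rw [h, map_smul] at this
  rw [HasDeg, ← neg_eq_iff_eq_neg.2 this, pow_succ, mul_neg_one, neg_smul]

theorem hasDeg_odif {ω : Omega1 R} {q : ℕ} (h : HasDeg ω q) : HasDeg (odif R ω) (q + 1) := by
  have := odif_par ω
  rw [h, map_smul] at this
  rw [HasDeg, ← neg_eq_iff_eq_neg.2 this, pow_succ, mul_neg_one, neg_smul]

theorem odif_gcomms (ν : Omega1 R) (h : ν ∈ gcomms R) : (nat R).comp (odif R) ν = 0 := by
  obtain ⟨p, q, x, ω, hx, hω, rfl⟩ := h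
  have hx' : par (Unitization ℂ R) (x : Unitization ℂ R) = (-1 : ℂ) ^ p • (x : Unitization ℂ R) := by
    rw [par_inr, hx, Unitization.inr_smul]
  have h1 := nat_eq_zero ⟨p + 1, q, dif R x, ω, hasDeg_dif hx, hω, rfl⟩
  have h2 := nat_eq_zero ⟨p, q + 1, x, odif R ω, hx, hasDeg_odif hω, rfl⟩
  have : odif R (oleft R x ω - (-1 : ℂ) ^ (p * q) • oright R ω x) =
      (oleft R (dif R x : R) ω - (-1 : ℂ) ^ ((p + 1) * q) • oright R ω (dif R x : R)) +
      (-1 : ℂ) ^ p • (oleft R x (odif R ω) - (-1 : ℂ) ^ (p * (q + 1)) • oright R (odif R ω) x) := by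
    rw [map_sub, map_smul, odif_oleft, odif_oright, hx', hω, udif_inr]
    simp only [map_smul, BMap.smul_apply, smul_smul, smul_sub, smul_add]
    have e1 : (-1 : ℂ) ^ p * (-1 : ℂ) ^ (p * (q + 1)) = (-1 : ℂ) ^ (p * q) := by
      rw [← pow_add, show p + p * (q + 1) = p * q + 2 * p by ring, pow_add,
        (even_two_mul p).neg_one_pow, mul_one]
    have e2 : (-1 : ℂ) ^ ((p + 1) * q) = (-1 : ℂ) ^ (p * q) * (-1 : ℂ) ^ q := by
      rw [← pow_add]; ring
    rw [e1, e2]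
    abel
  rw [BMap.comp_apply, this, map_add, map_smul, h1, h2, smul_zero, add_zero]

instance : GCB (Omega1Nat R) where
  eps := (natLift ((nat R).comp (par _)) nat_par_gcomms).1
  eps_eps := fun x => by
    have : (natLift ((nat R).comp (par _)) nat_par_gcomms).comp
        (natLift ((nat R).comp (par _)) nat_par_gcomms) = BMap.id (Omega1Nat R) :=
      nat_ext fun ω => by simp
    exact DFunLike.congr_fun this x
  eps_bdd := fun _ hS => (natLift ((nat R).comp (par _)) nat_par_gcomms).bdd hS

@[simp] theorem par_nat (ω : Omega1 R) : par _ (nat R ω) = nat R (par _ ω) := rfl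

variable (R)

/-- The map `♮ x dy ↦ (-1)^|x| [x, y]` on the commutator quotient. -/
def bbar : Omega1Nat R ⟹ Unitization ℂ R := natLift (hoch R) hoch_gcomms

/-- The differential induced by `δ` on the commutator quotient. -/
def ndif : Omega1Nat R ⟹ Omega1Nat R := natLift ((nat R).comp (odif R)) odif_gcomms

/-- The map `♮ d`. -/
def natd : Unitization ℂ R ⟹ Omega1Nat R := (nat R).comp (dform R)

/-- The underlying graded space of the augmented `X`-complex. -/
abbrev XT : Type u := Unitization ℂ R × Omega1Nat R

/-- The total differential `(♮ d ⊕ b̄) + δ` of the augmented `X`-complex. -/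
def XD : XT R ⟹ XT R :=
  pairB ((udif R).comp (fstB _ _) + (bbar R).comp (sndB _ _))
    ((natd R).comp (fstB _ _) + (ndif R).comp (sndB _ _))

end nat


/-! ### The free product of two algebras -/

section dsumgrading
variable {ι : Type} [DecidableEq ι] {E : ι → Type u} [∀ i, GCB (E i)]

/-- The involution of a direct sum. -/
def dpar (E : ι → Type u) [∀ i, GCB (E i)] : (Π₀ i, E i) ⟹ (Π₀ i, E i) :=
  dlift fun i => (dof E i).comp (par (E i))

instance : GCB (Π₀ i, E i) where
  eps := (dpar E).1
  eps_eps := fun x => by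
    have : (dpar E).comp (dpar E) = BMap.id (Π₀ i, E i) := dsum_ext fun i x => by simp [dpar]
    exact DFunLike.congr_fun this x
  eps_bdd := fun _ hS => (dpar E).bdd hS

@[simp] theorem par_dof (i : ι) (x : E i) : par _ (dof E i x) = dof E i (par _ x) :=
  dlift_dof _ i x

end dsumgrading

/-- A complete bornological graded space with a differential, bundled. -/
structure DGSpace where
  carrier : Type u
  [gcb : GCB carrier]
  dif : carrier ⟹ carrier

attribute [instance] DGSpace.gcb

section freeprod
variable (R : Bool → Type u) [∀ b, DGBAlg (R b)]

/-- Alternating words with `n + 1` letters in `R true` and `R false`, the first one in `R b`: the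
spaces `R b ⊗̂ R (!b) ⊗̂ R b ⊗̂ ⋯`, with the differential given by the Leibniz rule. -/
def word : ℕ → Bool → DGSpace.{u}
  | 0, b => ⟨R b, dif (R b)⟩
  | n + 1, b => ⟨R b ⊗̂ (word n (!b)).carrier,
      tmap (dif (R b)) (BMap.id _) + tmap (par (R b)) (word n (!b)).dif⟩

/-- The space of alternating words. -/
abbrev Word (n : ℕ) (b : Bool) : Type u := (word R n b).carrier

/-- The Leibniz differential on words. -/
def wdif (n : ℕ) (b : Bool) : Word R n b ⟹ Word R n b := (word R n b).dif

/-- One-letter words. -/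
def wone (b : Bool) : R b ⟹ Word R 0 b := BMap.id (R b)
/-- The word `x ⊗ w`. -/
def wcons (n : ℕ) (b : Bool) : R b ⟹ Word R n (!b) ⟹ Word R (n + 1) b := tmul (R b) (Word R n (!b))

variable {R} {G : Type u} [CB G]

/-- Maps defined on one-letter words. -/
def wlift₀ (b : Bool) (f : R b ⟹ G) : Word R 0 b ⟹ G := f
/-- Maps defined on longer words. -/
def wlift (n : ℕ) (b : Bool) (β : R b ⟹ Word R n (!b) ⟹ G) : Word R (n + 1) b ⟹ G := lift β

@[simp] theorem wlift₀_wone (b : Bool) (f : R b ⟹ G) (x : R b) : wlift₀ b f (wone R b x) = f x := rfl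
@[simp] theorem wlift_wcons (n : ℕ) (b : Bool) (β : R b ⟹ Word R n (!b) ⟹ G) (x : R b)
    (w : Word R n (!b)) : wlift n b β (wcons R n b x w) = β x w := lift_tmul _ _ _

theorem word_ext₀ {b : Bool} {f g : Word R 0 b ⟹ G} (h : ∀ x, f (wone R b x) = g (wone R b x)) :
    f = g := BMap.ext h
theorem word_ext {n : ℕ} {b : Bool} {f g : Word R (n + 1) b ⟹ G}
    (h : ∀ x w, f (wcons R n b x w) = g (wcons R n b x w)) : f = g := tensor_ext h

@[simp] theorem par_wone (b : Bool) (x : R b) : par _ (wone R b x) = wone R b (par _ x) := rfl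
@[simp] theorem par_wcons (n : ℕ) (b : Bool) (x : R b) (w : Word R n (!b)) :
    par _ (wcons R n b x w) = wcons R n b (par _ x) (par _ w) := par_tmul x w

@[simp] theorem wdif_wone (b : Bool) (x : R b) : wdif R 0 b (wone R b x) = wone R b (dif _ x) := rfl
@[simp] theorem wdif_wcons (n : ℕ) (b : Bool) (x : R b) (w : Word R n (!b)) :
    wdif R (n + 1) b (wcons R n b x w) =
      wcons R n b (dif _ x) w + wcons R n b (par _ x) (wdif R n (!b) w) := by
  have h : wdif R (n + 1) b (wcons R n b x w) =
    tmap (dif (R b)) (BMap.id _) (tmul (R b) (Word R n (!b)) x w) +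
      tmap (par (R b)) (wdif R n (!b)) (tmul (R b) (Word R n (!b)) x w) := rfl
  rw [h, tmap_tmul, tmap_tmul]
  rfl

variable (R)

/-- The underlying space of the free product: the direct sum of the spaces of alternating words. -/
def FP : Type u := Π₀ p : ℕ × Bool, Word R p.1 p.2

instance : GCB (FP R) := inferInstanceAs (GCB (Π₀ p : ℕ × Bool, Word R p.1 p.2))

/-- The inclusion of the alternating words. -/
def inj (n : ℕ) (b : Bool) : Word R n b ⟹ FP R :=
  dof (fun p : ℕ × Bool => Word R p.1 p.2) (n, b)

variable {R}

/-- Maps defined on all words. -/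
def fpLift (f : ∀ n b, Word R n b ⟹ G) : FP R ⟹ G := dlift fun p : ℕ × Bool => f p.1 p.2

@[simp] theorem fpLift_inj (f : ∀ n b, Word R n b ⟹ G) (n : ℕ) (b : Bool) (w : Word R n b) :
    fpLift f (inj R n b w) = f n b w := dlift_dof (fun p : ℕ × Bool => f p.1 p.2) (n, b) w

theorem fp_ext {f g : FP R ⟹ G} (h : ∀ n b w, f (inj R n b w) = g (inj R n b w)) : f = g :=
  dsum_ext fun p w => h p.1 p.2 w

@[simp] theorem par_inj (n : ℕ) (b : Bool) (w : Word R n b) :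
    par _ (inj R n b w) = inj R n b (par _ w) :=
  par_dof (E := fun p : ℕ × Bool => Word R p.1 p.2) (n, b) w

/-- Words as successions of letters: the map with values `a x` on the one-letter words `x`, and
`s x v` on the words `x ⊗ w`, where `v` is the value on `w`. -/
def wrec (a : ∀ b, R b ⟹ G) (s : ∀ b, R b ⟹ G ⟹ G) : ∀ n b, Word R n b ⟹ G
  | 0, b => wlift₀ b (a b)
  | n + 1, b => wlift n b ((s b).bi (BMap.id _) (wrec a s n (!b)))

@[simp] theorem wrec_wone (a : ∀ b, R b ⟹ G) (s : ∀ b, R b ⟹ G ⟹ G) (b : Bool) (x : R b) :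
    wrec a s 0 b (wone R b x) = a b x := rfl
@[simp] theorem wrec_wcons (a : ∀ b, R b ⟹ G) (s : ∀ b, R b ⟹ G ⟹ G) (n : ℕ) (b : Bool) (x : R b)
    (w : Word R n (!b)) : wrec a s (n + 1) b (wcons R n b x w) = s b x (wrec a s n (!b) w) := by
  rw [wrec, wlift_wcons]; rfl

variable (R)

/-- The product of a letter and a word starting in the same algebra. -/
def lact : ∀ (n : ℕ) (b : Bool), R b ⟹ Word R n b ⟹ Word R n b
  | 0, b => (mulB (R b))
  | n + 1, b => ((tmapB (R b) (Word R n (!b)) (R b) (Word R n (!b))).flip (BMap.id _)).comp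
      (mulB (R b))

variable {R}
@[simp] theorem lact_wone (b : Bool) (x y : R b) : lact R 0 b x (wone R b y) = wone R b (x * y) := rfl
@[simp] theorem lact_wcons (n : ℕ) (b : Bool) (x y : R b) (w : Word R n (!b)) :
    lact R (n + 1) b x (wcons R n b y w) = wcons R n b (x * y) w :=
  tmap_tmul (mulB (R b) x) (BMap.id _) y w
variable (R)

/-- The product of a letter of `R b` and a word starting in `R c`. -/
def lw : ∀ (b c : Bool) (n : ℕ), R b ⟹ Word R n c ⟹ FP R
  | true, true, n => BMap.post (inj R n true) (lact R n true)
  | false, false, n => BMap.post (inj R n false) (lact R n false)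
  | true, false, n => BMap.post (inj R (n + 1) true) (wcons R n true)
  | false, true, n => BMap.post (inj R (n + 1) false) (wcons R n false)

theorem lw_same (b : Bool) (n : ℕ) (x : R b) (w : Word R n b) :
    lw R b b n x w = inj R n b (lact R n b x w) := by cases b <;> rfl
theorem lw_other (b : Bool) (n : ℕ) (x : R b) (w : Word R n (!b)) :
    lw R b (!b) n x w = inj R (n + 1) b (wcons R n b x w) := by cases b <;> rfl

/-- Left multiplication by letters. -/
def lmul (b : Bool) : R b ⟹ FP R ⟹ FP R :=
  BMap.flip (fpLift fun n c => (lw R b c n).flip)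

/-- The product of the free product: concatenation of words, followed by the product of the two
adjacent letters if they belong to the same algebra. -/
def fmul : FP R ⟹ FP R ⟹ FP R :=
  fpLift (wrec (lmul R) fun b => (BMap.compB (FP R) (FP R) (FP R)).comp (lmul R b))

/-- The differential of the free product. -/
def fdif : FP R ⟹ FP R := fpLift fun n b => (inj R n b).comp (wdif R n b)

variable {R}

@[simp] theorem lmul_inj (b c : Bool) (n : ℕ) (x : R b) (w : Word R n c) :
    lmul R b x (inj R n c w) = lw R b c n x w := by
  have h : lmul R b x (inj R n c w) = (fpLift fun n c => (lw R b c n).flip) (inj R n c w) x := rfl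
  rw [h, fpLift_inj]; rfl

@[simp] theorem fmul_wone (b : Bool) (x : R b) (Y : FP R) :
    fmul R (inj R 0 b (wone R b x)) Y = lmul R b x Y := by rw [fmul, fpLift_inj, wrec_wone]
theorem fmul_wcons (n : ℕ) (b : Bool) (x : R b) (w : Word R n (!b)) (Y : FP R) :
    fmul R (inj R (n + 1) b (wcons R n b x w)) Y = lmul R b x (fmul R (inj R n (!b) w) Y) := by
  rw [fmul, fpLift_inj, fpLift_inj, wrec_wcons]; rfl

@[simp] theorem fdif_inj (n : ℕ) (b : Bool) (w : Word R n b) :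
    fdif R (inj R n b w) = inj R n b (wdif R n b w) := by rw [fdif, fpLift_inj]; rfl

/-- Agreement of two maps on the free product, checked on letters and on words beginning with each
letter. -/
theorem fp_ext' (b : Bool) {f g : FP R ⟹ G}
    (h0 : ∀ y : R b, f (inj R 0 b (wone R b y)) = g (inj R 0 b (wone R b y)))
    (h1 : ∀ n (y : R b) (w : Word R n (!b)), f (inj R (n + 1) b (wcons R n b y w)) =
      g (inj R (n + 1) b (wcons R n b y w)))
    (h2 : ∀ n (w : Word R n (!b)), f (inj R n (!b) w) = g (inj R n (!b) w)) : f = g := by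
  refine fp_ext fun n c w => ?_
  by_cases hc : c = b
  · subst hc
    cases n with
    | zero =>
      exact DFunLike.congr_fun (word_ext₀ (f := f.comp (inj R 0 c)) (g := g.comp (inj R 0 c)) h0) w
    | succ n =>
      exact DFunLike.congr_fun
        (word_ext (f := f.comp (inj R (n + 1) c)) (g := g.comp (inj R (n + 1) c)) (h1 n)) w
  · obtain rfl : c = !b := by cases b <;> cases c <;> simp_all
    exact h2 n w

/-- Induction on the words. -/
theorem fp_induct {f g : FP R ⟹ G} (h0 : ∀ b (x : R b), f (inj R 0 b (wone R b x)) =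
      g (inj R 0 b (wone R b x)))
    (h1 : ∀ n b, (∀ w : Word R n (!b), f (inj R n (!b) w) = g (inj R n (!b) w)) →
      ∀ (x : R b) (w : Word R n (!b)), f (inj R (n + 1) b (wcons R n b x w)) =
        g (inj R (n + 1) b (wcons R n b x w))) : f = g := by
  refine fp_ext fun n => ?_
  induction n with
  | zero =>
    intro b w
    exact DFunLike.congr_fun
      (word_ext₀ (f := f.comp (inj R 0 b)) (g := g.comp (inj R 0 b)) (h0 b)) w
  | succ n ih =>
    intro b w
    exact DFunLike.congr_fun (word_ext (f := f.comp (inj R (n + 1) b))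
      (g := g.comp (inj R (n + 1) b)) (h1 n b (ih (!b)))) w

theorem lmul_mul (b : Bool) (x y : R b) (Y : FP R) :
    lmul R b (x * y) Y = lmul R b x (lmul R b y Y) := by
  have : lmul R b (x * y) = (lmul R b x).comp (lmul R b y) := by
    refine fp_ext' b (fun z => ?_) (fun n z w => ?_) (fun n w => ?_)
    · simp [lw_same, mul_assoc]
    · simp [lw_same, mul_assoc]
    · simp [lw_same, lw_other]
  exact DFunLike.congr_fun this Y

theorem fmul_lmul (b : Bool) (x : R b) (Y Z : FP R) :
    fmul R (lmul R b x Y) Z = lmul R b x (fmul R Y Z) := by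
  have : (fmul R).comp (lmul R b x) =
      (BMap.compB (FP R) (FP R) (FP R) (lmul R b x)).comp (fmul R) := by
    refine fp_ext' b (fun z => ?_) (fun n z w => ?_) (fun n w => ?_)
    · refine BMap.ext fun Z => ?_
      change fmul R (lmul R b x _) Z = lmul R b x (fmul R _ Z)
      simp [lw_same, lmul_mul]
    · refine BMap.ext fun Z => ?_
      change fmul R (lmul R b x _) Z = lmul R b x (fmul R _ Z)
      simp [lw_same, lmul_mul, fmul_wcons]
    · refine BMap.ext fun Z => ?_
      change fmul R (lmul R b x _) Z = lmul R b x (fmul R _ Z)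
      simp [lw_other, fmul_wcons]
  exact DFunLike.congr_fun (DFunLike.congr_fun this Y) Z

theorem fmul_assoc (X Y Z : FP R) : fmul R (fmul R X Y) Z = fmul R X (fmul R Y Z) := by
  have : ((fmul R).comp ((fmul R).flip Y)).flip Z = (fmul R).flip (fmul R Y Z) := by
    refine fp_induct (fun b x => ?_) (fun n b ih x w => ?_)
    · simp [fmul_lmul]
    · have := ih w
      simp only [BMap.comp_apply, BMap.flip_apply] at this ⊢
      rw [fmul_wcons, fmul_wcons, fmul_lmul, this]
  exact DFunLike.congr_fun this X

theorem par_lmul (b : Bool) (x : R b) (Y : FP R) :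
    par _ (lmul R b x Y) = lmul R b (par _ x) (par _ Y) := by
  have : (par _).comp (lmul R b x) = (lmul R b (par _ x)).comp (par _) := by
    refine fp_ext' b (fun z => ?_) (fun n z w => ?_) (fun n w => ?_)
    · simp [lw_same, par_mul]
    · simp [lw_same, par_mul]
    · simp [lw_other]
  exact DFunLike.congr_fun this Y

theorem par_fmul (X Y : FP R) : par _ (fmul R X Y) = fmul R (par _ X) (par _ Y) := by
  have : (par _).comp ((fmul R).flip Y) = ((fmul R).flip (par _ Y)).comp (par _) := by
    refine fp_induct (fun b x => ?_) (fun n b ih x w => ?_)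
    · simp [par_lmul]
    · have := ih w
      simp only [BMap.comp_apply, BMap.flip_apply, par_inj] at this ⊢
      rw [par_wcons, fmul_wcons, fmul_wcons, par_lmul, this]
  exact DFunLike.congr_fun this X

theorem fdif_lmul (b : Bool) (x : R b) (Y : FP R) :
    fdif R (lmul R b x Y) = lmul R b (dif _ x) Y + lmul R b (par _ x) (fdif R Y) := by
  have : (fdif R).comp (lmul R b x) = lmul R b (dif _ x) + (lmul R b (par _ x)).comp (fdif R) := by
    refine fp_ext' b (fun z => ?_) (fun n z w => ?_) (fun n w => ?_)
    · simp [lw_same, dif_mul]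
    · simp [lw_same, dif_mul, par_mul, add_assoc]
    · simp [lw_other]
  exact DFunLike.congr_fun this Y

theorem fdif_fmul (X Y : FP R) :
    fdif R (fmul R X Y) = fmul R (fdif R X) Y + fmul R (par _ X) (fdif R Y) := by
  have : (fdif R).comp ((fmul R).flip Y) =
      ((fmul R).flip Y).comp (fdif R) + ((fmul R).flip (fdif R Y)).comp (par _) := by
    refine fp_induct (fun b x => ?_) (fun n b ih x w => ?_)
    · simp [fdif_lmul]
    · have := ih w
      simp only [BMap.comp_apply, BMap.flip_apply, BMap.add_apply, par_inj, fdif_inj] at this ⊢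
      rw [wdif_wcons, par_wcons, map_add, map_add, fmul_wcons, fmul_wcons, BMap.add_apply,
        fmul_wcons, fmul_wcons, fdif_lmul, this, map_add]
      abel
  exact DFunLike.congr_fun this X

theorem fdif_par (X : FP R) : fdif R (par _ X) = -par _ (fdif R X) := by
  have : (fdif R).comp (par _) = -(par _).comp (fdif R) := by
    refine fp_induct (fun b x => ?_) (fun n b ih x w => ?_)
    · simp [dif_par]
    · have := ih w
      have e : ∀ (x : R b) (w : Word R n (!b)), inj R (n + 1) b (wcons R n b x w) =
          lmul R b x (inj R n (!b) w) := fun x w => by rw [lmul_inj, lw_other]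
      simp only [BMap.comp_apply, BMap.neg_apply] at this ⊢
      rw [e, par_lmul, fdif_lmul, fdif_lmul, this, dif_par, map_add, par_lmul, par_lmul, par_par]
      simp only [map_neg, BMap.neg_apply]
      abel
  exact DFunLike.congr_fun this X

theorem fdif_fdif (X : FP R) : fdif R (fdif R X) = 0 := by
  have : (fdif R).comp (fdif R) = 0 := by
    refine fp_induct (fun b x => ?_) (fun n b ih x w => ?_)
    · simp [dif_dif]
    · have := ih w
      have e : ∀ (x : R b) (w : Word R n (!b)), inj R (n + 1) b (wcons R n b x w) =
          lmul R b x (inj R n (!b) w) := fun x w => by rw [lmul_inj, lw_other]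
      simp only [BMap.comp_apply, BMap.zero_apply] at this ⊢
      rw [e, fdif_lmul, map_add, fdif_lmul, fdif_lmul, this, dif_dif, dif_par, par_par]
      simp only [map_neg, BMap.neg_apply, map_zero, BMap.zero_apply]
      abel
  exact DFunLike.congr_fun this X

/-- The free product is a complete bornological DG algebra. -/
instance : DGBAlg (FP R) where
  mul X Y := fmul R X Y
  left_distrib X Y Z := map_add (fmul R X) Y Z
  right_distrib X Y Z := by
    change fmul R (X + Y) Z = fmul R X Z + fmul R Y Z
    rw [map_add]; rfl
  zero_mul X := by
    change fmul R 0 X = 0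
    rw [map_zero]; rfl
  mul_zero X := map_zero (fmul R X)
  mul_assoc := fmul_assoc
  smul_mul_assoc' c X Y := by
    change fmul R (c • X) Y = c • fmul R X Y
    rw [map_smul]; rfl
  mul_smul_comm' c X Y := map_smul (fmul R X) c Y
  mul_bdd S T hS hT := (fmul R).bdd₂ hS hT
  eps_mul := par_fmul
  diff := (fdif R).1
  diff_bdd := fun _ hS => (fdif R).bdd hS
  diff_eps := fdif_par
  diff_mul := fdif_fmul
  diff_diff := fdif_fdif

variable (R) in
/-- The inclusions of the two factors. -/
def letter (b : Bool) : R b ⟹ FP R := (inj R 0 b).comp (wone R b)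

end freeprod


/-! ### Graded tensor products of algebras and bimodules -/

section graded
variable {E₁ E₂ F₁ F₂ G₁ G₂ : Type u} [CB E₁] [GCB E₂] [GCB F₁] [CB F₂] [CB G₁] [CB G₂]

/-- The graded product of two bilinear maps,
`(x₁ ⊗ x₂) (y₁ ⊗ y₂) = (-1)^(|x₂| |y₁|) a(x₁, y₁) ⊗ b(x₂, y₂)`. -/
def gmul (a : E₁ ⟹ F₁ ⟹ G₁) (b : E₂ ⟹ F₂ ⟹ G₂) : E₁ ⊗̂ E₂ ⟹ F₁ ⊗̂ F₂ ⟹ G₁ ⊗̂ G₂ :=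
  lift ((tmapB F₁ F₂ G₁ G₂).bi (((BMap.compB F₁ F₁ G₁).flip (evenB F₁)).comp a) b +
    (tmapB F₁ F₂ G₁ G₂).bi (((BMap.compB F₁ F₁ G₁).flip (oddB F₁)).comp a) (b.comp (par E₂)))

theorem gmul_tmul (a : E₁ ⟹ F₁ ⟹ G₁) (b : E₂ ⟹ F₂ ⟹ G₂) (x₁ : E₁) (x₂ : E₂) (y₁ : F₁) (y₂ : F₂) :
    gmul a b (tmul _ _ x₁ x₂) (tmul _ _ y₁ y₂) =
      tmul _ _ (a x₁ (evenB F₁ y₁)) (b x₂ y₂) +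
      tmul _ _ (a x₁ (oddB F₁ y₁)) (b (par E₂ x₂) y₂) := by
  rw [gmul, lift_tmul]
  simp

theorem gmul_tmul_deg (a : E₁ ⟹ F₁ ⟹ G₁) (b : E₂ ⟹ F₂ ⟹ G₂) {x₁ : E₁} {x₂ : E₂} {y₁ : F₁} {y₂ : F₂}
    {p q : ℕ} (hp : HasDeg x₂ p) (hq : HasDeg y₁ q) :
    gmul a b (tmul _ _ x₁ x₂) (tmul _ _ y₁ y₂) =
      (-1 : ℂ) ^ (p * q) • tmul _ _ (a x₁ y₁) (b x₂ y₂) := by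
  rw [gmul_tmul, evenB_apply, oddB_apply, hp, hq]
  rcases Nat.even_or_odd q with h | h
  · rw [h.neg_one_pow, (h.mul_left p).neg_one_pow, one_smul, one_smul, ← two_smul ℂ y₁, smul_smul]
    simp
  · rw [h.neg_one_pow, mul_comm p q, pow_mul, h.neg_one_pow, neg_one_smul, sub_neg_eq_add,
      ← two_smul ℂ y₁, smul_smul]
    simp

/-- The action `x₁ ⊗ x₂ ↦ f(x₁) ⊗ x₂` of a map on the first factor of a tensor product. -/
def on₁ {E E' : Type u} [CB E] [CB E'] (F : Type u) [CB F] (f : E ⟹ E') : E ⊗̂ F ⟹ E' ⊗̂ F :=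
  tmap f (BMap.id F)

/-- The action `x₁ ⊗ x₂ ↦ (-1)^|x₁| x₁ ⊗ f(x₂)` of an odd map on the second factor of a tensor
product. -/
def on₂ (E : Type u) [GCB E] {F F' : Type u} [CB F] [CB F'] (f : F ⟹ F') : E ⊗̂ F ⟹ E ⊗̂ F' :=
  tmap (par E) f

end graded

section pair
variable (R₁ R₂ : Type u) [DGBAlg R₁] [DGBAlg R₂]

/-- The DG algebra `R̃₁ ⊗̂ R̃₂`. -/
abbrev T00 : Type u := Unitization ℂ R₁ ⊗̂ Unitization ℂ R₂
/-- The bimodule `Ω¹R₁ ⊗̂ R̃₂`. -/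
abbrev T10 : Type u := Omega1 R₁ ⊗̂ Unitization ℂ R₂
/-- The bimodule `R̃₁ ⊗̂ Ω¹R₂`. -/
abbrev T01 : Type u := Unitization ℂ R₁ ⊗̂ Omega1 R₂
/-- The bimodule `Ω¹R₁ ⊗̂ Ω¹R₂`. -/
abbrev T11 : Type u := Omega1 R₁ ⊗̂ Omega1 R₂
/-- The quotient `Ω¹R₁♮ ⊗̂ R̃₂`. -/
abbrev N10 : Type u := Omega1Nat R₁ ⊗̂ Unitization ℂ R₂
/-- The quotient `R̃₁ ⊗̂ Ω¹R₂♮`. -/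
abbrev N01 : Type u := Unitization ℂ R₁ ⊗̂ Omega1Nat R₂
/-- The quotient `Ω¹R₁♮ ⊗̂ Ω¹R₂♮`. -/
abbrev N11 : Type u := Omega1Nat R₁ ⊗̂ Omega1Nat R₂
/-- The tensor product of the augmented `X`-complexes. -/
abbrev XX : Type u := XT R₁ ⊗̂ XT R₂

variable {R₁ R₂}

/-- The unit `1 ⊗ 1`. -/
def tone : T00 R₁ R₂ := tmul _ _ 1 1
/-- The product of `R̃₁ ⊗̂ R̃₂`. -/
def m00 : T00 R₁ R₂ ⟹ T00 R₁ R₂ ⟹ T00 R₁ R₂ := gmul (umul R₁) (umul R₂)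
/-- The right action on `Ω¹R₁ ⊗̂ R̃₂`. -/
def m10 : T10 R₁ R₂ ⟹ T00 R₁ R₂ ⟹ T10 R₁ R₂ := gmul (oright R₁) (umul R₂)
/-- The left action on `R̃₁ ⊗̂ Ω¹R₂`. -/
def m01 : T00 R₁ R₂ ⟹ T01 R₁ R₂ ⟹ T01 R₁ R₂ := gmul (umul R₁) (oleft R₂)
/-- The right action on `R̃₁ ⊗̂ Ω¹R₂`. -/
def m01' : T01 R₁ R₂ ⟹ T00 R₁ R₂ ⟹ T01 R₁ R₂ := gmul (umul R₁) (oright R₂)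
/-- The product of an element of `Ω¹R₁ ⊗̂ R̃₂` by an element of `R̃₁ ⊗̂ Ω¹R₂`. -/
def m12 : T10 R₁ R₂ ⟹ T01 R₁ R₂ ⟹ T11 R₁ R₂ := gmul (oright R₁) (oleft R₂)
/-- The product of an element of `R̃₁ ⊗̂ Ω¹R₂` by an element of `Ω¹R₁ ⊗̂ R̃₂`. -/
def m21 : T01 R₁ R₂ ⟹ T10 R₁ R₂ ⟹ T11 R₁ R₂ := gmul (oleft R₁) (oright R₂)
/-- The left action on `Ω¹R₁ ⊗̂ Ω¹R₂`. -/
def m11 : T00 R₁ R₂ ⟹ T11 R₁ R₂ ⟹ T11 R₁ R₂ := gmul (oleft R₁) (oleft R₂)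

/-- The differential `δ = δ₁ + δ₂` of `R̃₁ ⊗̂ R̃₂`. -/
def tdif : T00 R₁ R₂ ⟹ T00 R₁ R₂ := on₁ _ (udif R₁) + on₂ _ (udif R₂)
/-- The map `d₁`. -/
def d₁ : T00 R₁ R₂ ⟹ T10 R₁ R₂ := on₁ _ (dform R₁)
/-- The map `d₂`. -/
def d₂ : T00 R₁ R₂ ⟹ T01 R₁ R₂ := on₂ _ (dform R₂)
/-- The projection `♮₁`. -/
def nat₁ : T10 R₁ R₂ ⟹ N10 R₁ R₂ := tmap (nat R₁) (BMap.id _)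
/-- The projection `♮₂`. -/
def nat₂ : T01 R₁ R₂ ⟹ N01 R₁ R₂ := tmap (BMap.id _) (nat R₂)
/-- The projection `♮₁₂`. -/
def nat₁₂ : T11 R₁ R₂ ⟹ N11 R₁ R₂ := tmap (nat R₁) (nat R₂)

/-- The inclusions of the two summands of the augmented `X`-complex. -/
def xinl (R : Type u) [DGBAlg R] : Unitization ℂ R ⟹ XT R := pairB (BMap.id _) 0
def xinr (R : Type u) [DGBAlg R] : Omega1Nat R ⟹ XT R := pairB 0 (BMap.id _)

/-- The inclusions of the four components of `X̃(R₁) ⊗̂ X̃(R₂)`. -/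
def i00 : T00 R₁ R₂ ⟹ XX R₁ R₂ := tmap (xinl R₁) (xinl R₂)
def i10 : N10 R₁ R₂ ⟹ XX R₁ R₂ := tmap (xinr R₁) (xinl R₂)
def i01 : N01 R₁ R₂ ⟹ XX R₁ R₂ := tmap (xinl R₁) (xinr R₂)
def i11 : N11 R₁ R₂ ⟹ XX R₁ R₂ := tmap (xinr R₁) (xinr R₂)

/-- The projections onto the four components of `X̃(R₁) ⊗̂ X̃(R₂)`. -/
def c00 : XX R₁ R₂ ⟹ T00 R₁ R₂ := tmap (fstB _ _) (fstB _ _)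
def c10 : XX R₁ R₂ ⟹ N10 R₁ R₂ := tmap (sndB _ _) (fstB _ _)
def c01 : XX R₁ R₂ ⟹ N01 R₁ R₂ := tmap (fstB _ _) (sndB _ _)
def c11 : XX R₁ R₂ ⟹ N11 R₁ R₂ := tmap (sndB _ _) (sndB _ _)

/-- The total differential of `X̃(R₁) ⊗̂ X̃(R₂)`. -/
def Dtot : XX R₁ R₂ ⟹ XX R₁ R₂ := on₁ _ (XD R₁) + on₂ _ (XD R₂)

/-- The differential `δ = δ₁ + δ₂` on the components of `X̃(R₁) ⊗̂ X̃(R₂)`. -/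
def dif10 : N10 R₁ R₂ ⟹ N10 R₁ R₂ := on₁ _ (ndif R₁) + on₂ _ (udif R₂)
/-- The differential `δ`. -/
def dif01 : N01 R₁ R₂ ⟹ N01 R₁ R₂ := on₁ _ (udif R₁) + on₂ _ (ndif R₂)
/-- The differential `δ`. -/
def dif11 : N11 R₁ R₂ ⟹ N11 R₁ R₂ := on₁ _ (ndif R₁) + on₂ _ (ndif R₂)
/-- The map `b̄₁`. -/
def b10₁ : N10 R₁ R₂ ⟹ T00 R₁ R₂ := on₁ _ (bbar R₁)
/-- The map `b̄₁`. -/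
def b11₁ : N11 R₁ R₂ ⟹ N01 R₁ R₂ := on₁ _ (bbar R₁)
/-- The map `b̄₂`. -/
def b01₂ : N01 R₁ R₂ ⟹ T00 R₁ R₂ := on₂ _ (bbar R₂)
/-- The map `b̄₂`. -/
def b11₂ : N11 R₁ R₂ ⟹ N10 R₁ R₂ := on₂ _ (bbar R₂)
/-- The map `♮₁ d₁`. -/
def nd00₁ : T00 R₁ R₂ ⟹ N10 R₁ R₂ := on₁ _ (natd R₁)
/-- The map `♮₁ d₁`. -/
def nd01₁ : N01 R₁ R₂ ⟹ N11 R₁ R₂ := on₁ _ (natd R₁)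
/-- The map `♮₂ d₂`. -/
def nd00₂ : T00 R₁ R₂ ⟹ N01 R₁ R₂ := on₂ _ (natd R₂)
/-- The map `♮₂ d₂`. -/
def nd10₂ : N10 R₁ R₂ ⟹ N11 R₁ R₂ := on₂ _ (natd R₂)

/-! ### The chain map from the free product -/

variable (R₁ R₂) in
/-- The two algebras as a family. -/
def fam : Bool → Type u
  | true => R₁
  | false => R₂

instance famInst : ∀ b, DGBAlg (fam R₁ R₂ b)
  | true => inferInstanceAs (DGBAlg R₁)
  | false => inferInstanceAs (DGBAlg R₂)

variable (R₁ R₂) in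
/-- The free product `R₁ * R₂`. -/
abbrev FreeProd : Type u := FP (fam R₁ R₂)

variable (R₁ R₂) in
/-- The inclusion of `R₁` in the free product. -/
def in₁ : R₁ ⟹ FreeProd R₁ R₂ := letter (fam R₁ R₂) true
variable (R₁ R₂) in
/-- The inclusion of `R₂` in the free product. -/
def in₂ : R₂ ⟹ FreeProd R₁ R₂ := letter (fam R₁ R₂) false

/-- The maps `x₁ ↦ x₁ ⊗ 1` and `x₂ ↦ 1 ⊗ x₂`. -/
def alpha : ∀ b, fam R₁ R₂ b ⟹ T00 R₁ R₂
  | true => ((tmul (Unitization ℂ R₁) (Unitization ℂ R₂)).flip 1).comp (uinr R₁)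
  | false => (tmul (Unitization ℂ R₁) (Unitization ℂ R₂) 1).comp (uinr R₂)

/-- The pair `(μ, φ)` on the free product, defined recursively on the words by
`μ(x) = alpha x`, `φ(x) = 0` and
`μ(x * w) = μ(x) μ(w)`, `φ(x * w) = μ(x) φ(w) + (-1)^|x| d₂μ(x) d₁μ(w)` for a letter `x`. -/
def muphi : FreeProd R₁ R₂ ⟹ T00 R₁ R₂ × T11 R₁ R₂ :=
  fpLift (wrec (fun b => pairB (alpha b) 0) fun b =>
    BMap.post (pairB (BMap.id _) 0) (m00.bi (alpha b) (fstB _ _)) +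
    BMap.post (pairB 0 (BMap.id _)) (m11.bi (alpha b) (sndB _ _) +
      m21.bi (d₂.comp ((alpha b).comp (par _))) (d₁.comp (fstB _ _))))

/-- The multiplication morphism `μ` from the unital free product to `R̃₁ ⊗̂ R̃₂`. -/
def mu : Unitization ℂ (FreeProd R₁ R₂) ⟹ T00 R₁ R₂ := uext tone ((fstB _ _).comp muphi)

/-- The map `φ` from the unital free product to `Ω¹R₁ ⊗̂ Ω¹R₂`. -/
def phi : Unitization ℂ (FreeProd R₁ R₂) ⟹ T11 R₁ R₂ := ((sndB _ _).comp muphi).comp (usnd _)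

/-- The defining formulas of the map `Ψ : X̃(R₁ * R₂) → X̃(R₁) ⊗̂ X̃(R₂)`. -/
def IsPsi (Ψ : XT (FreeProd R₁ R₂) ⟹ XX R₁ R₂) : Prop :=
  (∀ X : Unitization ℂ (FreeProd R₁ R₂), Ψ (X, 0) = i00 (mu X) + i11 (nat₁₂ (phi X))) ∧
  ∀ (p q : ℕ) (X : Unitization ℂ (FreeProd R₁ R₂)) (Y : FreeProd R₁ R₂),
    HasDeg X p → HasDeg Y q →
    Ψ (0, nat _ (form _ X Y)) =
      (-1 : ℂ) ^ (p * (q + 1)) • i10 (nat₁ (m10 (d₁ (mu Y)) (mu X))) +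
      i01 (nat₂ (m01 (mu X) (d₂ (mu Y)))) +
      (-1 : ℂ) ^ p • (i10 (b11₂ (nat₁₂ (m11 (mu X) (phi Y)))) +
        i01 (b11₁ (nat₁₂ (m11 (mu X) (phi Y)))))

/-! ### The Chern character -/

/-- The linear inclusion `x₁ ⊗ x₂ ↦ x₁ * x₂` of `R̃₁ ⊗̂ R̃₂` in the unital free product. -/
def lin : T00 R₁ R₂ ⟹ Unitization ℂ (FreeProd R₁ R₂) :=
  lift ((umul (FreeProd R₁ R₂)).bi
    (uext 1 ((uinr _).comp (in₁ R₁ R₂))) (uext 1 ((uinr _).comp (in₂ R₁ R₂))))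

/-- Powers in `R̃₁ ⊗̂ R̃₂`. -/
def tpow (F : T00 R₁ R₂) : ℕ → T00 R₁ R₂
  | 0 => tone
  | n + 1 => m00 F (tpow F n)

/-- The curvature `F = δA + A²`. -/
def curv (A : T00 R₁ R₂) : T00 R₁ R₂ := tdif A + m00 A A

/-- The terms `(-s F)ⁿ / n!` of the exponential series of `-s F`. -/
def expTerm (F : T00 R₁ R₂) (s : ℝ) (n : ℕ) : T00 R₁ R₂ :=
  ((-s : ℂ) ^ n / (n.factorial : ℂ)) • tpow F n

/-- Convergence of the exponential series `e^{-F}`. -/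
def ExpConv (F : T00 R₁ R₂) : Prop := ∃ e, SHasSum (expTerm F 1) e

/-- The exponential `e^{-sF}`. -/
def bexp (F : T00 R₁ R₂) (s : ℝ) : T00 R₁ R₂ := ssum (expTerm F s)

/-- The curvature of the lift of `A` to the free product. -/
def lcurv (A : T00 R₁ R₂) : Unitization ℂ (FreeProd R₁ R₂) := udif _ (lin A) + lin A * lin A

/-- The term of order `n` in the curvature of the Chern character `(e^{-F}, -♮ e^{-F} dA)` of the
lift of `A` to the free product. -/
def qterm (A : T00 R₁ R₂) (n : ℕ) : XT (FreeProd R₁ R₂) :=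
  ((-1 : ℂ) ^ n / (n.factorial : ℂ)) •
    (lcurv A ^ n, -nat _ (oleft _ (lcurv A ^ n) (dform _ (lin A))))

/-- The Chern character of `A`: the image by `Ψ` of the Chern character of its lift. -/
def chern (Ψ : XT (FreeProd R₁ R₂) ⟹ XX R₁ R₂) (A : T00 R₁ R₂) : XX R₁ R₂ :=
  ssum fun n => Ψ (qterm A n)

end pair

/-! ### Integration and smoothness -/

section analysis
variable {E : Type u} [CB E]

/-- `I` is the integral of `f`, in the sense of Bochner, in the Banach space of some bounded disk. -/
def HasBIntegral {α : Type} [MeasurableSpace α] (m : MeasureTheory.Measure α) (f : α → E) (I : E) :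
    Prop :=
  ∃ (d : BanachDisk E) (g : α → d.V), MeasureTheory.Integrable g m ∧
    (∀ᵐ a ∂m, f a = d.j (g a)) ∧ I = d.j (∫ a, g a ∂m)

/-- Smooth maps from `[0,1]` to `E`, i.e. elements of `E ⊗̂ C^∞[0,1]`: they are smooth maps to the
Banach space of some bounded disk. -/
def SmoothMap (f : ℝ → E) : Prop :=
  ∃ (d : BanachDisk E) (g : ℝ → d.V), ContDiffOn ℝ (⊤ : ℕ∞) g (Icc 0 1) ∧
    ∀ t ∈ Icc (0 : ℝ) 1, f t = d.j (g t)

/-- Bornological convergence of a series in `E ⊗̂ C^∞[0,1]`: for the Banach space of some bounded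
disk, the partial sums converge uniformly on `[0,1]` with all derivatives. -/
def SmoothSummable (f : ℕ → ℝ → E) : Prop :=
  ∃ (d : BanachDisk E) (g : ℕ → ℝ → d.V) (h : ℝ → d.V),
    (∀ n, ContDiffOn ℝ (⊤ : ℕ∞) (g n) (Icc 0 1)) ∧ ContDiffOn ℝ (⊤ : ℕ∞) h (Icc 0 1) ∧
    (∀ n, ∀ t ∈ Icc (0 : ℝ) 1, f n t = d.j (g n t)) ∧
    ∀ k : ℕ, TendstoUniformlyOn
      (fun N => iteratedDerivWithin k (fun t => ∑ n ∈ Finset.range N, g n t) (Icc 0 1))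
      (iteratedDerivWithin k h (Icc 0 1)) atTop (Icc 0 1)

end analysis

/-- The points `(s₁, s₂)` of the standard `2`-simplex, with `s₀ = 1 - s₁ - s₂`. -/
def simplex2 : Set (ℝ × ℝ) := {s | 0 ≤ s.1 ∧ 0 ≤ s.2 ∧ s.1 + s.2 ≤ 1}

section hyp
variable {R₁ R₂ : Type u} [DGBAlg R₁] [DGBAlg R₂]

/-- A smooth family of connections over `[0,1]`, the exponential of whose curvature converges in the
algebra of smooth functions with values in `R̃₁ ⊗̂ R̃₂`. -/
structure SmoothConn (A : ℝ → T00 R₁ R₂) : Prop where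
  odd : ∀ t ∈ Icc (0 : ℝ) 1, HasDeg (A t) 1
  smooth : SmoothMap A
  exp : SmoothSummable fun (n : ℕ) t => expTerm (curv (A t)) 1 n

/-- The term `♮₁₂ d₁A e^{-F} d₂A`. -/
def edgeTerm (A : T00 R₁ R₂) : N11 R₁ R₂ := nat₁₂ (m12 (m10 (d₁ A) (bexp (curv A) 1)) (d₂ A))

/-- The integrand `♮₁₂ e^{-s₀F} d₂F e^{-s₁F} d₁F e^{-s₂F}`, with `s = (s₁, s₂)` and
`s₀ = 1 - s₁ - s₂`. -/
def simplexTerm (F : T00 R₁ R₂) (s : ℝ × ℝ) : N11 R₁ R₂ :=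
  nat₁₂ (m21 (m01' (m01 (bexp F (1 - s.1 - s.2)) (d₂ F)) (bexp F s.1)) (m10 (d₁ F) (bexp F s.2)))

end hyp

end BornChern

end

open BornChern

noncomputable section

namespace BornChern

/-! ### Parity -/

section parity
variable {E F G : Type u} [GCB E] [GCB F] [CB G]

/-! All products and projections of the statement are realised inside one DG algebra, `BiForm`, the
graded tensor product of the algebras `FormAlg` of forms of degree at most one over R₁ and over R₂.
There d₁, d₂ and δ are anticommuting odd derivations, two forms in the same direction multiply to
zero, and the various ♮ become one projection `natXX` onto the tensor product of the X-complexes.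
The algebra then rests on a single formula, `natXX_comm`: up to grading signs, ♮[u, v] = b̄₁♮(d₁v u)
+ b̄₂♮(u d₂v). When u or v already contains forms, boundary terms on the right disappear and ♮
becomes a graded trace.

The map Ψ. The map φ is a derivation up to the cup product of d₂μ and d₁μ. Rotating a factor
cyclically inside ♮X dY costs b̄₁ and b̄₂ of one and the same form, and the cup product in φ pays
for exactly this. Hence Ψ descends to the commutator quotient (`tev_mul_even_even` and its
companions for the other parities), and by the same formula it is a morphism of complexes
(`psi_XD`).

Cocycle and homotopy. With weights wₙ = (-1)ⁿ/n! one has (n+1) wₙ₊₁ = -wₙ. Together with the Bianchi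
identity this makes the differential of a partial sum of Quillen's character telescope to w_N ♮F^N
dF (`sum_XD_qX`). Its image under Ψ is a bounded linear function of the N-th term of e^{-F} in R̃₁
⊗̂ R̃₂, so it tends to zero, whether or not the series converges in the free product. In the same
way the t-derivative of a partial sum is the differential of a Chern–Simons sum plus one error of
top order (`sum_vX`); the formula is integrated in t before the limit is taken.

Convergence. The terms φ(Fⁿ) are not determined by the sum e^{-F}, but φ(Fⁿ⁺¹) = F φ(Fⁿ) + γ(Fⁿ)
with γ(x) = φ(F)x + d₂F d₁x. Solving this recursion and inserting the weights gives a discrete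
Duhamel formula: a Cauchy product of series, weighted by the beta integrals i! j!/(i+j+1)! = ∫
sⁱ(1-s)ʲ ds. The exponential series may converge only conditionally. A beta-weighted product of two
series with bounded partial sums nevertheless converges (`exists_tendsto_kconv`): for 0 < s < 1 the
integrand converges absolutely, Abel summation bounds its partial sums uniformly in s, and dominated
convergence applies. Used in the Banach space of continuous paths, the same statement gives uniform
convergence for families.

The component of bidegree (1,1). By the trace property the φ(F) part of γ collapses to d₁A e^{-F}
d₂A. In the d₂F d₁x part, a second Duhamel expansion of d₁e^{-F} gives a triple series whose weights
are the integrals of s₀ⁱs₁ʲs₂ᵏ over the simplex. These weights are summable, so the series converges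
absolutely and is the integral of its sum (`simplex_series`). -/

theorem evenB_add_oddB (x : E) : evenB E x + oddB E x = x := by
  rw [evenB_apply, oddB_apply, ← smul_add, add_add_sub_cancel, ← two_smul ℂ x, smul_smul]
  norm_num

theorem par_evenB (x : E) : par E (evenB E x) = evenB E x := by
  simp [evenB_apply, add_comm]

theorem par_oddB (x : E) : par E (oddB E x) = -oddB E x := by
  simp [oddB_apply, ← smul_neg]

theorem evenB_of_even {x : E} (h : par E x = x) : evenB E x = x := by
  rw [evenB_apply, h, ← two_smul ℂ x, smul_smul]; norm_num

theorem oddB_of_even {x : E} (h : par E x = x) : oddB E x = 0 := by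
  rw [oddB_apply, h, sub_self, smul_zero]

theorem evenB_of_odd {x : E} (h : par E x = -x) : evenB E x = 0 := by
  rw [evenB_apply, h, add_neg_cancel, smul_zero]

theorem oddB_of_odd {x : E} (h : par E x = -x) : oddB E x = x := by
  rw [oddB_apply, h, sub_neg_eq_add, ← two_smul ℂ x, smul_smul]; norm_num

theorem hasDeg_one {x : E} (h : HasDeg x 1) : par E x = -x := hasDeg_odd odd_one h

theorem hasDeg_parity {x : E} {p : ℕ} (h : HasDeg x p) :
    (Even p ∧ par E x = x) ∨ (Odd p ∧ par E x = -x) :=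
  (Nat.even_or_odd p).imp (fun hp => ⟨hp, hasDeg_even hp h⟩) fun hp => ⟨hp, hasDeg_odd hp h⟩

/-- Two bounded maps agree if they agree on homogeneous elements. -/
theorem parity_induct {f g : E ⟹ G} (he : ∀ x, par E x = x → f x = g x)
    (ho : ∀ x, par E x = -x → f x = g x) (x : E) : f x = g x := by
  rw [← evenB_add_oddB x, map_add, map_add, he _ (par_evenB x), ho _ (par_oddB x)]

/-- Elementary tensors determine bounded maps. In the pointwise form an identity in several tensor
variables is proved one variable at a time, each side being written as a bounded map of the variable
in question. -/
theorem tensor_induct {E F : Type u} [CB E] [CB F] (f g : E ⊗̂ F ⟹ G)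
    (h : ∀ x y, f (tmul E F x y) = g (tmul E F x y)) (z : E ⊗̂ F) : f z = g z :=
  DFunLike.congr_fun (tensor_ext h) z

/-- Two bounded maps on a tensor product agree if they agree on tensors with homogeneous first
factor. -/
theorem tensor_induct_left {E F : Type u} [GCB E] [CB F] (f g : E ⊗̂ F ⟹ G)
    (h : ∀ x y, (par E x = x ∨ par E x = -x) → f (tmul E F x y) = g (tmul E F x y))
    (z : E ⊗̂ F) : f z = g z := by
  refine tensor_induct f g (fun x y => ?_) z
  exact parity_induct (f := f.comp ((tmul E F).flip y)) (g := g.comp ((tmul E F).flip y))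
    (fun x hx => h x y (Or.inl hx)) (fun x hx => h x y (Or.inr hx)) x

/-- Two bounded maps on a tensor product agree if they agree on homogeneous tensors. -/
theorem tensor_induct_homog (f g : E ⊗̂ F ⟹ G)
    (h : ∀ x y, (par E x = x ∨ par E x = -x) → (par F y = y ∨ par F y = -y) →
      f (tmul E F x y) = g (tmul E F x y)) (z : E ⊗̂ F) : f z = g z := by
  refine tensor_induct_left f g (fun x y hx => ?_) z
  exact parity_induct (f := f.comp (tmul E F x)) (g := g.comp (tmul E F x))
    (fun y hy => h x y hx (Or.inl hy)) (fun y hy => h x y hx (Or.inr hy)) y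

end parity

/-! ### Graded products on homogeneous elements and their naturality. -/

section gmul
variable {E₁ E₂ F₁ F₂ G₁ G₂ : Type u} [CB E₁] [GCB E₂] [GCB F₁] [CB F₂] [CB G₁] [CB G₂]

theorem gmul_even (a : E₁ ⟹ F₁ ⟹ G₁) (b : E₂ ⟹ F₂ ⟹ G₂) (x₁ : E₁) (x₂ : E₂) {y₁ : F₁} (y₂ : F₂)
    (h : par F₁ y₁ = y₁) : gmul a b (tmul _ _ x₁ x₂) (tmul _ _ y₁ y₂) =
      tmul _ _ (a x₁ y₁) (b x₂ y₂) := by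
  rw [gmul_tmul, evenB_of_even h, oddB_of_even h]; simp

theorem gmul_odd (a : E₁ ⟹ F₁ ⟹ G₁) (b : E₂ ⟹ F₂ ⟹ G₂) (x₁ : E₁) (x₂ : E₂) {y₁ : F₁} (y₂ : F₂)
    (h : par F₁ y₁ = -y₁) : gmul a b (tmul _ _ x₁ x₂) (tmul _ _ y₁ y₂) =
      tmul _ _ (a x₁ y₁) (b (par E₂ x₂) y₂) := by
  rw [gmul_tmul, evenB_of_odd h, oddB_of_odd h]; simp

/-- Graded products are compatible with tensor products of morphisms of bilinear maps. -/
theorem gmul_map {E₁' E₂' F₁' F₂' G₁' G₂' : Type u} [CB E₁'] [GCB E₂'] [GCB F₁'] [CB F₂'] [CB G₁']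
    [CB G₂'] (a : E₁ ⟹ F₁ ⟹ G₁) (b : E₂ ⟹ F₂ ⟹ G₂) (a' : E₁' ⟹ F₁' ⟹ G₁') (b' : E₂' ⟹ F₂' ⟹ G₂')
    (e₁ : E₁ ⟹ E₁') (e₂ : E₂ ⟹ E₂') (f₁ : F₁ ⟹ F₁') (f₂ : F₂ ⟹ F₂') (g₁ : G₁ ⟹ G₁') (g₂ : G₂ ⟹ G₂')
    (ha : ∀ x y, g₁ (a x y) = a' (e₁ x) (f₁ y)) (hb : ∀ x y, g₂ (b x y) = b' (e₂ x) (f₂ y))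
    (hf : ∀ y, f₁ (par F₁ y) = par F₁' (f₁ y)) (he : ∀ x, e₂ (par E₂ x) = par E₂' (e₂ x))
    (u : E₁ ⊗̂ E₂) (v : F₁ ⊗̂ F₂) :
    tmap g₁ g₂ (gmul a b u v) = gmul a' b' (tmap e₁ e₂ u) (tmap f₁ f₂ v) := by
  refine tensor_induct ((tmap g₁ g₂).comp ((gmul a b).flip v))
    (((gmul a' b').flip (tmap f₁ f₂ v)).comp (tmap e₁ e₂)) (fun x₁ x₂ => ?_) u
  -- The Koszul sign of a product depends on the second left entry only through `par`, and on the
  -- first right entry through its parity; so only y₁ has to be homogeneous.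
  refine tensor_induct_left ((tmap g₁ g₂).comp (gmul a b (tmul _ _ x₁ x₂)))
    ((gmul a' b' (tmap e₁ e₂ (tmul _ _ x₁ x₂))).comp (tmap f₁ f₂)) (fun y₁ y₂ hy => ?_) v
  simp only [BMap.comp_apply, tmap_tmul]
  rcases hy with hy | hy
  · rw [gmul_even _ _ _ _ _ hy, gmul_even _ _ _ _ _ (by rw [← hf, hy]), tmap_tmul, ha, hb]
  · rw [gmul_odd _ _ _ _ _ hy, gmul_odd _ _ _ _ _ (by rw [← hf, hy, map_neg]), tmap_tmul, ha, hb,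
      he]

end gmul

/-! ### Graded tensor products of DG algebras -/

section tensoralg
variable {P Q : Type u} [DGBAlg P] [DGBAlg Q]

variable (P Q) in
/-- The graded product of a tensor product of algebras. -/
def talg : P ⊗̂ Q ⟹ P ⊗̂ Q ⟹ P ⊗̂ Q := gmul (mulB P) (mulB Q)

theorem talg_even (x₁ : P) (x₂ : Q) {y₁ : P} (y₂ : Q) (h : par P y₁ = y₁) :
    talg P Q (tmul _ _ x₁ x₂) (tmul _ _ y₁ y₂) = tmul _ _ (x₁ * y₁) (x₂ * y₂) :=
  gmul_even _ _ _ _ _ h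

theorem talg_odd (x₁ : P) (x₂ : Q) {y₁ : P} (y₂ : Q) (h : par P y₁ = -y₁) :
    talg P Q (tmul _ _ x₁ x₂) (tmul _ _ y₁ y₂) = tmul _ _ (x₁ * y₁) (par Q x₂ * y₂) :=
  gmul_odd _ _ _ _ _ h

/-- In both bracketings x₂ is moved past y₁ and past z₁, and y₂ past z₁, so the signs agree. Only
the parities of y₁ and z₁ have to be distinguished. -/
theorem talg_assoc (u v w : P ⊗̂ Q) : talg P Q (talg P Q u v) w = talg P Q u (talg P Q v w) := by
  refine tensor_induct (((talg P Q).flip w).comp ((talg P Q).flip v))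
    ((talg P Q).flip (talg P Q v w)) (fun x₁ x₂ => ?_) u
  refine tensor_induct_left (((talg P Q).flip w).comp (talg P Q (tmul _ _ x₁ x₂)))
    ((talg P Q (tmul _ _ x₁ x₂)).comp ((talg P Q).flip w)) (fun y₁ y₂ hy => ?_) v
  refine tensor_induct_left (talg P Q (talg P Q (tmul _ _ x₁ x₂) (tmul _ _ y₁ y₂)))
    ((talg P Q (tmul _ _ x₁ x₂)).comp (talg P Q (tmul _ _ y₁ y₂))) (fun z₁ z₂ hz => ?_) w
  simp only [BMap.comp_apply]
  rcases hy with hy | hy <;> rcases hz with hz | hz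
  · rw [talg_even _ _ _ hy, talg_even _ _ _ hz, talg_even _ _ _ hz,
      talg_even _ _ _ (by rw [par_mul, hy, hz]), mul_assoc, mul_assoc]
  · rw [talg_even _ _ _ hy, talg_odd _ _ _ hz, talg_odd _ _ _ hz,
      talg_odd _ _ _ (by rw [par_mul, hy, hz, mul_neg]), mul_assoc, par_mul, mul_assoc]
  · rw [talg_odd _ _ _ hy, talg_even _ _ _ hz, talg_even _ _ _ hz,
      talg_odd _ _ _ (by rw [par_mul, hy, hz, neg_mul]), mul_assoc, mul_assoc]
  · rw [talg_odd _ _ _ hy, talg_odd _ _ _ hz, talg_odd _ _ _ hz,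
      talg_even _ _ _ (by rw [par_mul, hy, hz, neg_mul_neg]), mul_assoc, par_mul, par_par,
      mul_assoc]

theorem par_talg (u v : P ⊗̂ Q) : par _ (talg P Q u v) = talg P Q (par _ u) (par _ v) :=
  gmul_map (mulB P) (mulB Q) (mulB P) (mulB Q) (par P) (par Q) (par P) (par Q) (par P) (par Q)
    par_mul par_mul (fun _ => rfl) (fun _ => rfl) u v

/-- An odd derivation of the first factor. -/
theorem on₁_talg {f : P ⟹ P} (hf : ∀ x y, f (x * y) = f x * y + par P x * f y)
    (hp : ∀ x, f (par P x) = -par P (f x)) (u v : P ⊗̂ Q) :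
    on₁ Q f (talg P Q u v) = talg P Q (on₁ Q f u) v + talg P Q (par _ u) (on₁ Q f v) := by
  refine tensor_induct ((on₁ Q f).comp ((talg P Q).flip v))
    (((talg P Q).flip v).comp (on₁ Q f) + ((talg P Q).flip (on₁ Q f v)).comp (par _))
    (fun x₁ x₂ => ?_) u
  refine tensor_induct_left ((on₁ Q f).comp (talg P Q (tmul _ _ x₁ x₂)))
    (talg P Q (on₁ Q f (tmul _ _ x₁ x₂)) + (talg P Q (par _ (tmul _ _ x₁ x₂))).comp (on₁ Q f))
    (fun y₁ y₂ hy => ?_) v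
  simp only [BMap.comp_apply, BMap.add_apply, on₁, tmap_tmul, par_tmul, BMap.id_apply]
  have hfy := hp y₁
  rcases hy with hy | hy
  -- For even y₁ the element f y₁ is odd. The product with it applies `par` to `par x₂`, and the two
  -- signs cancel.
  · rw [hy, eq_neg_iff_add_eq_zero, add_comm, ← eq_neg_iff_add_eq_zero] at hfy
    rw [talg_even _ _ _ hy, talg_even _ _ _ hy, talg_odd _ _ _ hfy, tmap_tmul, hf, par_par,
      map_add]; rfl
  · rw [hy, map_neg, neg_inj, eq_comm] at hfy
    rw [talg_odd _ _ _ hy, talg_odd _ _ _ hy, talg_even _ _ _ hfy, tmap_tmul, hf, map_add]; rfl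

/-- An odd derivation of the second factor. -/
theorem on₂_talg {f : Q ⟹ Q} (hf : ∀ x y, f (x * y) = f x * y + par Q x * f y)
    (hp : ∀ x, f (par Q x) = -par Q (f x)) (u v : P ⊗̂ Q) :
    on₂ P f (talg P Q u v) = talg P Q (on₂ P f u) v + talg P Q (par _ u) (on₂ P f v) := by
  refine tensor_induct ((on₂ P f).comp ((talg P Q).flip v))
    (((talg P Q).flip v).comp (on₂ P f) + ((talg P Q).flip (on₂ P f v)).comp (par _))
    (fun x₁ x₂ => ?_) u
  refine tensor_induct_left ((on₂ P f).comp (talg P Q (tmul _ _ x₁ x₂)))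
    (talg P Q (on₂ P f (tmul _ _ x₁ x₂)) + (talg P Q (par _ (tmul _ _ x₁ x₂))).comp (on₂ P f))
    (fun y₁ y₂ hy => ?_) v
  simp only [BMap.comp_apply, BMap.add_apply, on₂, tmap_tmul, par_tmul]
  rcases hy with hy | hy
  · rw [talg_even _ _ _ hy, talg_even _ _ _ hy, hy, talg_even _ _ _ hy, tmap_tmul, hf, par_mul, hy,
      map_add]
  · have hy' : par P (-y₁) = - -y₁ := by rw [map_neg, hy]
    rw [talg_odd _ _ _ hy, talg_odd _ _ _ hy, hy, talg_odd _ _ _ hy', tmap_tmul, hf, par_mul, hy,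
      map_add, hp, neg_mul, par_par]
    simp only [mul_neg, map_neg, BMap.neg_apply, neg_neg]

theorem on₁_par {f : P ⟹ P} (hp : ∀ x, f (par P x) = -par P (f x)) (u : P ⊗̂ Q) :
    on₁ Q f (par _ u) = -par _ (on₁ Q f u) :=
  tensor_induct ((on₁ Q f).comp (par _)) (-(par _).comp (on₁ Q f))
    (fun x y => by simp [on₁, hp]) u

theorem on₂_par {f : Q ⟹ Q} (hp : ∀ x, f (par Q x) = -par Q (f x)) (u : P ⊗̂ Q) :
    on₂ P f (par _ u) = -par _ (on₂ P f u) :=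
  tensor_induct ((on₂ P f).comp (par _)) (-(par _).comp (on₂ P f))
    (fun x y => by simp [on₂, hp]) u

variable (P Q) in
/-- The differential of a tensor product of DG algebras. -/
def tadif : P ⊗̂ Q ⟹ P ⊗̂ Q := on₁ Q (dif P) + on₂ P (dif Q)

theorem tadif_tadif (u : P ⊗̂ Q) : tadif P Q (tadif P Q u) = 0 :=
  tensor_induct ((tadif P Q).comp (tadif P Q)) 0 (fun x y => by
    simp [tadif, on₁, on₂, dif_dif, dif_par]) u

theorem tadif_par (u : P ⊗̂ Q) : tadif P Q (par _ u) = -par _ (tadif P Q u) := by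
  simp only [tadif, BMap.add_apply]
  rw [on₁_par dif_par, on₂_par dif_par, map_add, neg_add]

theorem tadif_talg (u v : P ⊗̂ Q) :
    tadif P Q (talg P Q u v) = talg P Q (tadif P Q u) v + talg P Q (par _ u) (tadif P Q v) := by
  simp only [tadif, BMap.add_apply]
  rw [on₁_talg dif_mul dif_par, on₂_talg dif_mul dif_par, map_add, map_add, BMap.add_apply]
  abel

/-- The instance is meant for two algebras of forms: all mixed products of functions and forms then
take place in one associative ring, where ring normalisation keeps track of the order of factors. -/
instance : DGBAlg (P ⊗̂ Q) where
  mul u v := talg P Q u v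
  left_distrib u v w := map_add (talg P Q u) v w
  right_distrib u v w := by
    change talg P Q (u + v) w = talg P Q u w + talg P Q v w
    rw [map_add]; rfl
  zero_mul u := by
    change talg P Q 0 u = 0
    rw [map_zero]; rfl
  mul_zero u := map_zero (talg P Q u)
  mul_assoc := talg_assoc
  smul_mul_assoc' c u v := by
    change talg P Q (c • u) v = c • talg P Q u v
    rw [map_smul]; rfl
  mul_smul_comm' c u v := map_smul (talg P Q u) c v
  mul_bdd S T hS hT := (talg P Q).bdd₂ hS hT
  eps_mul := par_talg
  diff := (tadif P Q).1
  diff_bdd := fun _ hS => (tadif P Q).bdd hS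
  diff_eps := tadif_par
  diff_mul := tadif_talg
  diff_diff := tadif_tadif

theorem tensor_dif_def : dif (P ⊗̂ Q) = on₁ Q (dif P) + on₂ P (dif Q) := rfl

theorem tmul_mul_even (x₁ : P) (x₂ : Q) {y₁ : P} (y₂ : Q) (h : par P y₁ = y₁) :
    tmul P Q x₁ x₂ * tmul P Q y₁ y₂ = tmul _ _ (x₁ * y₁) (x₂ * y₂) := talg_even _ _ _ h

theorem tmul_mul_odd (x₁ : P) (x₂ : Q) {y₁ : P} (y₂ : Q) (h : par P y₁ = -y₁) :
    tmul P Q x₁ x₂ * tmul P Q y₁ y₂ = tmul _ _ (x₁ * y₁) (par Q x₂ * y₂) := talg_odd _ _ _ h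

end tensoralg

/-! ### The algebra of forms of degree at most one -/

section formalg
variable {R : Type u} [DGBAlg R]

theorem dform_apply (x : Unitization ℂ R) : dform R x = form R 1 x.snd := rfl

theorem dform_inr (y : R) : dform R (y : Unitization ℂ R) = form R 1 y := by
  rw [dform_apply, Unitization.snd_inr]

theorem form_eq_oleft (x : Unitization ℂ R) (y : R) : form R x y = oleft R x (form R 1 y) := by
  rw [oleft_form, mul_one]

theorem oleft_oleft (z w : Unitization ℂ R) (ω : Omega1 R) :
    oleft R (z * w) ω = oleft R z (oleft R w ω) := by
  have h : oleft R (z * w) = (oleft R z).comp (oleft R w) :=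
    omega_ext fun x y => by simp only [BMap.comp_apply, oleft_form, mul_assoc]
  exact DFunLike.congr_fun h ω

theorem oleft_one (ω : Omega1 R) : oleft R 1 ω = ω := by
  have h : oleft R 1 = BMap.id _ :=
    omega_ext fun x y => by simp only [BMap.id_apply, oleft_form, one_mul]
  exact DFunLike.congr_fun h ω

theorem oright_one (ω : Omega1 R) : oright R ω 1 = ω := by
  have h : (oright R).flip 1 = BMap.id _ :=
    omega_ext fun x y => by simp [rmul_apply]
  exact DFunLike.congr_fun h ω

theorem oleft_oright (z w : Unitization ℂ R) (ω : Omega1 R) :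
    oleft R z (oright R ω w) = oright R (oleft R z ω) w := by
  have h : (oleft R z).comp ((oright R).flip w) = ((oright R).flip w).comp (oleft R z) :=
    omega_ext fun x y => by
      simp only [BMap.comp_apply, BMap.flip_apply, oright_form, oleft_form, map_sub, mul_assoc]
  exact DFunLike.congr_fun h ω

theorem rmul_rmul (z w : Unitization ℂ R) (y : R) : rmul R w (rmul R z y) = rmul R (z * w) y := by
  simp only [rmul_apply, Unitization.fst_mul, Unitization.snd_mul, smul_add, mul_add, add_mul,
    smul_mul_assoc, mul_smul_comm, mul_assoc, smul_smul]
  rw [mul_comm w.fst]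
  abel

/-- The right action is dictated by the Leibniz rule. Acting by z and then by w creates the term in
(xy)z dw twice, once from each action, and what remains is the action of zw. -/
theorem oright_oright (z w : Unitization ℂ R) (ω : Omega1 R) :
    oright R (oright R ω z) w = oright R ω (z * w) := by
  have h : ((oright R).flip w).comp ((oright R).flip z) = (oright R).flip (z * w) :=
    omega_ext fun x y => by
      simp only [BMap.comp_apply, BMap.flip_apply, oright_form, map_sub, rmul_rmul,
        Unitization.snd_mul, map_add, map_smul]
      have e1 : ((par R (rmul R z y) : R) : Unitization ℂ R) = z.fst • ((par R y : R) : Unitization ℂ R)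
          + ((par R y : R) : Unitization ℂ R) * ((par R z.snd : R) : Unitization ℂ R) := by
        rw [rmul_apply, map_add, map_smul, par_mul, Unitization.inr_add, Unitization.inr_smul,
          Unitization.inr_mul]
      rw [e1, mul_add, mul_smul_comm, map_add, map_smul, BMap.add_apply, BMap.smul_apply,
        rmul_apply w z.snd, map_add, map_smul, mul_assoc]
      abel
  exact DFunLike.congr_fun h ω

theorem odif_odif (ω : Omega1 R) : odif R (odif R ω) = 0 := by
  have h : (odif R).comp (odif R) = 0 :=
    omega_ext fun x y => by
      have e : ∀ x : Unitization ℂ R, udif R (udif R x) = 0 := fun x => by simp [dif_dif]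
      simp only [BMap.comp_apply, odif_form, map_sub, e, dif_dif, udif_par, map_neg, map_zero,
        BMap.neg_apply, BMap.zero_apply]
      abel
  exact DFunLike.congr_fun h ω

/-- The right module structure is built so that this holds. The scalar part of y survives only as a
multiple of dx, because d1 = 0. -/
theorem dform_mul (x y : Unitization ℂ R) :
    dform R (x * y) = oright R (dform R x) y + oleft R (par _ x) (dform R y) := by
  rw [dform_apply, dform_apply, dform_apply, oright_form, ← form_eq_oleft]
  simp only [one_mul, rmul_apply, Unitization.snd_mul, map_add, map_smul, par_unit]
  have e : (Unitization.inl x.fst : Unitization ℂ R) = x.fst • 1 := by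
    refine Unitization.ext ?_ ?_ <;> simp
  rw [e, map_smul, BMap.add_apply, BMap.smul_apply]
  abel

theorem dform_par (x : Unitization ℂ R) : dform R (par _ x) = -par _ (dform R x) := by
  rw [dform_apply, dform_apply, par_snd, par_form, neg_neg]
  have : par (Unitization ℂ R) 1 = 1 := by
    rw [par_unit]; refine Unitization.ext ?_ ?_ <;> simp
  rw [this]

theorem odif_dform (x : Unitization ℂ R) : odif R (dform R x) = -dform R (udif R x) := by
  have h1 : par (Unitization ℂ R) 1 = 1 := by
    rw [par_unit]; refine Unitization.ext ?_ ?_ <;> simp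
  have h2 : udif R (1 : Unitization ℂ R) = 0 := by simp
  rw [dform_apply, dform_apply, odif_form, h1, h2, map_zero, udif_apply, Unitization.snd_inr]
  simp

variable (R) in
/-- Forms of degree at most one over `R`, a square zero extension of the unitalization of `R`. -/
def FormAlg : Type u := Unitization ℂ R × Omega1 R

instance : GCB (FormAlg R) := inferInstanceAs (GCB (Unitization ℂ R × Omega1 R))

variable (R) in
/-- The inclusion of the forms of degree zero. -/
def fun0 : Unitization ℂ R ⟹ FormAlg R := pairB (BMap.id _) 0
variable (R) in
/-- The inclusion of the forms of degree one. -/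
def form1 : Omega1 R ⟹ FormAlg R := pairB 0 (BMap.id _)
variable (R) in
/-- The component of degree zero. -/
def deg0 : FormAlg R ⟹ Unitization ℂ R := fstB _ _
variable (R) in
/-- The component of degree one. -/
def deg1 : FormAlg R ⟹ Omega1 R := sndB _ _

theorem formAlg_ext {x y : FormAlg R} (h0 : deg0 R x = deg0 R y) (h1 : deg1 R x = deg1 R y) :
    x = y := Prod.ext h0 h1

@[simp] theorem deg0_fun0 (x : Unitization ℂ R) : deg0 R (fun0 R x) = x := rfl
@[simp] theorem deg1_fun0 (x : Unitization ℂ R) : deg1 R (fun0 R x) = 0 := rfl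
@[simp] theorem deg0_form1 (ω : Omega1 R) : deg0 R (form1 R ω) = 0 := rfl
@[simp] theorem deg1_form1 (ω : Omega1 R) : deg1 R (form1 R ω) = ω := rfl
@[simp] theorem deg0_par (x : FormAlg R) : deg0 R (par _ x) = par _ (deg0 R x) := rfl
@[simp] theorem deg1_par (x : FormAlg R) : deg1 R (par _ x) = par _ (deg1 R x) := rfl

variable (R) in
/-- The product of forms of degree at most one. -/
def formMul : FormAlg R ⟹ FormAlg R ⟹ FormAlg R :=
  BMap.post (fun0 R) ((umul R).bi (deg0 R) (deg0 R)) +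
  BMap.post (form1 R) ((oleft R).bi (deg0 R) (deg1 R) + (oright R).bi (deg1 R) (deg0 R))

theorem deg0_formMul (x y : FormAlg R) : deg0 R (formMul R x y) = deg0 R x * deg0 R y := by
  simp [formMul]
theorem deg1_formMul (x y : FormAlg R) : deg1 R (formMul R x y) =
    oleft R (deg0 R x) (deg1 R y) + oright R (deg1 R x) (deg0 R y) := by
  simp [formMul]

variable (R) in
/-- The differential `δ` on forms of degree at most one. -/
def formDif : FormAlg R ⟹ FormAlg R :=
  (fun0 R).comp ((udif R).comp (deg0 R)) + (form1 R).comp ((odif R).comp (deg1 R))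

theorem deg0_formDif (x : FormAlg R) : deg0 R (formDif R x) = udif R (deg0 R x) := by
  simp only [formDif, BMap.add_apply, BMap.comp_apply, map_add, deg0_fun0, deg0_form1, add_zero]
theorem deg1_formDif (x : FormAlg R) : deg1 R (formDif R x) = odif R (deg1 R x) := by
  simp only [formDif, BMap.add_apply, BMap.comp_apply, map_add, deg1_fun0, deg1_form1, zero_add]

theorem formMul_assoc (x y z : FormAlg R) :
    formMul R (formMul R x y) z = formMul R x (formMul R y z) := by
  refine formAlg_ext ?_ ?_
  · simp only [deg0_formMul, mul_assoc]
  · simp only [deg0_formMul, deg1_formMul, map_add, oleft_oleft, BMap.add_apply, oright_oright,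
      oleft_oright]
    abel

theorem par_formMul (x y : FormAlg R) :
    par _ (formMul R x y) = formMul R (par _ x) (par _ y) := by
  refine formAlg_ext ?_ ?_
  · simp only [deg0_formMul, deg0_par, upar_mul]
  · simp only [deg1_formMul, deg1_par, deg0_par, map_add, par_oleft, par_oright]

theorem formDif_par (x : FormAlg R) : formDif R (par _ x) = -par _ (formDif R x) := by
  refine formAlg_ext ?_ ?_
  · rw [map_neg, deg0_par, deg0_formDif, deg0_formDif, deg0_par, udif_par]
  · rw [map_neg, deg1_par, deg1_formDif, deg1_formDif, deg1_par, odif_par]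

theorem formDif_formMul (x y : FormAlg R) : formDif R (formMul R x y) =
    formMul R (formDif R x) y + formMul R (par _ x) (formDif R y) := by
  refine formAlg_ext ?_ ?_
  · simp only [map_add, deg0_formDif, deg0_formMul, deg0_par, udif_mul]
  · simp only [map_add, deg1_formDif, deg1_formMul, deg0_par, deg1_par, deg0_formDif, odif_oleft,
      odif_oright]
    abel

theorem formDif_formDif (x : FormAlg R) : formDif R (formDif R x) = 0 := by
  refine formAlg_ext ?_ ?_
  · rw [deg0_formDif, deg0_formDif, map_zero]; simp [dif_dif]
  · rw [deg1_formDif, deg1_formDif, odif_odif, map_zero]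

instance : DGBAlg (FormAlg R) where
  mul u v := formMul R u v
  left_distrib u v w := map_add (formMul R u) v w
  right_distrib u v w := by
    change formMul R (u + v) w = formMul R u w + formMul R v w
    rw [map_add]; rfl
  zero_mul u := by
    change formMul R 0 u = 0
    rw [map_zero]; rfl
  mul_zero u := map_zero (formMul R u)
  mul_assoc := formMul_assoc
  smul_mul_assoc' c u v := by
    change formMul R (c • u) v = c • formMul R u v
    rw [map_smul]; rfl
  mul_smul_comm' c u v := map_smul (formMul R u) c v
  mul_bdd S T hS hT := (formMul R).bdd₂ hS hT
  eps_mul := par_formMul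
  diff := (formDif R).1
  diff_bdd := fun _ hS => (formDif R).bdd hS
  diff_eps := formDif_par
  diff_mul := formDif_formMul
  diff_diff := formDif_formDif

@[simp] theorem deg0_mul (x y : FormAlg R) : deg0 R (x * y) = deg0 R x * deg0 R y :=
  deg0_formMul x y
@[simp] theorem deg1_mul (x y : FormAlg R) : deg1 R (x * y) =
    oleft R (deg0 R x) (deg1 R y) + oright R (deg1 R x) (deg0 R y) := deg1_formMul x y
@[simp] theorem deg0_dif (x : FormAlg R) : deg0 R (dif _ x) = udif R (deg0 R x) := deg0_formDif x
@[simp] theorem deg1_dif (x : FormAlg R) : deg1 R (dif _ x) = odif R (deg1 R x) := deg1_formDif x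

variable (R) in
/-- The differential `d` on forms of degree at most one, with values in the forms of degree one. -/
def formD : FormAlg R ⟹ FormAlg R := (form1 R).comp ((dform R).comp (deg0 R))

@[simp] theorem deg0_formD (x : FormAlg R) : deg0 R (formD R x) = 0 := rfl
@[simp] theorem deg1_formD (x : FormAlg R) : deg1 R (formD R x) = dform R (deg0 R x) := rfl

theorem formD_mul (x y : FormAlg R) :
    formD R (x * y) = formD R x * y + par _ x * formD R y := by
  refine formAlg_ext ?_ ?_ <;> simp [dform_mul, -par_unit, add_comm]

theorem formD_par (x : FormAlg R) : formD R (par _ x) = -par _ (formD R x) := by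
  refine formAlg_ext ?_ ?_ <;> simp [dform_par, -par_unit]

theorem formD_formD (x : FormAlg R) : formD R (formD R x) = 0 := by
  refine formAlg_ext ?_ ?_ <;> simp

theorem dif_formD (x : FormAlg R) : dif _ (formD R x) = -formD R (dif _ x) := by
  refine formAlg_ext ?_ ?_ <;> simp [odif_dform, -udif_apply]

@[simp] theorem fun0_mul (x y : Unitization ℂ R) : fun0 R (x * y) = fun0 R x * fun0 R y := by
  refine formAlg_ext ?_ ?_ <;> simp

theorem fun0_one_mul (x : FormAlg R) : fun0 R 1 * x = x := by
  refine formAlg_ext ?_ ?_ <;> simp [oleft_one]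

theorem mul_fun0_one (x : FormAlg R) : x * fun0 R 1 = x := by
  refine formAlg_ext ?_ ?_ <;> simp [oright_one]

theorem form1_oleft (x : Unitization ℂ R) (ω : Omega1 R) :
    form1 R (oleft R x ω) = fun0 R x * form1 R ω := by
  refine formAlg_ext ?_ ?_ <;> simp

theorem form1_oright (x : Unitization ℂ R) (ω : Omega1 R) :
    form1 R (oright R ω x) = form1 R ω * fun0 R x := by
  refine formAlg_ext ?_ ?_ <;> simp

theorem form1_dform (x : Unitization ℂ R) : form1 R (dform R x) = formD R (fun0 R x) := rfl

theorem par_fun0 (x : Unitization ℂ R) : par _ (fun0 R x) = fun0 R (par _ x) :=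
  formAlg_ext rfl (by rw [deg1_par, deg1_fun0, map_zero, deg1_fun0])
theorem par_form1 (x : Omega1 R) : par _ (form1 R x) = form1 R (par _ x) :=
  formAlg_ext (by rw [deg0_par, deg0_form1, map_zero, deg0_form1]) rfl
theorem dif_fun0 (x : Unitization ℂ R) : dif _ (fun0 R x) = fun0 R (udif R x) :=
  formAlg_ext (by simp only [deg0_dif, deg0_fun0]) (by rw [deg1_dif, deg1_fun0, map_zero, deg1_fun0])

theorem par_one : par (Unitization ℂ R) 1 = 1 := by
  rw [par_unit]; refine Unitization.ext ?_ ?_ <;> simp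

theorem udif_one : udif R (1 : Unitization ℂ R) = 0 := by simp

theorem dform_one : dform R (1 : Unitization ℂ R) = 0 := by
  rw [dform_apply, Unitization.snd_one, map_zero]

/-! ### The trace on forms -/

theorem nat_oleft_inr {z : R} {p q : ℕ} {ω : Omega1 R} (hz : HasDeg z p) (hω : HasDeg ω q) :
    nat R (oleft R z ω) = (-1 : ℂ) ^ (p * q) • nat R (oright R ω z) := by
  have := nat_eq_zero ⟨p, q, z, ω, hz, hω, rfl⟩
  rwa [map_sub, map_smul, sub_eq_zero] at this

theorem hasDeg_of_even {E : Type u} [GCB E] {x : E} (h : par E x = x) : HasDeg x 0 := by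
  rw [HasDeg, h, pow_zero, one_smul]

theorem hasDeg_of_odd {E : Type u} [GCB E] {x : E} (h : par E x = -x) : HasDeg x 1 := by
  rw [HasDeg, h, pow_one, neg_one_smul]

/-- The relations defining ♮ involve homogeneous elements of R only; the unit acts trivially on both
sides, and linearity does the rest. Against an even form no sign appears whatever the parity of x;
against an odd form the sign is that of x, which is why `par` enters in the odd counterpart. -/
theorem nat_oleft_of_form_even {ω : Omega1 R} (hω : par _ ω = ω) (x : Unitization ℂ R) :
    nat R (oleft R x ω) = nat R (oright R ω x) := by
  have key : ∀ y : R, nat R (oleft R y ω) = nat R (oright R ω y) := by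
    refine parity_induct (f := (nat R).comp ((oleft R).flip ω |>.comp (uinr R)))
      (g := (nat R).comp ((oright R ω).comp (uinr R))) (fun y hy => ?_) (fun y hy => ?_)
    · simpa using nat_oleft_inr (hasDeg_of_even hy) (hasDeg_of_even hω)
    · simpa using nat_oleft_inr (hasDeg_of_odd hy) (hasDeg_of_even hω)
  have e : x = x.fst • 1 + (x.snd : Unitization ℂ R) := by
    refine Unitization.ext ?_ ?_ <;> simp
  rw [e]
  simp only [map_add, map_smul, BMap.add_apply, BMap.smul_apply, oleft_one, oright_one, key]

theorem nat_oleft_of_form_odd {ω : Omega1 R} (hω : par _ ω = -ω) (x : Unitization ℂ R) :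
    nat R (oleft R x ω) = nat R (oright R ω (par _ x)) := by
  have key : ∀ y : R, nat R (oleft R y ω) = nat R (oright R ω (par R y : R)) := by
    refine parity_induct (f := (nat R).comp ((oleft R).flip ω |>.comp (uinr R)))
      (g := (nat R).comp ((oright R ω).comp ((uinr R).comp (par R)))) (fun y hy => ?_)
      (fun y hy => ?_)
    · simpa [hy] using nat_oleft_inr (hasDeg_of_even hy) (hasDeg_of_odd hω)
    · simpa [hy] using nat_oleft_inr (hasDeg_of_odd hy) (hasDeg_of_odd hω)
  have e : x = x.fst • 1 + (x.snd : Unitization ℂ R) := by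
    refine Unitization.ext ?_ ?_ <;> simp
  rw [e]
  simp only [map_add, map_smul, BMap.add_apply, BMap.smul_apply, oleft_one, oright_one, key,
    par_one, par_inr]

theorem nat_oleft_even {z : Unitization ℂ R} (hz : par _ z = z) (ω : Omega1 R) :
    nat R (oleft R z ω) = nat R (oright R ω z) :=
  parity_induct (f := (nat R).comp (oleft R z)) (g := (nat R).comp ((oright R).flip z))
    (fun _ h => nat_oleft_of_form_even h z)
    (fun _ h => (nat_oleft_of_form_odd h z).trans (by rw [hz]; rfl)) ω

theorem nat_oleft_odd {z : Unitization ℂ R} (hz : par _ z = -z) (ω : Omega1 R) :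
    nat R (oleft R z ω) = nat R (oright R (par _ ω) z) :=
  parity_induct (f := (nat R).comp (oleft R z)) (g := (nat R).comp (((oright R).flip z).comp (par _)))
    (fun _ h => (nat_oleft_of_form_even h z).trans (by simp only [BMap.comp_apply, h]; rfl))
    (fun ω h => (nat_oleft_of_form_odd h z).trans (by
      simp only [BMap.comp_apply, h, hz, map_neg, BMap.flip_apply])) ω

variable (R) in
/-- The projection of forms to the augmented `X`-complex. -/
def natX : FormAlg R ⟹ XT R := pairB (deg0 R) ((nat R).comp (deg1 R))

variable (R) in
/-- The map `b̄` on the augmented `X`-complex. -/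
def bX : XT R ⟹ XT R := pairB ((bbar R).comp (sndB _ _)) 0

variable (R) in
/-- The map `♮d` on the augmented `X`-complex. -/
def dX : XT R ⟹ XT R := pairB 0 ((natd R).comp (fstB _ _))

variable (R) in
/-- The map `δ` on the augmented `X`-complex. -/
def deltaX : XT R ⟹ XT R := pairB ((udif R).comp (fstB _ _)) ((ndif R).comp (sndB _ _))

theorem XD_eq : XD R = bX R + dX R + deltaX R :=
  BMap.ext fun x => Prod.ext (by simp [XD, bX, dX, deltaX, add_comm])
    (by simp [XD, bX, dX, deltaX])

@[simp] theorem fst_natX (x : FormAlg R) : (natX R x).1 = deg0 R x := rfl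
@[simp] theorem snd_natX (x : FormAlg R) : (natX R x).2 = nat R (deg1 R x) := rfl
@[simp] theorem fst_bX (x : XT R) : (bX R x).1 = bbar R x.2 := rfl
@[simp] theorem snd_bX (x : XT R) : (bX R x).2 = 0 := rfl

@[simp] theorem bbar_nat (ω : Omega1 R) : bbar R (nat R ω) = hoch R ω := rfl
@[simp] theorem ndif_nat (ω : Omega1 R) : ndif R (nat R ω) = nat R (odif R ω) := rfl

theorem natX_par (x : FormAlg R) : natX R (par _ x) = par _ (natX R x) := rfl

theorem natX_formD (x : FormAlg R) : natX R (formD R x) = dX R (natX R x) := rfl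

theorem natX_dif (x : FormAlg R) : natX R (dif _ x) = deltaX R (natX R x) :=
  Prod.ext (deg0_dif x) (by rw [snd_natX, deg1_dif]; rfl)

theorem fst_eq_zero_of_odd {y : Unitization ℂ R} (hy : par _ y = -y) : y.fst = 0 := by
  have := congrArg (fun z : Unitization ℂ R => z.fst) hy
  simp only [par_unit, Unitization.fst_add, Unitization.fst_inl, Unitization.fst_inr, add_zero,
    Unitization.fst_neg] at this
  exact CharZero.eq_neg_self_iff.1 this

theorem hoch_oleft_dform_even (x : Unitization ℂ R) {y : Unitization ℂ R} (hy : par _ y = y) :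
    hoch R (oleft R x (dform R y)) = par _ x * y - y * par _ x := by
  have h := congrArg (fun z : Unitization ℂ R => z.snd) hy
  simp only [par_snd] at h
  rw [dform_apply, oleft_form, mul_one, hoch_even _ h]
  have e : y = y.fst • 1 + (y.snd : Unitization ℂ R) := by
    refine Unitization.ext ?_ ?_ <;> simp
  rw [e]
  simp only [mul_add, add_mul, mul_smul_comm, smul_mul_assoc, mul_one, one_mul, Unitization.snd_add,
    Unitization.snd_smul, Unitization.snd_one, smul_zero, zero_add, Unitization.snd_inr]
  abel

theorem hoch_oleft_dform_odd (x : Unitization ℂ R) {y : Unitization ℂ R} (hy : par _ y = -y) :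
    hoch R (oleft R x (dform R y)) = par _ x * y - y * x := by
  have h := congrArg (fun z : Unitization ℂ R => z.snd) hy
  simp only [par_snd, Unitization.snd_neg] at h
  rw [dform_apply, oleft_form, mul_one, hoch_odd _ h]
  have e : y = (y.snd : Unitization ℂ R) := by
    refine Unitization.ext ?_ ?_ <;> simp [fst_eq_zero_of_odd hy]
  rw [← e]

/-- In degree zero this is the definition of b̄. In degree one the right side is zero, and the left
side is a commutator of a function with a one-form, which ♮ kills. Only y needs a parity. -/
theorem natX_comm_even (x : FormAlg R) {y : FormAlg R} (hy : par _ y = y) :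
    natX R (x * y - y * x) = bX R (natX R (par _ x * formD R y)) := by
  have h0 := congrArg (deg0 R) hy
  have h1 := congrArg (deg1 R) hy
  rw [deg0_par] at h0
  rw [deg1_par] at h1
  refine Prod.ext ?_ ?_
  · change deg0 R (x * y - y * x) = hoch R (deg1 R (par _ x * formD R y))
    simp only [map_sub, deg0_mul, deg1_mul, deg0_par, deg1_formD,
      deg0_formD, map_zero, add_zero, hoch_oleft_dform_even _ h0, par_par]
  · change nat R (deg1 R (x * y - y * x)) = 0
    simp only [map_sub, deg1_mul, map_add, nat_oleft_of_form_even h1,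
      nat_oleft_even h0]
    abel

theorem natX_comm_odd (x : FormAlg R) {y : FormAlg R} (hy : par _ y = -y) :
    natX R (x * y - y * par _ x) = bX R (natX R (par _ x * formD R y)) := by
  have h0 := congrArg (deg0 R) hy
  have h1 := congrArg (deg1 R) hy
  rw [deg0_par, map_neg] at h0
  rw [deg1_par, map_neg] at h1
  refine Prod.ext ?_ ?_
  · change deg0 R (x * y - y * par _ x) = hoch R (deg1 R (par _ x * formD R y))
    simp only [map_sub, deg0_mul, deg1_mul, deg0_par, deg1_formD,
      deg0_formD, map_zero, add_zero, hoch_oleft_dform_odd _ h0, par_par]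
  · change nat R (deg1 R (x * y - y * par _ x)) = 0
    simp only [map_sub, deg1_mul, map_add, nat_oleft_of_form_odd h1,
      nat_oleft_odd h0, deg0_par, deg1_par, par_par]
    abel

theorem bX_bX (x : XT R) : bX R (bX R x) = 0 := Prod.ext (by simp) (by simp)

theorem xt_induct {G : Type u} [CB G] {f g : XT R ⟹ G} (h : ∀ x, f (natX R x) = g (natX R x))
    (x : XT R) : f x = g x := by
  obtain ⟨a, b⟩ := x
  obtain ⟨ω, rfl⟩ := BQuot.mk_surj (gcomms R) b
  exact h (a, ω)

theorem bX_par (x : XT R) : bX R (par _ x) = -par _ (bX R x) := by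
  have hh : ∀ ω : Omega1 R, hoch R (par _ ω) = -par _ (hoch R ω) := by
    have : (hoch R).comp (par _) = -(par _).comp (hoch R) := homog_ext fun x y hy => by
      simp only [BMap.comp_apply, BMap.neg_apply, par_form, map_neg]
      rcases hy with hy | hy
      · rw [hy, hoch_even _ hy, hoch_even _ hy, map_sub, upar_mul, upar_mul, par_inr, hy]
      · rw [hy, map_neg, map_neg, hoch_odd _ hy, hoch_odd _ hy, map_sub, upar_mul, upar_mul,
          par_inr, hy, Unitization.inr_neg]
        noncomm_ring
    exact DFunLike.congr_fun this
  refine xt_induct (f := (bX R).comp (par _)) (g := -(par _).comp (bX R)) (fun y => ?_) x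
  refine Prod.ext (hh (deg1 R y)) ?_
  change (0 : Omega1Nat R) = -par _ 0
  rw [map_zero, neg_zero]

theorem dX_par (x : XT R) : dX R (par _ x) = -par _ (dX R x) :=
  xt_induct (f := (dX R).comp (par _)) (g := -(par _).comp (dX R)) (fun y => by
    simp only [BMap.comp_apply, BMap.neg_apply]
    rw [← natX_par, ← natX_formD, ← natX_formD, formD_par, map_neg, natX_par]) x

theorem deltaX_par (x : XT R) : deltaX R (par _ x) = -par _ (deltaX R x) :=
  xt_induct (f := (deltaX R).comp (par _)) (g := -(par _).comp (deltaX R)) (fun y => by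
    simp only [BMap.comp_apply, BMap.neg_apply]
    rw [← natX_par, ← natX_dif, ← natX_dif, dif_par, map_neg, natX_par]) x

theorem formAlg_eq (x : FormAlg R) : x = fun0 R (deg0 R x) + form1 R (deg1 R x) :=
  formAlg_ext (by rw [map_add, deg0_fun0, deg0_form1, add_zero])
    (by rw [map_add, deg1_fun0, deg1_form1, zero_add])

theorem form1_form (x : Unitization ℂ R) (y : R) :
    form1 R (form R x y) = fun0 R x * formD R (fun0 R y) := by
  rw [← form1_dform, dform_inr, ← form1_oleft, ← form_eq_oleft]

/-- Two maps on the augmented `X`-complex agree if they agree on `x` and on `♮ x dy` for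
homogeneous `y`. -/
theorem xt_induct' {G : Type u} [CB G] {f g : XT R ⟹ G}
    (h0 : ∀ x, f (natX R (fun0 R x)) = g (natX R (fun0 R x)))
    (h1 : ∀ x (y : R), (par _ y = y ∨ par _ y = -y) →
      f (natX R (fun0 R x * formD R (fun0 R y))) = g (natX R (fun0 R x * formD R (fun0 R y))))
    (x : XT R) : f x = g x := by
  refine xt_induct (fun y => ?_) x
  have e : (f.comp ((natX R).comp (form1 R))) = g.comp ((natX R).comp (form1 R)) :=
    homog_ext fun x y hy => by
      simp only [BMap.comp_apply]
      rw [form1_form]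
      exact h1 x y hy
  rw [formAlg_eq y, map_add, map_add, map_add, h0]
  exact congrArg _ (DFunLike.congr_fun e (deg1 R y))

theorem bX_natX_fun0 (x : Unitization ℂ R) : bX R (natX R (fun0 R x)) = 0 := by
  refine Prod.ext ?_ rfl
  rw [fst_bX, snd_natX, deg1_fun0, map_zero, map_zero]; rfl

theorem par_uinr_cases {y : R} (hy : par _ y = y ∨ par _ y = -y) :
    par _ (fun0 R (y : Unitization ℂ R)) = fun0 R y ∨
      par _ (fun0 R (y : Unitization ℂ R)) = -fun0 R y := by
  rw [par_fun0, par_inr]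
  rcases hy with hy | hy
  · exact Or.inl (by rw [hy])
  · exact Or.inr (by rw [hy, Unitization.inr_neg, map_neg])

/-- The element b̄♮(x dy) is a commutator, and d of a commutator of functions is a sum of
commutators of a function with a one-form, which vanish under ♮. -/
theorem dX_bX (x : XT R) : dX R (bX R x) = 0 := by
  refine xt_induct' (f := (dX R).comp (bX R)) (g := 0) (fun x => ?_) (fun x y hy => ?_) x
  · rw [BMap.comp_apply, bX_natX_fun0, map_zero]; rfl
  simp only [BMap.comp_apply, BMap.zero_apply]
  -- With x replaced by `par x` the form is exactly the one in the commutator formulas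
  -- `natX_comm_even` and `natX_comm_odd`.
  obtain ⟨x, rfl⟩ : ∃ x', x = par _ x' := ⟨par _ x, (par_par x).symm⟩
  rw [← par_fun0]
  set X := fun0 R x
  set Y := fun0 R (y : Unitization ℂ R)
  have hDY : ∀ z : FormAlg R, natX R (z * formD R Y) = natX R (z * formD R Y) := fun _ => rfl
  -- Products of two one-forms are zero, so the commutator formulas have no boundary term when one
  -- entry is exact.
  have hb : ∀ u v : FormAlg R, bX R (natX R (par _ (formD R u) * formD R v)) = 0 := by
    intro u v
    have : par _ (formD R u) * formD R v = 0 := by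
      refine formAlg_ext ?_ ?_ <;> simp
    rw [this, map_zero, map_zero]
  rcases par_uinr_cases hy with hy | hy
  · rw [← natX_comm_even _ hy, ← natX_formD, map_sub, formD_mul, formD_mul, hy]
    have e1 := natX_comm_even (formD R X) hy
    have e2 : par _ (formD R Y) = -formD R Y := by
      rw [← neg_eq_iff_eq_neg, ← formD_par, hy]
    have e3 := natX_comm_odd (par _ X) e2
    rw [formD_formD, mul_zero, map_zero, map_zero, par_par, map_sub, sub_eq_zero] at e3
    rw [hb, map_sub, sub_eq_zero] at e1
    rw [map_sub, map_add, map_add, e1, e3]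
    abel
  · rw [← natX_comm_odd _ hy, ← natX_formD, map_sub, formD_mul, formD_mul, hy]
    have e1 := natX_comm_odd (formD R X) hy
    have e2 : par _ (formD R Y) = formD R Y := by
      rw [← neg_inj, ← formD_par, hy, map_neg]
    have e3 := natX_comm_even (par _ X) e2
    rw [formD_formD, mul_zero, map_zero, map_zero, map_sub, sub_eq_zero] at e3
    rw [hb, map_sub, sub_eq_zero] at e1
    rw [map_sub, map_add, map_add, e1, e3, formD_par, mul_neg, neg_mul, map_neg, map_neg]
    abel

/-- Since b̄♮(x dy) is a commutator and δ is an odd derivation, δ of it is the sum of the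
commutators of δx with y and of x with δy; these are again boundaries. The sign comes from δ
anticommuting with d. -/
theorem bX_deltaX (x : XT R) : bX R (deltaX R x) = -deltaX R (bX R x) := by
  refine xt_induct' (f := (bX R).comp (deltaX R)) (g := -(deltaX R).comp (bX R)) (fun x => ?_)
    (fun x y hy => ?_) x
  · rw [BMap.comp_apply, ← natX_dif, dif_fun0, bX_natX_fun0, BMap.neg_apply, BMap.comp_apply,
      bX_natX_fun0, map_zero, neg_zero]
  simp only [BMap.comp_apply, BMap.neg_apply]
  obtain ⟨x, rfl⟩ : ∃ x', x = par _ x' := ⟨par _ x, (par_par x).symm⟩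
  rw [← par_fun0]
  set X := fun0 R x
  set Y := fun0 R (y : Unitization ℂ R)
  have e0 : dif _ (par _ X * formD R Y) =
      -(par _ (dif _ X) * formD R Y) - par _ (par _ X) * formD R (dif _ Y) := by
    rw [dif_mul, dif_par, dif_formD, mul_neg, neg_mul]; abel
  rcases par_uinr_cases hy with hy | hy
  · have hdy : par _ (dif _ Y) = -dif _ Y := by rw [← neg_eq_iff_eq_neg, ← dif_par, hy]
    rw [← natX_comm_even _ hy, ← natX_dif, ← natX_dif, e0, map_sub, map_sub, map_neg, map_neg,
      ← natX_comm_even _ hy, ← natX_comm_odd _ hdy, map_sub (dif _), dif_mul, dif_mul, par_par, hy,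
      ← map_neg, ← map_neg, ← map_sub]
    congr 1; abel
  · have hdy : par _ (dif _ Y) = dif _ Y := by rw [← neg_inj, ← dif_par, hy, map_neg]
    rw [← natX_comm_odd _ hy, ← natX_dif, ← natX_dif, e0, map_sub, map_sub, map_neg, map_neg,
      ← natX_comm_odd _ hy, ← natX_comm_even _ hdy, map_sub (dif _), dif_mul, dif_mul, hy, dif_par,
      ← map_neg, ← map_neg, ← map_sub]
    congr 1
    simp only [neg_mul, mul_neg]
    abel

end formalg

/-! ### Forms over a pair of algebras -/

section pairforms
variable {R₁ R₂ : Type u} [DGBAlg R₁] [DGBAlg R₂]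

variable (R₁ R₂) in
/-- The DG algebra of forms of degree at most one in each of the two directions. -/
def BiForm : Type u := FormAlg R₁ ⊗̂ FormAlg R₂

instance : DGBAlg (BiForm R₁ R₂) := inferInstanceAs (DGBAlg (FormAlg R₁ ⊗̂ FormAlg R₂))

/-- The biform `x ⊗ y`. -/
def bt : FormAlg R₁ ⟹ FormAlg R₂ ⟹ BiForm R₁ R₂ := tmul (FormAlg R₁) (FormAlg R₂)

section
variable {G : Type u} [CB G]

theorem bt_induct (f g : BiForm R₁ R₂ ⟹ G) (h : ∀ x y, f (bt x y) = g (bt x y))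
    (z : BiForm R₁ R₂) : f z = g z := tensor_induct (E := FormAlg R₁) (F := FormAlg R₂) f g h z

theorem bt_induct_left (f g : BiForm R₁ R₂ ⟹ G)
    (h : ∀ x y, (par _ x = x ∨ par _ x = -x) → f (bt x y) = g (bt x y)) (z : BiForm R₁ R₂) :
    f z = g z := tensor_induct_left (E := FormAlg R₁) (F := FormAlg R₂) f g h z

theorem bt_induct_homog (f g : BiForm R₁ R₂ ⟹ G)
    (h : ∀ x y, (par _ x = x ∨ par _ x = -x) → (par _ y = y ∨ par _ y = -y) →
      f (bt x y) = g (bt x y)) (z : BiForm R₁ R₂) : f z = g z :=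
  tensor_induct_homog (E := FormAlg R₁) (F := FormAlg R₂) f g h z

end

theorem bt_mul_even (x₁ : FormAlg R₁) (x₂ : FormAlg R₂) {y₁ : FormAlg R₁} (y₂ : FormAlg R₂)
    (h : par _ y₁ = y₁) : bt x₁ x₂ * bt y₁ y₂ = bt (x₁ * y₁) (x₂ * y₂) := tmul_mul_even _ _ _ h
theorem bt_mul_odd (x₁ : FormAlg R₁) (x₂ : FormAlg R₂) {y₁ : FormAlg R₁} (y₂ : FormAlg R₂)
    (h : par _ y₁ = -y₁) : bt x₁ x₂ * bt y₁ y₂ = bt (x₁ * y₁) (par _ x₂ * y₂) :=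
  tmul_mul_odd _ _ _ h
@[simp] theorem par_bt (x : FormAlg R₁) (y : FormAlg R₂) :
    par _ (bt x y) = bt (par _ x) (par _ y) := par_tmul x y
theorem dif_bt (x : FormAlg R₁) (y : FormAlg R₂) :
    dif _ (bt x y) = bt (dif _ x) y + bt (par _ x) (dif _ y) := by
  have h : dif (FormAlg R₁ ⊗̂ FormAlg R₂) (tmul _ _ x y) =
      tmul _ _ (dif _ x) y + tmul _ _ (par _ x) (dif _ y) := by
    simp [tensor_dif_def, on₁, on₂]
  exact h

/-- The derivation `d₁` of the biforms. -/
def bd₁ : BiForm R₁ R₂ ⟹ BiForm R₁ R₂ := on₁ (FormAlg R₂) (formD R₁)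
/-- The derivation `d₂` of the biforms. -/
def bd₂ : BiForm R₁ R₂ ⟹ BiForm R₁ R₂ := on₂ (FormAlg R₁) (formD R₂)
/-- The components of the biforms. -/
def e00 : T00 R₁ R₂ ⟹ BiForm R₁ R₂ := tmap (fun0 R₁) (fun0 R₂)
def e10 : T10 R₁ R₂ ⟹ BiForm R₁ R₂ := tmap (form1 R₁) (fun0 R₂)
def e01 : T01 R₁ R₂ ⟹ BiForm R₁ R₂ := tmap (fun0 R₁) (form1 R₂)
def e11 : T11 R₁ R₂ ⟹ BiForm R₁ R₂ := tmap (form1 R₁) (form1 R₂)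

@[simp] theorem bd₁_bt (x : FormAlg R₁) (y : FormAlg R₂) : bd₁ (bt x y) = bt (formD _ x) y :=
  tmap_tmul _ _ _ _
@[simp] theorem bd₂_bt (x : FormAlg R₁) (y : FormAlg R₂) :
    bd₂ (bt x y) = bt (par _ x) (formD _ y) := tmap_tmul _ _ _ _
@[simp] theorem e00_tmul (x : Unitization ℂ R₁) (y : Unitization ℂ R₂) :
    e00 (tmul _ _ x y) = bt (fun0 _ x) (fun0 _ y) := tmap_tmul _ _ _ _
@[simp] theorem e10_tmul (x : Omega1 R₁) (y : Unitization ℂ R₂) :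
    e10 (tmul _ _ x y) = bt (form1 _ x) (fun0 _ y) := tmap_tmul _ _ _ _
@[simp] theorem e01_tmul (x : Unitization ℂ R₁) (y : Omega1 R₂) :
    e01 (tmul _ _ x y) = bt (fun0 _ x) (form1 _ y) := tmap_tmul _ _ _ _
@[simp] theorem e11_tmul (x : Omega1 R₁) (y : Omega1 R₂) :
    e11 (tmul _ _ x y) = bt (form1 _ x) (form1 _ y) := tmap_tmul _ _ _ _

/-- The projection to the tensor product of the `X`-complexes. -/
def natXX : BiForm R₁ R₂ ⟹ XX R₁ R₂ := tmap (natX R₁) (natX R₂)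
@[simp] theorem natXX_bt (x : FormAlg R₁) (y : FormAlg R₂) :
    natXX (bt x y) = tmul _ _ (natX _ x) (natX _ y) := tmap_tmul _ _ _ _
/-- The components of the total differential. -/
def xb₁ : XX R₁ R₂ ⟹ XX R₁ R₂ := on₁ _ (bX R₁)
def xb₂ : XX R₁ R₂ ⟹ XX R₁ R₂ := on₂ _ (bX R₂)
def xd₁ : XX R₁ R₂ ⟹ XX R₁ R₂ := on₁ _ (dX R₁)
def xd₂ : XX R₁ R₂ ⟹ XX R₁ R₂ := on₂ _ (dX R₂)
def xdelta : XX R₁ R₂ ⟹ XX R₁ R₂ := on₁ _ (deltaX R₁) + on₂ _ (deltaX R₂)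

theorem Dtot_apply (x : XX R₁ R₂) :
    Dtot x = xb₁ x + xb₂ x + (xd₁ x + xd₂ x) + xdelta x :=
  tensor_induct Dtot (xb₁ + xb₂ + (xd₁ + xd₂) + xdelta) (fun x y => by
    simp only [Dtot, xb₁, xb₂, xd₁, xd₂, xdelta, on₁, on₂, BMap.add_apply, tmap_tmul, XD_eq,
      map_add]
    abel) x

theorem bd₁_mul (u v : BiForm R₁ R₂) : bd₁ (u * v) = bd₁ u * v + par _ u * bd₁ v :=
  on₁_talg formD_mul formD_par u v
theorem bd₂_mul (u v : BiForm R₁ R₂) : bd₂ (u * v) = bd₂ u * v + par _ u * bd₂ v :=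
  on₂_talg formD_mul formD_par u v
theorem bd₁_par (u : BiForm R₁ R₂) : bd₁ (par _ u) = -par _ (bd₁ u) := on₁_par formD_par u
theorem bd₂_par (u : BiForm R₁ R₂) : bd₂ (par _ u) = -par _ (bd₂ u) := on₂_par formD_par u

theorem bd₁_bd₁ (u : BiForm R₁ R₂) : bd₁ (bd₁ u) = 0 :=
  bt_induct (bd₁.comp bd₁) 0 (fun x y => by
    simp [formD_formD]) u
theorem bd₂_bd₂ (u : BiForm R₁ R₂) : bd₂ (bd₂ u) = 0 :=
  bt_induct (bd₂.comp bd₂) 0 (fun x y => by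
    simp [formD_formD]) u
theorem bd₁_bd₂ (u : BiForm R₁ R₂) : bd₁ (bd₂ u) = -bd₂ (bd₁ u) :=
  bt_induct (bd₁.comp bd₂) (-bd₂.comp bd₁) (fun x y => by
    simp [formD_par]) u
theorem dif_bd₁ (u : BiForm R₁ R₂) : dif _ (bd₁ u) = -bd₁ (dif _ u) :=
  bt_induct ((dif _).comp bd₁) (-bd₁.comp (dif _)) (fun x y => by
    simp only [dif_bt, bd₁_bt, BMap.comp_apply, BMap.neg_apply, dif_formD, map_neg, map_add, formD_par]
    abel) u
theorem dif_bd₂ (u : BiForm R₁ R₂) : dif _ (bd₂ u) = -bd₂ (dif _ u) :=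
  bt_induct ((dif _).comp bd₂) (-bd₂.comp (dif _)) (fun x y => by
    simp only [dif_bt, bd₂_bt, BMap.comp_apply, BMap.neg_apply, dif_formD, map_neg, map_add, dif_par]
    abel) u

/-- The form dy has zero differential, so it can be moved around x inside ♮ with no boundary term.
The version with dy on the left is the one needed in the first tensor factor, where it has to stand
next to the second factor without crossing it. -/
theorem natX_comm_even_left (x : FormAlg R₁) {y : FormAlg R₁} (hy : par _ y = y) :
    natX R₁ (x * y) = natX R₁ (y * x) + bX R₁ (natX R₁ (formD R₁ y * x)) := by
  have h1 := natX_comm_even x hy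
  have h2 := natX_comm_odd (par _ x) (y := formD R₁ y) (by
    rw [← neg_eq_iff_eq_neg, ← formD_par, hy])
  rw [formD_formD, mul_zero, map_zero, map_zero, par_par, map_sub, sub_eq_zero] at h2
  rw [← h2, ← h1, map_sub]; abel

theorem natX_comm_odd_left (x : FormAlg R₁) {y : FormAlg R₁} (hy : par _ y = -y) :
    natX R₁ (x * y) = natX R₁ (y * par _ x) + bX R₁ (natX R₁ (formD R₁ y * par _ x)) := by
  have h1 := natX_comm_odd x hy
  have h2 := natX_comm_even (par _ x) (y := formD R₁ y) (by
    rw [← neg_inj, ← formD_par, hy, map_neg])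
  rw [formD_formD, mul_zero, map_zero, map_zero, map_sub, sub_eq_zero] at h2
  rw [← h2, ← h1, map_sub]; abel

theorem tmul_parity_even {E F : Type u} [GCB E] [GCB F] {x : E} {y : F}
    (h : (par E x = x ∧ par F y = y) ∨ (par E x = -x ∧ par F y = -y)) :
    par _ (tmul E F x y) = tmul E F x y := by
  rw [par_tmul]
  rcases h with ⟨h, k⟩ | ⟨h, k⟩ <;> simp [h, k]

theorem tmul_parity_odd {E F : Type u} [GCB E] [GCB F] {x : E} {y : F}
    (h : (par E x = x ∧ par F y = -y) ∨ (par E x = -x ∧ par F y = y)) :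
    par _ (tmul E F x y) = -tmul E F x y := by
  rw [par_tmul]
  rcases h with ⟨h, k⟩ | ⟨h, k⟩ <;> simp [h, k]

/-- Up to signs the commutator is x₁y₁ ⊗ [x₂, y₂] + [x₁, y₁] ⊗ y₂x₂. The second factors are
exchanged by `B` and the first ones by `A`; each exchange contributes one Hochschild boundary. -/
theorem natXX_comm_tmul_even (u : BiForm R₁ R₂) {y₁ : FormAlg R₁} {y₂ : FormAlg R₂}
    (h : (par _ y₁ = y₁ ∧ par _ y₂ = y₂) ∨ (par _ y₁ = -y₁ ∧ par _ y₂ = -y₂)) :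
    natXX (u * bt y₁ y₂ - bt y₁ y₂ * u) =
      xb₁ (natXX (bd₁ (bt y₁ y₂) * u)) + xb₂ (natXX (par _ u * bd₂ (bt y₁ y₂))) := by
  refine bt_induct_left (natXX.comp ((mulB _).flip (bt y₁ y₂) - mulB _ (bt y₁ y₂)))
    ((xb₁.comp natXX).comp (mulB _ (bd₁ (bt y₁ y₂))) +
      (xb₂.comp natXX).comp (((mulB _).flip (bd₂ (bt y₁ y₂))).comp (par _)))
    (fun x₁ x₂ hx => ?_) u
  simp only [BMap.comp_apply, mulB_apply, BMap.add_apply, BMap.sub_apply, BMap.flip_apply, bd₁_bt,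
    bd₂_bt, par_bt]
  rcases h with ⟨h₁, h₂⟩ | ⟨h₁, h₂⟩
  · have A := natX_comm_even_left x₁ h₁
    have B := natX_comm_even x₂ h₂
    rw [map_sub, sub_eq_iff_eq_add] at B
    have M : ∀ (w₁ : FormAlg R₁) (w₂ : FormAlg R₂), bt w₁ w₂ * bt y₁ y₂ = bt (w₁ * y₁) (w₂ * y₂) := fun w₁ w₂ =>
      bt_mul_even _ _ _ h₁
    have M' : ∀ (w₁ : FormAlg R₁) (w₂ : FormAlg R₂), bt w₁ w₂ * bt y₁ (formD R₂ y₂) =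
        bt (w₁ * y₁) (w₂ * formD R₂ y₂) := fun w₁ w₂ => bt_mul_even _ _ _ h₁
    rcases hx with hx | hx
    -- The parity of the first factor, which is the sign picked up by b̄₂ when it acts on the second
    -- factor.
    · have C : par _ (natX R₁ (x₁ * y₁)) = natX R₁ (x₁ * y₁) := by
        rw [← natX_par, par_mul, hx, h₁]
        try simp only [neg_mul, mul_neg, neg_neg, map_neg]
      have L : ∀ (w₁ : FormAlg R₁) (w₂ w : FormAlg R₂), bt w₁ w₂ * bt x₁ w = bt (w₁ * x₁) (w₂ * w) := fun w₁ w₂ w =>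
        bt_mul_even _ _ _ hx
      simp only [hx, h₁, M, M', L, natXX_bt, xb₁, xb₂, on₁, on₂, map_sub, tmap_tmul,
        BMap.id_apply, B, map_add, C]
      simp only [A, map_add, BMap.add_apply]
      abel
    · have C : par _ (natX R₁ (x₁ * y₁)) = -natX R₁ (x₁ * y₁) := by
        rw [← natX_par, par_mul, hx, h₁]
        try simp only [neg_mul, map_neg]
      have L : ∀ (w₁ : FormAlg R₁) (w₂ w : FormAlg R₂), bt w₁ w₂ * bt x₁ w = bt (w₁ * x₁) (par _ w₂ * w) := fun w₁ w₂ w =>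
        bt_mul_odd _ _ _ hx
      simp only [hx, h₁, h₂, M, M', L, natXX_bt, xb₁, xb₂, on₁, on₂, map_sub, tmap_tmul,
        BMap.id_apply, B, map_add, map_neg, C, neg_mul, neg_neg, BMap.neg_apply]
      simp only [A, map_add, BMap.add_apply]
      abel
  · have A := natX_comm_odd_left x₁ h₁
    have B := natX_comm_odd (par _ x₂) h₂
    rw [map_sub, sub_eq_iff_eq_add] at B
    have M : ∀ (w₁ : FormAlg R₁) (w₂ : FormAlg R₂), bt w₁ w₂ * bt y₁ y₂ = bt (w₁ * y₁) (par _ w₂ * y₂) := fun w₁ w₂ =>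
      bt_mul_odd _ _ _ h₁
    have M' : ∀ (w₁ : FormAlg R₁) (w₂ : FormAlg R₂), bt w₁ w₂ * bt y₁ (formD R₂ y₂) =
        bt (w₁ * y₁) (par _ w₂ * formD R₂ y₂) := fun w₁ w₂ => bt_mul_odd _ _ _ h₁
    rcases hx with hx | hx
    · have C : par _ (natX R₁ (x₁ * y₁)) = -natX R₁ (x₁ * y₁) := by
        rw [← natX_par, par_mul, hx, h₁]
        try simp only [mul_neg, map_neg]
      have L : ∀ (w₁ : FormAlg R₁) (w₂ w : FormAlg R₂), bt w₁ w₂ * bt x₁ w = bt (w₁ * x₁) (w₂ * w) := fun w₁ w₂ w =>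
        bt_mul_even _ _ _ hx
      simp only [hx, h₁, par_par, M, M', L, natXX_bt, xb₁, xb₂, on₁, on₂, map_sub, tmap_tmul,
        BMap.id_apply, B, map_add, map_neg, C, mul_neg, neg_neg, BMap.neg_apply]
      simp only [hx, A, map_add, BMap.add_apply]
      abel
    · have C : par _ (natX R₁ (x₁ * y₁)) = natX R₁ (x₁ * y₁) := by
        rw [← natX_par, par_mul, hx, h₁]
        try simp only [neg_mul, mul_neg, neg_neg]
      have L : ∀ (w₁ : FormAlg R₁) (w₂ w : FormAlg R₂), bt w₁ w₂ * bt x₁ w = bt (w₁ * x₁) (par _ w₂ * w) := fun w₁ w₂ w =>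
        bt_mul_odd _ _ _ hx
      simp only [hx, h₁, h₂, par_par, M, M', L, natXX_bt, xb₁, xb₂, on₁, on₂, map_sub, tmap_tmul,
        BMap.id_apply, B, map_add, map_neg, C, neg_mul, mul_neg, neg_neg, BMap.neg_apply]
      simp only [hx, A, map_add, map_neg, BMap.add_apply, BMap.neg_apply, mul_neg]
      abel

theorem natXX_comm_tmul_odd (u : BiForm R₁ R₂) {y₁ : FormAlg R₁} {y₂ : FormAlg R₂}
    (h : (par _ y₁ = y₁ ∧ par _ y₂ = -y₂) ∨ (par _ y₁ = -y₁ ∧ par _ y₂ = y₂)) :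
    natXX (u * bt y₁ y₂ - bt y₁ y₂ * par _ u) =
      xb₁ (natXX (bd₁ (bt y₁ y₂) * par _ u)) + xb₂ (natXX (par _ u * bd₂ (bt y₁ y₂))) := by
  refine bt_induct_left (natXX.comp ((mulB _).flip (bt y₁ y₂) - (mulB _ (bt y₁ y₂)).comp (par _)))
    ((xb₁.comp natXX).comp ((mulB _ (bd₁ (bt y₁ y₂))).comp (par _)) +
      (xb₂.comp natXX).comp (((mulB _).flip (bd₂ (bt y₁ y₂))).comp (par _)))
    (fun x₁ x₂ hx => ?_) u
  simp only [BMap.comp_apply, mulB_apply, BMap.add_apply, BMap.sub_apply, BMap.flip_apply, bd₁_bt,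
    bd₂_bt, par_bt]
  rcases h with ⟨h₁, h₂⟩ | ⟨h₁, h₂⟩
  · have A := natX_comm_even_left x₁ h₁
    have B := natX_comm_odd x₂ h₂
    rw [map_sub, sub_eq_iff_eq_add] at B
    have M : ∀ (w₁ : FormAlg R₁) (w₂ : FormAlg R₂), bt w₁ w₂ * bt y₁ y₂ = bt (w₁ * y₁) (w₂ * y₂) := fun w₁ w₂ =>
      bt_mul_even _ _ _ h₁
    have M' : ∀ (w₁ : FormAlg R₁) (w₂ : FormAlg R₂), bt w₁ w₂ * bt y₁ (formD R₂ y₂) =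
        bt (w₁ * y₁) (w₂ * formD R₂ y₂) := fun w₁ w₂ => bt_mul_even _ _ _ h₁
    rcases hx with hx | hx
    · have C : par _ (natX R₁ (x₁ * y₁)) = natX R₁ (x₁ * y₁) := by
        rw [← natX_par, par_mul, hx, h₁]
        try simp only [neg_mul, mul_neg, neg_neg, map_neg]
      have L : ∀ (w₁ : FormAlg R₁) (w₂ w : FormAlg R₂), bt w₁ w₂ * bt x₁ w = bt (w₁ * x₁) (w₂ * w) := fun w₁ w₂ w =>
        bt_mul_even _ _ _ hx
      simp only [hx, h₁, M, M', L, natXX_bt, xb₁, xb₂, on₁, on₂, map_sub, tmap_tmul,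
        BMap.id_apply, B, map_add, C]
      simp only [A, map_add, BMap.add_apply]
      abel
    · have C : par _ (natX R₁ (x₁ * y₁)) = -natX R₁ (x₁ * y₁) := by
        rw [← natX_par, par_mul, hx, h₁]
        try simp only [neg_mul, map_neg]
      have L : ∀ (w₁ : FormAlg R₁) (w₂ w : FormAlg R₂), bt w₁ w₂ * bt x₁ w = bt (w₁ * x₁) (par _ w₂ * w) := fun w₁ w₂ w =>
        bt_mul_odd _ _ _ hx
      simp only [hx, h₁, h₂, M, M', L, natXX_bt, xb₁, xb₂, on₁, on₂, map_sub, tmap_tmul,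
        BMap.id_apply, B, map_add, map_neg, C, neg_mul, mul_neg, neg_neg, BMap.neg_apply]
      simp only [A, map_add, BMap.add_apply]
      abel
  · have A := natX_comm_odd_left x₁ h₁
    have B := natX_comm_even (par _ x₂) h₂
    rw [map_sub, sub_eq_iff_eq_add] at B
    have M : ∀ (w₁ : FormAlg R₁) (w₂ : FormAlg R₂), bt w₁ w₂ * bt y₁ y₂ = bt (w₁ * y₁) (par _ w₂ * y₂) := fun w₁ w₂ =>
      bt_mul_odd _ _ _ h₁
    have M' : ∀ (w₁ : FormAlg R₁) (w₂ : FormAlg R₂), bt w₁ w₂ * bt y₁ (formD R₂ y₂) =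
        bt (w₁ * y₁) (par _ w₂ * formD R₂ y₂) := fun w₁ w₂ => bt_mul_odd _ _ _ h₁
    rcases hx with hx | hx
    · have C : par _ (natX R₁ (x₁ * y₁)) = -natX R₁ (x₁ * y₁) := by
        rw [← natX_par, par_mul, hx, h₁]
        try simp only [mul_neg, map_neg]
      have L : ∀ (w₁ : FormAlg R₁) (w₂ w : FormAlg R₂), bt w₁ w₂ * bt x₁ w = bt (w₁ * x₁) (w₂ * w) := fun w₁ w₂ w =>
        bt_mul_even _ _ _ hx
      simp only [hx, h₁, par_par, M, M', L, natXX_bt, xb₁, xb₂, on₁, on₂, map_sub, tmap_tmul,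
        BMap.id_apply, B, map_add, map_neg, C, mul_neg, neg_neg, BMap.neg_apply]
      simp only [hx, A, map_add, BMap.add_apply]
      abel
    · have C : par _ (natX R₁ (x₁ * y₁)) = natX R₁ (x₁ * y₁) := by
        rw [← natX_par, par_mul, hx, h₁]
        try simp only [neg_mul, mul_neg, neg_neg]
      have L : ∀ (w₁ : FormAlg R₁) (w₂ w : FormAlg R₂), bt w₁ w₂ * bt x₁ w = bt (w₁ * x₁) (par _ w₂ * w) := fun w₁ w₂ w =>
        bt_mul_odd _ _ _ hx
      simp only [hx, h₁, h₂, par_par, M, M', L, natXX_bt, xb₁, xb₂, on₁, on₂, map_sub, tmap_tmul,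
        BMap.id_apply, B, map_add, map_neg, C, neg_mul, mul_neg, neg_neg, BMap.neg_apply]
      simp only [hx, A, map_add, map_neg, BMap.add_apply, BMap.neg_apply, mul_neg]
      abel

/-- The graded commutator has a different shape for even and odd v, so v is split into its parts; by
linearity homogeneous tensors are enough. All trace properties of `natXX` are instances of this
formula in which boundary terms vanish. -/
theorem natXX_comm (u v : BiForm R₁ R₂) :
    natXX (u * v - evenB _ v * u - oddB _ v * par _ u) =
      xb₁ (natXX (bd₁ (evenB _ v) * u + bd₁ (oddB _ v) * par _ u)) +
        xb₂ (natXX (par _ u * bd₂ v)) := by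
  refine bt_induct_homog (natXX.comp (mulB _ u - ((mulB _).flip u).comp (evenB _) -
      ((mulB _).flip (par _ u)).comp (oddB _)))
    ((xb₁.comp natXX).comp (((mulB _).flip u).comp (bd₁.comp (evenB _)) +
      ((mulB _).flip (par _ u)).comp (bd₁.comp (oddB _))) +
      (xb₂.comp natXX).comp ((mulB _ (par _ u)).comp bd₂)) (fun y₁ y₂ h₁ h₂ => ?_) v
  simp only [BMap.comp_apply, mulB_apply, BMap.add_apply, BMap.sub_apply, BMap.flip_apply]
  have he : ∀ {v : BiForm R₁ R₂}, par _ v = v → natXX (u * v - v * u) =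
      xb₁ (natXX (bd₁ v * u)) + xb₂ (natXX (par _ u * bd₂ v)) →
      natXX (u * v - evenB _ v * u - oddB _ v * par _ u) =
      xb₁ (natXX (bd₁ (evenB _ v) * u + bd₁ (oddB _ v) * par _ u)) +
        xb₂ (natXX (par _ u * bd₂ v)) := fun hv h => by
    rw [evenB_of_even hv, oddB_of_even hv, map_zero, zero_mul, sub_zero, add_zero, h]
  have ho : ∀ {v : BiForm R₁ R₂}, par _ v = -v → natXX (u * v - v * par _ u) =
      xb₁ (natXX (bd₁ v * par _ u)) + xb₂ (natXX (par _ u * bd₂ v)) →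
      natXX (u * v - evenB _ v * u - oddB _ v * par _ u) =
      xb₁ (natXX (bd₁ (evenB _ v) * u + bd₁ (oddB _ v) * par _ u)) +
        xb₂ (natXX (par _ u * bd₂ v)) := fun hv h => by
    rw [evenB_of_odd hv, oddB_of_odd hv, map_zero, zero_mul, sub_zero, zero_add, h]
  rcases h₁ with h₁ | h₁ <;> rcases h₂ with h₂ | h₂
  · exact he (tmul_parity_even (Or.inl ⟨h₁, h₂⟩)) (natXX_comm_tmul_even u (Or.inl ⟨h₁, h₂⟩))
  · exact ho (tmul_parity_odd (Or.inl ⟨h₁, h₂⟩)) (natXX_comm_tmul_odd u (Or.inl ⟨h₁, h₂⟩))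
  · exact ho (tmul_parity_odd (Or.inr ⟨h₁, h₂⟩)) (natXX_comm_tmul_odd u (Or.inr ⟨h₁, h₂⟩))
  · exact he (tmul_parity_even (Or.inr ⟨h₁, h₂⟩)) (natXX_comm_tmul_even u (Or.inr ⟨h₁, h₂⟩))

theorem natXX_comm_even (u : BiForm R₁ R₂) {v : BiForm R₁ R₂} (hv : par _ v = v) :
    natXX (u * v) - natXX (v * u) = xb₁ (natXX (bd₁ v * u)) + xb₂ (natXX (par _ u * bd₂ v)) := by
  have h := natXX_comm u v
  rwa [evenB_of_even hv, oddB_of_even hv, map_zero, zero_mul, sub_zero, add_zero,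
    map_sub] at h

theorem natXX_comm_odd (u : BiForm R₁ R₂) {v : BiForm R₁ R₂} (hv : par _ v = -v) :
    natXX (u * v) - natXX (v * par _ u) =
      xb₁ (natXX (bd₁ v * par _ u)) + xb₂ (natXX (par _ u * bd₂ v)) := by
  have h := natXX_comm u v
  rwa [evenB_of_odd hv, oddB_of_odd hv, map_zero, zero_mul, sub_zero, zero_add,
    map_sub] at h

/-! ### The operators on the tensor product of the `X`-complexes -/

theorem natXX_bd₁ (u : BiForm R₁ R₂) : natXX (bd₁ u) = xd₁ (natXX u) :=
  bt_induct (natXX.comp bd₁) (xd₁.comp natXX) (fun x y => by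
    simp [xd₁, on₁, natX_formD]) u
theorem natXX_bd₂ (u : BiForm R₁ R₂) : natXX (bd₂ u) = xd₂ (natXX u) :=
  bt_induct (natXX.comp bd₂) (xd₂.comp natXX) (fun x y => by
    simp [xd₂, on₂, natX_formD, ← natX_par]) u
theorem natXX_dif (u : BiForm R₁ R₂) : natXX (dif _ u) = xdelta (natXX u) :=
  bt_induct (natXX.comp (dif _)) (xdelta.comp natXX) (fun x y => by
    simp [dif_bt, xdelta, on₁, on₂, natX_dif, ← natX_par]) u

theorem xd₁_xb₁ (x : XX R₁ R₂) : xd₁ (xb₁ x) = 0 :=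
  tensor_induct (xd₁.comp xb₁) 0 (fun x y => by simp [xb₁, xd₁, on₁, dX_bX]) x
theorem xd₂_xb₂ (x : XX R₁ R₂) : xd₂ (xb₂ x) = 0 :=
  tensor_induct (xd₂.comp xb₂) 0 (fun x y => by simp [xb₂, xd₂, on₂, dX_bX]) x
theorem xb₁_xb₁ (x : XX R₁ R₂) : xb₁ (xb₁ x) = 0 :=
  tensor_induct (xb₁.comp xb₁) 0 (fun x y => by simp [xb₁, on₁, bX_bX]) x
theorem xb₂_xb₂ (x : XX R₁ R₂) : xb₂ (xb₂ x) = 0 :=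
  tensor_induct (xb₂.comp xb₂) 0 (fun x y => by simp [xb₂, on₂, bX_bX]) x
-- Odd operators attached to different factors anticommute: the Koszul sign `par` carried by the
-- second one is reversed by the first. The relations below hold for the same reason, together with
-- those within one factor.
theorem xb₂_xb₁ (x : XX R₁ R₂) : xb₂ (xb₁ x) = -xb₁ (xb₂ x) :=
  tensor_induct (xb₂.comp xb₁) (-xb₁.comp xb₂) (fun x y => by
    simp only [xb₁, xb₂, on₁, on₂, BMap.comp_apply, BMap.neg_apply, tmap_tmul, bX_par, map_neg,
      BMap.id_apply, neg_neg]) x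
theorem xd₂_xb₁ (x : XX R₁ R₂) : xd₂ (xb₁ x) = -xb₁ (xd₂ x) :=
  tensor_induct (xd₂.comp xb₁) (-xb₁.comp xd₂) (fun x y => by
    simp only [xb₁, xd₂, on₁, on₂, BMap.comp_apply, BMap.neg_apply, tmap_tmul, bX_par, map_neg,
      BMap.id_apply, neg_neg]) x
theorem xd₁_xb₂ (x : XX R₁ R₂) : xd₁ (xb₂ x) = -xb₂ (xd₁ x) :=
  tensor_induct (xd₁.comp xb₂) (-xb₂.comp xd₁) (fun x y => by
    simp only [xb₂, xd₁, on₁, on₂, BMap.comp_apply, BMap.neg_apply, tmap_tmul, dX_par, map_neg,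
      BMap.id_apply]) x
theorem xdelta_xb₁ (x : XX R₁ R₂) : xdelta (xb₁ x) = -xb₁ (xdelta x) :=
  tensor_induct (xdelta.comp xb₁) (-xb₁.comp xdelta) (fun x y => by
    simp only [xb₁, xdelta, on₁, on₂, BMap.comp_apply, BMap.neg_apply, BMap.add_apply, tmap_tmul,
      bX_par, bX_deltaX, map_neg, BMap.id_apply, map_add, neg_neg, neg_add]) x
theorem xdelta_xb₂ (x : XX R₁ R₂) : xdelta (xb₂ x) = -xb₂ (xdelta x) :=
  tensor_induct (xdelta.comp xb₂) (-xb₂.comp xdelta) (fun x y => by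
    simp only [xb₂, xdelta, on₁, on₂, BMap.comp_apply, BMap.neg_apply, BMap.add_apply, tmap_tmul,
      bX_deltaX, deltaX_par, map_neg, BMap.id_apply, map_add, neg_neg, neg_add]) x

/-! ### Components -/

/-- Together with the six identities that follow, this turns every product and module structure of
the statement into the product of biforms, so that mixed associativity needs no separate proof. -/
theorem e00_m00 (u v : T00 R₁ R₂) : e00 (m00 u v) = e00 u * e00 v :=
  gmul_map _ _ (mulB (FormAlg R₁)) (mulB (FormAlg R₂)) _ _ _ _ _ _ fun0_mul fun0_mul (fun _ => (par_fun0 _).symm)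
    (fun _ => (par_fun0 _).symm) u v
theorem e10_m10 (u : T10 R₁ R₂) (v : T00 R₁ R₂) : e10 (m10 u v) = e10 u * e00 v :=
  gmul_map _ _ (mulB (FormAlg R₁)) (mulB (FormAlg R₂)) _ _ _ _ _ _ (fun _ _ => form1_oright _ _) fun0_mul
    (fun _ => (par_fun0 _).symm) (fun _ => (par_fun0 _).symm) u v
theorem e01_m01 (u : T00 R₁ R₂) (v : T01 R₁ R₂) : e01 (m01 u v) = e00 u * e01 v :=
  gmul_map _ _ (mulB (FormAlg R₁)) (mulB (FormAlg R₂)) _ _ _ _ _ _ fun0_mul (fun _ _ => form1_oleft _ _)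
    (fun _ => (par_fun0 _).symm) (fun _ => (par_fun0 _).symm) u v
theorem e01_m01' (u : T01 R₁ R₂) (v : T00 R₁ R₂) : e01 (m01' u v) = e01 u * e00 v :=
  gmul_map _ _ (mulB (FormAlg R₁)) (mulB (FormAlg R₂)) _ _ _ _ _ _ fun0_mul (fun _ _ => form1_oright _ _)
    (fun _ => (par_fun0 _).symm) (fun _ => (par_form1 _).symm) u v
theorem e11_m12 (u : T10 R₁ R₂) (v : T01 R₁ R₂) : e11 (m12 u v) = e10 u * e01 v :=
  gmul_map _ _ (mulB (FormAlg R₁)) (mulB (FormAlg R₂)) _ _ _ _ _ _ (fun _ _ => form1_oright _ _)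
    (fun _ _ => form1_oleft _ _) (fun _ => (par_fun0 _).symm) (fun _ => (par_fun0 _).symm) u v
theorem e11_m21 (u : T01 R₁ R₂) (v : T10 R₁ R₂) : e11 (m21 u v) = e01 u * e10 v :=
  gmul_map _ _ (mulB (FormAlg R₁)) (mulB (FormAlg R₂)) _ _ _ _ _ _ (fun _ _ => form1_oleft _ _)
    (fun _ _ => form1_oright _ _) (fun _ => (par_form1 _).symm) (fun _ => (par_form1 _).symm) u v
theorem e11_m11 (u : T00 R₁ R₂) (v : T11 R₁ R₂) : e11 (m11 u v) = e00 u * e11 v :=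
  gmul_map _ _ (mulB (FormAlg R₁)) (mulB (FormAlg R₂)) _ _ _ _ _ _ (fun _ _ => form1_oleft _ _)
    (fun _ _ => form1_oleft _ _) (fun _ => (par_form1 _).symm) (fun _ => (par_fun0 _).symm) u v

theorem e10_d₁ (u : T00 R₁ R₂) : e10 (d₁ u) = bd₁ (e00 u) :=
  tensor_induct (e10.comp d₁) (bd₁.comp e00) (fun x y => by
    simp [d₁, on₁, form1_dform]) u
theorem e01_d₂ (u : T00 R₁ R₂) : e01 (d₂ u) = bd₂ (e00 u) :=
  tensor_induct (e01.comp d₂) (bd₂.comp e00) (fun x y => by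
    simp [d₂, on₂, form1_dform, par_fun0, -par_unit]) u
theorem e00_tdif (u : T00 R₁ R₂) : e00 (tdif u) = dif _ (e00 u) :=
  tensor_induct (e00.comp tdif) ((dif _).comp e00) (fun x y => by
    simp [tdif, on₁, on₂, dif_bt, par_fun0, dif_fun0, -par_unit, -udif_apply]) u
theorem e00_par (u : T00 R₁ R₂) : e00 (par _ u) = par _ (e00 u) :=
  tensor_induct (e00.comp (par (T00 R₁ R₂))) ((par (BiForm R₁ R₂)).comp e00) (fun x y => by
    simp [par_fun0, -par_unit]) u

theorem natX_fun0 {R : Type u} [DGBAlg R] (x : Unitization ℂ R) : natX R (fun0 R x) = xinl R x :=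
  Prod.ext rfl (map_zero (nat R))
theorem natX_form1 {R : Type u} [DGBAlg R] (x : Omega1 R) : natX R (form1 R x) = xinr R (nat R x) :=
  rfl

theorem natXX_e00 (u : T00 R₁ R₂) : natXX (e00 u) = i00 u :=
  tensor_induct (natXX.comp e00) i00 (fun x y => by simp [i00, natX_fun0]) u
theorem natXX_e10 (u : T10 R₁ R₂) : natXX (e10 u) = i10 (nat₁ u) :=
  tensor_induct (natXX.comp e10) (i10.comp nat₁)
    (fun x y => by simp [i10, nat₁, natX_fun0, natX_form1]) u
theorem natXX_e01 (u : T01 R₁ R₂) : natXX (e01 u) = i01 (nat₂ u) :=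
  tensor_induct (natXX.comp e01) (i01.comp nat₂)
    (fun x y => by simp [i01, nat₂, natX_fun0, natX_form1]) u
theorem natXX_e11 (u : T11 R₁ R₂) : natXX (e11 u) = i11 (nat₁₂ u) :=
  tensor_induct (natXX.comp e11) (i11.comp nat₁₂)
    (fun x y => by simp [i11, nat₁₂, natX_form1]) u

theorem xb₁_natXX_e11 (u : T11 R₁ R₂) : xb₁ (natXX (e11 u)) = i01 (b11₁ (nat₁₂ u)) :=
  tensor_induct (xb₁.comp (natXX.comp e11)) (i01.comp (b11₁.comp nat₁₂)) (fun x y => by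
    simp only [natXX_bt, e11_tmul, i01, nat₁₂, b11₁, xb₁, on₁, BMap.comp_apply, tmap_tmul, BMap.id_apply,
      natX_form1]
    rfl) u
theorem xb₂_natXX_e11 (u : T11 R₁ R₂) : xb₂ (natXX (e11 u)) = i10 (b11₂ (nat₁₂ u)) :=
  tensor_induct (xb₂.comp (natXX.comp e11)) (i10.comp (b11₂.comp nat₁₂)) (fun x y => by
    simp only [natXX_bt, e11_tmul, i10, nat₁₂, b11₂, xb₂, on₂, BMap.comp_apply, tmap_tmul,
      ← natX_par, par_form1, par_nat]
    simp only [natX_form1]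
    rfl) u

theorem xb₁_natXX_e00 (u : T00 R₁ R₂) : xb₁ (natXX (e00 u)) = 0 :=
  tensor_induct (xb₁.comp (natXX.comp e00)) 0 (fun x y => by
    simp [xb₁, on₁, bX_natX_fun0]) u
theorem xb₂_natXX_e00 (u : T00 R₁ R₂) : xb₂ (natXX (e00 u)) = 0 :=
  tensor_induct (xb₂.comp (natXX.comp e00)) 0 (fun x y => by
    simp [xb₂, on₂, bX_natX_fun0]) u
theorem xb₁_natXX_e01 (u : T01 R₁ R₂) : xb₁ (natXX (e01 u)) = 0 :=
  tensor_induct (xb₁.comp (natXX.comp e01)) 0 (fun x y => by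
    simp [xb₁, on₁, bX_natX_fun0]) u
theorem xb₂_natXX_e10 (u : T10 R₁ R₂) : xb₂ (natXX (e10 u)) = 0 :=
  tensor_induct (xb₂.comp (natXX.comp e10)) 0 (fun x y => by
    simp [xb₂, on₂, bX_natX_fun0]) u

/-- The biforms are treated as a `NonUnitalRing`; their unit is carried along as the element `e00
tone`. -/
theorem e00_one_mul (u : BiForm R₁ R₂) : e00 tone * u = u := by
  refine bt_induct_left (mulB _ (e00 tone)) (BMap.id _) (fun x y hx => ?_) u
  simp only [mulB_apply, BMap.id_apply, tone, e00_tmul]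
  rcases hx with hx | hx
  · rw [bt_mul_even _ _ _ hx, fun0_one_mul, fun0_one_mul]
  · rw [bt_mul_odd _ _ _ hx, fun0_one_mul, par_fun0, par_one, fun0_one_mul]
theorem mul_e00_one (u : BiForm R₁ R₂) : u * e00 tone = u := by
  have h1 : par _ (fun0 R₁ 1) = fun0 R₁ 1 := by rw [par_fun0, par_one]
  refine bt_induct ((mulB _).flip (e00 tone)) (BMap.id _) (fun x y => ?_) u
  simp only [BMap.flip_apply, mulB_apply, BMap.id_apply, tone, e00_tmul]
  rw [bt_mul_even _ _ _ h1, mul_fun0_one, mul_fun0_one]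

end pairforms

/-! ### The morphism from the free product and its correction term -/

theorem unit_induct {E G : Type u} [CB E] [CB G] (f g : Unitization ℂ E ⟹ G)
    (h1 : f (Unitization.inl 1) = g (Unitization.inl 1)) (h : ∀ y : E, f y = g y)
    (x : Unitization ℂ E) :
    f x = g x := by
  have hx : x = x.fst • Unitization.inl 1 + (x.snd : Unitization ℂ E) := by
    refine Unitization.ext ?_ ?_ <;> simp
  rw [hx, map_add, map_add, map_smul, map_smul, h1, h]

section muphi
variable {R₁ R₂ : Type u} [DGBAlg R₁] [DGBAlg R₂]

/-- The letters as biforms. -/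
def alh (b : Bool) : fam R₁ R₂ b ⟹ BiForm R₁ R₂ := e00.comp (alpha b)

theorem alh_true (x : R₁) : alh (R₁ := R₁) (R₂ := R₂) true x = bt (fun0 R₁ x) (fun0 R₂ 1) :=
  e00_tmul _ _
theorem alh_false (x : R₂) : alh (R₁ := R₁) (R₂ := R₂) false x = bt (fun0 R₁ 1) (fun0 R₂ x) :=
  e00_tmul _ _

theorem par_fun0_one {R : Type u} [DGBAlg R] : par _ (fun0 R 1) = fun0 R 1 := by
  rw [par_fun0, par_one]

/-- In R₁ the Koszul sign would come from moving the unit of R̃₂, in R₂ from moving past the unit of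
R̃₁; the units are even, so there is none. -/
theorem alh_mul : ∀ (b : Bool) (x y : fam R₁ R₂ b), alh b (x * y) = alh b x * alh b y
  | true, x, y => by
    change R₁ at x y
    change alh (R₁ := R₁) (R₂ := R₂) true (x * y : R₁) = _
    rw [alh_true, alh_true, alh_true, Unitization.inr_mul, fun0_mul]
    refine parity_induct
      (f := (bt (R₁ := R₁) (R₂ := R₂)).flip (fun0 R₂ 1) |>.comp
        ((mulB (FormAlg R₁) (fun0 R₁ x)).comp ((fun0 R₁).comp (uinr R₁))))
      (g := (mulB (BiForm R₁ R₂) (bt (fun0 R₁ x) (fun0 R₂ 1))).comp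
        ((bt (R₁ := R₁) (R₂ := R₂)).flip (fun0 R₂ 1) |>.comp ((fun0 R₁).comp (uinr R₁)))) (fun y hy => ?_) (fun y hy => ?_) y
    · simp only [BMap.comp_apply, mulB_apply, BMap.flip_apply, uinr_apply]
      rw [bt_mul_even _ _ _ (by rw [par_fun0, par_inr, hy]), fun0_one_mul]
    · simp only [BMap.comp_apply, mulB_apply, BMap.flip_apply, uinr_apply]
      rw [bt_mul_odd _ _ _ (by rw [par_fun0, par_inr, hy, Unitization.inr_neg, map_neg]),
        par_fun0_one, fun0_one_mul]
  | false, x, y => by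
    change R₂ at x y
    change alh (R₁ := R₁) (R₂ := R₂) false (x * y : R₂) = _
    rw [alh_false, alh_false, alh_false, bt_mul_even _ _ _ par_fun0_one, fun0_one_mul,
      Unitization.inr_mul, fun0_mul]

theorem alh_par : ∀ (b : Bool) (x : fam R₁ R₂ b), par _ (alh b x) = alh b (par _ x)
  | true, x => by
    change R₁ at x
    change par _ (alh (R₁ := R₁) (R₂ := R₂) true x) = alh true (par R₁ x : R₁)
    rw [alh_true, alh_true, par_bt, par_fun0_one, par_fun0, par_inr]
  | false, x => by
    change R₂ at x
    change par _ (alh (R₁ := R₁) (R₂ := R₂) false x) = alh false (par R₂ x : R₂)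
    rw [alh_false, alh_false, par_bt, par_fun0_one, par_fun0, par_inr]

theorem alh_dif : ∀ (b : Bool) (x : fam R₁ R₂ b), dif _ (alh b x) = alh b (dif _ x)
  | true, x => by
    change R₁ at x
    change dif _ (alh (R₁ := R₁) (R₂ := R₂) true x) = alh true (dif R₁ x : R₁)
    rw [alh_true, alh_true, dif_bt, dif_fun0, dif_fun0, udif_one, map_zero, map_zero, add_zero,
      udif_inr]
  | false, x => by
    change R₂ at x
    change dif _ (alh (R₁ := R₁) (R₂ := R₂) false x) = alh false (dif R₂ x : R₂)
    rw [alh_false, alh_false, dif_bt, dif_fun0, dif_fun0, udif_one, map_zero, map_zero,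
      BMap.zero_apply, zero_add, udif_inr, par_fun0_one]

theorem formD_fun0_one {R : Type u} [DGBAlg R] : formD R (fun0 R 1) = 0 := by
  rw [← form1_dform, dform_one, map_zero]

/-- A letter of R₁ is constant in the second direction, and a letter of R₂ in the first. These two
facts make φ compatible with multiplying adjacent letters of the same algebra. -/
theorem bd₂_alh_true (x : fam R₁ R₂ true) : bd₂ (alh (R₁ := R₁) (R₂ := R₂) true x) = 0 := by
  change R₁ at x
  rw [alh_true, bd₂_bt, formD_fun0_one, map_zero]

theorem bd₁_alh_false (x : fam R₁ R₂ false) : bd₁ (alh (R₁ := R₁) (R₂ := R₂) false x) = 0 := by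
  change R₂ at x
  rw [alh_false, bd₁_bt, formD_fun0_one, map_zero, BMap.zero_apply]

/-- The morphism `μ` on the free product, with values in the biforms. -/
def muF : FreeProd R₁ R₂ ⟹ BiForm R₁ R₂ := e00.comp ((fstB _ _).comp muphi)
/-- The map `φ` on the free product, with values in the biforms. -/
def phF : FreeProd R₁ R₂ ⟹ BiForm R₁ R₂ := e11.comp ((sndB _ _).comp muphi)

theorem muphi_letter (b : Bool) (x : fam R₁ R₂ b) :
    muphi (inj (fam R₁ R₂) 0 b (wone _ b x)) = (alpha b x, 0) := by
  rw [muphi, fpLift_inj, wrec_wone]; rfl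

theorem muphi_wcons (n : ℕ) (b : Bool) (x : fam R₁ R₂ b) (w : Word (fam R₁ R₂) n (!b)) :
    muphi (inj (fam R₁ R₂) (n + 1) b (wcons _ n b x w)) =
      (m00 (alpha b x) (muphi (inj _ n (!b) w)).1,
        m11 (alpha b x) (muphi (inj _ n (!b) w)).2 +
          m21 (d₂ (alpha b (par _ x))) (d₁ (muphi (inj _ n (!b) w)).1)) := by
  rw [muphi, fpLift_inj, fpLift_inj, wrec_wcons]
  simp only [BMap.add_apply, BMap.post_apply, BMap.bi_apply, pairB_apply, BMap.id_apply,
    BMap.zero_apply, fstB_apply, sndB_apply, Prod.mk_add_mk, add_zero, zero_add, BMap.comp_apply]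

theorem muF_letter (b : Bool) (x : fam R₁ R₂ b) :
    muF (inj (fam R₁ R₂) 0 b (wone _ b x)) = alh b x := by
  simp only [muF, BMap.comp_apply, muphi_letter]; rfl
theorem phF_letter (b : Bool) (x : fam R₁ R₂ b) :
    phF (inj (fam R₁ R₂) 0 b (wone _ b x)) = 0 := by
  simp only [phF, BMap.comp_apply, muphi_letter]; exact map_zero _
theorem muF_wcons (n : ℕ) (b : Bool) (x : fam R₁ R₂ b) (w : Word (fam R₁ R₂) n (!b)) :
    muF (inj (fam R₁ R₂) (n + 1) b (wcons _ n b x w)) = alh b x * muF (inj _ n (!b) w) := by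
  simp only [muF, BMap.comp_apply, muphi_wcons, fstB_apply, e00_m00]; rfl
theorem phF_wcons (n : ℕ) (b : Bool) (x : fam R₁ R₂ b) (w : Word (fam R₁ R₂) n (!b)) :
    phF (inj (fam R₁ R₂) (n + 1) b (wcons _ n b x w)) = alh b x * phF (inj _ n (!b) w) +
      bd₂ (alh b (par _ x)) * bd₁ (muF (inj _ n (!b) w)) := by
  simp only [phF, muF, BMap.comp_apply, muphi_wcons, sndB_apply, map_add, e11_m11, e11_m21, e01_d₂,
    e10_d₁]; rfl

theorem muF_lmul (b : Bool) (x : fam R₁ R₂ b) (Y : FreeProd R₁ R₂) :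
    muF (lmul (fam R₁ R₂) b x Y) = alh b x * muF Y := by
  have : muF.comp (lmul (fam R₁ R₂) b x) = (mulB (BiForm R₁ R₂) (alh b x)).comp muF := by
    refine fp_ext' b (fun z => ?_) (fun n z w => ?_) (fun n w => ?_)
    · simp only [BMap.comp_apply, lmul_inj, lw_same, lact_wone, muF_letter, mulB_apply, alh_mul]
    · simp only [BMap.comp_apply, lmul_inj, lw_same, lact_wcons, muF_wcons, mulB_apply, alh_mul,
        mul_assoc]
    · simp only [BMap.comp_apply, lmul_inj, lw_other, muF_wcons, mulB_apply]
  exact DFunLike.congr_fun this Y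

/-- The point is the case where x meets a first letter of the same algebra. For R₁ all cross terms
contain d₂ of a letter of R₁ and vanish. For R₂ the letter is constant for d₁, and the two cross
terms combine by the Leibniz rule for d₂. -/
theorem phF_lmul (b : Bool) (x : fam R₁ R₂ b) (Y : FreeProd R₁ R₂) :
    phF (lmul (fam R₁ R₂) b x Y) = alh b x * phF Y + bd₂ (alh b (par _ x)) * bd₁ (muF Y) := by
  have : phF.comp (lmul (fam R₁ R₂) b x) = (mulB (BiForm R₁ R₂) (alh b x)).comp phF +
      (mulB (BiForm R₁ R₂) (bd₂ (alh b (par _ x)))).comp (bd₁.comp muF) := by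
    refine fp_ext' b (fun z => ?_) (fun n z w => ?_) (fun n w => ?_)
    · simp only [BMap.comp_apply, BMap.add_apply, lmul_inj, lw_same, lact_wone, phF_letter,
        muF_letter, mulB_apply, mul_zero, zero_add]
      cases b
      · rw [bd₁_alh_false, mul_zero]
      · rw [bd₂_alh_true, zero_mul]
    · simp only [BMap.comp_apply, BMap.add_apply, lmul_inj, lw_same, lact_wcons, phF_wcons,
        muF_wcons, mulB_apply, alh_mul]
      cases b
      · rw [bd₁_mul, bd₁_alh_false, zero_mul, zero_add, par_mul, alh_mul, bd₂_mul, alh_par,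
          alh_par, par_par, mul_add, add_mul]
        noncomm_ring
      · rw [bd₂_alh_true, bd₂_alh_true, bd₂_alh_true]
        simp only [zero_mul, add_zero, mul_assoc]
    · simp only [BMap.comp_apply, BMap.add_apply, lmul_inj, lw_other, phF_wcons, mulB_apply]
  exact DFunLike.congr_fun this Y

theorem inj_wcons (n : ℕ) (b : Bool) (x : fam R₁ R₂ b) (w : Word (fam R₁ R₂) n (!b)) :
    inj (fam R₁ R₂) (n + 1) b (wcons _ n b x w) = lmul _ b x (inj _ n (!b) w) := by
  rw [lmul_inj, lw_other]

theorem muF_mul (X Y : FreeProd R₁ R₂) : muF (X * Y) = muF X * muF Y := by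
  have : muF.comp ((fmul (fam R₁ R₂)).flip Y) = ((mulB (BiForm R₁ R₂)).flip (muF Y)).comp muF := by
    refine fp_induct (fun b x => ?_) (fun n b ih x w => ?_)
    · simp only [BMap.comp_apply, BMap.flip_apply, fmul_wone, muF_lmul, muF_letter, mulB_apply]
    · have ih := ih w
      simp only [BMap.comp_apply, BMap.flip_apply, mulB_apply] at ih ⊢
      rw [fmul_wcons, muF_lmul, ih, muF_wcons, mul_assoc]
  exact DFunLike.congr_fun this X

theorem muF_par (X : FreeProd R₁ R₂) : muF (par _ X) = par _ (muF X) := by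
  have : muF.comp (par (FreeProd R₁ R₂)) = (par (BiForm R₁ R₂)).comp muF := by
    refine fp_induct (fun b x => ?_) (fun n b ih x w => ?_)
    · simp only [BMap.comp_apply, par_inj, par_wone, muF_letter, alh_par]
    · have ih := ih w
      simp only [BMap.comp_apply] at ih ⊢
      rw [inj_wcons, par_lmul, muF_lmul, muF_lmul, par_mul, ih, alh_par]
  exact DFunLike.congr_fun this X

theorem muF_dif (X : FreeProd R₁ R₂) : muF (dif _ X) = dif _ (muF X) := by
  have : muF.comp (fdif (fam R₁ R₂)) = (dif (BiForm R₁ R₂)).comp muF := by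
    refine fp_induct (fun b x => ?_) (fun n b ih x w => ?_)
    · simp only [BMap.comp_apply, fdif_inj, wdif_wone, muF_letter, alh_dif]
    · have ih := ih w
      simp only [BMap.comp_apply] at ih ⊢
      rw [inj_wcons, fdif_lmul, map_add, muF_lmul, muF_lmul, muF_lmul, dif_mul, ih, alh_dif,
        alh_par]
  exact DFunLike.congr_fun this X

/-- The cross term is the cup product of the derivations d₂μ and d₁μ, hence a Hochschild
two-cocycle. This is why a rule imposed one letter at a time propagates to arbitrary products. -/
theorem phF_mul (X Y : FreeProd R₁ R₂) :
    phF (X * Y) = phF X * muF Y + muF X * phF Y + bd₂ (muF (par _ X)) * bd₁ (muF Y) := by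
  have : phF.comp ((fmul (fam R₁ R₂)).flip Y) = ((mulB (BiForm R₁ R₂)).flip (muF Y)).comp phF +
      ((mulB (BiForm R₁ R₂)).flip (phF Y)).comp muF +
      ((mulB (BiForm R₁ R₂)).flip (bd₁ (muF Y))).comp (bd₂.comp (muF.comp (par _))) := by
    refine fp_induct (fun b x => ?_) (fun n b ih x w => ?_)
    · simp only [BMap.comp_apply, BMap.add_apply, BMap.flip_apply, fmul_wone, phF_lmul, phF_letter,
        muF_letter, mulB_apply, muF_par, alh_par, zero_mul, zero_add]
    · have ih := ih w
      have hm := muF_mul (inj _ n (!b) w) Y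
      change muF (fmul _ _ _) = _ at hm
      simp only [BMap.comp_apply, BMap.add_apply, BMap.flip_apply, mulB_apply] at ih ⊢
      rw [fmul_wcons, phF_lmul, ih, phF_wcons, muF_wcons, hm, inj_wcons, par_lmul, muF_lmul,
        bd₂_mul, bd₁_mul, muF_par, alh_par, par_par]
      noncomm_ring
  exact DFunLike.congr_fun this X

theorem phF_par (X : FreeProd R₁ R₂) : phF (par _ X) = par _ (phF X) := by
  have : phF.comp (par (FreeProd R₁ R₂)) = (par (BiForm R₁ R₂)).comp phF := by
    refine fp_induct (fun b x => ?_) (fun n b ih x w => ?_)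
    · simp only [BMap.comp_apply, par_inj, par_wone, phF_letter, map_zero]
    · have ih := ih w
      simp only [BMap.comp_apply] at ih ⊢
      rw [inj_wcons, par_lmul, phF_lmul, phF_lmul, map_add, par_mul, par_mul, ih, muF_par, bd₁_par,
        ← alh_par, ← alh_par, ← alh_par, bd₂_par, bd₂_par, map_neg]
      simp only [par_par, neg_mul, mul_neg, neg_neg]
  exact DFunLike.congr_fun this X

/-- The differential δ anticommutes with both d₁ and d₂; in the cross term the two signs compensate,
so φ commutes with δ. -/
theorem phF_dif (X : FreeProd R₁ R₂) : phF (dif _ X) = dif _ (phF X) := by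
  have : phF.comp (fdif (fam R₁ R₂)) = (dif (BiForm R₁ R₂)).comp phF := by
    refine fp_induct (fun b x => ?_) (fun n b ih x w => ?_)
    · simp only [BMap.comp_apply, fdif_inj, wdif_wone, phF_letter, map_zero]
    · have ih := ih w
      have hm := muF_dif (inj (fam R₁ R₂) n (!b) w)
      change muF (fdif _ _) = _ at hm
      simp only [BMap.comp_apply] at ih ⊢
      rw [inj_wcons, fdif_lmul, map_add, phF_lmul, phF_lmul, phF_lmul, map_add, dif_mul, dif_mul,
        ih, hm, ← alh_par, ← alh_par, ← alh_par, ← alh_par, ← alh_dif, par_par, dif_bd₁, dif_bd₂,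
        bd₂_par, dif_par]
      simp only [map_neg, par_par, neg_mul, mul_neg, neg_neg, bd₂_par]
      abel
  exact DFunLike.congr_fun this X

/-- The morphism `μ` with values in the biforms. -/
def muh : Unitization ℂ (FreeProd R₁ R₂) ⟹ BiForm R₁ R₂ := e00.comp mu
/-- The map `φ` with values in the biforms. -/
def phh : Unitization ℂ (FreeProd R₁ R₂) ⟹ BiForm R₁ R₂ := e11.comp phi

theorem muh_inr (X : FreeProd R₁ R₂) : muh (X : Unitization ℂ (FreeProd R₁ R₂)) = muF X := by
  simp [muh, mu, muF]
theorem phh_inr (X : FreeProd R₁ R₂) : phh (X : Unitization ℂ (FreeProd R₁ R₂)) = phF X := by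
  simp [phh, phi, phF]
theorem muh_one : muh (1 : Unitization ℂ (FreeProd R₁ R₂)) = e00 tone := by
  simp [muh, mu]
theorem phh_one : phh (1 : Unitization ℂ (FreeProd R₁ R₂)) = 0 := by
  simp [phh, phi]
theorem inl_one {R : Type u} [DGBAlg R] : (Unitization.inl 1 : Unitization ℂ R) = 1 := rfl

theorem e00_tone : e00 (tone : T00 R₁ R₂) = bt (fun0 R₁ 1) (fun0 R₂ 1) := e00_tmul _ _
theorem bd₁_one : bd₁ (e00 (tone : T00 R₁ R₂)) = 0 := by
  rw [e00_tone, bd₁_bt, formD_fun0_one, map_zero, BMap.zero_apply]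
theorem bd₂_one : bd₂ (e00 (tone : T00 R₁ R₂)) = 0 := by
  rw [e00_tone, bd₂_bt, formD_fun0_one, map_zero]
theorem par_one' : par _ (e00 (tone : T00 R₁ R₂)) = e00 tone := by
  rw [e00_tone, par_bt, par_fun0_one, par_fun0_one]
theorem dif_one' : dif _ (e00 (tone : T00 R₁ R₂)) = 0 := by
  rw [e00_tone, dif_bt, dif_fun0, dif_fun0, udif_one, udif_one, map_zero, map_zero, map_zero,
    map_zero, BMap.zero_apply, add_zero]

theorem muh_par (X : Unitization ℂ (FreeProd R₁ R₂)) : muh (par _ X) = par _ (muh X) :=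
  unit_induct (muh.comp (par (Unitization ℂ (FreeProd R₁ R₂)))) ((par (BiForm R₁ R₂)).comp muh)
    (by simp only [BMap.comp_apply, inl_one, par_one, muh_one, par_one'])
    (fun y => by simp only [BMap.comp_apply, par_inr, muh_inr, muF_par]) X
theorem phh_par (X : Unitization ℂ (FreeProd R₁ R₂)) : phh (par _ X) = par _ (phh X) :=
  unit_induct (phh.comp (par (Unitization ℂ (FreeProd R₁ R₂)))) ((par (BiForm R₁ R₂)).comp phh)
    (by simp only [BMap.comp_apply, inl_one, par_one, phh_one, map_zero])
    (fun y => by simp only [BMap.comp_apply, par_inr, phh_inr, phF_par]) X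
theorem muh_dif (X : Unitization ℂ (FreeProd R₁ R₂)) : muh (udif _ X) = dif _ (muh X) :=
  unit_induct (muh.comp (udif (FreeProd R₁ R₂))) ((dif (BiForm R₁ R₂)).comp muh)
    (by simp only [BMap.comp_apply, inl_one, udif_one, muh_one, dif_one', map_zero])
    (fun y => by simp only [BMap.comp_apply, udif_inr, muh_inr, muF_dif]) X
theorem phh_dif (X : Unitization ℂ (FreeProd R₁ R₂)) : phh (udif _ X) = dif _ (phh X) :=
  unit_induct (phh.comp (udif (FreeProd R₁ R₂))) ((dif (BiForm R₁ R₂)).comp phh)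
    (by simp only [BMap.comp_apply, inl_one, udif_one, phh_one, map_zero])
    (fun y => by simp only [BMap.comp_apply, udif_inr, phh_inr, phF_dif]) X

theorem muh_mul (X Y : Unitization ℂ (FreeProd R₁ R₂)) : muh (X * Y) = muh X * muh Y := by
  refine unit_induct (muh.comp ((umul _).flip Y)) (((mulB (BiForm R₁ R₂)).flip (muh Y)).comp muh)
    ?_ (fun X => ?_) X
  · simp only [BMap.comp_apply, BMap.flip_apply, umul_apply, mulB_apply, inl_one, one_mul, muh_one,
      e00_one_mul]
  refine unit_induct (muh.comp (umul _ (X : Unitization ℂ (FreeProd R₁ R₂))))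
    ((mulB (BiForm R₁ R₂) (muh X)).comp muh) ?_ (fun Y => ?_) Y
  · simp only [BMap.comp_apply, umul_apply, mulB_apply, inl_one, mul_one, muh_one, mul_e00_one]
  · simp only [BMap.comp_apply, umul_apply, mulB_apply, ← Unitization.inr_mul, muh_inr, muF_mul]

theorem phh_mul (X Y : Unitization ℂ (FreeProd R₁ R₂)) :
    phh (X * Y) = phh X * muh Y + muh X * phh Y + bd₂ (muh (par _ X)) * bd₁ (muh Y) := by
  refine unit_induct (phh.comp ((umul _).flip Y)) (((mulB (BiForm R₁ R₂)).flip (muh Y)).comp phh +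
    ((mulB (BiForm R₁ R₂)).flip (phh Y)).comp muh +
    ((mulB (BiForm R₁ R₂)).flip (bd₁ (muh Y))).comp (bd₂.comp (muh.comp (par _))))
    ?_ (fun X => ?_) X
  · simp only [BMap.comp_apply, BMap.flip_apply, BMap.add_apply, umul_apply, mulB_apply, inl_one,
      one_mul, muh_one, phh_one, par_one, bd₂_one, zero_mul, e00_one_mul, add_zero, zero_add]
  refine unit_induct (phh.comp (umul _ (X : Unitization ℂ (FreeProd R₁ R₂))))
    (mulB (BiForm R₁ R₂) (phh X) |>.comp muh |> (· + (mulB (BiForm R₁ R₂) (muh X)).comp phh) |>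
      (· + (mulB (BiForm R₁ R₂) (bd₂ (muh (par _ (X : Unitization ℂ (FreeProd R₁ R₂)))))).comp
        (bd₁.comp muh))) ?_ (fun Y => ?_) Y
  · simp only [BMap.comp_apply, BMap.add_apply, umul_apply, mulB_apply, inl_one, mul_one, muh_one,
      phh_one, bd₁_one, mul_zero, add_zero, mul_e00_one]
  · simp only [BMap.comp_apply, BMap.add_apply, umul_apply, mulB_apply, ← Unitization.inr_mul,
      muh_inr, phh_inr, phF_mul, par_inr]

/-! ### The lift of a tensor -/

theorem muF_in₁ (x : R₁) : muF (in₁ R₁ R₂ x) = bt (fun0 R₁ x) (fun0 R₂ 1) := by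
  rw [← alh_true]; exact muF_letter true x
theorem muF_in₂ (x : R₂) : muF (in₂ R₁ R₂ x) = bt (fun0 R₁ 1) (fun0 R₂ x) := by
  rw [← alh_false]; exact muF_letter false x
theorem phF_in₁ (x : R₁) : phF (in₁ R₁ R₂ x) = 0 := phF_letter true x
theorem phF_in₂ (x : R₂) : phF (in₂ R₁ R₂ x) = 0 := phF_letter false x

/-- The unital inclusions of the factors. -/
def uin₁ : Unitization ℂ R₁ ⟹ Unitization ℂ (FreeProd R₁ R₂) := uext 1 ((uinr _).comp (in₁ R₁ R₂))
def uin₂ : Unitization ℂ R₂ ⟹ Unitization ℂ (FreeProd R₁ R₂) := uext 1 ((uinr _).comp (in₂ R₁ R₂))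

theorem uin₁_one : uin₁ (R₁ := R₁) (R₂ := R₂) 1 = 1 := by simp [uin₁]
theorem uin₂_one : uin₂ (R₁ := R₁) (R₂ := R₂) 1 = 1 := by simp [uin₂]
theorem uin₁_inr (x : R₁) : uin₁ (R₁ := R₁) (R₂ := R₂) x = in₁ R₁ R₂ x := by simp [uin₁]
theorem uin₂_inr (x : R₂) : uin₂ (R₁ := R₁) (R₂ := R₂) x = in₂ R₁ R₂ x := by simp [uin₂]

theorem lin_tmul (x : Unitization ℂ R₁) (y : Unitization ℂ R₂) :
    lin (tmul _ _ x y) = uin₁ x * uin₂ y := lift_tmul _ _ _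

theorem muh_uin₁ (x : Unitization ℂ R₁) : muh (uin₁ (R₂ := R₂) x) = bt (fun0 R₁ x) (fun0 R₂ 1) :=
  unit_induct (muh.comp uin₁) (((bt (R₁ := R₁) (R₂ := R₂)).flip (fun0 R₂ 1)).comp (fun0 R₁))
    (by simp only [BMap.comp_apply, inl_one, uin₁_one, muh_one, e00_tone, BMap.flip_apply])
    (fun x => by simp only [BMap.comp_apply, uin₁_inr, muh_inr, muF_in₁, BMap.flip_apply]) x
theorem muh_uin₂ (x : Unitization ℂ R₂) : muh (uin₂ (R₁ := R₁) x) = bt (fun0 R₁ 1) (fun0 R₂ x) :=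
  unit_induct (muh.comp uin₂) ((bt (R₁ := R₁) (R₂ := R₂) (fun0 R₁ 1)).comp (fun0 R₂))
    (by simp only [BMap.comp_apply, inl_one, uin₂_one, muh_one, e00_tone])
    (fun x => by simp only [BMap.comp_apply, uin₂_inr, muh_inr, muF_in₂]) x
theorem phh_uin₁ (x : Unitization ℂ R₁) : phh (uin₁ (R₂ := R₂) x) = 0 :=
  unit_induct (phh.comp uin₁) 0
    (by simp only [BMap.comp_apply, inl_one, uin₁_one, phh_one, BMap.zero_apply])
    (fun x => by simp only [BMap.comp_apply, uin₁_inr, phh_inr, phF_in₁, BMap.zero_apply]) x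
theorem phh_uin₂ (x : Unitization ℂ R₂) : phh (uin₂ (R₁ := R₁) x) = 0 :=
  unit_induct (phh.comp uin₂) 0
    (by simp only [BMap.comp_apply, inl_one, uin₂_one, phh_one, BMap.zero_apply])
    (fun x => by simp only [BMap.comp_apply, uin₂_inr, phh_inr, phF_in₂, BMap.zero_apply]) x

theorem par_letter {R : Bool → Type u} [∀ b, DGBAlg (R b)] (b : Bool) (x : R b) :
    par _ (letter R b x) = letter R b (par _ x) := by
  simp only [letter, BMap.comp_apply, par_inj, par_wone]
theorem par_in₁ (x : R₁) : par _ (in₁ R₁ R₂ x) = in₁ R₁ R₂ (par _ x) :=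
  par_letter (R := fam R₁ R₂) true x
theorem par_in₂ (x : R₂) : par _ (in₂ R₁ R₂ x) = in₂ R₁ R₂ (par _ x) :=
  par_letter (R := fam R₁ R₂) false x
theorem par_uin₁ (x : Unitization ℂ R₁) : par _ (uin₁ (R₂ := R₂) x) = uin₁ (par _ x) :=
  unit_induct ((par (Unitization ℂ (FreeProd R₁ R₂))).comp uin₁)
    (uin₁.comp (par (Unitization ℂ R₁)))
    (by simp only [BMap.comp_apply, inl_one, par_one, uin₁_one])
    (fun x => by simp only [BMap.comp_apply, par_inr, uin₁_inr, par_in₁]) x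
theorem par_uin₂ (x : Unitization ℂ R₂) : par _ (uin₂ (R₁ := R₁) x) = uin₂ (par _ x) :=
  unit_induct ((par (Unitization ℂ (FreeProd R₁ R₂))).comp uin₂)
    (uin₂.comp (par (Unitization ℂ R₂)))
    (by simp only [BMap.comp_apply, inl_one, par_one, uin₂_one])
    (fun x => by simp only [BMap.comp_apply, par_inr, uin₂_inr, par_in₂]) x

theorem lin_par (A : T00 R₁ R₂) : lin (par _ A) = par _ (lin A) :=
  tensor_induct (lin.comp (par (T00 R₁ R₂))) ((par (Unitization ℂ (FreeProd R₁ R₂))).comp lin)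
    (fun x y => by
      simp only [BMap.comp_apply, par_tmul, lin_tmul, upar_mul, par_uin₁, par_uin₂]) A

theorem muh_lin (A : T00 R₁ R₂) : muh (lin A) = e00 A :=
  tensor_induct (muh.comp lin) e00 (fun x y => by
    simp only [BMap.comp_apply, lin_tmul, muh_mul, muh_uin₁, muh_uin₂, e00_tmul]
    rw [bt_mul_even _ _ _ par_fun0_one, mul_fun0_one, fun0_one_mul]) A

/-- In x₁ * x₂ the only possible cross term contains d₁ of x₂, which is zero. -/
theorem phh_lin (A : T00 R₁ R₂) : phh (lin A) = 0 :=
  tensor_induct (phh.comp lin) 0 (fun x y => by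
    simp only [BMap.comp_apply, lin_tmul, phh_mul, muh_par, muh_uin₁, muh_uin₂, phh_uin₁, phh_uin₂,
      zero_mul, mul_zero, bd₁_bt, formD_fun0_one, map_zero, BMap.zero_apply, add_zero]) A

theorem deg_e00 (A : T00 R₁ R₂) : tmap (deg0 R₁) (deg0 R₂) (e00 A : FormAlg R₁ ⊗̂ FormAlg R₂) = A :=
  tensor_induct ((tmap (deg0 R₁) (deg0 R₂)).comp
    (show T00 R₁ R₂ ⟹ FormAlg R₁ ⊗̂ FormAlg R₂ from e00)) (BMap.id _) (fun x y => by
    have : e00 (tmul _ _ x y) = tmul (FormAlg R₁) (FormAlg R₂) (fun0 _ x) (fun0 _ y) := e00_tmul _ _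
    exact (congrArg (tmap (deg0 R₁) (deg0 R₂)) this).trans (tmap_tmul _ _ _ _)) A

/-- Taking components of degree zero recovers the tensor. Identities for μ with values in R̃₁ ⊗̂ R̃₂
can therefore be checked among biforms. -/
theorem e00_injective : Function.Injective (e00 (R₁ := R₁) (R₂ := R₂)) := fun A B h => by
  rw [← deg_e00 A, h, deg_e00]

theorem mu_lin (A : T00 R₁ R₂) : mu (lin A) = A := e00_injective (muh_lin A)

theorem mu_mul (X Y : Unitization ℂ (FreeProd R₁ R₂)) : mu (X * Y) = m00 (mu X) (mu Y) :=
  e00_injective (by rw [e00_m00]; exact muh_mul X Y)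

theorem mu_udif (X : Unitization ℂ (FreeProd R₁ R₂)) : mu (udif _ X) = tdif (mu X) :=
  e00_injective (by rw [e00_tdif]; exact muh_dif X)

theorem mu_one : mu (1 : Unitization ℂ (FreeProd R₁ R₂)) = tone := by simp [mu]

theorem mu_lcurv (A : T00 R₁ R₂) : mu (lcurv A) = curv A := by
  rw [lcurv, curv, map_add, mu_udif, mu_mul, mu_lin]

theorem mu_pow (X : Unitization ℂ (FreeProd R₁ R₂)) (n : ℕ) : mu (X ^ n) = tpow (mu X) n := by
  induction n with
  | zero => rw [pow_zero, mu_one, tpow]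
  | succ n ih => rw [pow_succ', mu_mul, ih, tpow]

/-- The lift of A and its δ are invisible to φ; only the cross term of A * A remains, and the sign
is that of the odd element A. This is the origin of the term d₁A e^{-F} d₂A of the Chern character.
-/
theorem phh_lcurv {A : T00 R₁ R₂} (hA : par _ A = -A) :
    phh (lcurv A) = -(bd₂ (e00 A) * bd₁ (e00 A)) := by
  rw [lcurv, map_add, phh_dif, phh_lin, map_zero, zero_add, phh_mul, phh_lin, zero_mul, mul_zero,
    zero_add, zero_add, muh_par, muh_lin, ← e00_par, hA, map_neg, map_neg, neg_mul]

end muphi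

/-! ### Ideals of forms -/

section ideals
variable {R₁ R₂ : Type u} [DGBAlg R₁] [DGBAlg R₂]

/-- The biforms of positive degree in the first direction. -/
def j1 : Omega1 R₁ ⊗̂ FormAlg R₂ ⟹ BiForm R₁ R₂ := tmap (form1 R₁) (BMap.id _)
/-- The biforms of positive degree in the second direction. -/
def j2 : FormAlg R₁ ⊗̂ Omega1 R₂ ⟹ BiForm R₁ R₂ := tmap (BMap.id _) (form1 R₂)

@[simp] theorem j1_tmul (x : Omega1 R₁) (y : FormAlg R₂) : j1 (tmul _ _ x y) = bt (form1 _ x) y :=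
  tmap_tmul _ _ _ _
@[simp] theorem j2_tmul (x : FormAlg R₁) (y : Omega1 R₂) : j2 (tmul _ _ x y) = bt x (form1 _ y) :=
  tmap_tmul _ _ _ _

/-- The projections to the biforms of degree zero in one direction. -/
def pr1 : BiForm R₁ R₂ ⟹ BiForm R₁ R₂ := tmap ((fun0 R₁).comp (deg0 R₁)) (BMap.id _)
def pr2 : BiForm R₁ R₂ ⟹ BiForm R₁ R₂ := tmap (BMap.id _) ((fun0 R₂).comp (deg0 R₂))

@[simp] theorem pr1_bt (x : FormAlg R₁) (y : FormAlg R₂) :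
    pr1 (bt x y) = bt (fun0 _ (deg0 _ x)) y := tmap_tmul _ _ _ _
@[simp] theorem pr2_bt (x : FormAlg R₁) (y : FormAlg R₂) :
    pr2 (bt x y) = bt x (fun0 _ (deg0 _ y)) := tmap_tmul _ _ _ _

theorem pr1_mul (u v : BiForm R₁ R₂) : pr1 (u * v) = pr1 u * pr1 v :=
  gmul_map (mulB (FormAlg R₁)) (mulB (FormAlg R₂)) (mulB (FormAlg R₁)) (mulB (FormAlg R₂))
    ((fun0 R₁).comp (deg0 R₁)) (BMap.id _) ((fun0 R₁).comp (deg0 R₁)) (BMap.id _)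
    ((fun0 R₁).comp (deg0 R₁)) (BMap.id _) (fun x y => by simp) (fun x y => rfl)
    (fun y => by simp [par_fun0, -par_unit]) (fun x => rfl) u v
theorem pr2_mul (u v : BiForm R₁ R₂) : pr2 (u * v) = pr2 u * pr2 v :=
  gmul_map (mulB (FormAlg R₁)) (mulB (FormAlg R₂)) (mulB (FormAlg R₁)) (mulB (FormAlg R₂))
    (BMap.id _) ((fun0 R₂).comp (deg0 R₂)) (BMap.id _) ((fun0 R₂).comp (deg0 R₂))
    (BMap.id _) ((fun0 R₂).comp (deg0 R₂)) (fun x y => rfl) (fun x y => by simp)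
    (fun x => rfl) (fun y => by simp [par_fun0, -par_unit]) u v

theorem pr1_par (u : BiForm R₁ R₂) : pr1 (par _ u) = par _ (pr1 u) :=
  bt_induct (pr1.comp (par (BiForm R₁ R₂))) ((par (BiForm R₁ R₂)).comp pr1) (fun x y => by
    simp [par_fun0, -par_unit]) u
theorem pr2_par (u : BiForm R₁ R₂) : pr2 (par _ u) = par _ (pr2 u) :=
  bt_induct (pr2.comp (par (BiForm R₁ R₂))) ((par (BiForm R₁ R₂)).comp pr2) (fun x y => by
    simp [par_fun0, -par_unit]) u

/-- The components of positive degree in one direction. -/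
def q1 : BiForm R₁ R₂ ⟹ Omega1 R₁ ⊗̂ FormAlg R₂ := tmap (deg1 R₁) (BMap.id _)
def q2 : BiForm R₁ R₂ ⟹ FormAlg R₁ ⊗̂ Omega1 R₂ := tmap (BMap.id _) (deg1 R₂)

theorem q1_bt (x : FormAlg R₁) (y : FormAlg R₂) : q1 (bt x y) = tmul _ _ (deg1 _ x) y :=
  tmap_tmul _ _ _ _
theorem q2_bt (x : FormAlg R₁) (y : FormAlg R₂) : q2 (bt x y) = tmul _ _ x (deg1 _ y) :=
  tmap_tmul _ _ _ _

theorem pr1_add_j1 (u : BiForm R₁ R₂) : pr1 u + j1 (q1 u) = u :=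
  bt_induct (pr1 + j1.comp q1) (BMap.id (BiForm R₁ R₂)) (fun x y => by
    rw [BMap.add_apply, BMap.comp_apply, q1_bt, j1_tmul, pr1_bt, ← BMap.add_apply, ← map_add,
      ← formAlg_eq]; rfl) u
theorem pr2_add_j2 (u : BiForm R₁ R₂) : pr2 u + j2 (q2 u) = u :=
  bt_induct (pr2 + j2.comp q2) (BMap.id (BiForm R₁ R₂)) (fun x y => by
    rw [BMap.add_apply, BMap.comp_apply, q2_bt, j2_tmul, pr2_bt, ← map_add,
      ← formAlg_eq]; rfl) u

theorem form1_mul_form1 {R : Type u} [DGBAlg R] (x y : Omega1 R) (z : FormAlg R) :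
    form1 R x * z * form1 R y = 0 := by
  refine formAlg_ext ?_ ?_ <;> simp

theorem bt_mul_cases (x₁ : FormAlg R₁) (x₂ : FormAlg R₂) (y₁ : FormAlg R₁) (y₂ : FormAlg R₂)
    (h : par _ y₁ = y₁ ∨ par _ y₁ = -y₁) : ∃ w, bt x₁ x₂ * bt y₁ y₂ = bt (x₁ * y₁) w := by
  rcases h with h | h
  · exact ⟨_, bt_mul_even _ _ _ h⟩
  · exact ⟨_, bt_mul_odd _ _ _ h⟩

/-- There are no forms of degree two in one direction. The arbitrary middle factor is needed because
the one-forms met later are separated by functions and by forms in the other direction. -/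
theorem j1_mul_j1 (a : Omega1 R₁ ⊗̂ FormAlg R₂) (w : BiForm R₁ R₂) (b : Omega1 R₁ ⊗̂ FormAlg R₂) :
    j1 a * w * j1 b = 0 := by
  refine tensor_induct (((mulB (BiForm R₁ R₂)).flip (j1 b)).comp
    (((mulB (BiForm R₁ R₂)).flip w).comp j1)) 0 (fun x₁ x₂ => ?_) a
  refine bt_induct_left (((mulB (BiForm R₁ R₂)).flip (j1 b)).comp
    (mulB (BiForm R₁ R₂) (j1 (tmul _ _ x₁ x₂)))) 0 (fun y₁ y₂ hy => ?_) w
  refine tensor_induct_left ((mulB (BiForm R₁ R₂) (j1 (tmul _ _ x₁ x₂) * bt y₁ y₂)).comp j1) 0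
    (fun z₁ z₂ hz => ?_) b
  simp only [BMap.comp_apply, mulB_apply, BMap.zero_apply, j1_tmul]
  obtain ⟨c, hc⟩ := bt_mul_cases (form1 _ x₁) x₂ y₁ y₂ hy
  obtain ⟨d, hd⟩ := bt_mul_cases (form1 _ x₁ * y₁) c (form1 _ z₁) z₂ (by
    rw [par_form1]; rcases hz with hz | hz <;> simp [hz])
  rw [hc, hd, form1_mul_form1, map_zero, BMap.zero_apply]

theorem j2_mul_j2 (a : FormAlg R₁ ⊗̂ Omega1 R₂) (w : BiForm R₁ R₂) (b : FormAlg R₁ ⊗̂ Omega1 R₂) :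
    j2 a * w * j2 b = 0 := by
  refine tensor_induct (((mulB (BiForm R₁ R₂)).flip (j2 b)).comp
    (((mulB (BiForm R₁ R₂)).flip w).comp j2)) 0 (fun x₁ x₂ => ?_) a
  refine bt_induct_left (((mulB (BiForm R₁ R₂)).flip (j2 b)).comp
    (mulB (BiForm R₁ R₂) (j2 (tmul _ _ x₁ x₂)))) 0 (fun y₁ y₂ hy => ?_) w
  refine tensor_induct_left ((mulB (BiForm R₁ R₂) (j2 (tmul _ _ x₁ x₂) * bt y₁ y₂)).comp j2) 0
    (fun z₁ z₂ hz => ?_) b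
  simp only [BMap.comp_apply, mulB_apply, BMap.zero_apply, j2_tmul]
  rcases hy with hy | hy <;> rcases hz with hz | hz
  · rw [bt_mul_even _ _ _ hy, bt_mul_even _ _ _ hz, form1_mul_form1, map_zero]
  · rw [bt_mul_even _ _ _ hy, bt_mul_odd _ _ _ hz, par_mul, par_form1, form1_mul_form1, map_zero]
  · rw [bt_mul_odd _ _ _ hy, bt_mul_even _ _ _ hz, par_form1, form1_mul_form1, map_zero]
  · rw [bt_mul_odd _ _ _ hy, bt_mul_odd _ _ _ hz, par_mul, par_form1, par_form1, form1_mul_form1,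
      map_zero]

/-- `u` has positive degree in the first direction. -/
def F1 (u : BiForm R₁ R₂) : Prop := pr1 u = 0
/-- `u` has positive degree in the second direction. -/
def F2 (u : BiForm R₁ R₂) : Prop := pr2 u = 0

theorem F1.mul {u v : BiForm R₁ R₂} (hu : F1 u) (w : BiForm R₁ R₂) (hv : F1 v) : u * w * v = 0 := by
  rw [← pr1_add_j1 u, ← pr1_add_j1 v, show pr1 u = 0 from hu, show pr1 v = 0 from hv, zero_add,
    zero_add, j1_mul_j1]
theorem F2.mul {u v : BiForm R₁ R₂} (hu : F2 u) (w : BiForm R₁ R₂) (hv : F2 v) : u * w * v = 0 := by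
  rw [← pr2_add_j2 u, ← pr2_add_j2 v, show pr2 u = 0 from hu, show pr2 v = 0 from hv, zero_add,
    zero_add, j2_mul_j2]
theorem F1.mul' {u v : BiForm R₁ R₂} (hu : F1 u) (hv : F1 v) : u * v = 0 := by
  have := hu.mul (e00 tone) hv
  rwa [mul_e00_one] at this
theorem F2.mul' {u v : BiForm R₁ R₂} (hu : F2 u) (hv : F2 v) : u * v = 0 := by
  have := hu.mul (e00 tone) hv
  rwa [mul_e00_one] at this
theorem F1.left {u : BiForm R₁ R₂} (hu : F1 u) (v : BiForm R₁ R₂) : F1 (v * u) := by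
  rw [F1, pr1_mul, show pr1 u = 0 from hu, mul_zero]
theorem F1.right {u : BiForm R₁ R₂} (hu : F1 u) (v : BiForm R₁ R₂) : F1 (u * v) := by
  rw [F1, pr1_mul, show pr1 u = 0 from hu, zero_mul]
theorem F2.left {u : BiForm R₁ R₂} (hu : F2 u) (v : BiForm R₁ R₂) : F2 (v * u) := by
  rw [F2, pr2_mul, show pr2 u = 0 from hu, mul_zero]
theorem F1.par {u : BiForm R₁ R₂} (hu : F1 u) : F1 (BornChern.par _ u) := by
  rw [F1, pr1_par, show pr1 u = 0 from hu, map_zero]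
theorem F2.par {u : BiForm R₁ R₂} (hu : F2 u) : F2 (BornChern.par _ u) := by
  rw [F2, pr2_par, show pr2 u = 0 from hu, map_zero]

theorem deg0_formD' {R : Type u} [DGBAlg R] (x : FormAlg R) : deg0 R (formD R x) = 0 := rfl

theorem F1_bd₁ (u : BiForm R₁ R₂) : F1 (bd₁ u) :=
  bt_induct (pr1.comp bd₁) 0 (fun x y => by
    rw [BMap.comp_apply, bd₁_bt, pr1_bt, deg0_formD', map_zero, map_zero]; rfl) u
theorem F2_bd₂ (u : BiForm R₁ R₂) : F2 (bd₂ u) :=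
  bt_induct (pr2.comp bd₂) 0 (fun x y => by
    rw [BMap.comp_apply, bd₂_bt, pr2_bt, deg0_formD', map_zero, map_zero]; rfl) u
theorem F1_e11 (u : T11 R₁ R₂) : F1 (e11 u) :=
  tensor_induct (pr1.comp e11) 0 (fun x y => by
    rw [BMap.comp_apply, e11_tmul, pr1_bt, deg0_form1, map_zero, map_zero]; rfl) u
theorem F2_e11 (u : T11 R₁ R₂) : F2 (e11 u) :=
  tensor_induct (pr2.comp e11) 0 (fun x y => by
    rw [BMap.comp_apply, e11_tmul, pr2_bt, deg0_form1, map_zero, map_zero]; rfl) u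
theorem F1.bd₂ {u : BiForm R₁ R₂} (hu : F1 u) : F1 (BornChern.bd₂ u) := by
  have h : pr1 (BornChern.bd₂ u) = BornChern.bd₂ (pr1 u) :=
    bt_induct (pr1.comp BornChern.bd₂) (BornChern.bd₂.comp pr1) (fun x y => by
      simp [par_fun0, -par_unit]) u
  rw [F1, h, show pr1 u = 0 from hu, map_zero]
-- The derivation d₁ sees only the component of degree zero in the first direction.
theorem F1.bd₁ {u : BiForm R₁ R₂} (hu : F1 u) : BornChern.bd₁ u = 0 := by
  have h : BornChern.bd₁ u = BornChern.bd₁ (pr1 u) :=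
    bt_induct BornChern.bd₁ (BornChern.bd₁.comp pr1) (fun x y => by
      rw [BMap.comp_apply, pr1_bt, bd₁_bt, bd₁_bt]; rfl) u
  rw [h, show pr1 u = 0 from hu, map_zero]
theorem F2.bd₂ {u : BiForm R₁ R₂} (hu : F2 u) : BornChern.bd₂ u = 0 := by
  have h : BornChern.bd₂ u = BornChern.bd₂ (pr2 u) :=
    bt_induct BornChern.bd₂ (BornChern.bd₂.comp pr2) (fun x y => by
      rw [BMap.comp_apply, pr2_bt, bd₂_bt, bd₂_bt]; rfl) u
  rw [h, show pr2 u = 0 from hu, map_zero]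

/-- The projection is a graded trace on the biforms of positive degree in both directions. -/
theorem natXX_trace_even {u v : BiForm R₁ R₂} (hv : par _ v = v) (h1 : F1 u) (h2 : F2 u) :
    natXX (u * v) = natXX (v * u) := by
  have h := natXX_comm_even u hv
  -- Each boundary term of the commutator formula is a product of two forms in the same direction.
  rw [(F1_bd₁ v).mul' h1, h2.par.mul' (F2_bd₂ v)] at h
  simpa [sub_eq_zero] using h
theorem natXX_trace_odd {u v : BiForm R₁ R₂} (hv : par _ v = -v) (h1 : F1 u) (h2 : F2 u) :
    natXX (u * v) = natXX (v * par _ u) := by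
  have h := natXX_comm_odd u hv
  rw [(F1_bd₁ v).mul' h1.par, h2.par.mul' (F2_bd₂ v)] at h
  simpa [sub_eq_zero] using h
/-- The same, where the other factor has positive degree. -/
theorem natXX_trace_even' {u v : BiForm R₁ R₂} (hv : par _ v = v) (h1 : F1 v) (h2 : F2 v) :
    natXX (u * v) = natXX (v * u) := by
  have h := natXX_comm_even u hv
  rw [h1.bd₁, h2.bd₂] at h
  simpa [sub_eq_zero] using h
theorem natXX_trace_odd' {u v : BiForm R₁ R₂} (hv : par _ v = -v) (h1 : F1 v) (h2 : F2 v) :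
    natXX (u * v) = natXX (v * par _ u) := by
  have h := natXX_comm_odd u hv
  rw [h1.bd₁, h2.bd₂] at h
  simpa [sub_eq_zero] using h
/-- Exchange of a form of positive degree in the second direction and of one in the first. -/
theorem natXX_swap_even {u v : BiForm R₁ R₂} (hv : par _ v = v) (h2 : F2 u) (h1 : F1 v) :
    natXX (u * v) = natXX (v * u) := by
  have h := natXX_comm_even u hv
  -- The two boundary terms vanish for different reasons: v is already a form in the first
  -- direction, and u multiplied by d₂v has two forms in the second.
  rw [h1.bd₁, h2.par.mul' (F2_bd₂ v)] at h
  simpa [sub_eq_zero] using h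
theorem natXX_swap_odd {u v : BiForm R₁ R₂} (hv : par _ v = -v) (h2 : F2 u) (h1 : F1 v) :
    natXX (u * v) = natXX (v * par _ u) := by
  have h := natXX_comm_odd u hv
  rw [h1.bd₁, h2.par.mul' (F2_bd₂ v)] at h
  simpa [sub_eq_zero] using h
theorem natXX_swap_even' {u v : BiForm R₁ R₂} (hv : par _ v = v) (h1 : F1 u) (h2 : F2 v) :
    natXX (u * v) = natXX (v * u) := by
  have h := natXX_comm_even u hv
  rw [h2.bd₂, (F1_bd₁ v).mul' h1] at h
  simpa [sub_eq_zero] using h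
theorem natXX_swap_odd' {u v : BiForm R₁ R₂} (hv : par _ v = -v) (h1 : F1 u) (h2 : F2 v) :
    natXX (u * v) = natXX (v * par _ u) := by
  have h := natXX_comm_odd u hv
  rw [h2.bd₂, (F1_bd₁ v).mul' h1.par] at h
  simpa [sub_eq_zero] using h

/-- Commutators with forms of positive degree in the first direction. -/
theorem natXX_comm_F1_even {u v : BiForm R₁ R₂} (hv : par _ v = v) (h1 : F1 u) :
    natXX (u * v) - natXX (v * u) = xb₂ (natXX (par _ u * bd₂ v)) := by
  have h := natXX_comm_even u hv
  rwa [(F1_bd₁ v).mul' h1, map_zero, map_zero, zero_add] at h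
theorem natXX_comm_F1_odd {u v : BiForm R₁ R₂} (hv : par _ v = -v) (h1 : F1 u) :
    natXX (u * v) - natXX (v * par _ u) = xb₂ (natXX (par _ u * bd₂ v)) := by
  have h := natXX_comm_odd u hv
  rwa [(F1_bd₁ v).mul' h1.par, map_zero, map_zero, zero_add] at h
theorem natXX_comm_F2_even {u v : BiForm R₁ R₂} (hv : par _ v = v) (h2 : F2 u) :
    natXX (u * v) - natXX (v * u) = xb₁ (natXX (bd₁ v * u)) := by
  have h := natXX_comm_even u hv
  rwa [h2.par.mul' (F2_bd₂ v), map_zero, map_zero, add_zero] at h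
theorem natXX_comm_F2_odd {u v : BiForm R₁ R₂} (hv : par _ v = -v) (h2 : F2 u) :
    natXX (u * v) - natXX (v * par _ u) = xb₁ (natXX (bd₁ v * par _ u)) := by
  have h := natXX_comm_odd u hv
  rwa [h2.par.mul' (F2_bd₂ v), map_zero, map_zero, add_zero] at h

theorem par_bd₁_even {u : BiForm R₁ R₂} (h : par _ u = u) : par _ (bd₁ u) = -bd₁ u := by
  rw [← neg_eq_iff_eq_neg, ← bd₁_par, h]
theorem par_bd₁_odd {u : BiForm R₁ R₂} (h : par _ u = -u) : par _ (bd₁ u) = bd₁ u := by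
  rw [← neg_inj, ← bd₁_par, h, map_neg]
theorem par_bd₂_even {u : BiForm R₁ R₂} (h : par _ u = u) : par _ (bd₂ u) = -bd₂ u := by
  rw [← neg_eq_iff_eq_neg, ← bd₂_par, h]
theorem par_bd₂_odd {u : BiForm R₁ R₂} (h : par _ u = -u) : par _ (bd₂ u) = bd₂ u := by
  rw [← neg_inj, ← bd₂_par, h, map_neg]

end ideals

/-! ### The chain map -/

section psi
variable {R₁ R₂ : Type u} [DGBAlg R₁] [DGBAlg R₂]

/-- The sum of the two Hochschild maps. -/
def xb : XX R₁ R₂ ⟹ XX R₁ R₂ := xb₁ + xb₂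

theorem xb_apply (x : XX R₁ R₂) : xb x = xb₁ x + xb₂ x := rfl

/-- The values of the chain map on `♮ X dY`, for `u = μ(X)`, `y = μ(Y)`, `f = φ(Y)` and `Y` even. -/
def tev (u y f : BiForm R₁ R₂) : XX R₁ R₂ :=
  natXX (bd₁ y * par _ u + u * bd₂ y) + xb (natXX (par _ u * f))
/-- The same for odd `Y`. -/
def tod (u y f : BiForm R₁ R₂) : XX R₁ R₂ :=
  natXX (bd₁ y * u + u * bd₂ y) + xb (natXX (par _ u * f))

/-- Invariance of Ψ under commutators with z. After the Leibniz expansion the first-order terms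
differ by moving y around d₁z ū (`a`) and z around u d₂y (`b`). These moves cost b̄₂ and b̄₁ of the
same form d₁z u d₂y. The cross term of φ(YZ), rotated by `e`, supplies both; the part containing f
is invariant by the trace property `c`. The other parities follow the same pattern. -/
theorem tev_mul_even_even (u : BiForm R₁ R₂) {y z f : BiForm R₁ R₂} (g : BiForm R₁ R₂)
    (hy : par _ y = y) (hz : par _ z = z) (f1 : F1 f) (f2 : F2 f) :
    tev (z * u) y f = tev u (y * z) (f * z + y * g + bd₂ (par _ y) * bd₁ z) - tev (u * y) z g := by
  have a := natXX_comm_F1_even hy ((F1_bd₁ z).right (par _ u))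
  have b := natXX_comm_F2_even hz ((F2_bd₂ y).left u)
  have c := natXX_trace_even hz (f1.left (par _ u)) (f2.left (par _ u))
  have e := natXX_swap_odd (par_bd₁_even hz) ((F2_bd₂ y).left (par _ u)) (F1_bd₁ z)
  simp only [tev, bd₁_mul, bd₂_mul, par_mul, hy, hz, mul_add, add_mul, map_add, mul_assoc,
    par_bd₁_even hz, par_bd₂_even hy, par_par, neg_mul, mul_neg, map_neg, xb_apply] at a b c e ⊢
  rw [c, e]
  simp only [map_neg]
  linear_combination (norm := abel) a - b

theorem tod_mul_even_odd (u : BiForm R₁ R₂) {y z f : BiForm R₁ R₂} (g : BiForm R₁ R₂)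
    (hy : par _ y = -y) (hz : par _ z = z) (f1 : F1 f) (f2 : F2 f) :
    tod (z * u) y f = tod u (y * z) (f * z + y * g + bd₂ (par _ y) * bd₁ z) + tev (u * y) z g := by
  have a := natXX_comm_F1_odd hy ((F1_bd₁ z).right (par _ u))
  have b := natXX_comm_F2_even hz ((F2_bd₂ y).left u)
  have c := natXX_trace_even hz (f1.left (par _ u)) (f2.left (par _ u))
  have e := natXX_swap_odd (par_bd₁_even hz) ((F2_bd₂ y).left (par _ u)) (F1_bd₁ z)
  simp only [tev, tod, bd₁_mul, bd₂_mul, par_mul, hy, hz, mul_add, add_mul, map_add, mul_assoc,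
    par_bd₁_even hz, par_bd₂_odd hy, par_par, neg_mul, mul_neg, map_neg, xb_apply] at a b c e ⊢
  rw [c, e]
  linear_combination (norm := abel) a - b

theorem tev_mul_odd_even (u : BiForm R₁ R₂) {y z f : BiForm R₁ R₂} (g : BiForm R₁ R₂)
    (hy : par _ y = y) (hz : par _ z = -z) (hf : par _ f = f) (f1 : F1 f) (f2 : F2 f) :
    tev (z * u) y f = -tod (par _ u) (y * z) (f * z + y * g + bd₂ (par _ y) * bd₁ z) +
      tod (par _ u * y) z g := by
  have a := natXX_comm_F1_even hy ((F1_bd₁ z).right (par _ u))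
  have b := natXX_comm_F2_odd hz ((F2_bd₂ y).left (par _ u))
  have c := natXX_trace_odd hz (f1.left u) (f2.left u)
  have e := natXX_swap_even (par_bd₁_odd hz) ((F2_bd₂ y).left u) (F1_bd₁ z)
  simp only [tev, tod, bd₁_mul, bd₂_mul, par_mul, hy, hz, hf, mul_add, add_mul, map_add, mul_assoc,
    par_bd₁_odd hz, par_bd₂_even hy, par_par, neg_mul, mul_neg, map_neg, xb_apply, sub_neg_eq_add] at a b c e ⊢
  rw [c, e]
  linear_combination (norm := abel) b - a

theorem tod_mul_odd_odd (u : BiForm R₁ R₂) {y z f : BiForm R₁ R₂} (g : BiForm R₁ R₂)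
    (hy : par _ y = -y) (hz : par _ z = -z) (hf : par _ f = -f) (f1 : F1 f) (f2 : F2 f) :
    tod (z * u) y f = tev (par _ u) (y * z) (f * z + y * g + bd₂ (par _ y) * bd₁ z) +
      tod (par _ u * y) z g := by
  have a := natXX_comm_F1_odd hy ((F1_bd₁ z).right (par _ u))
  have b := natXX_comm_F2_odd hz ((F2_bd₂ y).left (par _ u))
  have c := natXX_trace_odd hz (f1.left u) (f2.left u)
  have e := natXX_swap_even (par_bd₁_odd hz) ((F2_bd₂ y).left u) (F1_bd₁ z)
  simp only [tev, tod, bd₁_mul, bd₂_mul, par_mul, hy, hz, hf, mul_add, add_mul, map_add, mul_assoc,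
    par_bd₁_odd hz, par_bd₂_odd hy, par_par, neg_mul, mul_neg, map_neg, xb_apply] at a b c e ⊢
  rw [c, e]
  simp only [map_neg]
  linear_combination (norm := abel) -a - b

/-- The bilinear map `(X, Y) ↦ Ψ(♮ X dY)`. -/
def tpsi : Unitization ℂ (FreeProd R₁ R₂) ⟹ FreeProd R₁ R₂ ⟹ XX R₁ R₂ :=
  BMap.post natXX (((mulB (BiForm R₁ R₂)).bi (bd₁.comp (muF.comp (evenB _)))
      ((par _).comp muh)).flip) +
    BMap.post natXX (((mulB (BiForm R₁ R₂)).bi (bd₁.comp (muF.comp (oddB _))) muh).flip) +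
    BMap.post natXX ((mulB (BiForm R₁ R₂)).bi muh (bd₂.comp muF)) +
    BMap.post (xb.comp natXX) ((mulB (BiForm R₁ R₂)).bi ((par _).comp muh) phF)

theorem tpsi_even (X : Unitization ℂ (FreeProd R₁ R₂)) {Y : FreeProd R₁ R₂} (hY : par _ Y = Y) :
    tpsi X Y = tev (muh X) (muF Y) (phF Y) := by
  simp only [tpsi, BMap.add_apply, BMap.post_apply, BMap.flip_apply, BMap.bi_apply, BMap.comp_apply,
    evenB_of_even hY, oddB_of_even hY, map_zero, BMap.zero_apply, add_zero, mulB_apply, tev, map_add]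

theorem tpsi_odd (X : Unitization ℂ (FreeProd R₁ R₂)) {Y : FreeProd R₁ R₂} (hY : par _ Y = -Y) :
    tpsi X Y = tod (muh X) (muF Y) (phF Y) := by
  simp only [tpsi, BMap.add_apply, BMap.post_apply, BMap.flip_apply, BMap.bi_apply, BMap.comp_apply,
    evenB_of_odd hY, oddB_of_odd hY, map_zero, BMap.zero_apply, zero_add, mulB_apply, tod, map_add]

theorem F1_phF (Y : FreeProd R₁ R₂) : F1 (phF Y) := F1_e11 _
theorem F2_phF (Y : FreeProd R₁ R₂) : F2 (phF Y) := F2_e11 _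

/-- The right action writes (X dY)z as X d(Yz) minus a signed XY dz, and the three values of Ψ are
then related by the identities for `tev` and `tod` with u = μ(X). -/
theorem tpsi_comm_even {z : FreeProd R₁ R₂} (hz : par _ z = z) (ω : Omega1 (FreeProd R₁ R₂)) :
    omegaLift tpsi (oleft _ z ω) = omegaLift (tpsi (R₁ := R₁) (R₂ := R₂)) (oright _ ω z) := by
  have h : (omegaLift tpsi).comp (oleft _ (z : Unitization ℂ (FreeProd R₁ R₂))) =
      (omegaLift (tpsi (R₁ := R₁) (R₂ := R₂))).comp
        ((oright _).flip (z : Unitization ℂ (FreeProd R₁ R₂))) := homog_ext fun X Y hY => by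
    have hr : rmul _ (z : Unitization ℂ (FreeProd R₁ R₂)) Y = Y * z := by simp [rmul_apply]
    have hz' : par _ (muF z) = muF z := by rw [← muF_par, hz]
    simp only [BMap.comp_apply, BMap.flip_apply, oleft_form, oright_form, map_sub, hr,
      Unitization.snd_inr, omegaLift_form]
    rcases hY with hY | hY
    · rw [tpsi_even _ hY, tpsi_even _ hz, tpsi_even _ (by rw [par_mul, hY, hz]), muh_mul, muh_mul,
        muh_inr, muh_inr, muF_mul, phF_mul, hY, tev_mul_even_even _ (phF z) (by rw [← muF_par, hY])
        hz' (F1_phF Y) (F2_phF Y), ← muF_par, hY]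
    · have hY' : par _ (muF Y) = -muF Y := by rw [← muF_par, hY, map_neg]
      rw [tpsi_odd _ hY, tpsi_even _ hz, tpsi_odd _ (by rw [par_mul, hY, hz, neg_mul]), muh_mul,
        muh_mul, muh_inr, muh_inr, muF_mul, phF_mul, tod_mul_even_odd _ (phF z) hY'
        hz' (F1_phF Y) (F2_phF Y), ← muF_par, hY]
      simp only [tev, map_neg, mul_neg, neg_mul, map_add, par_mul]
      abel
  exact DFunLike.congr_fun h ω

theorem tpsi_comm_odd {z : FreeProd R₁ R₂} (hz : par _ z = -z) (ω : Omega1 (FreeProd R₁ R₂)) :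
    omegaLift tpsi (oleft _ z ω) =
      omegaLift (tpsi (R₁ := R₁) (R₂ := R₂)) (oright _ (par _ ω) z) := by
  have h : (omegaLift tpsi).comp (oleft _ (z : Unitization ℂ (FreeProd R₁ R₂))) =
      ((omegaLift (tpsi (R₁ := R₁) (R₂ := R₂))).comp
        ((oright _).flip (z : Unitization ℂ (FreeProd R₁ R₂)))).comp (par _) :=
    homog_ext fun X Y hY => by
    have hr : ∀ Y, rmul _ (z : Unitization ℂ (FreeProd R₁ R₂)) Y = Y * z := fun Y => by
      simp [rmul_apply]
    have hz' : par _ (muF z) = -muF z := by rw [← muF_par, hz, map_neg]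
    simp only [BMap.comp_apply, BMap.flip_apply, oleft_form, par_form, map_neg, oright_form, map_sub, hr, par_par, Unitization.snd_inr, omegaLift_form]
    rcases hY with hY | hY
    · have hf : par _ (phF Y) = phF Y := by rw [← phF_par, hY]
      have hY' : par _ (muF Y) = muF Y := by rw [← muF_par, hY]
      rw [hY, tpsi_even _ hY, tpsi_odd _ hz, tpsi_odd _ (by rw [par_mul, hY, hz, mul_neg]), muh_mul,
        muh_mul, muh_inr, muh_inr, muh_par, muF_mul, phF_mul, hY,
        tev_mul_odd_even _ (phF z) hY' hz' hf (F1_phF Y) (F2_phF Y), hY']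
      abel
    · have hf : par _ (phF Y) = -phF Y := by rw [← phF_par, hY, map_neg]
      have hY' : par _ (muF Y) = -muF Y := by rw [← muF_par, hY, map_neg]
      rw [hY, neg_mul, map_neg, tpsi_odd _ hY, tpsi_odd _ hz,
        tpsi_even _ (by rw [par_mul, hY, hz, neg_mul_neg]),
        muh_mul, muh_mul, muh_inr, muh_inr, muh_par, muF_mul, phF_mul, muF_par,
        tod_mul_odd_odd _ (phF z) hY' hz' hf (F1_phF Y) (F2_phF Y)]
      abel
  exact DFunLike.congr_fun h ω

theorem tpsi_gcomms (ν : Omega1 (FreeProd R₁ R₂)) (h : ν ∈ gcomms (FreeProd R₁ R₂)) :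
    omegaLift (tpsi (R₁ := R₁) (R₂ := R₂)) ν = 0 := by
  obtain ⟨p, q, x, ω, hx, hω, rfl⟩ := h
  rw [map_sub, map_smul, sub_eq_zero]
  rcases Nat.even_or_odd p with hp | hp
  · rw [tpsi_comm_even (hasDeg_even hp hx), (hp.mul_right q).neg_one_pow, one_smul]
  · rw [tpsi_comm_odd (hasDeg_odd hp hx), hω, map_smul, BMap.smul_apply, map_smul, pow_mul,
      hp.neg_one_pow]

variable (R₁ R₂) in
/-- The chain map. -/
def psi : XT (FreeProd R₁ R₂) ⟹ XX R₁ R₂ :=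
  (natXX.comp (muh + phh)).comp (fstB _ _) + (natLift (omegaLift tpsi) tpsi_gcomms).comp (sndB _ _)

theorem psi_fst (X : Unitization ℂ (FreeProd R₁ R₂)) :
    psi R₁ R₂ (X, 0) = natXX (muh X) + natXX (phh X) := by
  simp [psi]

theorem psi_snd (ω : Omega1 (FreeProd R₁ R₂)) :
    psi R₁ R₂ (0, nat _ ω) = omegaLift tpsi ω := by
  simp [psi]

theorem psi_form (X : Unitization ℂ (FreeProd R₁ R₂)) (Y : FreeProd R₁ R₂) :
    psi R₁ R₂ (0, nat _ (form _ X Y)) = tpsi X Y := by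
  rw [psi_snd, omegaLift_form]

theorem tpsi_formula {p q : ℕ} {X : Unitization ℂ (FreeProd R₁ R₂)} {Y : FreeProd R₁ R₂}
    (hX : HasDeg X p) (hY : HasDeg Y q) : tpsi X Y =
      (-1 : ℂ) ^ (p * (q + 1)) • natXX (bd₁ (muh Y) * muh X) + natXX (muh X * bd₂ (muh Y)) +
        (-1 : ℂ) ^ p • xb (natXX (muh X * phh Y)) := by
  have hX' : par _ (muh X) = (-1 : ℂ) ^ p • muh X := by rw [← muh_par, hX, map_smul]
  rcases hasDeg_parity hY with ⟨h, hY⟩ | ⟨h, hY⟩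
  -- The sign (-1)^(p(q+1)) amounts to `par` on μ(X) when q is even and to nothing when q is odd;
  -- this is the whole difference between `tev` and `tod`.
  · have e : (-1 : ℂ) ^ (p * (q + 1)) = (-1) ^ p := by
      rw [mul_comm, pow_mul, (h.add_one).neg_one_pow]
    rw [tpsi_even _ hY, tev, hX', e, muh_inr, phh_inr, map_add, mul_smul_comm, smul_mul_assoc,
      map_smul, map_smul, map_smul]
  · have e : (-1 : ℂ) ^ (p * (q + 1)) = 1 := by
      rw [mul_comm, pow_mul, (h.add_one).neg_one_pow, one_pow]
    rw [tpsi_odd _ hY, tod, hX', e, muh_inr, phh_inr, map_add, smul_mul_assoc, one_smul,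
      map_smul, map_smul]

theorem isPsi_psi : IsPsi (psi R₁ R₂) := by
  refine ⟨fun X => ?_, fun p q X Y hX hY => ?_⟩
  · rw [psi_fst, ← natXX_e00, ← natXX_e11]; rfl
  · rw [psi_form, tpsi_formula hX hY, ← natXX_e10, ← natXX_e01, e10_m10, e01_m01, e10_d₁, e01_d₂,
      ← xb₁_natXX_e11, ← xb₂_natXX_e11, e11_m11, xb_apply, add_comm (xb₁ _)]; rfl

/-- The prescribed values cover X in degree zero and ♮X dY for homogeneous X and Y. Splitting both
entries by parity reaches every X dY, and these determine a bounded map on the one-forms. -/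
theorem IsPsi.ext {Ψ Φ : XT (FreeProd R₁ R₂) ⟹ XX R₁ R₂} (h : IsPsi Ψ) (k : IsPsi Φ) : Ψ = Φ := by
  have h2 : Ψ.comp ((pairB 0 (BMap.id _)).comp (nat (FreeProd R₁ R₂))) =
      Φ.comp ((pairB 0 (BMap.id _)).comp (nat (FreeProd R₁ R₂))) := by
    refine omega_ext fun X Y => ?_
    refine parity_induct (f := (Ψ.comp ((pairB 0 (BMap.id _)).comp (nat (FreeProd R₁ R₂)))).comp
      (form _ X)) (g := (Φ.comp ((pairB 0 (BMap.id _)).comp (nat (FreeProd R₁ R₂)))).comp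
      (form _ X)) (fun Y hY => ?_) (fun Y hY => ?_) Y
    all_goals
      refine parity_induct
        (f := (Ψ.comp ((pairB 0 (BMap.id _)).comp (nat (FreeProd R₁ R₂)))).comp
          ((form (FreeProd R₁ R₂)).flip Y))
        (g := (Φ.comp ((pairB 0 (BMap.id _)).comp (nat (FreeProd R₁ R₂)))).comp
          ((form (FreeProd R₁ R₂)).flip Y)) (fun X hX => ?_) (fun X hX => ?_) X
    · exact (h.2 0 0 X Y (hasDeg_of_even hX) (hasDeg_of_even hY)).trans
        (k.2 0 0 X Y (hasDeg_of_even hX) (hasDeg_of_even hY)).symm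
    · exact (h.2 1 0 X Y (hasDeg_of_odd hX) (hasDeg_of_even hY)).trans
        (k.2 1 0 X Y (hasDeg_of_odd hX) (hasDeg_of_even hY)).symm
    · exact (h.2 0 1 X Y (hasDeg_of_even hX) (hasDeg_of_odd hY)).trans
        (k.2 0 1 X Y (hasDeg_of_even hX) (hasDeg_of_odd hY)).symm
    · exact (h.2 1 1 X Y (hasDeg_of_odd hX) (hasDeg_of_odd hY)).trans
        (k.2 1 1 X Y (hasDeg_of_odd hX) (hasDeg_of_odd hY)).symm
  refine BMap.ext fun x => ?_
  obtain ⟨ω, hω⟩ := BQuot.mk_surj (gcomms (FreeProd R₁ R₂)) x.2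
  have hx : x = (x.1, 0) + (0, nat _ ω) := Prod.ext (by simp) (by rw [← hω]; simp; rfl)
  rw [hx, map_add, map_add, h.1, k.1]
  congr 1
  exact DFunLike.congr_fun h2 ω

end psi

/-! ### Compatibility of the chain map with the differentials. -/

section chainmap
variable {R₁ R₂ : Type u} [DGBAlg R₁] [DGBAlg R₂]

theorem xb_xb (x : XX R₁ R₂) : xb (xb x) = 0 := by
  simp only [xb_apply, map_add, xb₁_xb₁, xb₂_xb₂, xb₂_xb₁]
  abel

theorem Dtot_natXX (u : BiForm R₁ R₂) : Dtot (natXX u) =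
    xb₁ (natXX u) + xb₂ (natXX u) + (natXX (bd₁ u) + natXX (bd₂ u)) + natXX (dif _ u) := by
  rw [Dtot_apply, natXX_bd₁, natXX_bd₂, natXX_dif]

/-- The total differential of the Hochschild boundary of a form of maximal degree. -/
theorem Dtot_xb_natXX {u : BiForm R₁ R₂} (h1 : F1 u) (h2 : F2 u) :
    Dtot (xb (natXX u)) = -xb (natXX (dif _ u)) := by
  rw [Dtot_apply, ← xb_apply, xb_xb, zero_add, xb_apply]
  simp only [map_add, xd₁_xb₁, xd₂_xb₂, xd₁_xb₂, xd₂_xb₁, ← natXX_bd₁, ← natXX_bd₂, h1.bd₁, h2.bd₂,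
    xdelta_xb₁, xdelta_xb₂, ← natXX_dif, map_zero, xb_apply]
  abel

theorem bd₁_e00_mul (u v : T00 R₁ R₂) : bd₁ (e00 u) * e00 v = e10 (m10 (d₁ u) v) := by
  rw [e10_m10, e10_d₁]
theorem e00_mul_bd₂ (u v : T00 R₁ R₂) : e00 u * bd₂ (e00 v) = e01 (m01 u (d₂ v)) := by
  rw [e01_m01, e01_d₂]

theorem xb₂_bd₁_e00_mul (u v : T00 R₁ R₂) : xb₂ (natXX (bd₁ (e00 u) * e00 v)) = 0 := by
  rw [bd₁_e00_mul, xb₂_natXX_e10]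
theorem xb₁_e00_mul_bd₂ (u v : T00 R₁ R₂) : xb₁ (natXX (e00 u * bd₂ (e00 v))) = 0 := by
  rw [e00_mul_bd₂, xb₁_natXX_e01]

/-- The equations with u₀ and y₀ say that u and y are functions, so each first-order term is seen by
only one of b̄₁ and b̄₂; together these give ♮[ū, y]. The two terms with d₂d₁y cancel by the trace
property `e`. The remaining products of a d₁ with a d₂ are put by `g` and `h` in the order of the
cross term of φ, and δ passes through. -/
theorem Dtot_tev (u₀ y₀ : T00 R₁ R₂) {u y f : BiForm R₁ R₂} (hu : e00 u₀ = u) (hy₀ : e00 y₀ = y)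
    (hy : par _ y = y) (f1 : F1 f) (f2 : F2 f) :
    Dtot (tev u y f) = natXX (par _ u * y - y * par _ u) +
      natXX (bd₂ u * bd₁ y - bd₂ y * bd₁ (par _ u)) + tev (dif _ u) y f -
      tod (par _ u) (dif _ y) (dif _ f) := by
  have a := natXX_comm_even (par _ u) hy
  have b : xb₂ (natXX (bd₁ y * par _ u)) = 0 := by
    rw [← hu, ← hy₀, ← e00_par, xb₂_bd₁_e00_mul]
  have c : xb₁ (natXX (u * bd₂ y)) = 0 := by rw [← hu, ← hy₀, xb₁_e00_mul_bd₂]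
  have e := natXX_trace_even' (u := par _ u) (v := bd₂ (bd₁ y))
    (by rw [par_bd₂_odd]; rw [par_bd₁_even hy]) (F1_bd₁ y).bd₂ (F2_bd₂ _)
  have g := natXX_swap_odd (par_bd₁_even hy) (F2_bd₂ u) (F1_bd₁ y)
  have h := natXX_swap_odd' (par_bd₂_even hy) (F1_bd₁ u) (F2_bd₂ y)
  rw [tev, map_add, Dtot_natXX, Dtot_xb_natXX (f1.left _) (f2.left _)]
  have z1 : bd₁ y * par _ (bd₁ u) = 0 := (F1_bd₁ y).mul' (F1_bd₁ _).par
  have z2 : bd₂ u * bd₂ y = 0 := (F2_bd₂ u).mul' (F2_bd₂ _)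
  simp only [tev, tod, map_add, map_sub, bd₁_mul, bd₂_mul, dif_mul, b, c, e, g, h, bd₁_bd₁, bd₂_bd₂,
    bd₁_bd₂, dif_bd₁, dif_bd₂, par_par, par_bd₁_even hy, zero_mul, mul_zero, neg_mul, mul_neg,
    map_neg, z1, z2, map_zero, bd₁_par, bd₂_par, dif_par, neg_neg, xb_apply] at a ⊢
  linear_combination (norm := abel) -a

theorem Dtot_tod (u₀ y₀ : T00 R₁ R₂) {u y f : BiForm R₁ R₂} (hu : e00 u₀ = u) (hy₀ : e00 y₀ = y)
    (hy : par _ y = -y) (f1 : F1 f) (f2 : F2 f) :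
    Dtot (tod u y f) = natXX (par _ u * y - y * u) +
      natXX (bd₂ u * bd₁ y + bd₂ y * bd₁ u) + tod (dif _ u) y f -
      tev (par _ u) (dif _ y) (dif _ f) := by
  have a := natXX_comm_odd (par _ u) hy
  have b : xb₂ (natXX (bd₁ y * u)) = 0 := by rw [← hu, ← hy₀, xb₂_bd₁_e00_mul]
  have c : xb₁ (natXX (u * bd₂ y)) = 0 := by rw [← hu, ← hy₀, xb₁_e00_mul_bd₂]
  have e := natXX_trace_odd' (u := par _ u) (v := bd₂ (bd₁ y))
    (by rw [par_bd₂_even]; rw [par_bd₁_odd hy]) (F1_bd₁ y).bd₂ (F2_bd₂ _)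
  have g := natXX_swap_even (par_bd₁_odd hy) (F2_bd₂ u) (F1_bd₁ y)
  have h := natXX_swap_even' (par_bd₂_odd hy) (F1_bd₁ u) (F2_bd₂ y)
  rw [tod, map_add, Dtot_natXX, Dtot_xb_natXX (f1.left _) (f2.left _)]
  have z1 : bd₁ y * bd₁ u = 0 := (F1_bd₁ y).mul' (F1_bd₁ _)
  have z2 : bd₂ u * bd₂ y = 0 := (F2_bd₂ u).mul' (F2_bd₂ _)
  simp only [tev, tod, map_add, map_sub, bd₁_mul, bd₂_mul, dif_mul, b, c, e, g, h, bd₁_bd₁, bd₂_bd₂,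
    bd₁_bd₂, dif_bd₁, dif_bd₂, par_par, par_bd₁_odd hy, zero_mul, mul_zero, neg_mul, mul_neg,
    map_neg, z1, z2, map_zero, dif_par, xb_apply] at a ⊢
  linear_combination (norm := abel) -a

theorem XD_nat_form {R : Type u} [DGBAlg R] (X : Unitization ℂ R) (Y : R) :
    XD R (0, nat R (form R X Y)) = (hoch R (form R X Y), 0) +
      ((0, nat R (form R (udif R X) Y)) - (0, nat R (form R (par _ X) (dif R Y)))) := by
  refine Prod.ext ?_ ?_
  · simp only [XD, pairB_apply, BMap.add_apply, BMap.comp_apply, fstB_apply, sndB_apply, map_zero,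
      zero_add, bbar_nat, Prod.fst_add, Prod.fst_sub, sub_self, add_zero]
  · simp only [XD, pairB_apply, BMap.add_apply, BMap.comp_apply, fstB_apply, sndB_apply, map_zero,
      zero_add, ndif_nat, odif_form, map_sub, Prod.snd_add, Prod.snd_sub]

/-- The Hochschild map sends ♮X dY to a graded commutator. In φ of this commutator the terms with
φ(X) and with φ(Y) cancel by the trace properties `t1` and `t2`; only the cross terms stay, and they
are those produced by the total differential on the other side. -/
theorem psi_XD_form (X : Unitization ℂ (FreeProd R₁ R₂)) (Y : FreeProd R₁ R₂)
    (hY : par _ Y = Y ∨ par _ Y = -Y) :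
    psi R₁ R₂ (XD _ (0, nat _ (form _ X Y))) = Dtot (psi R₁ R₂ (0, nat _ (form _ X Y))) := by
  obtain ⟨y₀, hy₀⟩ : ∃ y₀, e00 y₀ = muF Y := ⟨mu (Y : Unitization ℂ (FreeProd R₁ R₂)), muh_inr Y⟩
  rw [XD_nat_form, map_add, map_sub, psi_form, psi_form, psi_form, psi_fst]
  rcases hY with hY | hY
  · have hY' : par _ (muF Y) = muF Y := by rw [← muF_par, hY]
    have hD : par _ (dif _ Y) = -dif _ Y := by rw [← neg_eq_iff_eq_neg, ← dif_par, hY]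
    have t1 := natXX_trace_even (u := par _ (phh X)) hY' (F1_e11 _).par (F2_e11 _).par
    have t2 := natXX_trace_even' (u := par _ (muh X)) (v := phF Y) (by rw [← phF_par, hY])
      (F1_phF Y) (F2_phF Y)
    rw [tpsi_even _ hY, tpsi_even _ hY, tpsi_odd _ hD, hoch_even _ hY, map_sub, map_sub, map_sub, muh_mul,
      muh_mul, phh_mul, phh_mul, muh_inr, phh_inr, muh_par, muh_dif, muF_dif, phF_dif, muh_par,
      muh_par, par_par, muh_par, muh_inr, hY', phh_par,
      Dtot_tev (mu X) y₀ (u := muh X) rfl hy₀ hY' (F1_phF Y) (F2_phF Y)]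
    simp only [map_add, map_sub, t1, t2]
    abel
  · have hY' : par _ (muF Y) = -muF Y := by rw [← muF_par, hY, map_neg]
    have hD : par _ (dif _ Y) = dif _ Y := by rw [← neg_inj, ← dif_par, hY, map_neg]
    have t1 := natXX_trace_odd (u := par _ (phh X)) hY' (F1_e11 _).par (F2_e11 _).par
    have t2 := natXX_trace_odd' (u := par _ (muh X)) (v := phF Y)
      (by rw [← phF_par, hY, map_neg]) (F1_phF Y) (F2_phF Y)
    rw [tpsi_odd _ hY, tpsi_odd _ hY, tpsi_even _ hD, hoch_odd _ hY, map_sub, map_sub, map_sub, muh_mul,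
      muh_mul, phh_mul, phh_mul, muh_inr, phh_inr, muh_par, muh_dif, muF_dif, phF_dif, muh_par,
      muh_par, par_par, muh_par, muh_inr, hY', phh_par,
      Dtot_tod (mu X) y₀ (u := muh X) rfl hy₀ hY' (F1_phF Y) (F2_phF Y)]
    rw [par_par] at t1 t2
    simp only [map_add, map_sub, map_neg, neg_mul, t1, t2]
    abel

theorem XD_fst {R : Type u} [DGBAlg R] (X : Unitization ℂ R) :
    XD R (X, 0) = (udif R X, 0) + (0, nat R (dform R X)) := by
  refine Prod.ext ?_ ?_ <;> simp [XD, natd]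

theorem tpsi_one (Y : FreeProd R₁ R₂) (hY : par _ Y = Y ∨ par _ Y = -Y) :
    tpsi 1 Y = natXX (bd₁ (muF Y)) + natXX (bd₂ (muF Y)) + xb (natXX (phF Y)) := by
  rcases hY with hY | hY
  · rw [tpsi_even _ hY, tev, muh_one, par_one', e00_one_mul, e00_one_mul, mul_e00_one, map_add]
  · rw [tpsi_odd _ hY, tod, muh_one, par_one', e00_one_mul, e00_one_mul, mul_e00_one, map_add]

/-- Here b̄ vanishes on μ(X), while d₁ and d₂ vanish on φ(X). What is left besides δ is d₁μ(X) +
d₂μ(X) and the boundary of φ(X), which is the value of Ψ on ♮dX. -/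
theorem psi_XD_fst (X : Unitization ℂ (FreeProd R₁ R₂)) :
    psi R₁ R₂ (XD _ (X, 0)) = Dtot (psi R₁ R₂ (X, 0)) := by
  have key : ∀ X : Unitization ℂ (FreeProd R₁ R₂), Dtot (psi R₁ R₂ (X, 0)) =
      natXX (dif _ (muh X)) + natXX (dif _ (phh X)) + (natXX (bd₁ (muh X)) + natXX (bd₂ (muh X)) +
        xb (natXX (phh X))) := fun X => by
    have h1 : F1 (phh X) := F1_e11 _
    have h2 : F2 (phh X) := F2_e11 _
    have b1 : xb₁ (natXX (muh X)) = 0 := xb₁_natXX_e00 (mu X)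
    have b2 : xb₂ (natXX (muh X)) = 0 := xb₂_natXX_e00 (mu X)
    rw [psi_fst, map_add, Dtot_natXX, Dtot_natXX, h1.bd₁, h2.bd₂, b1, b2, map_zero, xb_apply]
    abel
  have h0 : ∀ Y : FreeProd R₁ R₂, psi R₁ R₂ (0, nat _ (form _ 1 Y)) =
      natXX (bd₁ (muF Y)) + natXX (bd₂ (muF Y)) + xb (natXX (phF Y)) := fun Y => by
    rw [psi_form]
    exact parity_induct (f := tpsi 1) (g := natXX.comp (bd₁.comp muF) + natXX.comp (bd₂.comp muF) +
      xb.comp (natXX.comp phF)) (fun Y hY => tpsi_one Y (Or.inl hY))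
      (fun Y hY => tpsi_one Y (Or.inr hY)) Y
  rw [key, XD_fst, map_add, psi_fst, muh_dif, phh_dif]
  congr 1
  refine unit_induct ((psi R₁ R₂).comp ((pairB 0 (BMap.id _)).comp ((nat _).comp (dform _))))
    (natXX.comp (bd₁.comp muh) + natXX.comp (bd₂.comp muh) + xb.comp (natXX.comp phh)) ?_
    (fun Y => ?_) X
  · simp only [BMap.comp_apply, BMap.add_apply, inl_one, dform_one, map_zero, muh_one, bd₁_one,
      bd₂_one, phh_one, add_zero]
  · have := h0 Y
    rw [← dform_inr, ← muh_inr, ← phh_inr] at this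
    exact this

/-- The map `Ψ` is a morphism of complexes. -/
theorem psi_XD (x : XT (FreeProd R₁ R₂)) : psi R₁ R₂ (XD _ x) = Dtot (psi R₁ R₂ x) := by
  have h2 : ((psi R₁ R₂).comp (XD _)).comp ((pairB 0 (BMap.id _)).comp (nat (FreeProd R₁ R₂))) =
      (Dtot.comp (psi R₁ R₂)).comp ((pairB 0 (BMap.id _)).comp (nat (FreeProd R₁ R₂))) :=
    homog_ext fun X Y hY => psi_XD_form X Y hY
  obtain ⟨ω, hω⟩ := BQuot.mk_surj (gcomms (FreeProd R₁ R₂)) x.2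
  have hx : x = (x.1, 0) + (0, nat _ ω) := Prod.ext (by simp) (by rw [← hω]; simp; rfl)
  rw [hx, map_add, map_add, map_add, map_add, psi_XD_fst]
  congr 1
  exact DFunLike.congr_fun h2 ω

end chainmap

/-! ### The beta kernel -/

section kernel
open MeasureTheory

/-- The beta integral `∫₀¹ sⁱ (1 - s)ʲ ds`. -/
def kk (i j : ℕ) : ℝ := (i.factorial * j.factorial : ℝ) / (i + j + 1).factorial

theorem kk_pos (i j : ℕ) : 0 < kk i j := by unfold kk; positivity

theorem kk_zero_right (i : ℕ) : kk i 0 = 1 / (i + 1) := by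
  unfold kk
  rw [add_zero, Nat.factorial_succ, Nat.factorial_zero]
  push_cast
  field_simp

/-- Under the integral this is 1 = s + (1 - s). It is the source of the telescoping sums below. -/
theorem kk_add (i j : ℕ) : kk i j = kk (i + 1) j + kk i (j + 1) := by
  unfold kk
  rw [show i + 1 + j + 1 = (i + j + 1) + 1 by ring, show i + (j + 1) + 1 = (i + j + 1) + 1 by ring,
    Nat.factorial_succ (i + j + 1), Nat.factorial_succ i, Nat.factorial_succ j]
  push_cast
  field_simp
  ring

theorem kk_comm (i j : ℕ) : kk i j = kk j i := by
  unfold kk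
  rw [add_comm i j, mul_comm]

theorem kk_succ (i j : ℕ) : kk i (j + 1) = (j + 1) / (i + 1) * kk (i + 1) j := by
  unfold kk
  rw [show i + 1 + j + 1 = i + (j + 1) + 1 by ring, Nat.factorial_succ i, Nat.factorial_succ j]
  push_cast
  field_simp

/-- Integration by parts: the function sⁱ⁺¹(1 - s)ʲ⁺¹ vanishes at both ends, which trades a power of
1 - s for a power of s as in `kk_succ`. -/
theorem integral_kk (i j : ℕ) : ∫ s in (0 : ℝ)..1, s ^ i * (1 - s) ^ j = kk i j := by
  induction j generalizing i with
  | zero => simp [kk_zero_right]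
  | succ j ih =>
    have hd : ∀ s : ℝ, HasDerivAt (fun s : ℝ => s ^ (i + 1) * (1 - s) ^ (j + 1))
        ((i + 1) * (s ^ i * (1 - s) ^ (j + 1)) - (j + 1) * (s ^ (i + 1) * (1 - s) ^ j)) s := by
      intro s
      have h1 := (hasDerivAt_id s).pow (i + 1)
      have h2 := ((hasDerivAt_id s).const_sub 1).pow (j + 1)
      refine (h1.mul h2).congr_deriv ?_
      simp
      ring
    have h0 := intervalIntegral.integral_eq_sub_of_hasDerivAt (a := 0) (b := 1)
      (fun s _ => hd s) ((by fun_prop : Continuous fun s : ℝ =>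
        (i + 1) * (s ^ i * (1 - s) ^ (j + 1)) - (j + 1) * (s ^ (i + 1) * (1 - s) ^ j)).intervalIntegrable
          0 1)
    rw [intervalIntegral.integral_sub
      ((by fun_prop : Continuous fun s : ℝ => ((i : ℝ) + 1) *
        (s ^ i * (1 - s) ^ (j + 1))).intervalIntegrable 0 1)
      ((by fun_prop : Continuous fun s : ℝ => ((j : ℝ) + 1) *
        (s ^ (i + 1) * (1 - s) ^ j)).intervalIntegrable 0 1),
      intervalIntegral.integral_const_mul, intervalIntegral.integral_const_mul, ih (i + 1)] at h0
    simp only [sub_self, ne_eq, Nat.add_eq_zero_iff, one_ne_zero, and_false, not_false_eq_true,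
      zero_pow, mul_zero, sub_zero, zero_mul] at h0
    rw [kk_succ]
    have hi : (i : ℝ) + 1 ≠ 0 := by positivity
    field_simp
    linarith

/-- By `kk_add` the summand is `kk m j - kk m (j + 1)`; the sum telescopes, and its first term is
1/(m+1). -/
theorem sum_kk_le (m N : ℕ) : ∑ j ∈ Finset.range N, kk (m + 1) j ≤ 1 / (m + 1) := by
  have h : ∀ N, ∑ j ∈ Finset.range N, kk (m + 1) j = kk m 0 - kk m N := fun N => by
    induction N with
    | zero => simp
    | succ N ih => rw [Finset.sum_range_succ, ih, kk_add m N]; ring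
  rw [h, kk_zero_right]
  linarith [kk_pos m N]

end kernel

/-! ### Series weighted by the beta kernel -/

section abel
open MeasureTheory
variable {V W U : Type*} [NormedAddCommGroup V] [NormedSpace ℂ V] [NormedAddCommGroup W]
  [NormedSpace ℂ W] [NormedAddCommGroup U] [NormedSpace ℂ U]

/-- Partial sums weighted by a geometric sequence are bounded by the bound of the partial sums. -/
theorem norm_geom_sum_le {r C : ℝ} (h0 : 0 ≤ r) (h1 : r ≤ 1) (n : ℕ) : ∀ (b : ℕ → W) (c : W),
    (∀ k, ‖c + ∑ j ∈ Finset.range k, b j‖ ≤ C) →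
      ‖c + ∑ j ∈ Finset.range n, ((r ^ j : ℝ) : ℂ) • b j‖ ≤ C := by
  induction n with
  | zero => intro b c h; simpa using h 0
  | succ n ih =>
    intro b c h
    have h2 := ih (fun j => b (j + 1)) (c + b 0) fun k => by
      have := h (k + 1)
      rwa [Finset.sum_range_succ', add_comm _ (b 0), ← add_assoc] at this
    have h3 := h 1
    rw [Finset.sum_range_one] at h3
    -- Abel summation as convexity: the weighted sum is a convex combination, with weights 1 - r and
    -- r, of the first partial sum and of the same expression for the shifted sequence. The constant
    -- c absorbs the shift.
    have e : c + ∑ j ∈ Finset.range (n + 1), ((r ^ j : ℝ) : ℂ) • b j =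
        ((1 - r : ℝ) : ℂ) • (c + b 0) +
          ((r : ℝ) : ℂ) • (c + b 0 + ∑ j ∈ Finset.range n, ((r ^ j : ℝ) : ℂ) • b (j + 1)) := by
      rw [Finset.sum_range_succ']
      simp only [smul_add, Finset.smul_sum, smul_smul, ← Complex.ofReal_mul, ← pow_succ']
      simp only [Complex.ofReal_sub, sub_smul, Complex.ofReal_one, one_smul, pow_zero]
      abel
    rw [e]
    refine (norm_add_le _ _).trans ?_
    rw [norm_smul, norm_smul, Complex.norm_real, Complex.norm_real, Real.norm_of_nonneg h0,
      Real.norm_of_nonneg (by linarith)]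
    nlinarith

/-- The weighted terms of a product of two series. -/
def wterm (β : V →L[ℂ] W →L[ℂ] U) (a : ℕ → V) (b : ℕ → W) (s : ℝ) (p : ℕ × ℕ) : U :=
  ((s ^ p.1 * (1 - s) ^ p.2 : ℝ) : ℂ) • β (a p.1) (b p.2)

/-- For fixed i the weights (1 - s)ʲ decrease, so the inner sum is controlled by the partial sums of
b. For s ≤ 1/2 the outer weights sⁱ add up to at most 2. The bound depends neither on s nor on N. -/
theorem norm_wterm_sum_le_left (β : V →L[ℂ] W →L[ℂ] U) {a : ℕ → V} {b : ℕ → W} {C D : ℝ}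
    (ha : ∀ n, ‖a n‖ ≤ C) (hb : ∀ n, ‖∑ j ∈ Finset.range n, b j‖ ≤ D) {s : ℝ} (h0 : 0 ≤ s)
    (h1 : s ≤ 1 / 2) (N : ℕ) :
    ‖∑ n ∈ Finset.range N, ∑ p ∈ Finset.HasAntidiagonal.antidiagonal n, wterm β a b s p‖ ≤ 2 * (‖β‖ * C * D) := by
  have hC : 0 ≤ C := (norm_nonneg _).trans (ha 0)
  have hD : 0 ≤ D := (norm_nonneg _).trans (hb 0)
  simp only [Finset.Nat.sum_antidiagonal_eq_sum_range_succ_mk]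
  rw [Finset.sum_range_diag_flip N fun i j => wterm β a b s (i, j)]
  have h : ∀ i ∈ Finset.range N, ‖∑ j ∈ Finset.range (N - i), wterm β a b s (i, j)‖ ≤
      (1 / 2) ^ i * (‖β‖ * C * D) := fun i _ => by
    have e : ∑ j ∈ Finset.range (N - i), wterm β a b s (i, j) = ((s ^ i : ℝ) : ℂ) •
        β (a i) (0 + ∑ j ∈ Finset.range (N - i), (((1 - s) ^ j : ℝ) : ℂ) • b j) := by
      rw [zero_add, map_sum, Finset.smul_sum]
      refine Finset.sum_congr rfl fun j _ => ?_
      rw [wterm, map_smul, smul_smul, ← Complex.ofReal_mul]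
    have hg := norm_geom_sum_le (r := 1 - s) (by linarith) (by linarith) (N - i) b 0
      (C := D) (by simpa using hb)
    rw [e, norm_smul, Complex.norm_real, Real.norm_of_nonneg (by positivity)]
    refine mul_le_mul (pow_le_pow_left₀ h0 h1 i) ?_ (norm_nonneg _) (by positivity)
    refine (β.le_opNorm₂ _ _).trans ?_
    gcongr
    exact ha i
  refine (norm_sum_le_of_le _ h).trans ?_
  rw [← Finset.sum_mul]
  have hs : ∑ i ∈ Finset.range N, (1 / 2 : ℝ) ^ i ≤ 2 :=
    (summable_geometric_two.sum_le_tsum _ fun i _ => by positivity).trans_eq tsum_geometric_two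
  gcongr

theorem wterm_swap (β : V →L[ℂ] W →L[ℂ] U) (a : ℕ → V) (b : ℕ → W) (s : ℝ) (n : ℕ) :
    ∑ p ∈ Finset.HasAntidiagonal.antidiagonal n, wterm β a b s p =
      ∑ p ∈ Finset.HasAntidiagonal.antidiagonal n, wterm β.flip b a (1 - s) p := by
  rw [← Finset.Nat.sum_antidiagonal_swap]
  refine Finset.sum_congr rfl fun p _ => ?_
  simp only [wterm, Prod.fst_swap, Prod.snd_swap, ContinuousLinearMap.flip_apply, sub_sub_cancel,
    mul_comm]

theorem norm_term_le {a : ℕ → V} {C : ℝ} (ha : ∀ n, ‖∑ i ∈ Finset.range n, a i‖ ≤ C) (n : ℕ) :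
    ‖a n‖ ≤ 2 * C := by
  have h := norm_sub_le (∑ i ∈ Finset.range (n + 1), a i) (∑ i ∈ Finset.range n, a i)
  rw [Finset.sum_range_succ, add_sub_cancel_left, ← Finset.sum_range_succ] at h
  linarith [ha n, ha (n + 1)]

/-- On the half s ≥ 1/2 the two series exchange roles. The constant 4 is 2 from the geometric series
times 2 from bounding a term by two consecutive partial sums. -/
theorem norm_wterm_sum_le (β : V →L[ℂ] W →L[ℂ] U) {a : ℕ → V} {b : ℕ → W} {C D : ℝ}
    (ha : ∀ n, ‖∑ i ∈ Finset.range n, a i‖ ≤ C) (hb : ∀ n, ‖∑ j ∈ Finset.range n, b j‖ ≤ D)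
    {s : ℝ} (h0 : 0 ≤ s) (h1 : s ≤ 1) (N : ℕ) :
    ‖∑ n ∈ Finset.range N, ∑ p ∈ Finset.HasAntidiagonal.antidiagonal n, wterm β a b s p‖ ≤ 4 * (‖β‖ * C * D) := by
  rcases le_total s (1 / 2) with h | h
  · refine (norm_wterm_sum_le_left β (norm_term_le ha) hb h0 h N).trans_eq ?_
    ring
  · rw [Finset.sum_congr rfl fun n _ => wterm_swap β a b s n]
    refine (norm_wterm_sum_le_left β.flip (norm_term_le hb) ha (by linarith) (by linarith)
      N).trans_eq ?_
    rw [ContinuousLinearMap.opNorm_flip]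
    ring

theorem summable_wterm [CompleteSpace U] (β : V →L[ℂ] W →L[ℂ] U) {a : ℕ → V} {b : ℕ → W} {C D : ℝ}
    (ha : ∀ n, ‖a n‖ ≤ C) (hb : ∀ n, ‖b n‖ ≤ D) {s : ℝ} (h0 : 0 < s) (h1 : s < 1) :
    Summable (wterm β a b s) := by
  have hC : 0 ≤ C := (norm_nonneg _).trans (ha 0)
  have hg := ((summable_geometric_of_lt_one h0.le h1).mul_of_nonneg
    (summable_geometric_of_lt_one (sub_nonneg.2 h1.le) (by linarith : 1 - s < 1))
    (fun i => by positivity) (fun i => pow_nonneg (by linarith) i)).mul_right (‖β‖ * C * D)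
  refine Summable.of_norm_bounded hg fun p => ?_
  have hp : 0 ≤ s ^ p.1 * (1 - s) ^ p.2 :=
    mul_nonneg (by positivity) (pow_nonneg (by linarith) _)
  rw [wterm, norm_smul, Complex.norm_real, Real.norm_of_nonneg hp]
  gcongr
  refine (β.le_opNorm₂ _ _).trans ?_
  gcongr
  exacts [ha _, hb _]

theorem hasSum_antidiagonal {f : ℕ × ℕ → U} {u : U} (h : HasSum f u) :
    HasSum (fun n => ∑ p ∈ Finset.HasAntidiagonal.antidiagonal n, f p) u := by
  have := (Finset.HasAntidiagonal.sigmaAntidiagonalEquivProd.hasSum_iff.2 h).sigma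
    (fun n => hasSum_fintype _)
  refine this.congr_fun ?_ |> fun h => h
  intro n
  exact (Finset.sum_coe_sort (Finset.HasAntidiagonal.antidiagonal n) f).symm

/-- The terms of the product of two series weighted by the beta kernel. -/
def kconv (β : V →L[ℂ] W →L[ℂ] U) (a : ℕ → V) (b : ℕ → W) (n : ℕ) : U :=
  ∑ p ∈ Finset.HasAntidiagonal.antidiagonal n, (kk p.1 p.2 : ℂ) • β (a p.1) (b p.2)

theorem continuous_wterm (β : V →L[ℂ] W →L[ℂ] U) (a : ℕ → V) (b : ℕ → W) (p : ℕ × ℕ) :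
    Continuous fun s => wterm β a b s p := by
  unfold wterm
  fun_prop

theorem integral_wterm (β : V →L[ℂ] W →L[ℂ] U) (a : ℕ → V) (b : ℕ → W) [CompleteSpace U] (n : ℕ) :
    ∫ s in (0 : ℝ)..1, ∑ p ∈ Finset.HasAntidiagonal.antidiagonal n, wterm β a b s p = kconv β a b n := by
  rw [intervalIntegral.integral_finsetSum fun p _ =>
    (continuous_wterm β a b p).intervalIntegrable 0 1]
  refine Finset.sum_congr rfl fun p _ => ?_
  unfold wterm
  rw [intervalIntegral.integral_smul_const, intervalIntegral.integral_ofReal, integral_kk]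

/-- The product of two series with bounded partial sums, weighted by the beta kernel, converges. -/
theorem exists_tendsto_kconv [CompleteSpace U] (β : V →L[ℂ] W →L[ℂ] U) {a : ℕ → V} {b : ℕ → W}
    {C D : ℝ} (ha : ∀ n, ‖∑ i ∈ Finset.range n, a i‖ ≤ C)
    (hb : ∀ n, ‖∑ j ∈ Finset.range n, b j‖ ≤ D) :
    ∃ c, Tendsto (fun N => ∑ n ∈ Finset.range N, kconv β a b n) atTop (𝓝 c) := by
  have hc : ∀ n, Continuous fun s => ∑ p ∈ Finset.HasAntidiagonal.antidiagonal n, wterm β a b s p := fun n =>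
    continuous_finsetSum _ fun p _ => continuous_wterm β a b p
  refine ⟨∫ s in (0 : ℝ)..1, ∑' p, wterm β a b s p, ?_⟩
  -- For 0 < s < 1 bounded terms already make the double series absolutely convergent, which gives
  -- the pointwise limit; the preceding uniform bound dominates the partial sums. The point s = 1 is
  -- discarded as a null set.
  have h := intervalIntegral.tendsto_integral_filter_of_dominated_convergence (μ := volume)
    (a := (0 : ℝ)) (b := 1) (l := atTop)
    (F := fun N s => ∑ n ∈ Finset.range N, ∑ p ∈ Finset.HasAntidiagonal.antidiagonal n, wterm β a b s p)
    (f := fun s => ∑' p, wterm β a b s p)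
    (fun _ => 4 * (‖β‖ * C * D))
    (Eventually.of_forall fun N =>
      (continuous_finsetSum _ fun n _ => hc n).aestronglyMeasurable)
    (Eventually.of_forall fun N => Eventually.of_forall fun s hs => by
      rw [uIoc_of_le zero_le_one] at hs
      exact norm_wterm_sum_le β ha hb hs.1.le hs.2 N)
    intervalIntegrable_const (by
      have h1 : ∀ᵐ s : ℝ ∂volume, s ≠ 1 := by
        simp [ae_iff]
      filter_upwards [h1] with s hs1 hs
      rw [uIoc_of_le zero_le_one] at hs
      exact (hasSum_antidiagonal (summable_wterm β (norm_term_le ha) (norm_term_le hb) hs.1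
        (lt_of_le_of_ne hs.2 hs1)).hasSum).tendsto_sum_nat)
  refine h.congr fun N => ?_
  rw [intervalIntegral.integral_finsetSum fun n _ => (hc n).intervalIntegrable 0 1]
  exact Finset.sum_congr rfl fun n _ => integral_wterm β a b n

end abel

/-! ### Series over the simplex -/

section simplex
open MeasureTheory

theorem sum_kk_le' (m N : ℕ) : ∑ i ∈ Finset.range N, kk i (m + 1) ≤ 1 / (m + 1) := by
  simp only [kk_comm _ (m + 1)]
  exact sum_kk_le m N

/-- The integral of `s₀ⁱ s₁ʲ s₂ᵏ` over the simplex, at `(i, j, k)`. -/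
def kk3 (t : ℕ × ℕ × ℕ) : ℝ := kk t.1 (t.2.1 + t.2.2 + 1) * kk t.2.1 t.2.2

/-- Both sides equal i! j! k!/(i+j+k+2)!. The right side is the order in which Fubini's theorem
integrates over the simplex, s₂ first and s₁ last. -/
theorem kk3_eq (i j k : ℕ) : kk3 (i, j, k) = kk k i * kk j (i + k + 1) := by
  unfold kk3 kk
  simp only
  rw [show i + (j + k + 1) + 1 = j + (i + k + 1) + 1 by ring, add_comm k i]
  field_simp

/-- The row k = 0 is the series of 1/(j+1)². In the row k = m + 1 the factor 1/(j+k+1) is at most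
1/(m+1), and the telescoping bound gives another 1/(m+1). -/
theorem summable_kk_div : Summable fun p : ℕ × ℕ => kk p.2 p.1 * (1 / (p.2 + p.1 + 1) : ℝ) := by
  have hn : ∀ j k : ℕ, 0 ≤ kk j k * (1 / (j + k + 1) : ℝ) := fun j k =>
    mul_nonneg (kk_pos _ _).le (by positivity)
  have hb : ∀ m N : ℕ, ∑ j ∈ Finset.range N, kk j (m + 1) * (1 / (j + (m + 1 : ℕ) + 1) : ℝ) ≤
      (1 / (m + 1)) * (1 / (m + 1)) := fun m N => by
    refine (Finset.sum_le_sum fun j _ => ?_).trans ((Finset.sum_mul _ _ _).symm.trans_le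
      (mul_le_mul_of_nonneg_right (sum_kk_le' m N) (by positivity : (0 : ℝ) ≤ 1 / (m + 1))))
    refine mul_le_mul_of_nonneg_left ?_ (kk_pos _ _).le
    refine one_div_le_one_div_of_le (by positivity) ?_
    push_cast
    linarith [(Nat.cast_nonneg j : (0 : ℝ) ≤ j)]
  have hsq : Summable fun m : ℕ => (1 / (m + 1) : ℝ) * (1 / (m + 1)) := by
    have := (summable_nat_add_iff 1).2 (Real.summable_one_div_nat_pow.2 one_lt_two)
    refine this.congr fun m => ?_
    push_cast
    rw [div_mul_div_comm, one_mul, sq]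
  refine (summable_prod_of_nonneg fun p => hn p.2 p.1).2 ⟨fun k => ?_, ?_⟩
  · cases k with
    | zero => simpa [kk_zero_right] using hsq
    | succ m => exact summable_of_sum_range_le (fun j => hn j (m + 1)) (hb m)
  · refine (summable_nat_add_iff 1).1 (Summable.of_nonneg_of_le
      (fun m => tsum_nonneg fun j => hn j (m + 1)) (fun m => ?_) hsq)
    exact Real.tsum_le_of_sum_range_le (fun j => hn j (m + 1)) (hb m)

/-- The sum over i is taken first and is at most 1/(j+k+1) by telescoping, which leaves
`summable_kk_div`. In terms of integrals, the product of the 1/(1 - sᵢ) is integrable over the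
simplex. -/
theorem summable_kk3 : Summable kk3 := by
  have h1 : Summable fun q : (ℕ × ℕ) × ℕ => kk q.2 (q.1.2 + q.1.1 + 1) * kk q.1.2 q.1.1 := by
    refine (summable_prod_of_nonneg fun q => mul_nonneg (kk_pos _ _).le (kk_pos _ _).le).2
      ⟨fun p => ?_, ?_⟩
    · have h : Summable fun i => kk i (p.2 + p.1 + 1) :=
        summable_of_sum_range_le (fun i => (kk_pos _ _).le) (sum_kk_le' _)
      exact h.mul_right (kk p.2 p.1)
    · refine Summable.of_nonneg_of_le
        (fun p => tsum_nonneg fun i => mul_nonneg (kk_pos _ _).le (kk_pos _ _).le) (fun p => ?_)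
        summable_kk_div
      have h : ∑' i, kk i (p.2 + p.1 + 1) ≤ 1 / ((p.2 + p.1 : ℕ) + 1) :=
        Real.tsum_le_of_sum_range_le (fun i => (kk_pos _ _).le) (sum_kk_le' _)
      simp only
      rw [tsum_mul_right, mul_comm]
      refine mul_le_mul_of_nonneg_left (h.trans_eq ?_) (kk_pos _ _).le
      push_cast
      rfl
  let e : ℕ × ℕ × ℕ ≃ (ℕ × ℕ) × ℕ := ⟨fun t => ((t.2.2, t.2.1), t.1), fun q => (q.2, q.1.2, q.1.1),
    fun _ => rfl, fun _ => rfl⟩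
  exact e.summable_iff.2 h1

/-- The monomial `s₀ⁱ s₁ʲ s₂ᵏ` on the simplex. -/
def smon (t : ℕ × ℕ × ℕ) (s : ℝ × ℝ) : ℝ := (1 - s.1 - s.2) ^ t.1 * (s.1 ^ t.2.1 * s.2 ^ t.2.2)

theorem isClosed_simplex2 : IsClosed simplex2 :=
  ((isClosed_le continuous_const continuous_fst).inter
    ((isClosed_le continuous_const continuous_snd).inter
      (isClosed_le (continuous_fst.add continuous_snd) continuous_const)))

theorem isCompact_simplex2 : IsCompact simplex2 := by
  refine (isCompact_Icc (a := (0 : ℝ × ℝ)) (b := 1)).of_isClosed_subset isClosed_simplex2 ?_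
  rintro ⟨x, y⟩ ⟨h1, h2, h3⟩
  simp only at h1 h2 h3
  exact ⟨⟨h1, h2⟩, ⟨by simp; linarith, by simp; linarith⟩⟩

theorem continuous_smon (t : ℕ × ℕ × ℕ) : Continuous (smon t) := by
  unfold smon
  fun_prop

theorem smon_nonneg (t : ℕ × ℕ × ℕ) {s : ℝ × ℝ} (h : s ∈ simplex2) : 0 ≤ smon t s := by
  obtain ⟨h1, h2, h3⟩ := h
  have : 0 ≤ 1 - s.1 - s.2 := by linarith
  unfold smon
  positivity

theorem integrable_smon (t : ℕ × ℕ × ℕ) : Integrable (smon t) (volume.restrict simplex2) :=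
  (continuous_smon t).continuousOn.integrableOn_compact isCompact_simplex2

/-- The substitution of (1 - x)y for y reduces the slice of the simplex to the beta integral. -/
theorem integral_pow_mul_pow (i k : ℕ) (x : ℝ) :
    ∫ y in (0 : ℝ)..(1 - x), (1 - x - y) ^ i * y ^ k = (1 - x) ^ (i + k + 1) * kk k i := by
  have h := intervalIntegral.smul_integral_comp_mul_left (a := 0) (b := 1)
    (fun y => (1 - x - y) ^ i * y ^ k) (1 - x)
  rw [mul_zero, mul_one] at h
  rw [← h, ← integral_kk, smul_eq_mul, pow_succ', mul_assoc]
  congr 1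
  rw [← intervalIntegral.integral_const_mul]
  congr 1
  funext y
  rw [show 1 - x - (1 - x) * y = (1 - x) * (1 - y) by ring, mul_pow, mul_pow, pow_add]
  ring

theorem integral_smon (t : ℕ × ℕ × ℕ) : ∫ s in simplex2, smon t s = kk3 t := by
  obtain ⟨i, j, k⟩ := t
  have hm := isClosed_simplex2.measurableSet
  rw [← integral_indicator hm, Measure.volume_eq_prod,
    integral_prod _ ((integrable_indicator_iff hm).2 (integrable_smon _))]
  have h : ∀ x, (∫ y, simplex2.indicator (smon (i, j, k)) (x, y)) =
      (Icc (0 : ℝ) 1).indicator (fun x => x ^ j * (1 - x) ^ (i + k + 1) * kk k i) x := fun x => by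
    by_cases hx : x ∈ Icc (0 : ℝ) 1
    · have e : (fun y => simplex2.indicator (smon (i, j, k)) (x, y)) =
          (Icc (0 : ℝ) (1 - x)).indicator fun y => x ^ j * ((1 - x - y) ^ i * y ^ k) := by
        funext y
        by_cases hy : y ∈ Icc (0 : ℝ) (1 - x)
        · rw [indicator_of_mem hy, indicator_of_mem]
          · simp only [smon]; ring
          · exact ⟨hx.1, hy.1, by linarith [hy.2]⟩
        · rw [indicator_of_notMem hy, indicator_of_notMem]
          exact fun hs => hy ⟨hs.2.1, by linarith [hs.2.2]⟩
      rw [indicator_of_mem hx, e, integral_indicator measurableSet_Icc, integral_Icc_eq_integral_Ioc,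
        ← intervalIntegral.integral_of_le (by linarith [hx.2]), intervalIntegral.integral_const_mul,
        integral_pow_mul_pow]
      ring
    · rw [indicator_of_notMem hx]
      have e : (fun y => simplex2.indicator (smon (i, j, k)) (x, y)) = fun _ => 0 := by
        funext y
        refine indicator_of_notMem (fun hs => hx ⟨hs.1, ?_⟩) _
        have h1 := hs.2.1
        have h2 := hs.2.2
        simp only at h1 h2
        linarith
      rw [e, integral_zero]
  simp only [h]
  rw [integral_indicator measurableSet_Icc, integral_Icc_eq_integral_Ioc,
    ← intervalIntegral.integral_of_le zero_le_one, intervalIntegral.integral_mul_const, integral_kk,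
    kk3_eq, mul_comm]

variable {U : Type*} [NormedAddCommGroup U] [NormedSpace ℂ U] [CompleteSpace U]

/-- The geometric series fail to converge only at the three vertices, and these lie on the edges s₁
= 0 and s₂ = 0, which have measure zero. -/
theorem ae_simplex2 : ∀ᵐ s ∂(volume.restrict simplex2 : Measure (ℝ × ℝ)),
    s ∈ simplex2 ∧ 1 - s.1 - s.2 < 1 ∧ s.1 < 1 ∧ s.2 < 1 := by
  have h1 : ∀ᵐ s : ℝ × ℝ, s.1 ≠ 0 :=
    (Measure.quasiMeasurePreserving_fst (μ := volume) (ν := volume)).ae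
      (p := fun x : ℝ => x ≠ 0) (by simp [ae_iff])
  have h2 : ∀ᵐ s : ℝ × ℝ, s.2 ≠ 0 :=
    (Measure.quasiMeasurePreserving_snd (μ := volume) (ν := volume)).ae
      (p := fun x : ℝ => x ≠ 0) (by simp [ae_iff])
  filter_upwards [ae_restrict_mem isClosed_simplex2.measurableSet, ae_restrict_of_ae h1,
    ae_restrict_of_ae h2] with s hs hs1 hs2
  have p1 : 0 < s.1 := lt_of_le_of_ne hs.1 (Ne.symm hs1)
  have p2 : 0 < s.2 := lt_of_le_of_ne hs.2.1 (Ne.symm hs2)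
  have := hs.2.2
  exact ⟨hs, by linarith, by linarith, by linarith⟩

theorem summable_smon {s : ℝ × ℝ} (h : s ∈ simplex2 ∧ 1 - s.1 - s.2 < 1 ∧ s.1 < 1 ∧ s.2 < 1) :
    Summable fun t => smon t s := by
  obtain ⟨⟨h1, h2, h3⟩, l0, l1, l2⟩ := h
  refine (summable_geometric_of_lt_one (by linarith) l0).mul_of_nonneg
    ((summable_geometric_of_lt_one h1 l1).mul_of_nonneg (summable_geometric_of_lt_one h2 l2)
      (fun i => by positivity) fun i => by positivity)
    (fun i => pow_nonneg (by linarith) i) fun i => by positivity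

theorem norm_smon_smul_le {T : ℕ × ℕ × ℕ → U} {M : ℝ} (hT : ∀ t, ‖T t‖ ≤ M) (t : ℕ × ℕ × ℕ)
    {s : ℝ × ℝ} (h : s ∈ simplex2) : ‖(smon t s : ℂ) • T t‖ ≤ smon t s * M := by
  rw [norm_smul, Complex.norm_real, Real.norm_of_nonneg (smon_nonneg t h)]
  exact mul_le_mul_of_nonneg_left (hT t) (smon_nonneg t h)

/-- A series over the simplex with bounded coefficients may be integrated term by term. -/
theorem simplex_series {T : ℕ × ℕ × ℕ → U} {M : ℝ} (hT : ∀ t, ‖T t‖ ≤ M) :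
    Integrable (fun s => ∑' t, (smon t s : ℂ) • T t) (volume.restrict simplex2) ∧
      HasSum (fun t => (kk3 t : ℂ) • T t) (∫ s in simplex2, ∑' t, (smon t s : ℂ) • T t) := by
  have hc : ∀ t, Continuous fun s => (smon t s : ℂ) • T t := fun t =>
    (Complex.continuous_ofReal.comp (continuous_smon t)).smul continuous_const
  have hi : ∀ t, Integrable (fun s => (smon t s : ℂ) • T t) (volume.restrict simplex2) := fun t =>
    (hc t).continuousOn.integrableOn_compact isCompact_simplex2
  have hle : ∀ t, ∫ s in simplex2, ‖(smon t s : ℂ) • T t‖ ≤ kk3 t * M := fun t => by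
    rw [← integral_smon, ← integral_mul_const]
    exact setIntegral_mono_on (hi t).norm ((integrable_smon t).mul_const M)
      isClosed_simplex2.measurableSet fun s hs => norm_smon_smul_le hT t hs
  have hs : Summable fun t => ∫ s in simplex2, ‖(smon t s : ℂ) • T t‖ :=
    Summable.of_nonneg_of_le (fun t => integral_nonneg fun s => norm_nonneg _) hle
      (summable_kk3.mul_right M)
  have hsum : ∀ᵐ s ∂(volume.restrict simplex2 : Measure (ℝ × ℝ)),
      Summable fun t => (smon t s : ℂ) • T t := by
    filter_upwards [ae_simplex2] with s h
    exact Summable.of_norm_bounded ((summable_smon h).mul_right M) fun t =>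
      norm_smon_smul_le hT t h.1
  refine ⟨⟨?_, ?_⟩, ?_⟩
  · refine aestronglyMeasurable_of_tendsto_ae (u := (atTop : Filter (Finset (ℕ × ℕ × ℕ))))
      (f := fun F s => ∑ t ∈ F, (smon t s : ℂ) • T t)
      (fun F => (continuous_finsetSum _ fun t _ => hc t).aestronglyMeasurable) ?_
    filter_upwards [hsum] with s h using h.hasSum
  -- The norm of the sum is at most the sum of the norms, whose integrals are dominated by the
  -- summable weights `kk3`.
  · refine (lintegral_mono fun s => enorm_tsum_le_tsum_enorm).trans_lt ?_
    rw [lintegral_tsum fun t => (hi t).1.enorm, lt_top_iff_ne_top]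
    have this : ∀ t, ∫⁻ s in simplex2, ‖(smon t s : ℂ) • T t‖ₑ =
        ENNReal.ofReal (∫ s in simplex2, ‖(smon t s : ℂ) • T t‖) := by
      intro t
      rw [ofReal_integral_norm_eq_lintegral_enorm (hi t)]
    simp only [this]
    exact hs.tsum_ofReal_ne_top
  · refine (hasSum_integral_of_summable_integral_norm hi hs).congr_fun ?_
    intro t
    rw [integral_smul_const, ← integral_smon]
    exact congrArg (· • T t) integral_ofReal.symm

/-- A series over triples, summed by total degree. -/
theorem hasSum_antidiagonal₃ {f : ℕ × ℕ × ℕ → U} {u : U} (h : HasSum f u) :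
    HasSum (fun n => ∑ p ∈ Finset.HasAntidiagonal.antidiagonal n,
      ∑ q ∈ Finset.HasAntidiagonal.antidiagonal p.2, f (p.1, q)) u := by
  let e : (Σ p : ℕ × ℕ, Finset.HasAntidiagonal.antidiagonal p.2) ≃ ℕ × ℕ × ℕ :=
    ⟨fun x => (x.1.1, x.2.1), fun t => ⟨(t.1, t.2.1 + t.2.2), ⟨t.2, by simp⟩⟩, by
      rintro ⟨⟨i, m⟩, ⟨⟨j, k⟩, hq⟩⟩
      simp only [Finset.HasAntidiagonal.mem_antidiagonal] at hq
      subst hq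
      rfl, fun _ => rfl⟩
  refine hasSum_antidiagonal (f := fun p : ℕ × ℕ =>
    ∑ q ∈ Finset.HasAntidiagonal.antidiagonal p.2, f (p.1, q)) ?_
  refine ((e.hasSum_iff.2 h).sigma fun p => hasSum_fintype _).congr_fun fun p => ?_
  exact (Finset.sum_coe_sort (Finset.HasAntidiagonal.antidiagonal p.2) fun q => f (p.1, q)).symm

set_option maxSynthPendingDepth 3 in
/-- The product of three power series. -/
theorem tsum_smon {V : Type*} [NormedAddCommGroup V] [NormedSpace ℂ V] [CompleteSpace V]
    (κ : V →L[ℂ] V →L[ℂ] V →L[ℂ] U) {α : ℕ → V} {C : ℝ} (hα : ∀ n, ‖α n‖ ≤ C) {s : ℝ × ℝ}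
    (h : s ∈ simplex2 ∧ 1 - s.1 - s.2 < 1 ∧ s.1 < 1 ∧ s.2 < 1) {x y z : V}
    (hx : HasSum (fun n => (((1 - s.1 - s.2) ^ n : ℝ) : ℂ) • α n) x)
    (hy : HasSum (fun n => ((s.1 ^ n : ℝ) : ℂ) • α n) y)
    (hz : HasSum (fun n => ((s.2 ^ n : ℝ) : ℂ) • α n) z) :
    ∑' t : ℕ × ℕ × ℕ, (smon t s : ℂ) • κ (α t.1) (α t.2.1) (α t.2.2) = κ x y z := by
  have hC : 0 ≤ C := (norm_nonneg _).trans (hα 0)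
  have hs : Summable fun t : ℕ × ℕ × ℕ => (smon t s : ℂ) • κ (α t.1) (α t.2.1) (α t.2.2) := by
    refine Summable.of_norm_bounded ((summable_smon h).mul_right (‖κ‖ * C * C * C)) fun t =>
      norm_smon_smul_le (T := fun t : ℕ × ℕ × ℕ => κ (α t.1) (α t.2.1) (α t.2.2)) (fun t => ?_) t h.1
    refine ((κ (α t.1) (α t.2.1)).le_opNorm _).trans ?_
    refine mul_le_mul ?_ (hα _) (norm_nonneg _) (by positivity)
    refine (κ.le_opNorm₂ _ _).trans ?_
    gcongr
    exacts [hα _, hα _]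
  have e : ∀ i j k, (smon (i, j, k) s : ℂ) • κ (α i) (α j) (α k) =
      κ ((((1 - s.1 - s.2) ^ i : ℝ) : ℂ) • α i) (((s.1 ^ j : ℝ) : ℂ) • α j)
        (((s.2 ^ k : ℝ) : ℂ) • α k) := fun i j k => by
    simp only [map_smul, _root_.smul_apply, smul_smul, smon]
    push_cast
    ring_nf
  -- The triple sum, absolutely convergent by `hs`, is evaluated one index at a time, using
  -- continuity of κ in one argument; uniqueness of sums identifies each fibre.
  have h3 : ∀ i j, HasSum (fun k => (smon (i, j, k) s : ℂ) • κ (α i) (α j) (α k))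
      (κ ((((1 - s.1 - s.2) ^ i : ℝ) : ℂ) • α i) (((s.1 ^ j : ℝ) : ℂ) • α j) z) := fun i j => by
    simp only [e]
    exact hz.mapL _
  have h2 : ∀ i, HasSum (fun q : ℕ × ℕ => (smon (i, q) s : ℂ) • κ (α i) (α q.1) (α q.2))
      (κ ((((1 - s.1 - s.2) ^ i : ℝ) : ℂ) • α i) y z) := fun i => by
    have hq := (hs.comp_injective (Prod.mk_right_injective i)).hasSum
    have := hq.prod_fiberwise (h3 i)
    have hu := this.unique (hy.mapL ((κ ((((1 - s.1 - s.2) ^ i : ℝ) : ℂ) • α i)).flip z))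
    rw [ContinuousLinearMap.flip_apply] at hu
    rw [← hu]
    exact hq
  have h1 := hs.hasSum.prod_fiberwise h2
  exact h1.unique (hx.mapL ((κ.flip y).flip z))

end simplex

/-! ### Lifts to the Banach spaces of bounded disks -/

section disks
variable {E F G : Type u} [CB E] [CB F] [CB G]

/-- Rescaling to the unit ball gives preimages with norm control, and injectivity of the disk
inclusion makes them unique, hence linear in v. Through this lemma bounded maps become continuous
maps of Banach spaces. -/
theorem exists_linear_lift {V : Type*} [NormedAddCommGroup V] [NormedSpace ℂ V] (g : V →ₗ[ℂ] E)
    (d : BanachDisk E) (h : ∀ v, ‖v‖ ≤ 1 → g v ∈ d.j '' Metric.closedBall 0 1) :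
    ∃ T : V →L[ℂ] d.V, ∀ v, d.j (T v) = g v := by
  have key : ∀ v, ∃ u : d.V, d.j u = g v ∧ ‖u‖ ≤ 1 * ‖v‖ := fun v => by
    by_cases hv : v = 0
    · exact ⟨0, by simp [hv], by simp⟩
    have hn : (0 : ℝ) < ‖v‖ := norm_pos_iff.2 hv
    have hc : (‖v‖ : ℂ) ≠ 0 := by exact_mod_cast hn.ne'
    obtain ⟨u, hu, hu'⟩ := h ((‖v‖ : ℂ)⁻¹ • v) (by
      rw [norm_smul, norm_inv, Complex.norm_real, norm_norm, inv_mul_cancel₀ hn.ne'])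
    rw [mem_closedBall_zero_iff] at hu
    refine ⟨(‖v‖ : ℂ) • u, ?_, ?_⟩
    · rw [map_smul, hu', map_smul, smul_smul, mul_inv_cancel₀ hc, one_smul]
    · rw [norm_smul, Complex.norm_real, norm_norm, mul_comm]
      gcongr
  choose u hu hn using key
  let L : V →ₗ[ℂ] d.V :=
    { toFun := u
      map_add' := fun v w => d.inj (by simp only [map_add, hu])
      map_smul' := fun c v => d.inj (by simp only [map_smul, hu, RingHom.id_apply]) }
  exact ⟨L.mkContinuous 1 hn, hu⟩

theorem exists_disk_map (f : E ⟹ F) (d : BanachDisk E) :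
    ∃ (e : BanachDisk F) (T : d.V →L[ℂ] e.V), ∀ v, e.j (T v) = f (d.j v) := by
  obtain ⟨e, he⟩ := exists_disk (f.bdd (d.bdd 1))
  obtain ⟨T, hT⟩ := exists_linear_lift (f.1.comp d.j) e fun v hv =>
    he ⟨_, ⟨v, mem_closedBall_zero_iff.2 hv, rfl⟩, rfl⟩
  exact ⟨e, T, hT⟩

/-- The image of the product of the unit balls lies in one disk, and homogeneity in each argument
bounds the lifted map by the product of the norms. Every product used in the convergence arguments
is made continuous in this way. -/
theorem exists_disk_map₂ (β : E ⟹ F ⟹ G) (d : BanachDisk E) (e : BanachDisk F) :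
    ∃ (k : BanachDisk G) (T : d.V →L[ℂ] e.V →L[ℂ] k.V), ∀ v w, k.j (T v w) = β (d.j v) (e.j w) := by
  obtain ⟨k, hk⟩ := exists_disk (β.bdd₂ (d.bdd 1) (e.bdd 1))
  have h1 : ∀ v : d.V, ∃ T : e.V →L[ℂ] k.V, ∀ w, k.j (T w) = β (d.j v) (e.j w) := fun v => by
    by_cases hv : v = 0
    · exact ⟨0, fun w => by simp [hv]⟩
    have hn : (0 : ℝ) < ‖v‖ := norm_pos_iff.2 hv
    have hc : (‖v‖ : ℂ) ≠ 0 := by exact_mod_cast hn.ne'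
    obtain ⟨T, hT⟩ := exists_linear_lift ((β (d.j ((‖v‖ : ℂ)⁻¹ • v))).1.comp e.j) k fun w hw =>
      hk ⟨_, ⟨(‖v‖ : ℂ)⁻¹ • v, by
        rw [mem_closedBall_zero_iff, norm_smul, norm_inv, Complex.norm_real, norm_norm,
          inv_mul_cancel₀ hn.ne'], rfl⟩, _, ⟨w, mem_closedBall_zero_iff.2 hw, rfl⟩, rfl⟩
    refine ⟨(‖v‖ : ℂ) • T, fun w => ?_⟩
    have h := hT w
    rw [_root_.smul_apply, map_smul, h]
    change (‖v‖ : ℂ) • β (d.j ((‖v‖ : ℂ)⁻¹ • v)) (e.j w) = _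
    rw [map_smul, map_smul, BMap.smul_apply, smul_smul, mul_inv_cancel₀ hc, one_smul]
  choose T hT using h1
  have hn : ∀ v w, ‖T v w‖ ≤ 1 * ‖v‖ * ‖w‖ := fun v w => by
    by_cases hv : v = 0
    · have : T v w = 0 := k.inj (by rw [hT, hv]; simp)
      rw [this, norm_zero]
      positivity
    by_cases hw : w = 0
    · simp [hw]
    have hv' : (0 : ℝ) < ‖v‖ := norm_pos_iff.2 hv
    have hw' : (0 : ℝ) < ‖w‖ := norm_pos_iff.2 hw
    have hcv : (‖v‖ : ℂ) ≠ 0 := by exact_mod_cast hv'.ne'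
    have hcw : (‖w‖ : ℂ) ≠ 0 := by exact_mod_cast hw'.ne'
    obtain ⟨u, hu, hu'⟩ := hk ⟨_, ⟨(‖v‖ : ℂ)⁻¹ • v, by
        rw [mem_closedBall_zero_iff, norm_smul, norm_inv, Complex.norm_real, norm_norm,
          inv_mul_cancel₀ hv'.ne'], rfl⟩, _, ⟨(‖w‖ : ℂ)⁻¹ • w, by
        rw [mem_closedBall_zero_iff, norm_smul, norm_inv, Complex.norm_real, norm_norm,
          inv_mul_cancel₀ hw'.ne'], rfl⟩, rfl⟩
    rw [mem_closedBall_zero_iff] at hu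
    have e1 : T v w = ((‖v‖ : ℂ) * (‖w‖ : ℂ)) • u := k.inj (by
      rw [hT, map_smul, hu']
      simp only [map_smul, BMap.smul_apply, smul_smul]
      rw [mul_assoc, mul_comm _ (‖v‖ : ℂ)⁻¹, ← mul_assoc, ← mul_assoc]
      field_simp
      rw [one_smul])
    rw [e1, norm_smul, norm_mul, Complex.norm_real, Complex.norm_real, norm_norm, norm_norm, one_mul]
    exact mul_le_of_le_one_right (by positivity) hu
  let L : d.V →ₗ[ℂ] e.V →ₗ[ℂ] k.V := LinearMap.mk₂ ℂ (fun v w => T v w)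
    (fun v v' w => k.inj (by simp only [map_add, hT, BMap.add_apply]))
    (fun c v w => k.inj (by simp only [map_smul, hT, BMap.smul_apply]))
    (fun v w w' => map_add _ _ _) (fun c v w => map_smul _ _ _)
  exact ⟨k, L.mkContinuous₂ 1 hn, hT⟩

theorem exists_disk_join (d e : BanachDisk E) :
    ∃ (k : BanachDisk E) (S : d.V →L[ℂ] k.V) (T : e.V →L[ℂ] k.V),
      (∀ v, k.j (S v) = d.j v) ∧ ∀ w, k.j (T w) = e.j w := by
  obtain ⟨k, hk⟩ := exists_disk ((d.bdd 1).union (e.bdd 1))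
  obtain ⟨S, hS⟩ := exists_linear_lift d.j k fun v hv =>
    hk (Or.inl ⟨v, mem_closedBall_zero_iff.2 hv, rfl⟩)
  obtain ⟨T, hT⟩ := exists_linear_lift e.j k fun v hv =>
    hk (Or.inr ⟨v, mem_closedBall_zero_iff.2 hv, rfl⟩)
  exact ⟨k, S, T, hS, hT⟩

/-- A Mackey convergent sequence converges in the Banach space of some bounded disk. -/
theorem MTendsto.exists_lift {x : ℕ → E} {a : E} (h : MTendsto atTop x a) :
    ∃ (d : BanachDisk E) (v : ℕ → d.V) (w : d.V), (∀ n, x n = d.j (v n)) ∧ a = d.j w ∧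
      Tendsto v atTop (𝓝 w) := by
  obtain ⟨B, hB, hx⟩ := h
  obtain ⟨N, hN⟩ := eventually_atTop.1 (hx 1 one_pos)
  -- The Mackey estimate concerns late terms only, so the finitely many early terms and the limit
  -- are added to the bounded set before a disk is chosen.
  have hfin : IsBounded (x '' {n | n < N} ∪ {a}) :=
    (((Set.finite_lt_nat N).image x).union (Set.finite_singleton a)).isBounded
  obtain ⟨d, hd⟩ := exists_disk (hB.union hfin)
  obtain ⟨w, -, hw⟩ := hd (Or.inr (Or.inr rfl))
  have key : ∀ n, ∃ v : d.V, d.j v = x n := fun n => by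
    by_cases hn : n < N
    · obtain ⟨v, -, hv⟩ := hd (Or.inr (Or.inl ⟨n, hn, rfl⟩))
      exact ⟨v, hv⟩
    · obtain ⟨b, hb, hb'⟩ := hN n (not_lt.1 hn)
      obtain ⟨v, -, hv⟩ := hd (Or.inl hb)
      refine ⟨w + v, ?_⟩
      rw [map_add, hv, hw, add_comm, ← eq_sub_iff_add_eq, hb', Complex.ofReal_one, one_smul]
  choose v hv using key
  refine ⟨d, v, w, fun n => (hv n).symm, hw.symm, Metric.tendsto_nhds.2 fun ε hε => ?_⟩
  filter_upwards [hx (ε / 2) (by positivity)] with n ⟨b, hb, hb'⟩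
  obtain ⟨u, hu, rfl⟩ := hd (Or.inl hb)
  rw [mem_closedBall_zero_iff] at hu
  have e1 : v n - w = ((ε / 2 : ℝ) : ℂ) • u := d.inj (by rw [map_sub, hv, hw, hb', map_smul])
  rw [dist_eq_norm, e1, norm_smul, Complex.norm_real, Real.norm_of_nonneg (by positivity)]
  nlinarith

/-- The partial sums are lifted to a disk, and the terms are recovered as differences of consecutive
lifts. -/
theorem SHasSum.exists_lift {f : ℕ → E} {a : E} (h : SHasSum f a) :
    ∃ (d : BanachDisk E) (v : ℕ → d.V) (w : d.V), (∀ n, f n = d.j (v n)) ∧ a = d.j w ∧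
      Tendsto (fun N => ∑ n ∈ Finset.range N, v n) atTop (𝓝 w) := by
  obtain ⟨d, v, w, hv, hw, h⟩ := MTendsto.exists_lift h
  have h0 : v 0 = 0 := d.inj (by rw [← hv, Finset.sum_range_zero, map_zero])
  refine ⟨d, fun n => v (n + 1) - v n, w, fun n => ?_, hw, ?_⟩
  · rw [map_sub, ← hv, ← hv, Finset.sum_range_succ, add_sub_cancel_left]
  · simpa only [Finset.sum_range_sub, h0, sub_zero] using h

theorem ssum_eq {f : ℕ → E} {a : E} (h : SHasSum f a) : ssum f = a := by
  have h' : ∃ a, SHasSum f a := ⟨a, h⟩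
  rw [ssum, dif_pos h']
  exact h'.choose_spec.unique h

end disks

/-! ### Continuous paths and uniformly convergent series of paths -/

section paths
variable {E F G : Type u} [CB E] [CB F] [CB G]

section banach
variable {V W U : Type*} [NormedAddCommGroup V] [NormedSpace ℂ V] [NormedAddCommGroup W]
  [NormedSpace ℂ W] [NormedAddCommGroup U] [NormedSpace ℂ U]

/-- Pointwise application of a bounded bilinear map to continuous paths. -/
def cbil (T : V →L[ℂ] W →L[ℂ] U) :
    C(Icc (0 : ℝ) 1, V) →L[ℂ] C(Icc (0 : ℝ) 1, W) →L[ℂ] C(Icc (0 : ℝ) 1, U) :=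
  (LinearMap.mk₂ ℂ
    (fun (f : C(Icc (0 : ℝ) 1, V)) (g : C(Icc (0 : ℝ) 1, W)) =>
      (⟨fun t => T (f t) (g t), by fun_prop⟩ : C(Icc (0 : ℝ) 1, U)))
    (fun f f' g => by ext t; simp) (fun c f g => by ext t; simp)
    (fun f g g' => by ext t; simp) (fun c f g => by ext t; simp)).mkContinuous₂ ‖T‖ fun f g => by
      refine (ContinuousMap.norm_le _ (by positivity)).2 fun t => (T.le_opNorm₂ _ _).trans ?_
      gcongr
      exacts [f.norm_coe_le_norm t, g.norm_coe_le_norm t]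

@[simp] theorem cbil_apply (T : V →L[ℂ] W →L[ℂ] U) (f : C(Icc (0 : ℝ) 1, V))
    (g : C(Icc (0 : ℝ) 1, W)) (t : Icc (0 : ℝ) 1) : cbil T f g t = T (f t) (g t) := rfl

/-- Pointwise application of a bounded linear map to continuous paths. -/
def clin (T : V →L[ℂ] W) : C(Icc (0 : ℝ) 1, V) →L[ℂ] C(Icc (0 : ℝ) 1, W) :=
  T.compLeftContinuous ℂ (Icc (0 : ℝ) 1)

@[simp] theorem clin_apply (T : V →L[ℂ] W) (f : C(Icc (0 : ℝ) 1, V)) (t : Icc (0 : ℝ) 1) :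
    clin T f t = T (f t) := rfl

end banach

/-- Continuous paths `[0,1] → E`. -/
def CPath (f : ℝ → E) : Prop :=
  ∃ (d : BanachDisk E) (v : C(Icc (0 : ℝ) 1, d.V)), ∀ t : Icc (0 : ℝ) 1, f t = d.j (v t)

/-- Uniformly convergent series of continuous paths `[0,1] → E`. -/
def USum (f : ℕ → ℝ → E) (h : ℝ → E) : Prop :=
  ∃ (d : BanachDisk E) (v : ℕ → C(Icc (0 : ℝ) 1, d.V)) (w : C(Icc (0 : ℝ) 1, d.V)),
    (∀ n, ∀ t : Icc (0 : ℝ) 1, f n t = d.j (v n t)) ∧ (∀ t : Icc (0 : ℝ) 1, h t = d.j (w t)) ∧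
    Tendsto (fun N => ∑ n ∈ Finset.range N, v n) atTop (𝓝 w)

theorem CPath.const (x : E) : CPath fun _ => x := by
  obtain ⟨d, hd⟩ := exists_disk (isBounded_singleton (x := x))
  obtain ⟨v, -, hv⟩ := hd rfl
  exact ⟨d, ContinuousMap.const _ v, fun t => hv.symm⟩

theorem CPath.map {f : ℝ → E} (hf : CPath f) (φ : E ⟹ F) : CPath fun t => φ (f t) := by
  obtain ⟨d, v, hv⟩ := hf
  obtain ⟨e, T, hT⟩ := exists_disk_map φ d
  exact ⟨e, clin T v, fun t => by simp only [clin_apply, hT, hv]⟩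

theorem CPath.map₂ {f : ℝ → E} {g : ℝ → F} (hf : CPath f) (hg : CPath g) (β : E ⟹ F ⟹ G) :
    CPath fun t => β (f t) (g t) := by
  obtain ⟨d, v, hv⟩ := hf
  obtain ⟨e, w, hw⟩ := hg
  obtain ⟨k, T, hT⟩ := exists_disk_map₂ β d e
  exact ⟨k, cbil T v w, fun t => by simp only [cbil_apply, hT, hv, hw]⟩

theorem CPath.add {f g : ℝ → E} (hf : CPath f) (hg : CPath g) : CPath fun t => f t + g t := by
  obtain ⟨d, v, hv⟩ := hf
  obtain ⟨e, w, hw⟩ := hg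
  obtain ⟨k, S, T, hS, hT⟩ := exists_disk_join d e
  exact ⟨k, clin S v + clin T w, fun t => by
    simp only [ContinuousMap.add_apply, map_add, clin_apply, clin_apply, hS, hT, hv, hw]⟩

theorem USum.congr {f f' : ℕ → ℝ → E} {h h' : ℝ → E} (hf : USum f h)
    (e : ∀ n, ∀ t ∈ Icc (0 : ℝ) 1, f' n t = f n t) (e' : ∀ t ∈ Icc (0 : ℝ) 1, h' t = h t) :
    USum f' h' := by
  obtain ⟨d, v, w, hv, hw, ht⟩ := hf
  exact ⟨d, v, w, fun n t => by rw [e n t t.2, hv], fun t => by rw [e' t t.2, hw], ht⟩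

theorem USum.map {f : ℕ → ℝ → E} {h : ℝ → E} (hf : USum f h) (φ : E ⟹ F) :
    USum (fun n t => φ (f n t)) fun t => φ (h t) := by
  obtain ⟨d, v, w, hv, hw, ht⟩ := hf
  obtain ⟨e, T, hT⟩ := exists_disk_map φ d
  refine ⟨e, fun n => clin T (v n), clin T w, fun n t => by simp only [clin_apply, hT, hv],
    fun t => by simp only [clin_apply, hT, hw], ?_⟩
  simpa only [Function.comp_def, map_sum] using ((clin T).continuous.tendsto w).comp ht

theorem USum.neg {f : ℕ → ℝ → E} {h : ℝ → E} (hf : USum f h) :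
    USum (fun n t => -f n t) fun t => -h t := hf.map (-BMap.id E)

theorem USum.add {f g : ℕ → ℝ → E} {h k : ℝ → E} (hf : USum f h) (hg : USum g k) :
    USum (fun n t => f n t + g n t) fun t => h t + k t := by
  obtain ⟨d, v, w, hv, hw, ht⟩ := hf
  obtain ⟨e, v', w', hv', hw', ht'⟩ := hg
  obtain ⟨l, S, T, hS, hT⟩ := exists_disk_join d e
  refine ⟨l, fun n => clin S (v n) + clin T (v' n), clin S w + clin T w', fun n t => ?_,
    fun t => ?_, ?_⟩
  · simp only [ContinuousMap.add_apply, map_add, clin_apply, clin_apply, hS, hT, hv, hv']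
  · simp only [ContinuousMap.add_apply, map_add, clin_apply, clin_apply, hS, hT, hw, hw']
  · simpa only [Function.comp_def, map_sum, Finset.sum_add_distrib] using
      (((clin S).continuous.tendsto w).comp ht).add (((clin T).continuous.tendsto w').comp ht')

theorem USum.map₂ {g : ℝ → E} {f : ℕ → ℝ → F} {h : ℝ → F} (β : E ⟹ F ⟹ G) (hg : CPath g)
    (hf : USum f h) : USum (fun n t => β (g t) (f n t)) fun t => β (g t) (h t) := by
  obtain ⟨d, a, ha⟩ := hg
  obtain ⟨e, v, w, hv, hw, ht⟩ := hf
  obtain ⟨k, T, hT⟩ := exists_disk_map₂ β d e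
  refine ⟨k, fun n => cbil T a (v n), cbil T a w, fun n t => by simp only [cbil_apply, hT, ha, hv],
    fun t => by simp only [cbil_apply, hT, ha, hw], ?_⟩
  simpa only [Function.comp_def, map_sum] using ((cbil T a).continuous.tendsto w).comp ht

/-- The terms of the product of two series weighted by the beta kernel. -/
def bconv (β : E ⟹ F ⟹ G) (a : ℕ → E) (b : ℕ → F) (n : ℕ) : G :=
  ∑ p ∈ Finset.HasAntidiagonal.antidiagonal n, (kk p.1 p.2 : ℂ) • β (a p.1) (b p.2)

theorem exists_norm_le_of_tendsto {V : Type*} [NormedAddCommGroup V] {x : ℕ → V} {a : V}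
    (h : Tendsto x atTop (𝓝 a)) : ∃ C, ∀ n, ‖x n‖ ≤ C := by
  obtain ⟨C, hC⟩ := (Metric.isBounded_range_of_tendsto x h).exists_norm_le
  exact ⟨C, fun n => hC _ ⟨n, rfl⟩⟩

/-- Continuous paths in the Banach space of a disk form a Banach space. The theorem on beta-weighted
products, applied there, gives uniform convergence in the parameter; convergent series enter it only
through bounded partial sums. -/
theorem USum.bconv {f : ℕ → ℝ → E} {g : ℕ → ℝ → F} {h : ℝ → E} {k : ℝ → F} (β : E ⟹ F ⟹ G)
    (hf : USum f h) (hg : USum g k) :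
    ∃ c, USum (fun n t => bconv β (f · t) (g · t) n) c := by
  obtain ⟨d, v, w, hv, hw, ht⟩ := hf
  obtain ⟨e, v', w', hv', hw', ht'⟩ := hg
  obtain ⟨l, T, hT⟩ := exists_disk_map₂ β d e
  obtain ⟨C, hC⟩ := exists_norm_le_of_tendsto ht
  obtain ⟨D, hD⟩ := exists_norm_le_of_tendsto ht'
  obtain ⟨c, hc⟩ := exists_tendsto_kconv (cbil T) hC hD
  refine ⟨fun t => l.j (IccExtend zero_le_one c t), l, fun n => kconv (cbil T) v v' n, c,
    fun n t => ?_, fun t => by simp only [IccExtend_val], hc⟩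
  simp only [kconv, ContinuousMap.coe_sum, Finset.sum_apply, map_sum, BornChern.bconv]
  refine Finset.sum_congr rfl fun p _ => ?_
  rw [ContinuousMap.smul_apply, cbil_apply, map_smul, hT, hv, hv']

theorem USum.of_succ {f : ℕ → ℝ → E} {h : ℝ → E} (h0 : ∀ t ∈ Icc (0 : ℝ) 1, f 0 t = 0)
    (hf : USum (fun n => f (n + 1)) h) : USum f h := by
  obtain ⟨d, v, w, hv, hw, ht⟩ := hf
  refine ⟨d, fun n => n.casesOn 0 v, w, fun n t => ?_, hw, ?_⟩
  · cases n with
    | zero => simp [h0 t t.2]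
    | succ n => exact hv n t
  · rw [← tendsto_add_atTop_iff_nat 1]
    refine ht.congr fun N => ?_
    rw [Finset.sum_range_succ']
    exact (add_zero _).symm

theorem USum.sHasSum {f : ℕ → ℝ → E} {h : ℝ → E} (hf : USum f h) {t : ℝ} (ht : t ∈ Icc (0 : ℝ) 1) :
    SHasSum (fun n => f n t) (h t) := by
  obtain ⟨d, v, w, hv, hw, hs⟩ := hf
  have h1 := MTendsto.of_disk d (((continuous_eval_const
    (⟨t, ht⟩ : Icc (0 : ℝ) 1)).tendsto w).comp hs)
  have h2 := hw ⟨t, ht⟩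
  simp only at h2
  rw [← h2] at h1
  have e : (fun N => ∑ n ∈ Finset.range N, f n t) = fun N => d.j (((fun f => f ⟨t, ht⟩) ∘
      fun N => ∑ n ∈ Finset.range N, v n) N) := funext fun N => by
    simp only [Function.comp_apply, ContinuousMap.coe_sum, Finset.sum_apply, map_sum]
    exact Finset.sum_congr rfl fun n _ => hv n ⟨t, ht⟩
  rw [SHasSum, e]
  exact h1

/-- A single series is a constant family, so the Chern character of one element and of a smooth
family are treated by the same lemmas. -/
theorem SHasSum.uSum {f : ℕ → E} {a : E} (h : SHasSum f a) : USum (fun n _ => f n) fun _ => a := by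
  obtain ⟨d, v, w, hv, hw, ht⟩ := h.exists_lift
  refine ⟨d, fun n => ContinuousMap.const _ (v n), ContinuousMap.const _ w, fun n _ => hv n,
    fun _ => hw, ?_⟩
  have hc : Continuous fun x : d.V => ContinuousMap.const (Icc (0 : ℝ) 1) x :=
    ContinuousMap.continuous_const'
  refine ((hc.tendsto w).comp ht).congr fun N => ?_
  ext t
  simp

theorem SmoothSummable.uSum {f : ℕ → ℝ → E} (h : SmoothSummable f) : ∃ k, USum f k := by
  obtain ⟨d, g, w, hg, hw, hf, ht⟩ := h
  have h0 := ht 0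
  simp only [iteratedDerivWithin_zero] at h0
  refine ⟨fun t => d.j (w t), d, fun n => ⟨(Icc (0 : ℝ) 1).domRestrict (g n),
    (hg n).continuousOn.domRestrict⟩, ⟨(Icc (0 : ℝ) 1).domRestrict w, hw.continuousOn.domRestrict⟩,
    fun n t => hf n t t.2, fun t => rfl, ?_⟩
  rw [ContinuousMap.tendsto_iff_tendstoUniformly]
  rw [tendstoUniformlyOn_iff_tendstoUniformly_comp_coe] at h0
  convert h0 using 2 with N
  · ext t
    simp
  · rfl

/-! ### Integration of paths -/

/-- `I` is the integral from `s` to `t` of the continuous path `f`. -/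
def HasInt (s t : ℝ) (f : ℝ → E) (I : E) : Prop :=
  ∃ (d : BanachDisk E) (v : C(Icc (0 : ℝ) 1, d.V)), (∀ t : Icc (0 : ℝ) 1, f t = d.j (v t)) ∧
    I = d.j (∫ x in s..t, IccExtend zero_le_one v x)

theorem integral_clin {V W : Type*} [NormedAddCommGroup V] [NormedSpace ℂ V] [CompleteSpace V]
    [NormedAddCommGroup W] [NormedSpace ℂ W] [CompleteSpace W] (T : V →L[ℂ] W)
    (v : C(Icc (0 : ℝ) 1, V)) (s t : ℝ) :
    ∫ x in s..t, IccExtend zero_le_one (clin T v) x = T (∫ x in s..t, IccExtend zero_le_one v x) :=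
  T.intervalIntegral_comp_comm (v.continuous.Icc_extend'.intervalIntegrable s t)

theorem HasInt.map {s t : ℝ} {f : ℝ → E} {I : E} (h : HasInt s t f I) (φ : E ⟹ F) :
    HasInt s t (fun t => φ (f t)) (φ I) := by
  obtain ⟨d, v, hv, rfl⟩ := h
  obtain ⟨e, T, hT⟩ := exists_disk_map φ d
  exact ⟨e, clin T v, fun t => by simp only [clin_apply, hT, hv], by rw [integral_clin, hT]⟩

/-- Two disks are compared inside a common one. The integral is therefore single-valued, and
identities between integrands on [0,1] may be integrated. -/
theorem HasInt.unique {s t : ℝ} {f f' : ℝ → E} {I I' : E} (h : HasInt s t f I)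
    (h' : HasInt s t f' I') (e : ∀ t ∈ Icc (0 : ℝ) 1, f t = f' t) : I = I' := by
  obtain ⟨d, v, hv, rfl⟩ := h
  obtain ⟨d', v', hv', rfl⟩ := h'
  obtain ⟨k, S, T, hS, hT⟩ := exists_disk_join d d'
  have h1 : clin S v = clin T v' := by
    ext x
    exact k.inj (by rw [clin_apply, clin_apply, hS, hT, ← hv, ← hv', e x x.2])
  rw [← hS, ← hT, ← integral_clin, ← integral_clin, h1]

theorem HasInt.add {s t : ℝ} {f g : ℝ → E} {I J : E} (hf : HasInt s t f I) (hg : HasInt s t g J) :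
    HasInt s t (fun t => f t + g t) (I + J) := by
  obtain ⟨d, v, hv, rfl⟩ := hf
  obtain ⟨e, w, hw, rfl⟩ := hg
  obtain ⟨k, S, T, hS, hT⟩ := exists_disk_join d e
  refine ⟨k, clin S v + clin T w, fun t => by
    simp only [ContinuousMap.add_apply, map_add, clin_apply, clin_apply, hS, hT, hv, hw], ?_⟩
  rw [← hS, ← hT, ← map_add, ← integral_clin, ← integral_clin, ← intervalIntegral.integral_add
    ((clin S v).continuous.Icc_extend'.intervalIntegrable s t)
    ((clin T w).continuous.Icc_extend'.intervalIntegrable s t)]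
  rfl

theorem HasInt.sum {s t : ℝ} {f : ℕ → ℝ → E} {I : ℕ → E} (h : ∀ n, HasInt s t (f n) (I n)) (N : ℕ) :
    HasInt s t (fun t => ∑ n ∈ Finset.range N, f n t) (∑ n ∈ Finset.range N, I n) := by
  induction N with
  | zero =>
    simp only [Finset.sum_range_zero]
    -- The integral of the zero path is obtained as the image of any integral under the zero map.
    simpa using (h 0).map (0 : E ⟹ E)
  | succ N ih =>
    simp only [Finset.sum_range_succ]
    exact ih.add (h N)

/-- The integral of continuous paths, as a bounded linear map. -/
def cint {V : Type*} [NormedAddCommGroup V] [NormedSpace ℂ V] [CompleteSpace V] (s t : ℝ) :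
    C(Icc (0 : ℝ) 1, V) →L[ℂ] V :=
  LinearMap.mkContinuous
    { toFun := fun v => ∫ x in s..t, IccExtend zero_le_one v x
      map_add' := fun v w => intervalIntegral.integral_add
        (v.continuous.Icc_extend'.intervalIntegrable s t)
        (w.continuous.Icc_extend'.intervalIntegrable s t)
      map_smul' := fun c v => intervalIntegral.integral_smul c _ } |t - s| fun v => by
    rw [mul_comm]
    exact intervalIntegral.norm_integral_le_of_norm_le_const fun x _ => v.norm_coe_le_norm _

/-- Integration is a continuous linear map on the space of paths, so a uniformly convergent series
may be integrated term by term. -/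
theorem USum.exists_int {f : ℕ → ℝ → E} {h : ℝ → E} (hf : USum f h) (s t : ℝ) :
    ∃ (I : ℕ → E) (J : E), (∀ n, HasInt s t (f n) (I n)) ∧ SHasSum I J := by
  obtain ⟨d, v, w, hv, hw, ht⟩ := hf
  refine ⟨fun n => d.j (cint s t (v n)), d.j (cint s t w), fun n => ⟨d, v n, hv n, rfl⟩, ?_⟩
  have h1 := MTendsto.of_disk d (((cint s t).continuous.tendsto w).comp ht)
  simpa only [SHasSum, Function.comp_def, map_sum] using h1

/-- The terms of a convergent series tend to zero. -/
theorem SHasSum.tendsto_zero {f : ℕ → E} {a : E} (h : SHasSum f a) : MTendsto atTop f 0 := by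
  obtain ⟨d, v, w, hv, hw, ht⟩ := h.exists_lift
  have h1 := ((tendsto_add_atTop_iff_nat 1).2 ht).sub ht
  simp only [Finset.sum_range_succ, add_sub_cancel_left, sub_self] at h1
  have := MTendsto.of_disk d h1
  simpa only [← hv, map_zero] using this

/-! ### Derivatives of paths -/

/-- The path `f` is continuously differentiable with derivative `f'`. -/
def CDeriv (f f' : ℝ → E) : Prop :=
  ∃ (d : BanachDisk E) (v v' : ℝ → d.V), (∀ t ∈ Icc (0 : ℝ) 1, f t = d.j (v t)) ∧
    (∀ t ∈ Icc (0 : ℝ) 1, f' t = d.j (v' t)) ∧ ContinuousOn v' (Icc 0 1) ∧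
    ∀ t ∈ Icc (0 : ℝ) 1, HasDerivWithinAt v (v' t) (Icc 0 1) t

theorem CDeriv.const (x : E) : CDeriv (fun _ => x) fun _ => 0 := by
  obtain ⟨d, hd⟩ := exists_disk (isBounded_singleton (x := x))
  obtain ⟨v, -, hv⟩ := hd rfl
  exact ⟨d, fun _ => v, fun _ => 0, fun t _ => hv.symm, fun t _ => (map_zero _).symm,
    continuousOn_const, fun t _ => hasDerivWithinAt_const _ _ _⟩

theorem CDeriv.map {f f' : ℝ → E} (h : CDeriv f f') (φ : E ⟹ F) :
    CDeriv (fun t => φ (f t)) fun t => φ (f' t) := by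
  obtain ⟨d, v, v', h1, h2, h3, h4⟩ := h
  obtain ⟨e, T, hT⟩ := exists_disk_map φ d
  refine ⟨e, fun t => T (v t), fun t => T (v' t), fun t ht => by simp only [hT, h1 t ht],
    fun t ht => by simp only [hT, h2 t ht], T.continuous.comp_continuousOn h3, fun t ht => ?_⟩
  exact (T.restrictScalars ℝ).hasFDerivAt.comp_hasDerivWithinAt t (h4 t ht)

theorem CDeriv.add {f f' g g' : ℝ → E} (hf : CDeriv f f') (hg : CDeriv g g') :
    CDeriv (fun t => f t + g t) fun t => f' t + g' t := by
  obtain ⟨d, v, v', h1, h2, h3, h4⟩ := hf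
  obtain ⟨e, w, w', k1, k2, k3, k4⟩ := hg
  obtain ⟨k, S, T, hS, hT⟩ := exists_disk_join d e
  refine ⟨k, fun t => S (v t) + T (w t), fun t => S (v' t) + T (w' t),
    fun t ht => by simp only [map_add, hS, hT, h1 t ht, k1 t ht],
    fun t ht => by simp only [map_add, hS, hT, h2 t ht, k2 t ht],
    (S.continuous.comp_continuousOn h3).add (T.continuous.comp_continuousOn k3), fun t ht => ?_⟩
  exact ((S.restrictScalars ℝ).hasFDerivAt.comp_hasDerivWithinAt t (h4 t ht)).add
    ((T.restrictScalars ℝ).hasFDerivAt.comp_hasDerivWithinAt t (k4 t ht))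

theorem CDeriv.map₂ {f f' : ℝ → E} {g g' : ℝ → F} (hf : CDeriv f f') (hg : CDeriv g g')
    (β : E ⟹ F ⟹ G) :
    CDeriv (fun t => β (f t) (g t)) fun t => β (f' t) (g t) + β (f t) (g' t) := by
  obtain ⟨d, v, v', h1, h2, h3, h4⟩ := hf
  obtain ⟨e, w, w', k1, k2, k3, k4⟩ := hg
  obtain ⟨k, T, hT⟩ := exists_disk_map₂ β d e
  have hv : ContinuousOn v (Icc 0 1) := fun t ht => (h4 t ht).continuousWithinAt
  have hw : ContinuousOn w (Icc 0 1) := fun t ht => (k4 t ht).continuousWithinAt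
  refine ⟨k, fun t => T (v t) (w t), fun t => T (v t) (w' t) + T (v' t) (w t),
    fun t ht => by simp only [hT, h1 t ht, k1 t ht],
    fun t ht => by simp only [map_add, hT, h1 t ht, h2 t ht, k1 t ht, k2 t ht, add_comm],
    ((T.continuous.comp_continuousOn hv).clm_apply k3).add
      ((T.continuous.comp_continuousOn h3).clm_apply hw), fun t ht => ?_⟩
  exact (T.bilinearRestrictScalars ℝ).hasDerivWithinAt_of_bilinear (h4 t ht) (k4 t ht)

theorem CDeriv.cpath {f f' : ℝ → E} (h : CDeriv f f') : CPath f := by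
  obtain ⟨d, v, v', h1, h2, h3, h4⟩ := h
  have hv : ContinuousOn v (Icc 0 1) := fun t ht => (h4 t ht).continuousWithinAt
  exact ⟨d, ⟨_, hv.domRestrict⟩, fun t => h1 t t.2⟩

theorem CDeriv.cpath' {f f' : ℝ → E} (h : CDeriv f f') : CPath f' := by
  obtain ⟨d, v, v', h1, h2, h3, h4⟩ := h
  exact ⟨d, ⟨_, h3.domRestrict⟩, fun t => h2 t t.2⟩

/-- The fundamental theorem of calculus. -/
theorem CDeriv.hasInt {f f' : ℝ → E} (h : CDeriv f f') {s t : ℝ} (hs : s ∈ Icc (0 : ℝ) 1)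
    (ht : t ∈ Icc (0 : ℝ) 1) (hst : s ≤ t) : HasInt s t f' (f t - f s) := by
  obtain ⟨d, v, v', h1, h2, h3, h4⟩ := h
  refine ⟨d, ⟨_, h3.domRestrict⟩, fun t => h2 t t.2, ?_⟩
  have hc : Continuous (IccExtend zero_le_one ((Icc (0 : ℝ) 1).domRestrict v')) :=
    h3.domRestrict.Icc_extend'
  have hsub : Icc s t ⊆ Icc (0 : ℝ) 1 := Icc_subset_Icc hs.1 ht.2
  have := intervalIntegral.integral_eq_sub_of_hasDerivAt_of_le
    (f' := IccExtend zero_le_one ((Icc (0 : ℝ) 1).domRestrict v')) hst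
    (fun x hx => ((h4 x (hsub hx)).mono hsub).continuousWithinAt) (fun x hx => by
      have hx' := hsub (Ioo_subset_Icc_self hx)
      rw [IccExtend_of_mem _ _ hx']
      exact (h4 x hx').hasDerivAt (Icc_mem_nhds (hs.1.trans_lt hx.1) (hx.2.trans_le ht.2)))
    (hc.intervalIntegrable s t)
  rw [h1 t ht, h1 s hs, ← map_sub, ← this]
  rfl

theorem SmoothMap.exists_cDeriv {f : ℝ → E} (h : SmoothMap f) : ∃ f', CDeriv f f' := by
  obtain ⟨d, g, hg, hf⟩ := h
  have hd : UniqueDiffOn ℝ (Icc (0 : ℝ) 1) := uniqueDiffOn_Icc zero_lt_one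
  refine ⟨fun t => d.j (derivWithin g (Icc 0 1) t), d, g, derivWithin g (Icc 0 1), hf,
    fun t _ => rfl, ?_, fun t ht => ?_⟩
  · exact hg.continuousOn_derivWithin hd (by simp)
  · exact ((hg.differentiableOn (by simp)) t ht).hasDerivWithinAt

end paths

/-! ### Recursions and exponential weights -/

section weights

/-- The coefficients of the exponential series of `-x`. -/
def ww (n : ℕ) : ℂ := (-1) ^ n / (n.factorial : ℂ)

theorem ww_zero : ww 0 = 1 := by simp [ww]

/-- This relation is what makes the weighted sums in the free product telescope. -/
theorem ww_succ (n : ℕ) : ww (n + 1) * (n + 1) = -ww n := by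
  unfold ww
  rw [Nat.factorial_succ, pow_succ]
  push_cast
  have h1 : (n.factorial : ℂ) ≠ 0 := by exact_mod_cast n.factorial_ne_zero
  have h2 : (n : ℂ) + 1 ≠ 0 := by exact_mod_cast n.succ_ne_zero
  field_simp

/-- The bridge between exponential weights and the beta kernel, that is, the coefficient form of
Duhamel's formula for e^{-F}. -/
theorem ww_add (i j : ℕ) : ww (i + j + 1) = -((kk i j : ℂ) * (ww i * ww j)) := by
  unfold ww kk
  push_cast
  have h1 : (i.factorial : ℂ) ≠ 0 := by exact_mod_cast i.factorial_ne_zero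
  have h2 : (j.factorial : ℂ) ≠ 0 := by exact_mod_cast j.factorial_ne_zero
  have h3 : ((i + j + 1).factorial : ℂ) ≠ 0 := by exact_mod_cast (i + j + 1).factorial_ne_zero
  field_simp
  ring

variable {P : Type u} [DGBAlg P]

/-- Variation of constants for a linear recursion with zero initial value. Since p 0 is only assumed
to be a left unit, the recursion is unrolled from the left. -/
theorem rec_mul {f : P} {p x c : ℕ → P} (hp : ∀ n, p (n + 1) = f * p n) (hp0 : ∀ y, p 0 * y = y)
    (h0 : x 0 = 0) (h : ∀ n, x (n + 1) = f * x n + c n) (n : ℕ) :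
    x (n + 1) = ∑ q ∈ Finset.HasAntidiagonal.antidiagonal n, p q.1 * c q.2 := by
  induction n with
  | zero => simp [h, h0, hp0]
  | succ n ih =>
    rw [h, ih, Finset.Nat.sum_antidiagonal_succ, hp0, add_comm, Finset.mul_sum]
    simp only [hp, mul_assoc]

/-- The solution of a linear recursion, with exponential weights. -/
theorem rec_mul_weighted {f : P} {p x c : ℕ → P} (hp : ∀ n, p (n + 1) = f * p n)
    (hp0 : ∀ y, p 0 * y = y) (h0 : x 0 = 0) (h : ∀ n, x (n + 1) = f * x n + c n) (n : ℕ) :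
    ww (n + 1) • x (n + 1) =
      -bconv (mulB P) (fun i => ww i • p i) (fun j => ww j • c j) n := by
  rw [rec_mul hp hp0 h0 h, bconv, Finset.smul_sum, ← Finset.sum_neg_distrib]
  refine Finset.sum_congr rfl fun q hq => ?_
  rw [← Finset.HasAntidiagonal.mem_antidiagonal.1 hq, ww_add, mulB_apply, smul_mul_assoc,
    mul_smul_comm, smul_smul, smul_smul, neg_smul, mul_assoc]

end weights

/-! ### Powers of the curvature -/

section curvature
variable {R₁ R₂ : Type u} [DGBAlg R₁] [DGBAlg R₂]

theorem expTerm_one (F : T00 R₁ R₂) (n : ℕ) : expTerm F 1 n = ww n • tpow F n := by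
  simp [expTerm, ww]

theorem tpow_succ' (F : T00 R₁ R₂) (s : ℝ) (n : ℕ) :
    expTerm F s n = ((s ^ n : ℝ) : ℂ) • expTerm F 1 n := by
  rw [expTerm_one, expTerm, smul_smul, ww, neg_pow]
  push_cast
  ring_nf

variable (A : T00 R₁ R₂)

/-- The powers of the curvature. -/
def pw (n : ℕ) : BiForm R₁ R₂ := muh (lcurv A ^ n)
/-- The terms of the exponential series. -/
def ah (n : ℕ) : BiForm R₁ R₂ := ww n • pw A n
/-- The terms of the image by `φ` of the exponential series. -/
def fh (n : ℕ) : BiForm R₁ R₂ := ww n • phh (lcurv A ^ n)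
/-- The inhomogeneous part of the recursion for `φ` of the powers of the curvature. -/
def gam (x : BiForm R₁ R₂) : BiForm R₁ R₂ := phh (lcurv A) * x + bd₂ (muh (lcurv A)) * bd₁ x

theorem pw_zero : pw A 0 = e00 tone := by rw [pw, pow_zero, muh_one]
theorem pw_succ (n : ℕ) : pw A (n + 1) = muh (lcurv A) * pw A n := by
  rw [pw, pow_succ', muh_mul, pw]
theorem pw_eq (n : ℕ) : pw A n = e00 (tpow (curv A) n) := by
  rw [← mu_lcurv, ← mu_pow]; rfl
theorem muh_lcurv : muh (lcurv A) = e00 (curv A) := by rw [← mu_lcurv]; rfl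
theorem ah_eq (n : ℕ) : ah A n = e00 (expTerm (curv A) 1 n) := by
  rw [ah, pw_eq, expTerm_one, map_smul]
theorem pw_mul_pw (i j : ℕ) : pw A i * pw A j = pw A (i + j) := by
  rw [pw, pw, pw, ← muh_mul, pow_add]
theorem ah_zero : ah A 0 = e00 tone := by rw [ah, ww_zero, one_smul, pw_zero]
theorem fh_zero : fh A 0 = 0 := by rw [fh, pow_zero, phh_one, smul_zero]

theorem gam_smul (c : ℂ) (x : BiForm R₁ R₂) : gam A (c • x) = c • gam A x := by
  rw [gam, gam, map_smul, mul_smul_comm, mul_smul_comm, smul_add]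

variable {A}

theorem par_lcurv (hA : par _ A = -A) : par _ (lcurv A) = lcurv A := by
  have h : par _ (lin A) = -lin A := by rw [← lin_par, hA, map_neg]
  rw [lcurv, map_add, upar_mul, h, neg_mul_neg, ← neg_neg (par _ (udif _ _)), ← udif_par, h, map_neg,
    neg_neg]

theorem par_lcurv_pow (hA : par _ A = -A) (n : ℕ) : par _ (lcurv A ^ n) = lcurv A ^ n := by
  induction n with
  | zero => rw [pow_zero, par_one]
  | succ n ih => rw [pow_succ, upar_mul, ih, par_lcurv hA]

theorem par_pw (hA : par _ A = -A) (n : ℕ) : par _ (pw A n) = pw A n := by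
  rw [pw, ← muh_par, par_lcurv_pow hA]
theorem par_ah (hA : par _ A = -A) (n : ℕ) : par _ (ah A n) = ah A n := by
  rw [ah, map_smul, par_pw hA]
theorem par_muh_lcurv (hA : par _ A = -A) : par _ (muh (lcurv A)) = muh (lcurv A) := by
  rw [← muh_par, par_lcurv hA]

/-- Applying φ to F · Fⁿ gives F φ(Fⁿ) + γ(Fⁿ) by the twisted Leibniz rule. Solving this recursion
with exponential weights expresses φ(Fⁿ⁺¹) by terms of e^{-F} in R̃₁ ⊗̂ R̃₂ alone. -/
theorem fh_succ (hA : par _ A = -A) (n : ℕ) :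
    fh A (n + 1) = -bconv (mulB _) (ah A) (fun j => gam A (ah A j)) n := by
  have h := rec_mul_weighted (f := muh (lcurv A)) (p := pw A) (x := fun n => phh (lcurv A ^ n))
    (c := fun n => gam A (pw A n)) (pw_succ A) (fun y => by rw [pw_zero, e00_one_mul])
    (by rw [pow_zero, phh_one]) (fun n => by
      rw [pow_succ', phh_mul, par_lcurv hA, gam, pw]
      abel) n
  simp only [← gam_smul] at h
  exact h

/-- Duhamel's formula for d₁e^{-F}, from the Leibniz rule d₁(F Fⁿ) = d₁F Fⁿ + F d₁(Fⁿ), F being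
even. -/
theorem bd₁_ah_succ (hA : par _ A = -A) (n : ℕ) :
    bd₁ (ah A (n + 1)) = -bconv (mulB _) (ah A) (fun j => bd₁ (muh (lcurv A)) * ah A j) n := by
  have h := rec_mul_weighted (f := muh (lcurv A)) (p := pw A) (x := fun n => bd₁ (pw A n))
    (c := fun n => bd₁ (muh (lcurv A)) * pw A n) (pw_succ A) (fun y => by rw [pw_zero, e00_one_mul])
    (by rw [pw_zero, bd₁_one]) (fun n => by
      rw [pw_succ, bd₁_mul, par_muh_lcurv hA, add_comm]) n
  simp only [← mul_smul_comm] at h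
  rw [ah, map_smul]
  exact h

end curvature

/-! ### Convergence of the image of the Chern character -/

section convergence
variable {R₁ R₂ : Type u} [DGBAlg R₁] [DGBAlg R₂] {A : ℝ → T00 R₁ R₂} {h : ℝ → T00 R₁ R₂}

theorem CPath.lcurv (hA : CPath A) : CPath fun t => lcurv (A t) :=
  (hA.map ((udif _).comp lin)).add ((hA.map lin).map₂ (hA.map lin) (umul _))

theorem USum.ah (hs : USum (fun n t => expTerm (curv (A t)) 1 n) h) :
    USum (fun n t => ah (A t) n) fun t => e00 (h t) :=
  (hs.map e00).congr (fun n t _ => ah_eq (A t) n) fun _ _ => rfl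

theorem USum.gam (hA : CPath A) {x : ℕ → ℝ → BiForm R₁ R₂} {y : ℝ → BiForm R₁ R₂} (hx : USum x y) :
    USum (fun n t => gam (A t) (x n t)) fun t => gam (A t) (y t) :=
  (USum.map₂ (mulB _) (hA.lcurv.map phh) hx).add
    (USum.map₂ (mulB _) (hA.lcurv.map (bd₂.comp muh)) (hx.map bd₁))

/-- The powers of the lifted curvature live in the free product, where their exponential series need
not converge, so continuity of φ does not help. The recursion replaces φ of the powers by a
beta-weighted product of series that do converge. -/
theorem USum.exists_fh (hA : CPath A) (ho : ∀ t ∈ Icc (0 : ℝ) 1, par _ (A t) = -A t)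
    (hs : USum (fun n t => expTerm (curv (A t)) 1 n) h) :
    ∃ k, USum (fun n t => fh (A t) n) k := by
  obtain ⟨c, hc⟩ := USum.bconv (mulB (BiForm R₁ R₂)) hs.ah (USum.gam hA hs.ah)
  exact ⟨fun t => -c t, USum.of_succ (fun t _ => fh_zero _)
    (hc.neg.congr (fun n t ht => fh_succ (ho t ht) n) fun _ _ => rfl)⟩

end convergence

/-! ### The Chern character in the augmented `X`-complex -/

section universal
variable {R : Type u} [DGBAlg R]

theorem natX_trace_even {u v : FormAlg R} (hu : deg0 R u = 0) (hv : par _ v = v) :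
    natX R (u * v) = natX R (v * u) := by
  have h := natX_comm_even u hv
  have h0 : par _ u * formD R v = 0 := formAlg_ext (by simp) (by
    rw [deg1_mul, deg0_par, hu, map_zero, map_zero, deg0_formD, map_zero, BMap.zero_apply, add_zero,
      map_zero])
  rw [h0, map_zero, map_zero, map_sub, sub_eq_zero] at h
  exact h

theorem natX_trace_odd {u v : FormAlg R} (hu : deg0 R u = 0) (hv : par _ v = -v) :
    natX R (u * v) = natX R (v * par _ u) := by
  have h := natX_comm_odd u hv
  have h0 : par _ u * formD R v = 0 := formAlg_ext (by simp) (by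
    rw [deg1_mul, deg0_par, hu, map_zero, map_zero, deg0_formD, map_zero, BMap.zero_apply, add_zero,
      map_zero])
  rw [h0, map_zero, map_zero, map_sub, sub_eq_zero] at h
  exact h

theorem deg0_mul_formD (x y : FormAlg R) : deg0 R (x * formD R y) = 0 := by simp

theorem formD_mul_formD_right (x y : FormAlg R) : formD R (x * formD R y) = 0 :=
  formAlg_ext (by simp) (by simp)

theorem dX_natX_comm_even (x : FormAlg R) {y : FormAlg R} (hy : par _ y = y) :
    dX R (natX R (x * y)) = dX R (natX R (y * x)) := by
  rw [← sub_eq_zero, ← map_sub, ← map_sub, natX_comm_even x hy, dX_bX]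

theorem par_formD_odd' {y : FormAlg R} (hy : par _ y = -y) : par _ (formD R y) = formD R y := by
  rw [← neg_inj, ← formD_par, hy, map_neg]

/-- The sum of all `fⁱ x fʲ` with `i + j + 1 = n`. -/
def cyc (f x : Unitization ℂ R) : ℕ → Unitization ℂ R
  | 0 => 0
  | n + 1 => f * cyc f x n + x * f ^ n

theorem cyc_succ (f x : Unitization ℂ R) (n : ℕ) : cyc f x (n + 1) = f * cyc f x n + x * f ^ n := rfl

/-- The same cyclic sum peeled from the other end: either f stands immediately to the right of x, or
x is the last factor. This form suits inductions in which x is arbitrary. -/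
theorem cyc_succ' (f x : Unitization ℂ R) (n : ℕ) :
    cyc f x (n + 1) = cyc f (x * f) n + f ^ n * x := by
  induction n with
  | zero => simp [cyc]
  | succ n ih =>
    rw [cyc_succ, ih, cyc_succ f (x * f), pow_succ', mul_add]
    simp only [mul_assoc]
    abel

theorem cyc_one (f : Unitization ℂ R) (n : ℕ) : cyc f 1 (n + 1) = ((n : ℂ) + 1) • f ^ n := by
  induction n with
  | zero => simp [cyc]
  | succ n ih =>
    rw [cyc_succ, ih, one_mul, mul_smul_comm, ← pow_succ']
    push_cast
    module

theorem cyc_par {f x : Unitization ℂ R} (hf : par _ f = f) (hx : par _ x = -x) (n : ℕ) :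
    par _ (cyc f x n) = -cyc f x n := by
  have hp : ∀ n, par _ (f ^ n) = f ^ n := fun n => by
    induction n with
    | zero => rw [pow_zero, par_one]
    | succ n ih => rw [pow_succ, upar_mul, ih, hf]
  induction n with
  | zero => rw [cyc, map_zero, neg_zero]
  | succ n ih => rw [cyc_succ, map_add, upar_mul, upar_mul, ih, hf, hx, hp, mul_neg, neg_mul, neg_add]

theorem fun0_pow_succ (f : Unitization ℂ R) (n : ℕ) :
    fun0 R (f ^ (n + 1)) = fun0 R f * fun0 R (f ^ n) := by rw [pow_succ', fun0_mul]

theorem par_fun0_pow {f : Unitization ℂ R} (hf : par _ f = f) (n : ℕ) :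
    par _ (fun0 R (f ^ n)) = fun0 R (f ^ n) := by
  induction n with
  | zero => rw [pow_zero, par_fun0, par_one]
  | succ n ih => rw [fun0_pow_succ, par_mul, ih, par_fun0, hf]

/-- Modulo commutators, the differential of a power is a cyclic sum. -/
theorem natX_mul_formD_pow {f : Unitization ℂ R} (hf : par _ f = f) (n : ℕ) :
    ∀ x : Unitization ℂ R, natX R (fun0 R x * formD R (fun0 R (f ^ n))) =
      natX R (fun0 R (cyc f x n) * formD R (fun0 R f)) := by
  induction n with
  | zero => intro x; rw [pow_zero, formD_fun0_one, cyc, map_zero, mul_zero, zero_mul]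
  | succ n ih =>
    intro x
    -- Of the two Leibniz terms, x df fⁿ is rotated to fⁿ x df, while x f d(fⁿ) is the induction
    -- hypothesis with xf in place of x.
    rw [fun0_pow_succ, formD_mul, par_fun0, hf, mul_add, ← mul_assoc, ← mul_assoc, map_add,
      natX_trace_even (deg0_mul_formD _ _) (par_fun0_pow hf n), ← fun0_mul, ih, cyc_succ', map_add,
      add_mul, map_add, fun0_mul (f ^ n), mul_assoc, add_comm]

/-- All n + 1 summands of the cyclic sum are rotations of x fⁿ, and ♮d does not see commutators
because it kills b̄. -/
theorem dX_natX_cyc {f : Unitization ℂ R} (hf : par _ f = f) (n : ℕ) :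
    ∀ x : Unitization ℂ R, dX R (natX R (fun0 R (cyc f x (n + 1)))) =
      ((n : ℂ) + 1) • dX R (natX R (fun0 R (x * f ^ n))) := by
  induction n with
  | zero => intro x; simp [cyc]
  | succ n ih =>
    intro x
    rw [cyc_succ', map_add, map_add, map_add, ih, mul_assoc, ← pow_succ', fun0_mul (f ^ (n + 1)),
      ← dX_natX_comm_even _ (par_fun0_pow hf _), ← fun0_mul]
    push_cast
    module

variable {a : Unitization ℂ R}

variable (a) in
/-- The curvature of `a`. -/
def ucurv : Unitization ℂ R := udif R a + a * a

theorem par_ucurv (ha : par _ a = -a) : par _ (ucurv a) = ucurv a := by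
  rw [ucurv, map_add, upar_mul, ha, neg_mul_neg, ← neg_neg (par _ (udif _ _)), ← udif_par, ha,
    map_neg, neg_neg]

/-- The Bianchi identity, δF = [F, a]. -/
theorem udif_ucurv (ha : par _ a = -a) : udif R (ucurv a) = ucurv a * a - a * ucurv a := by
  have h : udif R (udif R a) = 0 := by simp [dif_dif]
  rw [ucurv, map_add, udif_mul, ha, h]
  noncomm_ring

theorem udif_ucurv_pow (ha : par _ a = -a) (n : ℕ) :
    udif R (ucurv a ^ n) = ucurv a ^ n * a - a * ucurv a ^ n := by
  induction n with
  | zero => rw [pow_zero, udif_one, one_mul, mul_one, sub_self]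
  | succ n ih =>
    rw [pow_succ', udif_mul, ih, par_ucurv ha, udif_ucurv ha]
    noncomm_ring

theorem formD_ucurv (ha : par _ a = -a) : formD R (fun0 R (ucurv a)) =
    formD R (dif _ (fun0 R a)) + (formD R (fun0 R a) * fun0 R a - fun0 R a * formD R (fun0 R a)) := by
  rw [ucurv, map_add, map_add, dif_fun0, fun0_mul, formD_mul, par_fun0, ha, map_neg, neg_mul,
    sub_eq_add_neg]

/-- The terms of the Chern character, without the weights. -/
def qX (a : Unitization ℂ R) (n : ℕ) : XT R :=
  natX R (fun0 R (ucurv a ^ n) - fun0 R (ucurv a ^ n) * formD R (fun0 R a))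

theorem XD_natX_sub {u : Unitization ℂ R} {x : FormAlg R} (hx : fun0 R u = x) (y : FormAlg R) :
    XD R (natX R (x - x * formD R y)) = natX R (dif _ x) - bX R (natX R (x * formD R y)) +
      natX R (formD R x) - natX R (dif _ x * formD R y) + natX R (par _ x * formD R (dif _ y)) := by
  subst hx
  rw [XD_eq, BMap.add_apply, BMap.add_apply, map_sub (natX R), map_sub (bX R), map_sub (dX R),
    map_sub (deltaX R), bX_natX_fun0, ← natX_formD, ← natX_formD, ← natX_dif, ← natX_dif,
    formD_mul_formD_right, dif_mul, dif_formD, mul_neg, map_add, map_neg, map_zero]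
  abel

/-- By the Bianchi identity δFⁿ = [Fⁿ, a], which cancels b̄♮(Fⁿ da). A rotation of a collects the
other terms of degree one into Fⁿ(dδa + da a - a da) = Fⁿ dF, and d(Fⁿ) becomes a cyclic sum times
dF. -/
theorem XD_qX (ha : par _ a = -a) (n : ℕ) : XD R (qX a n) =
    natX R (fun0 R (cyc (ucurv a) 1 n) * formD R (fun0 R (ucurv a))) +
      natX R (fun0 R (ucurv a ^ n) * formD R (fun0 R (ucurv a))) := by
  have hf := par_ucurv ha
  have hp := par_fun0_pow hf n
  have ha' : par _ (fun0 R a) = -fun0 R a := by rw [par_fun0, ha, map_neg]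
  have hb := natX_comm_odd (fun0 R (ucurv a ^ n)) ha'
  have ht := natX_trace_odd (deg0_mul_formD (fun0 R (ucurv a ^ n)) (fun0 R a)) ha'
  rw [par_mul, hp, par_formD_odd' ha'] at ht
  rw [hp] at hb
  rw [qX, XD_natX_sub rfl, dif_fun0, udif_ucurv_pow ha, map_sub, fun0_mul, fun0_mul, hb,
    ← natX_mul_formD_pow hf, fun0_one_mul, hp, formD_ucurv ha]
  simp only [mul_add, mul_sub, sub_mul, map_add, map_sub, mul_assoc] at ht ⊢
  rw [ht]
  abel

/-- The cyclic sum of Fⁿ⁺¹ with middle term 1 is (n+1)Fⁿ. With the weight wₙ₊₁ it cancels the term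
wₙFⁿ dF of the preceding order, so only the last order remains. -/
theorem sum_XD_qX (ha : par _ a = -a) (N : ℕ) :
    XD R (∑ n ∈ Finset.range (N + 1), ww n • qX a n) =
      ww N • natX R (fun0 R (ucurv a ^ N) * formD R (fun0 R (ucurv a))) := by
  induction N with
  | zero =>
    rw [Finset.sum_range_one, map_smul, XD_qX ha, cyc, map_zero, zero_mul, map_zero, zero_add]
  | succ N ih =>
    rw [Finset.sum_range_succ, map_add, ih, map_smul, XD_qX ha, cyc_one, map_smul, smul_mul_assoc,
      map_smul, smul_add, smul_smul, ww_succ, neg_smul]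
    abel

/-! ### Variation of the Chern character -/

variable {a' : Unitization ℂ R}

/-- The terms of the Chern–Simons transgression, without the weights. -/
def csX (a a' : Unitization ℂ R) (n : ℕ) : XT R :=
  natX R (fun0 R (cyc (ucurv a) a' n) - fun0 R (cyc (ucurv a) a' n) * formD R (fun0 R a))

/-- The error terms of the transgression formula. -/
def erX (a a' : Unitization ℂ R) (n : ℕ) : XT R :=
  natX R (fun0 R (cyc (ucurv a) a' n) * formD R (fun0 R (ucurv a))) -
    natX R (fun0 R (ucurv a ^ n) * formD R (fun0 R a'))

/-- The variation of the powers of the curvature. -/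
def vpow (a a' : Unitization ℂ R) (n : ℕ) : Unitization ℂ R :=
  udif R (cyc (ucurv a) a' n) + a * cyc (ucurv a) a' n + cyc (ucurv a) a' n * a

theorem vpow_zero : vpow a a' 0 = 0 := by simp [vpow, cyc]

/-- This is the recursion satisfied by the derivative of Fⁿ when a' is the derivative of a, the
derivative of F being δa' + a'a + aa'. So `vpow` is that derivative, written as a covariant
differential of the cyclic sum. -/
theorem vpow_succ (ha : par _ a = -a) (ha' : par _ a' = -a') (n : ℕ) :
    vpow a a' (n + 1) = (udif R a' + a' * a + a * a') * ucurv a ^ n + ucurv a * vpow a a' n := by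
  rw [vpow, cyc_succ, map_add, udif_mul, udif_mul, par_ucurv ha, ha', udif_ucurv ha,
    udif_ucurv_pow ha, vpow]
  noncomm_ring

/-- The variation of the terms of the Chern character, without the weights. -/
def vX (a a' : Unitization ℂ R) (n : ℕ) : XT R :=
  natX R (fun0 R (vpow a a' n) - (fun0 R (vpow a a' n) * formD R (fun0 R a) +
    fun0 R (ucurv a ^ n) * formD R (fun0 R a')))

/-- Transgression at one order. The Hochschild boundary of the Chern–Simons form supplies the
commutator with a, and the failure to be exact is collected in ♮d of the cyclic sum and in `erX`. -/
theorem vX_eq (ha : par _ a = -a) (ha' : par _ a' = -a') (n : ℕ) :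
    vX a a' n = XD R (csX a a' n) - natX R (formD R (fun0 R (cyc (ucurv a) a' n))) +
      erX a a' n := by
  have hf := par_ucurv ha
  have hW : par _ (fun0 R (cyc (ucurv a) a' n)) = -fun0 R (cyc (ucurv a) a' n) := by
    rw [par_fun0, cyc_par hf ha', map_neg]
  have hb := natX_comm_odd (fun0 R (cyc (ucurv a) a' n)) (by rw [par_fun0, ha, map_neg] :
    par _ (fun0 R a) = -fun0 R a)
  have ht := natX_trace_odd (deg0_mul_formD (fun0 R (cyc (ucurv a) a' n)) (fun0 R a))
    (by rw [par_fun0, ha, map_neg] : par _ (fun0 R a) = -fun0 R a)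
  rw [par_mul, hW, par_formD_odd' (by rw [par_fun0, ha, map_neg])] at ht
  rw [hW, neg_mul, map_neg, map_neg] at hb
  have hb' := neg_eq_iff_eq_neg.1 hb.symm
  rw [vX, csX, XD_natX_sub rfl, erX, hW, formD_ucurv ha, hb', vpow]
  simp only [dif_fun0, map_add, fun0_mul, mul_add, add_mul, mul_sub, neg_mul, mul_neg,
    map_sub, map_neg, mul_assoc] at ht ⊢
  rw [ht]
  abel

/-- Modulo commutators the cyclic sum is (n+1) a'Fⁿ under ♮d; the Leibniz rule and a rotation then
turn ♮d(a'Fⁿ) into the error of the preceding order. -/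
theorem natX_formD_cyc (ha : par _ a = -a) (ha' : par _ a' = -a') (n : ℕ) :
    natX R (formD R (fun0 R (cyc (ucurv a) a' (n + 1)))) = -(((n : ℂ) + 1) • erX a a' n) := by
  have hf := par_ucurv ha
  rw [natX_formD, dX_natX_cyc hf, ← natX_formD, fun0_mul, formD_mul, par_fun0, ha', map_neg, neg_mul,
    map_add, map_neg, natX_mul_formD_pow hf, ← smul_neg, erX, neg_sub]
  rw [natX_trace_even (by simp) (par_fun0_pow hf n), sub_eq_add_neg]

/-- The relation (n+1)wₙ₊₁ = -wₙ cancels the error of each order against the next one; only the last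
error survives. -/
theorem sum_vX (ha : par _ a = -a) (ha' : par _ a' = -a') (N : ℕ) :
    ∑ n ∈ Finset.range (N + 1), ww n • vX a a' n =
      XD R (∑ n ∈ Finset.range (N + 1), ww n • csX a a' n) + ww N • erX a a' N := by
  induction N with
  | zero =>
    rw [Finset.sum_range_one, Finset.sum_range_one, vX_eq ha ha', cyc, map_zero, map_zero, map_zero,
      sub_zero, smul_add, map_smul]
  | succ N ih =>
    rw [Finset.sum_range_succ, ih, Finset.sum_range_succ _ (N + 1), map_add, vX_eq ha ha',
      natX_formD_cyc ha ha', sub_neg_eq_add, smul_add, smul_add, smul_smul, ww_succ, map_smul, neg_smul]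
    abel

end universal

/-! ### The image of the Chern character under the chain map -/

section image
variable {R₁ R₂ : Type u} [DGBAlg R₁] [DGBAlg R₂]

theorem formD_fun0_snd {R : Type u} [DGBAlg R] (Y : Unitization ℂ R) :
    formD R (fun0 R Y) = formD R (fun0 R (Y.snd : Unitization ℂ R)) := by
  rw [← form1_dform, ← form1_dform, dform_apply, dform_apply, Unitization.snd_inr]

theorem natX_form {R : Type u} [DGBAlg R] (X : Unitization ℂ R) (Y : Unitization ℂ R) :
    natX R (fun0 R X * formD R (fun0 R Y)) = (0, nat R (form R X Y.snd)) := by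
  rw [formD_fun0_snd, ← form1_form]; rfl

theorem unit_eq {R : Type u} [DGBAlg R] (Y : Unitization ℂ R) :
    Y = Y.fst • (1 : Unitization ℂ R) + (Y.snd : Unitization ℂ R) := by
  refine Unitization.ext ?_ ?_ <;> simp

theorem bd₁_muh (Y : Unitization ℂ (FreeProd R₁ R₂)) : bd₁ (muh Y) = bd₁ (muF Y.snd) := by
  conv_lhs => rw [unit_eq Y, map_add, map_smul, muh_one, muh_inr, map_add, map_smul, bd₁_one,
    smul_zero, zero_add]
theorem bd₂_muh (Y : Unitization ℂ (FreeProd R₁ R₂)) : bd₂ (muh Y) = bd₂ (muF Y.snd) := by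
  conv_lhs => rw [unit_eq Y, map_add, map_smul, muh_one, muh_inr, map_add, map_smul, bd₂_one,
    smul_zero, zero_add]
theorem phh_snd (Y : Unitization ℂ (FreeProd R₁ R₂)) : phh Y = phF Y.snd := by
  conv_lhs => rw [unit_eq Y, map_add, map_smul, phh_one, phh_inr, smul_zero, zero_add]

theorem psi_natX_even (X : Unitization ℂ (FreeProd R₁ R₂)) {Y : Unitization ℂ (FreeProd R₁ R₂)}
    (hY : par _ Y = Y) : psi R₁ R₂ (natX _ (fun0 _ X * formD _ (fun0 _ Y))) =
      tev (muh X) (muh Y) (phh Y) := by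
  have h : par _ Y.snd = Y.snd := by rw [← par_snd, hY]
  rw [natX_form, psi_form, tpsi_even _ h, tev, tev, bd₁_muh Y, bd₂_muh Y, phh_snd Y]

theorem psi_natX_odd (X : Unitization ℂ (FreeProd R₁ R₂)) {Y : Unitization ℂ (FreeProd R₁ R₂)}
    (hY : par _ Y = -Y) : psi R₁ R₂ (natX _ (fun0 _ X * formD _ (fun0 _ Y))) =
      tod (muh X) (muh Y) (phh Y) := by
  have h : par _ Y.snd = -Y.snd := by rw [← par_snd, hY, Unitization.snd_neg]
  rw [natX_form, psi_form, tpsi_odd _ h, tod, tod, bd₁_muh Y, bd₂_muh Y, phh_snd Y]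

theorem psi_natX_fun0 (X : Unitization ℂ (FreeProd R₁ R₂)) :
    psi R₁ R₂ (natX _ (fun0 _ X)) = natXX (muh X) + natXX (phh X) := by
  rw [natX_fun0, ← psi_fst]; rfl

theorem par_lin {A : T00 R₁ R₂} (hA : par _ A = -A) : par _ (lin A) = -lin A := by
  rw [← lin_par, hA, map_neg]

theorem qterm_eq (A : T00 R₁ R₂) (n : ℕ) : qterm A n = ww n • qX (lin A) n := by
  rw [qterm, qX, ww]
  congr 1
  refine Prod.ext ?_ ?_
  · simp [lcurv, ucurv]
  · rw [map_sub, ← form1_dform, ← form1_oleft, natX_fun0, natX_form1]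
    simp [xinl, xinr, lcurv, ucurv]

/-- Since φ vanishes on the lift of A, the one-form part of Quillen's character contributes no
boundary of φ; φ enters only through the powers of the curvature. -/
theorem psi_qterm {A : T00 R₁ R₂} (hA : par _ A = -A) (n : ℕ) : psi R₁ R₂ (qterm A n) =
    natXX (ah A n) + natXX (fh A n) -
      (natXX (bd₁ (e00 A) * ah A n) + natXX (ah A n * bd₂ (e00 A))) := by
  rw [qterm_eq, qX, map_smul, map_sub, map_sub, psi_natX_fun0, psi_natX_odd _ (par_lin hA), phh_lin,
    muh_lin, tod, mul_zero, map_zero, map_zero, add_zero, map_add, ah, fh, map_smul, map_smul,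
    mul_smul_comm, smul_mul_assoc, map_smul, map_smul, smul_sub, smul_add, smul_add]
  rfl

theorem USum.exists_psi_qterm {A : ℝ → T00 R₁ R₂} {h : ℝ → T00 R₁ R₂} (hA : CPath A)
    (ho : ∀ t ∈ Icc (0 : ℝ) 1, par _ (A t) = -A t)
    (hs : USum (fun n t => expTerm (curv (A t)) 1 n) h) :
    ∃ k, USum (fun n t => psi R₁ R₂ (qterm (A t) n)) k := by
  obtain ⟨k, hk⟩ := USum.exists_fh hA ho hs
  have h1 := USum.map₂ (mulB _) (hA.map (bd₁.comp e00)) hs.ah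
  have h2 := USum.map₂ (mulB _).flip (hA.map (bd₂.comp e00)) hs.ah
  exact ⟨_, (((hs.ah.map natXX).add (hk.map natXX)).add ((h1.map natXX).add (h2.map natXX)).neg).congr
    (fun n t ht => (psi_qterm (ho t ht) n).trans (sub_eq_add_neg _ _)) fun _ _ => rfl⟩

/-! ### Components -/

theorem c00_i00 (u : T00 R₁ R₂) : c00 (i00 u) = u :=
  tensor_induct (c00.comp i00) (BMap.id _) (fun x y => by simp [c00, i00, xinl]) u
theorem c00_i10 (u : N10 R₁ R₂) : c00 (i10 u) = 0 :=
  tensor_induct (c00.comp i10) 0 (fun x y => by simp [c00, i10, xinl, xinr]) u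
theorem c00_i01 (u : N01 R₁ R₂) : c00 (i01 u) = 0 :=
  tensor_induct (c00.comp i01) 0 (fun x y => by simp [c00, i01, xinl, xinr]) u
theorem c00_i11 (u : N11 R₁ R₂) : c00 (i11 u) = 0 :=
  tensor_induct (c00.comp i11) 0 (fun x y => by simp [c00, i11, xinr]) u
theorem c10_i00 (u : T00 R₁ R₂) : c10 (i00 u) = 0 :=
  tensor_induct (c10.comp i00) 0 (fun x y => by simp [c10, i00, xinl]) u
theorem c10_i10 (u : N10 R₁ R₂) : c10 (i10 u) = u :=
  tensor_induct (c10.comp i10) (BMap.id _) (fun x y => by simp [c10, i10, xinl, xinr]) u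
theorem c10_i01 (u : N01 R₁ R₂) : c10 (i01 u) = 0 :=
  tensor_induct (c10.comp i01) 0 (fun x y => by simp [c10, i01, xinl, xinr]) u
theorem c10_i11 (u : N11 R₁ R₂) : c10 (i11 u) = 0 :=
  tensor_induct (c10.comp i11) 0 (fun x y => by simp [c10, i11, xinr]) u
theorem c01_i00 (u : T00 R₁ R₂) : c01 (i00 u) = 0 :=
  tensor_induct (c01.comp i00) 0 (fun x y => by simp [c01, i00, xinl]) u
theorem c01_i10 (u : N10 R₁ R₂) : c01 (i10 u) = 0 :=
  tensor_induct (c01.comp i10) 0 (fun x y => by simp [c01, i10, xinl, xinr]) u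
theorem c01_i01 (u : N01 R₁ R₂) : c01 (i01 u) = u :=
  tensor_induct (c01.comp i01) (BMap.id _) (fun x y => by simp [c01, i01, xinl, xinr]) u
theorem c01_i11 (u : N11 R₁ R₂) : c01 (i11 u) = 0 :=
  tensor_induct (c01.comp i11) 0 (fun x y => by simp [c01, i11, xinr]) u
theorem c11_i00 (u : T00 R₁ R₂) : c11 (i00 u) = 0 :=
  tensor_induct (c11.comp i00) 0 (fun x y => by simp [c11, i00, xinl]) u
theorem c11_i10 (u : N10 R₁ R₂) : c11 (i10 u) = 0 :=
  tensor_induct (c11.comp i10) 0 (fun x y => by simp [c11, i10, xinl, xinr]) u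
theorem c11_i01 (u : N01 R₁ R₂) : c11 (i01 u) = 0 :=
  tensor_induct (c11.comp i01) 0 (fun x y => by simp [c11, i01, xinl, xinr]) u
theorem c11_i11 (u : N11 R₁ R₂) : c11 (i11 u) = u :=
  tensor_induct (c11.comp i11) (BMap.id _) (fun x y => by simp [c11, i11, xinr]) u

theorem i11_injective : Function.Injective (i11 (R₁ := R₁) (R₂ := R₂)) :=
  Function.LeftInverse.injective c11_i11

/-- The component of bidegree `(1, 1)` of the terms of the Chern character. -/
def pterm (A : T00 R₁ R₂) (n : ℕ) : N11 R₁ R₂ := ww n • nat₁₂ (phi (lcurv A ^ n))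

theorem natXX_fh (A : T00 R₁ R₂) (n : ℕ) : natXX (fh A n) = i11 (pterm A n) := by
  rw [fh, pterm, map_smul, map_smul, ← natXX_e11]; rfl

theorem psi_qterm' {A : T00 R₁ R₂} (hA : par _ A = -A) (n : ℕ) : psi R₁ R₂ (qterm A n) =
    i00 (expTerm (curv A) 1 n) + i11 (pterm A n) -
      (i10 (nat₁ (m10 (d₁ A) (expTerm (curv A) 1 n))) +
        i01 (nat₂ (m01 (expTerm (curv A) 1 n) (d₂ A)))) := by
  rw [psi_qterm hA, natXX_fh, ah_eq, bd₁_e00_mul, e00_mul_bd₂, natXX_e00, natXX_e10, natXX_e01]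

theorem c00_Dtot (x : XX R₁ R₂) :
    c00 (Dtot x) = tdif (c00 x) + b10₁ (c10 x) + b01₂ (c01 x) := by
  have h := tensor_induct (c00.comp Dtot) (tdif.comp c00 + b10₁.comp c10 + b01₂.comp c01) (fun x y => by
    have e1 : (par (XT R₁) x).1 = par _ x.1 := rfl
    have e2 : (par (XT R₁) x).2 = par _ x.2 := rfl
    simp [c00, c10, c01, Dtot, tdif, b10₁, b01₂, on₁, on₂, XD, e1, -udif_apply, -par_unit]
    abel) x
  simpa only [BMap.add_apply, BMap.comp_apply] using h
theorem c10_Dtot (x : XX R₁ R₂) :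
    c10 (Dtot x) = dif10 (c10 x) + nd00₁ (c00 x) + b11₂ (c11 x) := by
  have h := tensor_induct (c10.comp Dtot) (dif10.comp c10 + nd00₁.comp c00 + b11₂.comp c11) (fun x y => by
    have e1 : (par (XT R₁) x).1 = par _ x.1 := rfl
    have e2 : (par (XT R₁) x).2 = par _ x.2 := rfl
    simp [c00, c10, c11, Dtot, dif10, nd00₁, b11₂, on₁, on₂, XD, e2, -udif_apply, -par_unit]
    abel) x
  simpa only [BMap.add_apply, BMap.comp_apply] using h
theorem c01_Dtot (x : XX R₁ R₂) :
    c01 (Dtot x) = dif01 (c01 x) + b11₁ (c11 x) + nd00₂ (c00 x) := by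
  have h := tensor_induct (c01.comp Dtot) (dif01.comp c01 + b11₁.comp c11 + nd00₂.comp c00) (fun x y => by
    have e1 : (par (XT R₁) x).1 = par _ x.1 := rfl
    have e2 : (par (XT R₁) x).2 = par _ x.2 := rfl
    simp [c00, c01, c11, Dtot, dif01, b11₁, nd00₂, on₁, on₂, XD, e1, -udif_apply, -par_unit]
    abel) x
  simpa only [BMap.add_apply, BMap.comp_apply] using h
theorem c11_Dtot (x : XX R₁ R₂) :
    c11 (Dtot x) = dif11 (c11 x) + nd01₁ (c01 x) + nd10₂ (c10 x) := by
  have h := tensor_induct (c11.comp Dtot) (dif11.comp c11 + nd01₁.comp c01 + nd10₂.comp c10) (fun x y => by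
    have e1 : (par (XT R₁) x).1 = par _ x.1 := rfl
    have e2 : (par (XT R₁) x).2 = par _ x.2 := rfl
    simp [c01, c10, c11, Dtot, dif11, nd01₁, nd10₂, on₁, on₂, XD, e2, -udif_apply, -par_unit]
    abel) x
  simpa only [BMap.add_apply, BMap.comp_apply] using h

end image

/-! ### The component of bidegree `(1, 1)` -/

section component
variable {R₁ R₂ : Type u} [DGBAlg R₁] [DGBAlg R₂]

/-- Here φ(F) = -d₂A d₁A, and inside ♮ the even factor e^{-F} d₂A can be exchanged with d₁A. -/
theorem natXX_phh_lcurv {A : T00 R₁ R₂} (hA : par _ A = -A) (n : ℕ) :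
    natXX (ah A n * phh (lcurv A)) =
      -i11 (nat₁₂ (m12 (m10 (d₁ A) (expTerm (curv A) 1 n)) (d₂ A))) := by
  have hp : par _ (ah A n * bd₂ (e00 A)) = ah A n * bd₂ (e00 A) := by
    rw [par_mul, par_ah hA, par_bd₂_odd (by rw [← e00_par, hA, map_neg])]
  rw [phh_lcurv hA, mul_neg, map_neg, ← mul_assoc, ← natXX_swap_even' hp (F1_bd₁ _)
    ((F2_bd₂ _).left _), ← mul_assoc, ah_eq, ← natXX_e11, e11_m12, e10_m10, e10_d₁, e01_d₂]

theorem F1_phh (X : Unitization ℂ (FreeProd R₁ R₂)) : F1 (phh X) := F1_e11 _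
theorem F2_phh (X : Unitization ℂ (FreeProd R₁ R₂)) : F2 (phh X) := F2_e11 _

/-- The trilinear map of the integrand of the component of bidegree `(1, 1)`. -/
def simplexB (F : T00 R₁ R₂) : T00 R₁ R₂ ⟹ T00 R₁ R₂ ⟹ T00 R₁ R₂ ⟹ N11 R₁ R₂ :=
  BMap.post (BMap.post nat₁₂ (m21.bi (BMap.id _) (m10 (d₁ F)))) (m01'.bi (m01.flip (d₂ F)) (BMap.id _))

theorem simplexB_apply (F x y z : T00 R₁ R₂) :
    simplexB F x y z = nat₁₂ (m21 (m01' (m01 x (d₂ F)) y) (m10 (d₁ F) z)) := rfl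

theorem i11_simplexB (F x y z : T00 R₁ R₂) : i11 (simplexB F x y z) =
    natXX (e00 x * (bd₂ (e00 F) * (e00 y * (bd₁ (e00 F) * e00 z)))) := by
  rw [simplexB_apply, ← natXX_e11, e11_m21, e01_m01', e01_m01, e10_m10, e10_d₁, e01_d₂]
  simp only [mul_assoc]

/-- The terms of the triple series in the component of bidegree `(1, 1)`. -/
def striple (A : T00 R₁ R₂) : ℕ → N11 R₁ R₂
  | 0 => 0
  | n + 1 => ∑ p ∈ Finset.HasAntidiagonal.antidiagonal n, ∑ q ∈ Finset.HasAntidiagonal.antidiagonal p.2,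
      (kk3 (p.1, q) : ℂ) • simplexB (curv A) (expTerm (curv A) 1 p.1) (expTerm (curv A) 1 q.1)
        (expTerm (curv A) 1 q.2)

/-- By the trace property all n + 1 products equal ♮(Fⁿ φ(F)), each with coefficient -wₙ₊₁; the
total -(n+1)wₙ₊₁ is wₙ. The beta weights disappear, which leaves the boundary term of the integral
formula. -/
theorem sum_natXX_phh {A : T00 R₁ R₂} (hA : par _ A = -A) (n : ℕ) :
    natXX (bconv (mulB _) (ah A) (fun j => phh (lcurv A) * ah A j) n) =
      natXX (ah A n * phh (lcurv A)) := by
  have h : ∀ p ∈ Finset.HasAntidiagonal.antidiagonal n,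
      natXX ((kk p.1 p.2 : ℂ) • (mulB (BiForm R₁ R₂)) (ah A p.1) (phh (lcurv A) * ah A p.2)) =
        -ww (n + 1) • natXX (pw A n * phh (lcurv A)) := fun p hp => by
    rw [← Finset.HasAntidiagonal.mem_antidiagonal.1 hp, ww_add, neg_neg, mulB_apply, ← mul_assoc, map_smul,
      natXX_trace_even (par_ah hA _) ((F1_phh _).left _) ((F2_phh _).left _), ← mul_assoc, ah, ah,
      smul_mul_smul_comm, pw_mul_pw, smul_mul_assoc, map_smul, smul_smul, add_comm p.2,
      mul_comm (ww p.2)]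
  rw [bconv, map_sum, Finset.sum_congr rfl h, Finset.sum_const, Finset.Nat.card_antidiagonal,
    ← Nat.cast_smul_eq_nsmul ℂ, smul_smul, ah, smul_mul_assoc, map_smul]
  congr 1
  have := ww_succ n
  push_cast
  linear_combination -this

/-- The Duhamel expansion of d₁e^{-F} is inserted in the second slot, and the two beta weights
multiply to `kk3`. The term with d₁ of the unit is zero, so the triple series enters one order
later; hence the value zero of `striple` at order zero. -/
theorem sum_natXX_bd {A : T00 R₁ R₂} (hA : par _ A = -A) (n : ℕ) :
    natXX (bconv (mulB _) (ah A) (fun j => bd₂ (muh (lcurv A)) * bd₁ (ah A j)) n) =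
      -i11 (striple A n) := by
  cases n with
  | zero =>
    rw [striple, bconv, Finset.Nat.antidiagonal_zero, Finset.sum_singleton, ah_zero]
    simp only [bd₁_one, mul_zero, map_zero, smul_zero, neg_zero]
  | succ n =>
    rw [striple, bconv, Finset.Nat.sum_antidiagonal_succ', map_add, map_sum, map_sum,
      ← Finset.sum_neg_distrib]
    have h0 : bd₁ (ah A 0) = 0 := by rw [ah_zero, bd₁_one]
    rw [h0, mul_zero, map_zero, smul_zero, map_zero, zero_add]
    refine Finset.sum_congr rfl fun p _ => ?_
    rw [bd₁_ah_succ hA, bconv, mul_neg, map_neg, Finset.mul_sum, map_sum, smul_neg, map_neg, map_sum,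
      Finset.smul_sum, map_sum]
    congr 1
    refine Finset.sum_congr rfl fun q hq => ?_
    rw [map_smul i11, i11_simplexB, ← ah_eq, ← ah_eq, ← ah_eq, ← muh_lcurv, mul_smul_comm, map_smul,
      map_smul, map_smul, smul_smul, mulB_apply, mulB_apply, kk3,
      ← Finset.HasAntidiagonal.mem_antidiagonal.1 hq]
    push_cast
    rfl

theorem pterm_zero (A : T00 R₁ R₂) : pterm A 0 = 0 :=
  i11_injective (by rw [← natXX_fh, fh_zero, map_zero, map_zero])

theorem pterm_succ {A : T00 R₁ R₂} (hA : par _ A = -A) (n : ℕ) : pterm A (n + 1) =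
    nat₁₂ (m12 (m10 (d₁ A) (expTerm (curv A) 1 n)) (d₂ A)) + striple A n := by
  refine i11_injective ?_
  have h : bconv (mulB (BiForm R₁ R₂)) (ah A) (fun j => gam A (ah A j)) n =
      bconv (mulB _) (ah A) (fun j => phh (lcurv A) * ah A j) n +
        bconv (mulB _) (ah A) (fun j => bd₂ (muh (lcurv A)) * bd₁ (ah A j)) n := by
    simp only [bconv, gam, map_add, smul_add, Finset.sum_add_distrib]
  rw [← natXX_fh, fh_succ hA, map_neg, h, map_add, sum_natXX_phh hA, sum_natXX_bd hA,
    natXX_phh_lcurv hA, map_add, neg_add, neg_neg, neg_neg]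

end component

/-! ### The integral over the simplex -/

section simplexIntegral
variable {E F G : Type u} [CB E] [CB F] [CB G]
open MeasureTheory

theorem SHasSum.map {f : ℕ → E} {a : E} (h : SHasSum f a) (φ : E ⟹ F) :
    SHasSum (fun n => φ (f n)) (φ a) := by
  have := MTendsto.map h φ
  simpa only [SHasSum, map_sum] using this

theorem SHasSum.add {f g : ℕ → E} {a b : E} (hf : SHasSum f a) (hg : SHasSum g b) :
    SHasSum (fun n => f n + g n) (a + b) := by
  simpa only [SHasSum, Finset.sum_add_distrib] using MTendsto.add hf hg

theorem SHasSum.unique {f : ℕ → E} {a b : E} (h : SHasSum f a) (h' : SHasSum f b) : a = b :=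
  MTendsto.unique h h'

theorem SHasSum.of_succ {f : ℕ → E} {a : E} (h0 : f 0 = 0) (h : SHasSum (fun n => f (n + 1)) a) :
    SHasSum f a :=
  USum.sHasSum (f := fun n _ => f n) (h := fun _ => a)
    (USum.of_succ (fun _ _ => h0) h.uSum) (left_mem_Icc.2 zero_le_one)

theorem SHasSum.of_hasSum (d : BanachDisk E) {v : ℕ → d.V} {w : d.V} (h : HasSum v w) :
    SHasSum (fun n => d.j (v n)) (d.j w) := by
  simpa only [SHasSum, ← map_sum] using MTendsto.of_disk d h.tendsto_sum_nat

set_option maxSynthPendingDepth 3 in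
-- The trilinear map is lifted first as a bilinear map with values in bounded maps; evaluation,
-- which is the identity read as a bilinear map, is lifted next.
theorem exists_disk_map₃ (β : E ⟹ E ⟹ E ⟹ G) (d : BanachDisk E) :
    ∃ (k : BanachDisk G) (κ : d.V →L[ℂ] d.V →L[ℂ] d.V →L[ℂ] k.V),
      ∀ x y z, k.j (κ x y z) = β (d.j x) (d.j y) (d.j z) := by
  obtain ⟨l, T, hT⟩ := exists_disk_map₂ β d d
  obtain ⟨k, S, hS⟩ := exists_disk_map₂ (BMap.id (E ⟹ G)) l d
  refine ⟨k, (ContinuousLinearMap.compL ℂ d.V l.V (d.V →L[ℂ] k.V) S).comp T, fun x y z => ?_⟩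
  change k.j (S (T x y) z) = _
  rw [hS, hT]
  rfl

set_option maxSynthPendingDepth 3 in
/-- The integral over the simplex of the product of three power series. -/
theorem exists_simplex_integral (β : E ⟹ E ⟹ E ⟹ G) {a : ℕ → E} {e : E} (ha : SHasSum a e)
    {x : ℝ → E} (hx : ∀ s, 0 ≤ s → s < 1 → x s = ssum fun n => ((s ^ n : ℝ) : ℂ) • a n) :
    ∃ I : G, HasBIntegral (volume.restrict simplex2)
        (fun s => β (x (1 - s.1 - s.2)) (x s.1) (x s.2)) I ∧
      SHasSum (fun n => ∑ p ∈ Finset.HasAntidiagonal.antidiagonal n,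
        ∑ q ∈ Finset.HasAntidiagonal.antidiagonal p.2,
          (kk3 (p.1, q) : ℂ) • β (a p.1) (a q.1) (a q.2)) I := by
  obtain ⟨d, v, w, hv, -, ht⟩ := ha.exists_lift
  obtain ⟨C, hC⟩ := exists_norm_le_of_tendsto ht
  have hb := norm_term_le hC
  have h0 : 0 ≤ 2 * C := (norm_nonneg _).trans (hb 0)
  -- The terms of the series convergent at s = 1 are bounded, so for s < 1 a geometric majorant
  -- gives absolute convergence.
  have hsum : ∀ s : ℝ, 0 ≤ s → s < 1 →
      ∃ y : d.V, HasSum (fun n => ((s ^ n : ℝ) : ℂ) • v n) y ∧ x s = d.j y := fun s hs hs1 => by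
    have hsm : Summable fun n => ((s ^ n : ℝ) : ℂ) • v n := by
      refine Summable.of_norm_bounded ((summable_geometric_of_lt_one hs hs1).mul_right (2 * C))
        fun n => ?_
      rw [norm_smul, Complex.norm_real, Real.norm_of_nonneg (by positivity)]
      exact mul_le_mul_of_nonneg_left (hb n) (by positivity)
    obtain ⟨y, hy⟩ := hsm
    refine ⟨y, hy, ?_⟩
    have := SHasSum.of_hasSum d hy
    simp only [map_smul, ← hv] at this
    rw [hx s hs hs1, ssum_eq this]
  obtain ⟨k, κ, hκ⟩ := exists_disk_map₃ β d
  have hT : ∀ t : ℕ × ℕ × ℕ, ‖κ (v t.1) (v t.2.1) (v t.2.2)‖ ≤ ‖κ‖ * (2 * C) * (2 * C) * (2 * C) :=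
    fun t => by
      refine ((κ _ _).le_opNorm _).trans (mul_le_mul ?_ (hb _) (norm_nonneg _) (by positivity))
      refine (κ.le_opNorm₂ _ _).trans ?_
      gcongr
      exacts [hb _, hb _]
  obtain ⟨h1, h2⟩ := simplex_series hT
  refine ⟨_, ⟨k, _, h1, ?_, rfl⟩, ?_⟩
  -- Away from the vertices all three barycentric coordinates are less than 1, and the product of
  -- the three power series is the triple series.
  · filter_upwards [ae_simplex2] with s hs
    obtain ⟨y0, hy0, e0⟩ := hsum (1 - s.1 - s.2) (by linarith [hs.1.2.2]) hs.2.1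
    obtain ⟨y1, hy1, e1⟩ := hsum s.1 hs.1.1 hs.2.2.1
    obtain ⟨y2, hy2, e2⟩ := hsum s.2 hs.1.2.1 hs.2.2.2
    rw [tsum_smon κ hb hs hy0 hy1 hy2, hκ, e0, e1, e2]
  · have := SHasSum.of_hasSum k (hasSum_antidiagonal₃ h2)
    simpa only [map_sum, map_smul, hκ, ← hv] using this

end simplexIntegral

/-! ### The cocycle -/

section cocycle
variable {R₁ R₂ : Type u} [DGBAlg R₁] [DGBAlg R₂] {A : T00 R₁ R₂}

theorem bexp_eq {e : T00 R₁ R₂} (h : SHasSum (expTerm (curv A) 1) e) : bexp (curv A) 1 = e :=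
  ssum_eq h

theorem sHasSum_bexp (h : ExpConv (curv A)) : SHasSum (expTerm (curv A) 1) (bexp (curv A) 1) := by
  obtain ⟨e, he⟩ := h
  rwa [bexp_eq he]

theorem sHasSum_psi_qterm (hA : par _ A = -A) (h : ExpConv (curv A)) :
    SHasSum (fun n => psi R₁ R₂ (qterm A n)) (chern (psi R₁ R₂) A) := by
  obtain ⟨k, hk⟩ := USum.exists_psi_qterm (CPath.const A) (fun _ _ => hA) (sHasSum_bexp h).uSum
  have := hk.sHasSum (left_mem_Icc.2 zero_le_one)
  rwa [chern, ssum_eq this]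

theorem c00_chern (hA : par _ A = -A) (h : ExpConv (curv A)) :
    c00 (chern (psi R₁ R₂) A) = bexp (curv A) 1 := by
  refine ((sHasSum_psi_qterm hA h).map c00).unique ?_
  simpa only [psi_qterm' hA, map_sub, map_add, c00_i00, c00_i11, c00_i10, c00_i01, add_zero,
    sub_zero] using sHasSum_bexp h

theorem c10_chern (hA : par _ A = -A) (h : ExpConv (curv A)) :
    c10 (chern (psi R₁ R₂) A) = -nat₁ (m10 (d₁ A) (bexp (curv A) 1)) := by
  refine ((sHasSum_psi_qterm hA h).map c10).unique ?_
  simp only [psi_qterm' hA, map_sub, map_add, c10_i00, c10_i11, c10_i10, c10_i01, add_zero,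
    zero_sub]
  exact (sHasSum_bexp h).map ((-nat₁).comp (m10 (d₁ A)))

theorem c01_chern (hA : par _ A = -A) (h : ExpConv (curv A)) :
    c01 (chern (psi R₁ R₂) A) = -nat₂ (m01 (bexp (curv A) 1) (d₂ A)) := by
  refine ((sHasSum_psi_qterm hA h).map c01).unique ?_
  simp only [psi_qterm' hA, map_sub, map_add, c01_i00, c01_i11, c01_i10, c01_i01, add_zero,
    zero_add, zero_sub]
  exact (sHasSum_bexp h).map ((-nat₂).comp (m01.flip (d₂ A)))

theorem c11_chern (hA : par _ A = -A) (h : ExpConv (curv A)) :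
    ∃ I : N11 R₁ R₂,
      HasBIntegral (MeasureTheory.volume.restrict simplex2) (simplexTerm (curv A)) I ∧
        c11 (chern (psi R₁ R₂) A) = edgeTerm A + I := by
  obtain ⟨I, hI, hs⟩ := exists_simplex_integral (simplexB (curv A)) (sHasSum_bexp h)
    (x := bexp (curv A)) fun s _ _ => by simp only [bexp, ← tpow_succ']
  refine ⟨I, hI, ((sHasSum_psi_qterm hA h).map c11).unique ?_⟩
  simp only [psi_qterm' hA, map_sub, map_add, c11_i00, c11_i11, c11_i10, c11_i01, add_zero,
    zero_add, sub_zero]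
  -- Duhamel's formula shifts the order by one in φ and by one more in d₁e^{-F}; both shifts are
  -- harmless because the leading terms vanish.
  refine SHasSum.of_succ (pterm_zero A) ?_
  simp only [pterm_succ hA]
  refine SHasSum.add ?_ (SHasSum.of_succ rfl hs)
  exact (sHasSum_bexp h).map (nat₁₂.comp ((m12.flip (d₂ A)).comp (m10 (d₁ A))))

theorem ucurv_lin (A : T00 R₁ R₂) : ucurv (lin A) = lcurv A := rfl

theorem psi_sum_qterm (hA : par _ A = -A) (N : ℕ) :
    Dtot (∑ n ∈ Finset.range (N + 1), psi R₁ R₂ (qterm A n)) =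
      tev (ah A N) (muh (lcurv A)) (phh (lcurv A)) := by
  have h := congrArg (psi R₁ R₂) (sum_XD_qX (par_lin hA) N)
  rw [psi_XD, map_sum, map_smul, ucurv_lin, psi_natX_even _ (par_lcurv hA)] at h
  simp only [← qterm_eq] at h
  rw [h, ah, tev, tev, pw]
  simp only [map_smul, smul_add, mul_smul_comm, smul_mul_assoc, map_add]

/-- The form `tev` as a bounded linear map of its first argument. -/
def tevB (y f : BiForm R₁ R₂) : BiForm R₁ R₂ ⟹ XX R₁ R₂ :=
  natXX.comp ((mulB _ (bd₁ y)).comp (par _) + (mulB _).flip (bd₂ y)) +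
    xb.comp (natXX.comp (((mulB _).flip f).comp (par _)))

theorem tevB_apply (u y f : BiForm R₁ R₂) : tevB y f u = tev u y f := by
  simp [tevB, tev]

theorem MTendsto.succ {E : Type u} [CB E] {x : ℕ → E} {a : E} (h : MTendsto atTop x a) :
    MTendsto atTop (fun n => x (n + 1)) a := by
  obtain ⟨B, hB, h⟩ := h
  exact ⟨B, hB, fun ε hε => (tendsto_add_atTop_nat 1).eventually (h ε hε)⟩

/-- By telescoping, D of a partial sum is a bounded linear function of the last term of e^{-F}. The
terms of a convergent series tend to zero, and limits are unique. -/
theorem Dtot_chern (hA : par _ A = -A) (h : ExpConv (curv A)) :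
    Dtot (chern (psi R₁ R₂) A) = 0 := by
  have h1 : MTendsto atTop (fun N => ∑ n ∈ Finset.range N, psi R₁ R₂ (qterm A n)) _ :=
    sHasSum_psi_qterm hA h
  have h2 : SHasSum (ah A) (e00 (bexp (curv A) 1)) := by
    have := (sHasSum_bexp h).map e00
    simp only [← ah_eq] at this
    exact this
  have h3 := h1.succ.map Dtot
  simp only [psi_sum_qterm hA, ← tevB_apply] at h3
  rw [h3.unique (h2.tendsto_zero.map _), map_zero]

end cocycle

/-! ### Homotopy invariance -/

section homotopy
variable {R₁ R₂ : Type u} [DGBAlg R₁] [DGBAlg R₂]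

theorem CDeriv.congr {E : Type u} [CB E] {f f' g g' : ℝ → E} (h : CDeriv f f')
    (e : ∀ t ∈ Icc (0 : ℝ) 1, g t = f t) (e' : ∀ t ∈ Icc (0 : ℝ) 1, g' t = f' t) : CDeriv g g' := by
  obtain ⟨d, v, v', h1, h2, h3, h4⟩ := h
  exact ⟨d, v, v', fun t ht => (e t ht).trans (h1 t ht), fun t ht => (e' t ht).trans (h2 t ht), h3, h4⟩

/-! ### Images of the Chern–Simons terms and of the error terms. -/

section pointwise
variable (A A' : T00 R₁ R₂)

/-- The image by `μ` of the variation of the exponential. -/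
def om (n : ℕ) : BiForm R₁ R₂ := ww n • muh (cyc (lcurv A) (lin A') n)
/-- The image by `φ` of the variation of the exponential. -/
def vh (n : ℕ) : BiForm R₁ R₂ := ww n • phh (cyc (lcurv A) (lin A') n)

theorem om_zero : om A A' 0 = 0 := by rw [om, cyc, map_zero, smul_zero]
theorem vh_zero : vh A A' 0 = 0 := by rw [vh, cyc, map_zero, smul_zero]

theorem om_succ (n : ℕ) :
    om A A' (n + 1) = -bconv (mulB _) (ah A) (fun j => e00 A' * ah A j) n := by
  have h := rec_mul_weighted (f := muh (lcurv A)) (p := pw A)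
    (x := fun n => muh (cyc (lcurv A) (lin A') n)) (c := fun n => e00 A' * pw A n) (pw_succ A)
    (fun y => by rw [pw_zero, e00_one_mul]) (by rw [cyc, map_zero]) (fun n => by
      rw [cyc_succ, map_add, muh_mul, muh_mul, muh_lin, pw]) n
  simp only [← mul_smul_comm] at h
  exact h

variable {A A'}

/-- In φ of F W + A'Fⁿ, with W the cyclic sum, the lift of A' has no φ of its own. It contributes
A'φ(Fⁿ) and the cross term with d₂A', whose sign is that of the odd element A'. -/
theorem vh_succ (hA : par _ A = -A) (hA' : par _ A' = -A') (n : ℕ) :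
    vh A A' (n + 1) = -bconv (mulB _) (ah A) (fun j => gam A (om A A' j) +
      (e00 A' * fh A j + -(bd₂ (e00 A') * bd₁ (ah A j)))) n := by
  have h := rec_mul_weighted (f := muh (lcurv A)) (p := pw A)
    (x := fun n => phh (cyc (lcurv A) (lin A') n))
    (c := fun n => gam A (muh (cyc (lcurv A) (lin A') n)) + (e00 A' * phh (lcurv A ^ n) +
      -(bd₂ (e00 A') * bd₁ (pw A n)))) (pw_succ A)
    (fun y => by rw [pw_zero, e00_one_mul]) (by rw [cyc, map_zero]) (fun n => by
      rw [cyc_succ, map_add, phh_mul, phh_mul, phh_lin, muh_lin, par_lcurv hA, par_lin hA', map_neg,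
        map_neg, muh_lin, gam, pw, zero_mul, neg_mul, zero_add]
      abel) n
  simp only [vh, om, fh, ah, map_smul, mul_smul_comm, gam_smul, smul_add, smul_neg] at h ⊢
  exact h

theorem psi_csX (hA : par _ A = -A) (n : ℕ) : psi R₁ R₂ (ww n • csX (lin A) (lin A') n) =
    natXX (om A A' n) + natXX (vh A A' n) +
      -(natXX (bd₁ (e00 A) * om A A' n) + natXX (om A A' n * bd₂ (e00 A))) := by
  rw [csX, map_smul, map_sub, map_sub, psi_natX_fun0, psi_natX_odd _ (par_lin hA), phh_lin,
    muh_lin, tod, mul_zero, map_zero, map_zero, add_zero, map_add, ucurv_lin, om, vh]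
  simp only [map_smul, mul_smul_comm, smul_mul_assoc]
  module

theorem psi_erX (hA : par _ A = -A) (hA' : par _ A' = -A') (n : ℕ) :
    psi R₁ R₂ (ww n • erX (lin A) (lin A') n) =
      natXX (bd₁ (muh (lcurv A)) * par _ (om A A' n)) + natXX (om A A' n * bd₂ (muh (lcurv A))) +
        xb (natXX (par _ (om A A' n) * phh (lcurv A))) +
      -(natXX (bd₁ (e00 A') * ah A n) + natXX (ah A n * bd₂ (e00 A'))) := by
  rw [erX, map_smul, map_sub, ucurv_lin, psi_natX_even _ (par_lcurv hA), psi_natX_odd _ (par_lin hA'),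
    phh_lin, muh_lin, tod, tev, mul_zero, map_zero, map_zero, add_zero, om, ah, pw]
  simp only [map_add, map_smul, mul_smul_comm, smul_mul_assoc]
  module

end pointwise

/-! ### Transgression along a differentiable family. -/

section family
variable {A A' h : ℝ → T00 R₁ R₂}

theorem USum.exists_om (hA' : CPath A') (hs : USum (fun n t => expTerm (curv (A t)) 1 n) h) :
    ∃ k, USum (fun n t => om (A t) (A' t) n) k := by
  obtain ⟨c, hc⟩ := USum.bconv (mulB (BiForm R₁ R₂)) hs.ah (USum.map₂ (mulB _) (hA'.map e00) hs.ah)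
  exact ⟨fun t => -c t, USum.of_succ (fun t _ => om_zero _ _)
    (hc.neg.congr (fun n t _ => om_succ _ _ n) fun _ _ => rfl)⟩

theorem USum.exists_vh (hA : CPath A) (hA' : CPath A')
    (ho : ∀ t ∈ Icc (0 : ℝ) 1, par _ (A t) = -A t) (ho' : ∀ t ∈ Icc (0 : ℝ) 1, par _ (A' t) = -A' t)
    (hs : USum (fun n t => expTerm (curv (A t)) 1 n) h) :
    ∃ k, USum (fun n t => vh (A t) (A' t) n) k := by
  obtain ⟨k, hk⟩ := USum.exists_om hA' hs
  obtain ⟨l, hl⟩ := USum.exists_fh hA ho hs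
  have h1 := (USum.gam hA hk).add ((USum.map₂ (mulB _) (hA'.map e00) hl).add
    (USum.map₂ (mulB _) (hA'.map (bd₂.comp e00)) (hs.ah.map bd₁)).neg)
  obtain ⟨c, hc⟩ := USum.bconv (mulB (BiForm R₁ R₂)) hs.ah h1
  exact ⟨fun t => -c t, USum.of_succ (fun t _ => vh_zero _ _)
    (hc.neg.congr (fun n t ht => vh_succ (ho t ht) (ho' t ht) n) fun _ _ => rfl)⟩

theorem USum.exists_psi_csX (hA : CPath A) (hA' : CPath A')
    (ho : ∀ t ∈ Icc (0 : ℝ) 1, par _ (A t) = -A t) (ho' : ∀ t ∈ Icc (0 : ℝ) 1, par _ (A' t) = -A' t)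
    (hs : USum (fun n t => expTerm (curv (A t)) 1 n) h) :
    ∃ k, USum (fun n t => psi R₁ R₂ (ww n • csX (lin (A t)) (lin (A' t)) n)) k := by
  obtain ⟨k, hk⟩ := USum.exists_om hA' hs
  obtain ⟨l, hl⟩ := USum.exists_vh hA hA' ho ho' hs
  have h1 := USum.map₂ (mulB _) (hA.map (bd₁.comp e00)) hk
  have h2 := USum.map₂ (mulB _).flip (hA.map (bd₂.comp e00)) hk
  exact ⟨_, (((hk.map natXX).add (hl.map natXX)).add ((h1.map natXX).add (h2.map natXX)).neg).congr
    (fun n t ht => psi_csX (ho t ht) n) fun _ _ => rfl⟩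

/-- The sum of this series has no role of its own: its integrated form converges, so the error left
after integrating the transgression formula tends to zero. -/
theorem USum.exists_psi_erX (hA : CPath A) (hA' : CPath A')
    (ho : ∀ t ∈ Icc (0 : ℝ) 1, par _ (A t) = -A t) (ho' : ∀ t ∈ Icc (0 : ℝ) 1, par _ (A' t) = -A' t)
    (hs : USum (fun n t => expTerm (curv (A t)) 1 n) h) :
    ∃ k, USum (fun n t => psi R₁ R₂ (ww n • erX (lin (A t)) (lin (A' t)) n)) k := by
  obtain ⟨k, hk⟩ := USum.exists_om hA' hs
  have h1 := USum.map₂ (mulB _) (hA.lcurv.map (bd₁.comp muh)) (hk.map (par _))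
  have h2 := USum.map₂ (mulB _).flip (hA.lcurv.map (bd₂.comp muh)) hk
  have h3 := USum.map₂ (mulB _).flip (hA.lcurv.map phh) (hk.map (par _))
  have h4 := USum.map₂ (mulB _) (hA'.map (bd₁.comp e00)) hs.ah
  have h5 := USum.map₂ (mulB _).flip (hA'.map (bd₂.comp e00)) hs.ah
  exact ⟨_, ((((h1.map natXX).add (h2.map natXX)).add (h3.map (xb.comp natXX))).add
    ((h4.map natXX).add (h5.map natXX)).neg).congr
    (fun n t ht => psi_erX (ho t ht) (ho' t ht) n) fun _ _ => rfl⟩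

theorem CDeriv.lcurv_pow (hA : CDeriv A A') (ho : ∀ t ∈ Icc (0 : ℝ) 1, par _ (A t) = -A t)
    (ho' : ∀ t ∈ Icc (0 : ℝ) 1, par _ (A' t) = -A' t) (n : ℕ) :
    CDeriv (fun t => lcurv (A t) ^ n) fun t => vpow (lin (A t)) (lin (A' t)) n := by
  induction n with
  | zero => exact (CDeriv.const 1).congr (fun t _ => pow_zero _) fun t _ => vpow_zero
  | succ n ih =>
    have h1 : CDeriv (fun t => lcurv (A t)) fun t => udif _ (lin (A' t)) +
        (lin (A' t) * lin (A t) + lin (A t) * lin (A' t)) :=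
      (hA.map ((udif _).comp lin)).add ((hA.map lin).map₂ (hA.map lin) (umul _))
    exact (h1.map₂ ih (umul _)).congr (fun t _ => pow_succ' _ _) fun t ht => by
      rw [vpow_succ (par_lin (ho t ht)) (par_lin (ho' t ht)), ucurv_lin, add_assoc]
      rfl

theorem CDeriv.psi_qterm (hA : CDeriv A A') (ho : ∀ t ∈ Icc (0 : ℝ) 1, par _ (A t) = -A t)
    (ho' : ∀ t ∈ Icc (0 : ℝ) 1, par _ (A' t) = -A' t) (n : ℕ) :
    CDeriv (fun t => psi R₁ R₂ (qterm (A t) n)) fun t =>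
      psi R₁ R₂ (ww n • vX (lin (A t)) (lin (A' t)) n) := by
  have hp := (hA.lcurv_pow ho ho' n).map (fun0 _)
  have h1 := (hp.add ((hp.map₂ (hA.map ((formD _).comp ((fun0 _).comp lin))) (mulB _)).map
    (-BMap.id _))).map ((ww n • psi R₁ R₂).comp (natX _))
  refine h1.congr (fun t _ => ?_) fun t _ => ?_
  · rw [qterm_eq, map_smul, qX, sub_eq_add_neg]
    rfl
  · rw [map_smul, vX, sub_eq_add_neg]
    rfl

/-- The transgression formula is integrated at the level of partial sums, where nothing has to
converge in the free product. The integrated Chern–Simons series then converges to the primitive,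
and the last error vanishes in the limit. -/
theorem chern_sub_eq_Dtot (hA : CDeriv A A') (ho : ∀ t ∈ Icc (0 : ℝ) 1, par _ (A t) = -A t)
    (ho' : ∀ t ∈ Icc (0 : ℝ) 1, par _ (A' t) = -A' t)
    (hs : USum (fun n t => expTerm (curv (A t)) 1 n) h) {s t : ℝ} (hs0 : s ∈ Icc (0 : ℝ) 1)
    (ht : t ∈ Icc (0 : ℝ) 1) (hst : s ≤ t) :
    ∃ c, chern (psi R₁ R₂) (A t) - chern (psi R₁ R₂) (A s) = Dtot c := by
  obtain ⟨k, hk⟩ := USum.exists_psi_csX hA.cpath hA.cpath' ho ho' hs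
  obtain ⟨l, hl⟩ := USum.exists_psi_erX hA.cpath hA.cpath' ho ho' hs
  obtain ⟨I, J, hI, hJ⟩ := hk.exists_int s t
  obtain ⟨P, Q, hP, hQ⟩ := hl.exists_int s t
  refine ⟨J, ?_⟩
  -- The left side is the integral of the derivative of the partial sum, by the fundamental theorem
  -- of calculus, and the right side integrates the expression given by `sum_vX`. The two integrands
  -- agree on [0,1].
  have key : ∀ N, ∑ n ∈ Finset.range (N + 1), psi R₁ R₂ (qterm (A t) n) +
      (-1 : ℂ) • ∑ n ∈ Finset.range (N + 1), psi R₁ R₂ (qterm (A s) n) =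
        Dtot (∑ n ∈ Finset.range (N + 1), I n) + P N := fun N => by
    have h1 := HasInt.sum (fun n => (hA.psi_qterm ho ho' n).hasInt hs0 ht hst) (N + 1)
    have h2 := ((HasInt.sum hI (N + 1)).map Dtot).add (hP N)
    rw [neg_one_smul, ← sub_eq_add_neg, ← Finset.sum_sub_distrib]
    refine h1.unique h2 fun τ hτ => ?_
    simp only [← map_sum]
    rw [sum_vX (par_lin (ho τ hτ)) (par_lin (ho' τ hτ)), map_add, psi_XD]
  have hc : ∀ τ ∈ Icc (0 : ℝ) 1, MTendsto atTop
      (fun N => ∑ n ∈ Finset.range N, psi R₁ R₂ (qterm (A τ) n)) (chern (psi R₁ R₂) (A τ)) :=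
    fun τ hτ => sHasSum_psi_qterm (ho τ hτ) ⟨_, hs.sHasSum hτ⟩
  have h1 := (hc t ht).succ.add ((hc s hs0).succ.smul (-1))
  have hJ' : MTendsto atTop (fun N => ∑ n ∈ Finset.range N, I n) J := hJ
  have h2 := (hJ'.succ.map Dtot).add hQ.tendsto_zero
  simp only [key] at h1
  have := h1.unique h2
  rwa [neg_one_smul, ← sub_eq_add_neg, add_zero] at this

theorem SmoothConn.exists_chern_sub {A : ℝ → T00 R₁ R₂} (hA : SmoothConn A) {s t : ℝ}
    (hs : s ∈ Icc (0 : ℝ) 1) (ht : t ∈ Icc (0 : ℝ) 1) :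
    ∃ c, chern (psi R₁ R₂) (A s) - chern (psi R₁ R₂) (A t) = Dtot c := by
  have ho : ∀ t ∈ Icc (0 : ℝ) 1, par _ (A t) = -A t := fun t ht => hasDeg_one (hA.odd t ht)
  obtain ⟨A', hd⟩ := hA.smooth.exists_cDeriv
  obtain ⟨h, hu⟩ := hA.exp.uSum
  -- The family equals its own odd part on [0,1], so the odd part of its derivative is again a
  -- derivative; this provides the odd A' required by the transgression formula.
  have hd' : CDeriv A fun t => oddB _ (A' t) :=
    (hd.map (oddB _)).congr (fun t ht => (oddB_of_odd (ho t ht)).symm) fun _ _ => rfl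
  have ho' : ∀ t ∈ Icc (0 : ℝ) 1, par _ (oddB _ (A' t)) = -oddB _ (A' t) := fun t _ => par_oddB _
  rcases le_total t s with hst | hst
  · exact chern_sub_eq_Dtot hd' ho ho' hu ht hs hst
  · obtain ⟨c, hc⟩ := chern_sub_eq_Dtot hd' ho ho' hu hs ht hst
    exact ⟨-c, by rw [map_neg, ← hc, neg_sub]⟩

end family

end homotopy

end BornChern

end

theorem mainTheorem6 (R₁ R₂ : Type u) [DGBAlg R₁] [DGBAlg R₂] :
    (∃! Ψ : XT (FreeProd R₁ R₂) ⟹ XX R₁ R₂, IsPsi Ψ) ∧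
    ∀ Ψ : XT (FreeProd R₁ R₂) ⟹ XX R₁ R₂, IsPsi Ψ →
      (∀ A : T00 R₁ R₂, HasDeg A 1 → ExpConv (curv A) →
        SHasSum (fun n => Ψ (qterm A n)) (chern Ψ A) ∧
        (∀ c, SHasSum (qterm A) c → chern Ψ A = Ψ c) ∧
        c00 (chern Ψ A) = bexp (curv A) 1 ∧
        c10 (chern Ψ A) = -nat₁ (m10 (d₁ A) (bexp (curv A) 1)) ∧
        c01 (chern Ψ A) = -nat₂ (m01 (bexp (curv A) 1) (d₂ A)) ∧
        (∃ I : N11 R₁ R₂,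
          HasBIntegral (MeasureTheory.volume.restrict simplex2) (simplexTerm (curv A)) I ∧
          c11 (chern Ψ A) = edgeTerm A + I) ∧
        Dtot (chern Ψ A) = 0 ∧
        tdif (c00 (chern Ψ A)) + b10₁ (c10 (chern Ψ A)) + b01₂ (c01 (chern Ψ A)) = 0 ∧
        dif10 (c10 (chern Ψ A)) + nd00₁ (c00 (chern Ψ A)) + b11₂ (c11 (chern Ψ A)) = 0 ∧
        dif01 (c01 (chern Ψ A)) + b11₁ (c11 (chern Ψ A)) + nd00₂ (c00 (chern Ψ A)) = 0 ∧
        dif11 (c11 (chern Ψ A)) + nd01₁ (c01 (chern Ψ A)) + nd10₂ (c10 (chern Ψ A)) = 0) ∧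
      ∀ A : ℝ → T00 R₁ R₂, SmoothConn A → ∀ s ∈ Set.Icc (0 : ℝ) 1, ∀ t ∈ Set.Icc (0 : ℝ) 1,
        ∃ c : XX R₁ R₂, chern Ψ (A s) - chern Ψ (A t) = Dtot c := by 
  refine ⟨⟨psi R₁ R₂, isPsi_psi, fun Ψ h => IsPsi.ext h isPsi_psi⟩, fun Ψ hΨ => ?_⟩
  obtain rfl : Ψ = psi R₁ R₂ := IsPsi.ext hΨ isPsi_psi
  refine ⟨fun A hA hF => ?_, fun A hA s hs t ht => hA.exists_chern_sub hs ht⟩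
  have ho := hasDeg_one hA
  have hc := sHasSum_psi_qterm ho hF
  have hD := Dtot_chern ho hF
  refine ⟨hc, fun c h => hc.unique (h.map _), c00_chern ho hF, c10_chern ho hF, c01_chern ho hF,
    c11_chern ho hF, hD, ?_, ?_, ?_, ?_⟩
  · rw [← c00_Dtot, hD, map_zero]
  · rw [← c10_Dtot, hD, map_zero]
  · rw [← c01_Dtot, hD, map_zero]
  · rw [← c11_Dtot, hD, map_zero]
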